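/- Let $a_1,a_2>0$ and put $A=(1+a_1)(1+a_2)$, $B=a_1a_2$. Assume $3A-4B>0$, and let $N_1,N_2$ be non-negative integers such that, if $A-4B>0$, then $(A-4B)(N_1+1)<2a_1(1+a_1)(N_2+1)$. Let $$J(x,y)=\tfrac{a_2(1+a_2)}{2}x^2+a_1a_2xy+\tfrac{a_1(1+a_1)}{2}y^2,$$ $$\Omega=\{(x,y): x,y>1,\ J(x-1,y-1)>J(N_1+1,N_2+1)\}.$$ Let $\alpha_1\ge 1$, $\alpha_2>1$ satisfy $$(3A-4B)\alpha_1+\tfrac{1+a_1}{a_2}(A-2B)\alpha_2=AN_1+\tfrac{1+a_1}{a_2}AN_2+\Big(4+2\tfrac{1+a_1}{a_2}\Big)(A-B),$$ $$\tfrac{4B-A}{A}(\alpha_1-1)+\tfrac{2a_1}{1+a_2}(\alpha_2-1)-(N_1+1)>0,$$ and set $$\gamma=\tfrac{4B-A}{A}(\alpha_1-1)+\tfrac{2a_1}{1+a_2}(\alpha_2-1)+1.$$ Then the Chern–Simons–Higgs problem $$\Delta U+(1+a_1)e^{U}-(1+a_1)^2e^{2U}=4\pi N_1\delta_0\ \text{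 in }\mathbb R^2,\qquad U(x)=-2\gamma\ln|x|+O(1)\ \text{ as }|x|\to\infty,$$ has a unique radial solution $U$, and $V(0):=\lim_{r\to0}(U(r)-2N_1\ln r)$ exists. With $F_k=(1+a_k)e^{2u_k}-e^{u_k}-a_ke^{u_1+u_2}$, there is $\varepsilon_0>0$ such that for every $\varepsilon\in(0,\varepsilon_0)$ the initial value problem $$\begin{cases}u_1''+\frac1r u_1'=(1+a_1)F_1-a_1F_2,\quad u_2''+\frac1r u_2'=(1+a_2)F_2-a_2F_1,& r>0,\\ u_1(r)=2N_1\ln r+V(0)+o(1),\quad u_2(r)=2N_2\ln r+\ln\varepsilon+o(1),& r\to0,\end{cases}$$ has a solution $(u_{1,\varepsilon},u_{2,\varepsilon})$ on all of $(0,\infty)$. As radial functions on $\mathbb R^2$ these solve, in the sense of distributions, $$\Delta u_1-(1+a_1)F_1+a_1F_2=4\pi N_1\delta_0,\qquad \Delta u_2-(1+a_2)F_2+a_2F_1=4\pi N_2\delta_0,$$ they are non-topological ($u_{1,\varepsilon},u_{2,\varepsilon}\to-\infty$ as $|x|\to\infty$), and there are radii $0<R_{1,\varepsilon}<R_{3,\varepsilon}$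 with $u_{1,\varepsilon}=u_{2,\varepsilon}$ at $r=R_{1,\varepsilon}$ and at $r=R_{3,\varepsilon}$, such that $re^{u_{1,\varepsilon}},re^{u_{2,\varepsilon}}\in L^1(0,\infty)$ and, as $\varepsilon\to0^+$: (0) $R_{1,\varepsilon}\to\infty$ and $R_{3,\varepsilon}/R_{1,\varepsilon}\to\infty$. (i) $u_{1,\varepsilon}\to U$ in $C^2_{loc}$ on the balls $B(0,R_{1,\varepsilon})$ exhausting the plane; that is, $u_{1,\varepsilon}-U$ extends to a $C^2$ function on $\mathbb R^2$ which tends to $0$ with its derivatives up to order two, uniformly on compact subsets of $\mathbb R^2$. Moreover, $\sup u_{2,\varepsilon}\to-\infty$. (ii) $\int_{R_{1,\varepsilon}}^{R_{3,\varepsilon}}re^{u_{1,\varepsilon}}dr\to0$, $\ \int_{R_{3,\varepsilon}}^{\infty}re^{u_{2,\varepsilon}}dr\to0$, and $$\int_{R_{1,\varepsilon}}^{R_{3,\varepsilon}}re^{u_{2,\varepsilon}}dr\to\tfrac{4}{1+a_2}\Big(\tfrac{a_2}{1+a_1}(\gamma+N_1)+N_2+1\Big),\qquad \int_{R_{3,\varepsilon}}^{\infty}re^{u_{1,\varepsilon}}dr\to\tfrac{4}{1+a_1}(\alpha_1-1).$$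 (iii) There are $(\alpha_{1,\varepsilon},\alpha_{2,\varepsilon})\in\Omega$ with $u_{k,\varepsilon}(r)=-2\alpha_{k,\varepsilon}\ln r+O(1)$ as $r\to\infty$ for $k=1,2$, and $(\alpha_{1,\varepsilon},\alpha_{2,\varepsilon})\to(\alpha_1,\alpha_2)$. -/

import Mathlib

open Set Filter Topology MeasureTheory

noncomputable section

namespace ChernSimons

/-- The Euclidean plane. -/
abbrev Plane : Type := EuclideanSpace ℝ (Fin 2)

/-- The radially symmetric function on the plane with profile `p`. -/
def radial (p : ℝ → ℝ) : Plane → ℝ := fun x => p ‖x‖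

/-- `Δ u + f = c δ₀` in the plane, in the sense of distributions: `u` and `f` are locally
integrable, and the identity holds against every smooth compactly supported test function. -/
structure SolvesWithDirac (u f : Plane → ℝ) (c : ℝ) : Prop where
  locallyIntegrable_u : LocallyIntegrable u volume
  locallyIntegrable_f : LocallyIntegrable f volume
  eq : ∀ φ : Plane → ℝ, ContDiff ℝ (⊤ : ℕ∞) φ → HasCompactSupport φ →
    (∫ x, u x * Laplacian.laplacian φ x) + (∫ x, f x * φ x) = c * φ 0

/-- `A = (1 + a₁) (1 + a₂)`. -/
def cA (a₁ a₂ : ℝ) : ℝ := (1 + a₁) * (1 + a₂)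

/-- `B = a₁ a₂`. -/
def cB (a₁ a₂ : ℝ) : ℝ := a₁ * a₂

/-- The quadratic form `J`. -/
def J (a₁ a₂ x y : ℝ) : ℝ :=
  a₂ * (1 + a₂) / 2 * x ^ 2 + a₁ * a₂ * x * y + a₁ * (1 + a₁) / 2 * y ^ 2

/-- The set `Ω` of pairs of exponents allowed by the Pohozaev identity. -/
def Omega (a₁ a₂ : ℝ) (N₁ N₂ : ℕ) : Set (ℝ × ℝ) :=
  {α | 1 < α.1 ∧ 1 < α.2 ∧ J a₁ a₂ (N₁ + 1) (N₂ + 1) < J a₁ a₂ (α.1 - 1) (α.2 - 1)}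

/-- The affine function `g`, whose zero set is the boundary line. -/
def g (a₁ a₂ : ℝ) (N₁ N₂ : ℕ) (α₁ α₂ : ℝ) : ℝ :=
  (3 * cA a₁ a₂ - 4 * cB a₁ a₂) * α₁
    + (1 + a₁) / a₂ * (cA a₁ a₂ - 2 * cB a₁ a₂) * α₂
    - cA a₁ a₂ * N₁ - (1 + a₁) / a₂ * cA a₁ a₂ * N₂
    - (4 + 2 * ((1 + a₁) / a₂)) * (cA a₁ a₂ - cB a₁ a₂)

/-- The affine function `h`. -/
def h (a₁ a₂ : ℝ) (N₁ : ℕ) (α₁ α₂ : ℝ) : ℝ :=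
  (4 * cB a₁ a₂ - cA a₁ a₂) / cA a₁ a₂ * (α₁ - 1)
    + 2 * a₁ / (1 + a₂) * (α₂ - 1) - (N₁ + 1)

/-- The decay rate `γ` of the limiting scalar solution. -/
def gam (a₁ a₂ α₁ α₂ : ℝ) : ℝ :=
  (4 * cB a₁ a₂ - cA a₁ a₂) / cA a₁ a₂ * (α₁ - 1)
    + 2 * a₁ / (1 + a₂) * (α₂ - 1) + 1

/-- `p(r) = -2 α ln r + O(1)` as `r → ∞`. -/
def HasDecayRate (p : ℝ → ℝ) (α : ℝ) : Prop :=
  (fun r => p r - (-2 * α * Real.log r)) =O[atTop] (fun _ => (1 : ℝ))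

/-- `p` is the profile of a radial solution `U` of the Chern-Simons-Higgs equation
`Δ U + (1 + a) e^U - (1 + a)² e^{2U} = 4 π N δ₀` in the plane with `U = -2 γ ln |x| + O(1)`
at infinity. -/
structure IsRadialCSH (a : ℝ) (N : ℕ) (γ : ℝ) (p : ℝ → ℝ) : Prop where
  contDiffOn : ContDiffOn ℝ 2 p (Ioi 0)
  solves : SolvesWithDirac (radial p)
    (fun x => (1 + a) * Real.exp (radial p x) - (1 + a) ^ 2 * Real.exp (2 * radial p x))
    (4 * Real.pi * N)
  decay : HasDecayRate p γ

/-- The function `F_k` (with `a = a_k`), where `s` is the value of `u_k` and `t` that of the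
other component. -/
def F (a s t : ℝ) : ℝ :=
  (1 + a) * Real.exp (2 * s) - Real.exp s - a * Real.exp (s + t)

/-- `(u₁, u₂)` solves, in the plane and in the sense of distributions, the Chern-Simons system
with parameters `a₁, a₂` and all vortices at the origin. -/
structure SolvesSystem (a₁ a₂ : ℝ) (N₁ N₂ : ℕ) (u₁ u₂ : Plane → ℝ) : Prop where
  fst : SolvesWithDirac u₁
    (fun x =>
      (1 + a₁) * (Real.exp (u₁ x) - (1 + a₁) * Real.exp (2 * u₁ x)
        + a₁ * Real.exp (u₁ x + u₂ x))
      - a₁ * (Real.exp (u₂ x) - (1 + a₂) * Real.exp (2 * u₂ x)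
        + a₂ * Real.exp (u₁ x + u₂ x)))
    (4 * Real.pi * N₁)
  snd : SolvesWithDirac u₂
    (fun x =>
      (1 + a₂) * (Real.exp (u₂ x) - (1 + a₂) * Real.exp (2 * u₂ x)
        + a₂ * Real.exp (u₁ x + u₂ x))
      - a₂ * (Real.exp (u₁ x) - (1 + a₁) * Real.exp (2 * u₁ x)
        + a₁ * Real.exp (u₁ x + u₂ x)))
    (4 * Real.pi * N₂)

/-- `(u₁, u₂)` is an entire solution (on all of `r > 0`) of the radial initial value problem
with `u₁ = 2 N₁ ln r + c₁ + o(1)` and `u₂ = 2 N₂ ln r + c₂ + o(1)` as `r → 0`. -/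
structure IsEntireShootingSolution (a₁ a₂ : ℝ) (N₁ N₂ : ℕ) (c₁ c₂ : ℝ) (u₁ u₂ : ℝ → ℝ) :
    Prop where
  contDiffOn_fst : ContDiffOn ℝ 2 u₁ (Ioi 0)
  contDiffOn_snd : ContDiffOn ℝ 2 u₂ (Ioi 0)
  ode_fst : ∀ r > 0, deriv (deriv u₁) r + 1 / r * deriv u₁ r =
    (1 + a₁) * F a₁ (u₁ r) (u₂ r) - a₁ * F a₂ (u₂ r) (u₁ r)
  ode_snd : ∀ r > 0, deriv (deriv u₂) r + 1 / r * deriv u₂ r =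
    (1 + a₂) * F a₂ (u₂ r) (u₁ r) - a₂ * F a₁ (u₁ r) (u₂ r)
  init_fst : Tendsto (fun r => u₁ r - 2 * N₁ * Real.log r) (𝓝[>] 0) (𝓝 c₁)
  init_snd : Tendsto (fun r => u₂ r - 2 * N₂ * Real.log r) (𝓝[>] 0) (𝓝 c₂)

/-- The planar pair is non-topological: both components tend to `-∞` at infinity. -/
def IsNonTopological (u₁ u₂ : Plane → ℝ) : Prop :=
  Tendsto u₁ (cocompact Plane) atBot ∧ Tendsto u₂ (cocompact Plane) atBot

/-- `u ε → U` in `C²_loc` of the plane as `ε → 0+`. Both `u ε` and `U` may have the same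
logarithmic singularity at the origin, so this means that the difference `u ε - U`
(defined off the origin) extends to a `C²` function on the plane that converges to zero
together with its derivatives up to order two, uniformly on compact sets. -/
def TendstoC2Loc (u : ℝ → Plane → ℝ) (U : Plane → ℝ) : Prop :=
  ∃ w : ℝ → Plane → ℝ,
    (∀ᶠ ε in 𝓝[>] (0 : ℝ), ContDiff ℝ 2 (w ε) ∧ ∀ x, x ≠ 0 → w ε x = u ε x - U x) ∧
    ∀ k : ℕ, k ≤ 2 → ∀ K : Set Plane, IsCompact K →
      TendstoUniformlyOn (fun ε => iteratedFDeriv ℝ k (w ε)) (fun _ => 0) (𝓝[>] 0) K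

end ChernSimons

end

/-! Put t = log r, X = u₁ + 2t, Y = u₂ + 2t, with slopes x, y. As ε → 0 the second component starts
arbitrarily low. Hence on every bounded range of t the first component follows the scalar solution
U, and the second is driven linearly by it: its regular part is log ε minus a₂/(1+a₁) times the
increment of the regular part of U. Since U has final slope -2γ, at a late time T both X and Y are
very negative, x ≈ -ρ with ρ = 2(γ-1), and y ≈ σ with σ = 2(N₂+1+a₂(γ+N₁)/(1+a₁)).

After T the quadratic exponentials carry a factor e^{-2t}, and the system is a small perturbation of
X'' = -(1+a₁)e^X + a₁e^Y, Y'' = -(1+a₂)e^Y + a₂e^X (`exists_flow`). This system conserves the energy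
J(x,y) + (1+a₁+a₂)(a₂e^X + a₁e^Y), which gives bounds for all later times. Its trajectories are
billiards. While only e^Y is active, (1+a₂)x + a₁y and y² + 2(1+a₂)e^Y are conserved: y turns from σ
to -σ, and x passes from -ρ to A. Then X, with slope A ≥ 0, overtakes the falling Y and is reflected
in turn: (1+a₁)y + a₂x is conserved, x turns from A to -A, and y passes from -σ to -B. Afterwards
both components decay. X and Y meet once before the first reflection and once between the two, which
gives R₁ and R₃ (`exists_meeting`, `exists_departure`, `exists_phases`).

The definition of γ and the equation g = 0 are the two reflection laws with A = 2(α₁-1) and B =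
2(α₂-1). The masses are the jumps of the slopes, 2σ and 2A, divided by 1+a₂ and 1+a₁. Reflections
preserve J, and J(-ρ/2, σ/2) exceeds J(N₁+1, N₂+1) by a positive multiple of (γ-1)² - (N₁+1)². So
membership in Ω follows from γ > N₁+2, which is the condition h > 0.

For the scalar problem, u = U + log(1+a₁) solves u'' + e^{2t}e^u(1-e^u) = 0, and one shoots with the
value c of its regular part at the origin. A parameter is good if the slope becomes negative; then u
< 0 and the slope tends to some ℓ(c) < -2. The good set is open and ℓ is continuous on it.
Pohozaev's identity shows that ℓ comes close to -2(N+2) for very negative c and falls to -∞ at the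
boundary of the good set, whence existence for γ > N+2. Uniqueness needs ℓ to decrease strictly to
the right of every good parameter; this rests on a sign analysis of the linearized equation
(`Good.linearized`, `Good.eventually_ell_lt`). Gaps in the good set do no harm, because ℓ would
restart from -∞ behind a gap and decrease further.

All exponentials are first capped at height one, which makes the singular initial value problem
globally Lipschitz (`exists_isSol`). The solutions turn out to be nonpositive, so the cap has no
effect. `IsSol.solvesWithDirac` and `SolvesWithDirac.integrated` translate between the equation in t
and its distributional form in the plane. -/

noncomputable section

namespace ChernSimons

/-! ### Comparison and continuation principles on the line. -/

section Calculus

variable {E : Type*} [NormedAddCommGroup E] [NormedSpace ℝ E]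

theorem norm_sub_le_of_hasDerivAt {f f' : ℝ → E} {B B' : ℝ → ℝ} {s t : ℝ} (hst : s ≤ t)
    (hf : ∀ r, HasDerivAt f (f' r) r) (hB : ∀ r, HasDerivAt B (B' r) r)
    (h : ∀ r ∈ Ico s t, ‖f' r‖ ≤ B' r) : ‖f t - f s‖ ≤ B t - B s := by
  have := image_norm_le_of_norm_deriv_right_le_deriv_boundary (f := fun r => f r - f s)
    (f' := f') (B := fun r => B r - B s) (B' := B') (a := s) (b := t)
    (fun r _ => ((hf r).sub_const _).continuousAt.continuousWithinAt)
    (fun r _ => ((hf r).sub_const _).hasDerivWithinAt) (by simp)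
    (fun r => (hB r).sub_const _) h
  exact this ⟨hst, le_rfl⟩

theorem sub_le_of_hasDerivAt {f f' g g' : ℝ → ℝ} {s t : ℝ} (hst : s ≤ t)
    (hf : ∀ r, HasDerivAt f (f' r) r) (hg : ∀ r, HasDerivAt g (g' r) r)
    (h : ∀ r ∈ Ioo s t, f' r ≤ g' r) : f t - f s ≤ g t - g s := by
  have hm : MonotoneOn (fun r => g r - f r) (Icc s t) := by
    apply monotoneOn_of_deriv_nonneg (convex_Icc s t)
    · exact fun r _ => ((hg r).sub (hf r)).continuousAt.continuousWithinAt
    · exact fun r _ => ((hg r).sub (hf r)).differentiableAt.differentiableWithinAt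
    · intro r hr
      rw [interior_Icc] at hr
      rw [((hg r).fun_sub (hf r)).deriv]
      linarith [h r hr]
  have := hm ⟨le_rfl, hst⟩ ⟨hst, le_rfl⟩ hst
  simp only at this
  linarith

theorem lt_of_hasDerivAt_pos {f f' : ℝ → ℝ} {s t : ℝ} (hst : s < t)
    (hf : ∀ r, HasDerivAt f (f' r) r) (h : ∀ r ∈ Ioo s t, 0 < f' r) : f s < f t := by
  have hm : StrictMonoOn f (Icc s t) := by
    apply strictMonoOn_of_deriv_pos (convex_Icc s t)
    · exact fun r _ => (hf r).continuousAt.continuousWithinAt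
    · intro r hr
      rw [interior_Icc] at hr
      rw [(hf r).deriv]
      exact h r hr
  exact hm ⟨le_rfl, hst.le⟩ ⟨hst.le, le_rfl⟩ hst

theorem lt_of_hasDerivAt_neg {f f' : ℝ → ℝ} {s t : ℝ} (hst : s < t)
    (hf : ∀ r, HasDerivAt f (f' r) r) (h : ∀ r ∈ Ioo s t, f' r < 0) : f t < f s := by
  have := lt_of_hasDerivAt_pos hst (f := fun r => -f r) (fun r => (hf r).fun_neg)
    (fun r hr => by linarith [h r hr])
  linarith

/-- Comparison with the left endpoint at `-∞`: in the variable `t = log r`, data at the origin are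
limits as `t → -∞`. -/
theorem norm_sub_lim_le_of_hasDerivAt {f f' : ℝ → E} {B B' : ℝ → ℝ} {t : ℝ} {a : E} {b : ℝ}
    (hf : ∀ r, HasDerivAt f (f' r) r) (hB : ∀ r, HasDerivAt B (B' r) r)
    (h : ∀ r < t, ‖f' r‖ ≤ B' r) (ha : Tendsto f atBot (𝓝 a)) (hb : Tendsto B atBot (𝓝 b)) :
    ‖f t - a‖ ≤ B t - b := by
  refine le_of_tendsto_of_tendsto ((tendsto_const_nhds.sub ha).norm)
    (tendsto_const_nhds.sub hb) ?_
  filter_upwards [eventually_le_atBot t] with s hs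
  exact norm_sub_le_of_hasDerivAt hs hf hB fun r hr => h r hr.2

theorem sub_lim_le_of_hasDerivAt {f f' g g' : ℝ → ℝ} {t a b : ℝ}
    (hf : ∀ r, HasDerivAt f (f' r) r) (hg : ∀ r, HasDerivAt g (g' r) r)
    (h : ∀ r < t, f' r ≤ g' r) (ha : Tendsto f atBot (𝓝 a)) (hb : Tendsto g atBot (𝓝 b)) :
    f t - a ≤ g t - b := by
  refine le_of_tendsto_of_tendsto (tendsto_const_nhds.sub ha) (tendsto_const_nhds.sub hb) ?_
  filter_upwards [eventually_le_atBot t] with s hs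
  exact sub_le_of_hasDerivAt hs hf hg fun r hr => h r hr.2

/-- Continuous induction for an open condition. -/
theorem forall_ge_of_isOpen {Q : ℝ → Prop} {a : ℝ} (ho : IsOpen {t | Q t})
    (h : ∀ t ≥ a, (∀ s ∈ Ico a t, Q s) → Q t) : ∀ t ≥ a, Q t := by
  by_contra! hc
  obtain ⟨b, hb, hQb⟩ := hc
  set S := {t | Q t}ᶜ ∩ Icc a b
  have hSc : IsCompact S := (isCompact_Icc.inter_left ho.isClosed_compl)
  have hne : S.Nonempty := ⟨b, hQb, hb, le_rfl⟩
  have hm := hSc.sInf_mem hne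
  refine hm.1 (h _ hm.2.1 fun s hs => ?_)
  by_contra hQ
  have : sInf S ≤ s := csInf_le hSc.bddBelow ⟨hQ, hs.1, hs.2.le.trans hm.2.2⟩
  exact absurd hs.2 (not_lt.2 this)

/-- Continuous induction started at `-∞`. -/
theorem forall_of_isOpen_of_eventually_atBot {Q : ℝ → Prop} (ho : IsOpen {t | Q t})
    (he : ∀ᶠ t in atBot, Q t) (h : ∀ t, (∀ s < t, Q s) → Q t) : ∀ t, Q t := by
  obtain ⟨a, ha⟩ := eventually_atBot.1 he
  intro t
  rcases le_total t a with hta | hta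
  · exact ha t hta
  refine forall_ge_of_isOpen ho (a := a) (fun t ht hs => h t fun s hst => ?_) t hta
  rcases le_total s a with hsa | hsa
  · exact ha s hsa
  · exact hs s ⟨hsa, hst⟩

/-- The first time at which a closed condition holds. -/
theorem exists_first_of_isClosed {Q : ℝ → Prop} {a b : ℝ} (ho : IsClosed {t | Q t})
    (hab : a ≤ b) (hb : Q b) : ∃ t ∈ Icc a b, Q t ∧ ∀ s ∈ Ico a t, ¬ Q s := by
  by_contra! hc
  -- If there were no first time, the failure of `Q` would propagate by continuous induction. Beyond
  -- `b` the property is vacuous, so that it is open on the whole line.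
  have := forall_ge_of_isOpen (Q := fun t => t ≤ b → ¬ Q t) (a := a) (by
    have : {t | t ≤ b → ¬ Q t} = Ioi b ∪ {t | Q t}ᶜ := by
      ext t; simp only [mem_ofPred_eq, mem_union, mem_Ioi, mem_compl_iff]
      constructor
      · intro h
        rcases lt_or_ge b t with h' | h'
        · exact Or.inl h'
        · exact Or.inr (h h')
      · rintro (h | h) h'
        · exact absurd h' (not_le.2 h)
        · exact h
    rw [this]
    exact isOpen_Ioi.union ho.isOpen_compl) (fun t ht hs htb hQ => by
      obtain ⟨s, hs', hQs⟩ := hc t ⟨ht, htb⟩ hQ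
      exact hs s hs' (hs'.2.le.trans htb) hQs)
  exact this b hab le_rfl hb

theorem hasDerivAt_exp_two_mul (t : ℝ) :
    HasDerivAt (fun t => Real.exp (2 * t)) (2 * Real.exp (2 * t)) t := by
  have := ((hasDerivAt_id t).const_mul 2).exp
  simpa [mul_comm] using this

theorem tendsto_exp_two_mul_atBot : Tendsto (fun t : ℝ => Real.exp (2 * t)) atBot (𝓝 0) :=
  Real.tendsto_exp_atBot.comp (tendsto_id.const_mul_atBot two_pos)

end Calculus

/-! ### The singular initial value problem at `t = -∞`. -/

section SingularIVP

variable {E : Type*} [NormedAddCommGroup E] [NormedSpace ℝ E]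

/-- In the variable `t = log r`: `x'' = e^{2t} g` with `x → x₀` and `p = x' → 0` as `t → -∞`.
This is the radial Poisson equation in the plane for a function that is regular at the origin. -/
structure IsSol (g : ℝ → E) (x₀ : E) (x p : ℝ → E) : Prop where
  lim_fst : Tendsto x atBot (𝓝 x₀)
  lim_snd : Tendsto p atBot (𝓝 0)
  hasDerivAt_fst : ∀ t, HasDerivAt x (p t) t
  hasDerivAt_snd : ∀ t, HasDerivAt p (Real.exp (2 * t) • g t) t

theorem IsSol.continuous_fst {g : ℝ → E} {x₀ : E} {x p : ℝ → E} (h : IsSol g x₀ x p) :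
    Continuous x :=
  continuous_iff_continuousAt.2 fun t => (h.hasDerivAt_fst t).continuousAt

theorem IsSol.continuous_snd {g : ℝ → E} {x₀ : E} {x p : ℝ → E} (h : IsSol g x₀ x p) :
    Continuous p :=
  continuous_iff_continuousAt.2 fun t => (h.hasDerivAt_snd t).continuousAt

theorem IsSol.sub {g h : ℝ → E} {x₀ y₀ : E} {x p y q : ℝ → E} (hx : IsSol g x₀ x p)
    (hy : IsSol h y₀ y q) :
    IsSol (fun t => g t - h t) (x₀ - y₀) (fun t => x t - y t) (fun t => p t - q t) where
  lim_fst := hx.lim_fst.sub hy.lim_fst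
  lim_snd := by simpa using hx.lim_snd.sub hy.lim_snd
  hasDerivAt_fst t := (hx.hasDerivAt_fst t).sub (hy.hasDerivAt_fst t)
  hasDerivAt_snd t := by
    simpa [smul_sub] using (hx.hasDerivAt_snd t).fun_sub (hy.hasDerivAt_snd t)

theorem IsSol.const_smul {g : ℝ → E} {x₀ : E} {x p : ℝ → E} (hx : IsSol g x₀ x p) (c : ℝ) :
    IsSol (fun t => c • g t) (c • x₀) (fun t => c • x t) (fun t => c • p t) where
  lim_fst := hx.lim_fst.const_smul c
  lim_snd := by simpa using hx.lim_snd.const_smul c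
  hasDerivAt_fst t := (hx.hasDerivAt_fst t).const_smul c
  hasDerivAt_snd t := by
    simpa [smul_smul, mul_comm] using (hx.hasDerivAt_snd t).fun_const_smul c

/-- The weight `exp (l e^{2t})`. -/
def weight (l t : ℝ) : ℝ := Real.exp (l * Real.exp (2 * t))

theorem weight_pos (l t : ℝ) : 0 < weight l t := Real.exp_pos _

theorem hasDerivAt_weight (l t : ℝ) :
    HasDerivAt (weight l) (2 * l * Real.exp (2 * t) * weight l t) t := by
  have := ((hasDerivAt_exp_two_mul t).const_mul l).exp
  refine this.congr_deriv ?_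
  unfold weight; ring

theorem continuous_weight (l : ℝ) : Continuous (weight l) := by unfold weight; fun_prop

theorem one_le_weight {l : ℝ} (hl : 0 ≤ l) (t : ℝ) : 1 ≤ weight l t :=
  Real.one_le_exp (by positivity)

theorem weight_mono {l : ℝ} (hl : 0 ≤ l) : Monotone (weight l) := fun s t h =>
  Real.exp_le_exp.2 (mul_le_mul_of_nonneg_left (Real.exp_le_exp.2 (by linarith)) hl)

theorem tendsto_weight (l : ℝ) : Tendsto (weight l) atBot (𝓝 1) := by
  have := (tendsto_exp_two_mul_atBot.const_mul l).rexp
  unfold weight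
  simpa using this

theorem weight_sub_one_le (l t : ℝ) :
    weight l t - 1 ≤ l * Real.exp (2 * t) * weight l t := by
  have h := Real.add_one_le_exp (-(l * Real.exp (2 * t)))
  have h2 : Real.exp (-(l * Real.exp (2 * t))) * weight l t = 1 := by
    rw [weight, ← Real.exp_add]; simp
  nlinarith [mul_le_mul_of_nonneg_right h (weight_pos l t).le]

/-- The weight has derivative `2 l e^{2t}` times itself, so one integration from `-∞` gains a factor
`1 / (2 l)`. The first bound gives up this gain in order to keep the factor `e^{2t}`, and can be
integrated again; the second keeps the gain. Used in succession they make a double primitive small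
relative to the weight. -/
theorem norm_sub_le_of_weight {f f' : ℝ → E} {a : E} {K l T : ℝ} (hl : 0 < l)
    (hK : 0 ≤ K) (hf : ∀ r, HasDerivAt f (f' r) r) (ha : Tendsto f atBot (𝓝 a))
    (h : ∀ r ≤ T, ‖f' r‖ ≤ K * Real.exp (2 * r) * weight l r) {t : ℝ} (ht : t ≤ T) :
    ‖f t - a‖ ≤ K / 2 * Real.exp (2 * t) * weight l t ∧
    ‖f t - a‖ ≤ K / (2 * l) * weight l t := by
  have h1 : ‖f t - a‖ ≤ K / (2 * l) * weight l t - K / (2 * l) * 1 := by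
    refine norm_sub_lim_le_of_hasDerivAt (B := fun r => K / (2 * l) * weight l r) hf
      (fun r => (hasDerivAt_weight l r).const_mul _) (fun r hr => ?_) ha
      ((tendsto_weight l).const_mul _)
    refine (h r (hr.le.trans ht)).trans_eq ?_
    field_simp
  have h2 := mul_le_mul_of_nonneg_left (weight_sub_one_le l t)
    (show 0 ≤ K / (2 * l) by positivity)
  have h3 : K / (2 * l) * (l * Real.exp (2 * t) * weight l t)
      = K / 2 * Real.exp (2 * t) * weight l t := by field_simp
  have h4 : 0 ≤ K / (2 * l) := by positivity
  constructor <;> linarith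

/-- The primitive vanishing at `-∞`. -/
def prim (h : ℝ → E) (t : ℝ) : E := ∫ s in Iic t, h s

theorem integrableOn_Iic_of_le_exp {F : Type*} [NormedAddCommGroup F] {h : ℝ → F} (hc : Continuous h) {K T : ℝ}
    (hK : ∀ s ≤ T, ‖h s‖ ≤ K * Real.exp (2 * s)) : IntegrableOn h (Iic T) := by
  refine Integrable.mono' ((integrableOn_exp_mul_Iic two_pos T).const_mul K)
    hc.aestronglyMeasurable ?_
  filter_upwards [ae_restrict_mem measurableSet_Iic] with s hs using hK s hs

theorem hasDerivAt_prim [CompleteSpace E] {h : ℝ → E} (hc : Continuous h)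
    (hK : ∀ T, ∃ K, ∀ s ≤ T, ‖h s‖ ≤ K * Real.exp (2 * s)) (t : ℝ) :
    HasDerivAt (prim h) (h t) t := by
  have hi : ∀ T, IntegrableOn h (Iic T) := fun T =>
    (hK T).elim fun K hK => integrableOn_Iic_of_le_exp hc hK
  have : prim h = fun u => (∫ s in Iic t, h s) + ∫ s in t..u, h s := by
    funext u
    rw [← intervalIntegral.integral_Iic_sub_Iic (hi t) (hi u)]
    simp [prim]
  rw [this]
  exact (intervalIntegral.integral_hasDerivAt_right (hc.intervalIntegrable _ _)
    hc.stronglyMeasurable.stronglyMeasurableAtFilter hc.continuousAt).const_add _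

theorem tendsto_prim {h : ℝ → E} (hK : ∀ T, ∃ K, ∀ s ≤ T, ‖h s‖ ≤ K * Real.exp (2 * s)) :
    Tendsto (prim h) atBot (𝓝 0) := by
  obtain ⟨K, hK⟩ := hK 0
  refine squeeze_zero_norm' (a := fun t => K * (Real.exp (2 * t) / 2)) ?_ ?_
  · filter_upwards [eventually_le_atBot 0] with t ht
    rw [← integral_exp_mul_Iic two_pos t, ← integral_const_mul]
    refine norm_integral_le_of_norm_le ((integrableOn_exp_mul_Iic two_pos t).const_mul K) ?_
    filter_upwards [ae_restrict_mem measurableSet_Iic] with s hs using hK s (le_trans hs ht)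
  · simpa using (tendsto_exp_two_mul_atBot.div_const 2).const_mul K

/-- Global solvability of the singular initial value problem for Lipschitz right-hand sides. -/
theorem exists_isSol [CompleteSpace E] (G : ℝ → E → E) (x₀ : E) {L C : ℝ} (hL : 0 ≤ L)
    (hC : 0 ≤ C) (hG : Continuous fun q : ℝ × E => G q.1 q.2)
    (hLip : ∀ t x y, ‖G t x - G t y‖ ≤ L * ‖x - y‖) (hbd : ∀ t, ‖G t 0‖ ≤ C) :
    ∃ x p, IsSol (fun t => G t (x t)) x₀ x p := by
  -- Two integrations yield the Lipschitz constant `L / (4 l)`, which this choice keeps below one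
  -- half.
  set l := L + 1 with hldef
  have hl : 0 < l := by positivity
  let h : BoundedContinuousFunction ℝ E → ℝ → E := fun ξ t =>
    Real.exp (2 * t) • G t (weight l t • ξ t)
  have hcont : ∀ ξ, Continuous (h ξ) := fun ξ => by
    have h1 : Continuous fun t : ℝ => (t, weight l t • ξ t) :=
      continuous_id.prodMk ((continuous_weight l).smul ξ.continuous)
    exact (by fun_prop : Continuous fun t : ℝ => Real.exp (2 * t)).smul (hG.comp h1)
  have hGb : ∀ t x, ‖G t x‖ ≤ C + L * ‖x‖ := fun t x => by
    have h1 := hLip t x 0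
    have h2 := norm_sub_norm_le (G t x) (G t 0)
    rw [sub_zero] at h1
    linarith [hbd t]
  have hb1 : ∀ ξ s, ‖h ξ s‖ ≤ (C + L * ‖ξ‖) * Real.exp (2 * s) * weight l s := fun ξ s => by
    have hw := one_le_weight hl.le s
    have h1 : ‖weight l s • ξ s‖ ≤ weight l s * ‖ξ‖ := by
      rw [norm_smul, Real.norm_of_nonneg (weight_pos l s).le]
      exact mul_le_mul_of_nonneg_left (ξ.norm_coe_le_norm s) (weight_pos l s).le
    have h2 : ‖G s (weight l s • ξ s)‖ ≤ (C + L * ‖ξ‖) * weight l s := by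
      refine (hGb _ _).trans ?_
      nlinarith [mul_le_mul_of_nonneg_left h1 hL]
    calc ‖h ξ s‖ = Real.exp (2 * s) * ‖G s (weight l s • ξ s)‖ := by
          simp [h, norm_smul]
      _ ≤ Real.exp (2 * s) * ((C + L * ‖ξ‖) * weight l s) := by gcongr
      _ = _ := by ring
  have hexp : ∀ {K : ℝ} {f : ℝ → E}, 0 ≤ K →
      (∀ s, ‖f s‖ ≤ K * Real.exp (2 * s) * weight l s) →
      ∀ T, ∃ K, ∀ s ≤ T, ‖f s‖ ≤ K * Real.exp (2 * s) := fun {K f} hK hf T =>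
    ⟨K * weight l T, fun s hs => (hf s).trans (by
      rw [mul_right_comm]
      gcongr
      exact weight_mono hl.le hs)⟩
  have hK0 : ∀ ξ : BoundedContinuousFunction ℝ E, 0 ≤ C + L * ‖ξ‖ := fun ξ => by positivity
  have hp1 := fun ξ => hasDerivAt_prim (hcont ξ) (hexp (hK0 ξ) (hb1 ξ))
  have hp2 := fun ξ => tendsto_prim (hexp (hK0 ξ) (hb1 ξ))
  have hpc : ∀ ξ, Continuous (prim (h ξ)) := fun ξ =>
    continuous_iff_continuousAt.2 fun t => (hp1 ξ t).continuousAt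
  have hpb : ∀ ξ s, ‖prim (h ξ) s‖ ≤
      (C + L * ‖ξ‖) / 2 * Real.exp (2 * s) * weight l s := fun ξ s => by
    have := (norm_sub_le_of_weight hl (hK0 ξ) (hp1 ξ) (hp2 ξ) (T := s)
      (fun r _ => hb1 ξ r) le_rfl).1
    rwa [sub_zero] at this
  have hK2 : ∀ ξ : BoundedContinuousFunction ℝ E, 0 ≤ (C + L * ‖ξ‖) / 2 := fun ξ => by
    positivity
  have hx1 := fun ξ => hasDerivAt_prim (hpc ξ) (hexp (hK2 ξ) (hpb ξ))
  have hx2 := fun ξ => tendsto_prim (hexp (hK2 ξ) (hpb ξ))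
  have hxc : ∀ ξ, Continuous (prim (prim (h ξ))) := fun ξ =>
    continuous_iff_continuousAt.2 fun t => (hx1 ξ t).continuousAt
  have hxb : ∀ ξ s, ‖prim (prim (h ξ)) s‖ ≤
      (C + L * ‖ξ‖) / 2 / (2 * l) * weight l s := fun ξ s => by
    have := (norm_sub_le_of_weight hl (hK2 ξ) (hx1 ξ) (hx2 ξ) (T := s)
      (fun r _ => hpb ξ r) le_rfl).2
    rwa [sub_zero] at this
  -- The unknown is the solution divided by the weight. It is bounded even if the solution grows, so
  -- the contraction principle applies on the whole line at once.
  let Φ : BoundedContinuousFunction ℝ E → BoundedContinuousFunction ℝ E := fun ξ =>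
    BoundedContinuousFunction.ofNormedAddCommGroup
      (fun t => (weight l t)⁻¹ • (x₀ + prim (prim (h ξ)) t))
      (((continuous_weight l).inv₀ fun t => (weight_pos l t).ne').smul
        (continuous_const.add (hxc ξ)))
      (‖x₀‖ + (C + L * ‖ξ‖) / 2 / (2 * l)) (fun t => by
        have hw := one_le_weight hl.le t
        rw [norm_smul, norm_inv, Real.norm_of_nonneg (weight_pos l t).le,
          inv_mul_le_iff₀ (weight_pos l t)]
        refine (norm_add_le _ _).trans ?_
        have := hxb ξ t
        nlinarith [norm_nonneg x₀])
  have hΦ : ContractingWith (1 / 2) Φ := by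
    refine ⟨by rw [← NNReal.coe_lt_coe]; norm_num, ?_⟩
    refine LipschitzWith.of_dist_le_mul fun ξ η => ?_
    rw [BoundedContinuousFunction.dist_le (by positivity)]
    intro t
    set D := dist ξ η with hD
    have hD0 : 0 ≤ D := dist_nonneg
    have hd1 : ∀ s, ‖h ξ s - h η s‖ ≤ (L * D) * Real.exp (2 * s) * weight l s := fun s => by
      have h1 : ‖weight l s • ξ s - weight l s • η s‖ ≤ weight l s * D := by
        rw [← smul_sub, norm_smul, Real.norm_of_nonneg (weight_pos l s).le, ← dist_eq_norm]
        exact mul_le_mul_of_nonneg_left (BoundedContinuousFunction.dist_coe_le_dist s)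
          (weight_pos l s).le
      calc ‖h ξ s - h η s‖
          = Real.exp (2 * s) * ‖G s (weight l s • ξ s) - G s (weight l s • η s)‖ := by
            simp [h, ← smul_sub, norm_smul]
        _ ≤ Real.exp (2 * s) * (L * (weight l s * D)) := by
            gcongr
            exact (hLip _ _ _).trans (mul_le_mul_of_nonneg_left h1 hL)
        _ = _ := by ring
    have hLD : 0 ≤ L * D := by positivity
    have hd2 : ∀ s, ‖prim (h ξ) s - prim (h η) s‖ ≤
        L * D / 2 * Real.exp (2 * s) * weight l s := fun s => by
      have := (norm_sub_le_of_weight hl hLD (fun r => (hp1 ξ r).sub (hp1 η r))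
        ((hp2 ξ).sub (hp2 η)) (T := s) (fun r _ => hd1 r) le_rfl).1
      simpa using this
    have hd3 : ‖prim (prim (h ξ)) t - prim (prim (h η)) t‖ ≤
        L * D / 2 / (2 * l) * weight l t := by
      have := (norm_sub_le_of_weight hl (by positivity) (fun r => (hx1 ξ r).sub (hx1 η r))
        ((hx2 ξ).sub (hx2 η)) (T := t) (fun r _ => hd2 r) le_rfl).2
      simpa using this
    have hcalc : dist (Φ ξ t) (Φ η t)
        = (weight l t)⁻¹ * ‖prim (prim (h ξ)) t - prim (prim (h η)) t‖ := by
      have : Φ ξ t - Φ η t = (weight l t)⁻¹ • (prim (prim (h ξ)) t - prim (prim (h η)) t) := by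
        simp only [Φ, BoundedContinuousFunction.coe_ofNormedAddCommGroup]
        rw [← smul_sub]; congr 1; abel
      rw [dist_eq_norm, this, norm_smul, norm_inv, Real.norm_of_nonneg (weight_pos l t).le]
    rw [hcalc, inv_mul_le_iff₀ (weight_pos l t)]
    refine hd3.trans ?_
    rw [mul_comm]
    have : L * D / 2 / (2 * l) ≤ 1 / 2 * D := by
      rw [div_div, div_le_iff₀ (by positivity)]
      nlinarith
    have h2 := mul_le_mul_of_nonneg_left this (weight_pos l t).le
    simpa using h2
  set ξ := hΦ.fixedPoint with hξ
  have hfix : Φ ξ = ξ := hΦ.fixedPoint_isFixedPt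
  have hx : (fun t => weight l t • ξ t) = fun t => x₀ + prim (prim (h ξ)) t := by
    funext t
    have : ξ t = (weight l t)⁻¹ • (x₀ + prim (prim (h ξ)) t) := by
      conv_lhs => rw [← hfix]
      rfl
    rw [this, smul_smul, mul_inv_cancel₀ (weight_pos l t).ne', one_smul]
  refine ⟨fun t => weight l t • ξ t, prim (h ξ), ?_, hp2 ξ, ?_, fun t => hp1 ξ t⟩
  · rw [hx]
    simpa using tendsto_const_nhds.add (hx2 ξ)
  · rw [hx]
    exact fun t => (hx1 ξ t).const_add _

/-- Continuous dependence for the singular initial value problem. -/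
theorem IsSol.norm_sub_le {g h : ℝ → E} {x₀ y₀ : E} {x p y q : ℝ → E} (hx : IsSol g x₀ x p)
    (hy : IsSol h y₀ y q) {L d e T : ℝ} (hL : 1 ≤ L) (hd : 0 ≤ d) (he : 0 ≤ e)
    (h₀ : ‖x₀ - y₀‖ ≤ d) (hgh : ∀ t ≤ T, ‖g t - h t‖ ≤ L * ‖x t - y t‖ + e) {t : ℝ}
    (ht : t ≤ T) :
    ‖x t - y t‖ ≤ 2 * weight L T * (d + e) ∧
    ‖p t - q t‖ ≤ 2 * L * Real.exp (2 * T) * weight L T * (d + e) := by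
  have hxy := hx.sub hy
  set z := fun t => x t - y t
  have hL0 : 0 < L := by linarith
  obtain ⟨M, hM⟩ : ∃ M, ∀ s ≤ T, ‖z s‖ ≤ M := by
    have h1 := (hxy.lim_fst.norm).eventually_lt_const (lt_add_one ‖x₀ - y₀‖)
    obtain ⟨a, ha⟩ := eventually_atBot.1 h1
    obtain ⟨M, hM⟩ := (isCompact_Icc (a := a) (b := T)).exists_bound_of_continuousOn
      hxy.continuous_fst.continuousOn
    refine ⟨max M (‖x₀ - y₀‖ + 1), fun s hs => ?_⟩
    rcases le_total s a with h | h
    · exact (ha s h).le.trans (le_max_right _ _)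
    · exact (hM s ⟨h, hs⟩).trans (le_max_left _ _)
  -- `D = sSup S` is the best constant in `‖z‖ ≤ D * weight` up to `T`. The twice integrated
  -- equation bounds `D` by `D / 4` plus the data, which replaces a Gronwall iteration.
  set S := (fun s => ‖z s‖ / weight L s) '' Iic T with hS
  have hSb : BddAbove S := by
    refine ⟨M, ?_⟩
    rintro _ ⟨s, hs, rfl⟩
    have hw := one_le_weight hL0.le s
    have := hM s hs
    rw [div_le_iff₀ (weight_pos _ _)]
    nlinarith [norm_nonneg (z s)]
  set D := sSup S with hD
  have hD1 : ∀ s ≤ T, ‖z s‖ ≤ D * weight L s := fun s hs => by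
    rw [← div_le_iff₀ (weight_pos _ _)]
    exact le_csSup hSb ⟨s, hs, rfl⟩
  have hD0 : 0 ≤ D :=
    (div_nonneg (norm_nonneg _) (weight_pos _ _).le).trans (le_csSup hSb ⟨T, le_refl T, rfl⟩)
  have hb : ∀ s ≤ T, ‖Real.exp (2 * s) • (g s - h s)‖ ≤
      (L * D + e) * Real.exp (2 * s) * weight L s := fun s hs => by
    have hw := one_le_weight hL0.le s
    have h1 : ‖g s - h s‖ ≤ (L * D + e) * weight L s := by
      refine (hgh s hs).trans ?_
      nlinarith [mul_le_mul_of_nonneg_left (hD1 s hs) hL0.le]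
    rw [norm_smul, Real.norm_of_nonneg (Real.exp_pos _).le]
    calc Real.exp (2 * s) * ‖g s - h s‖ ≤ Real.exp (2 * s) * ((L * D + e) * weight L s) := by
          gcongr
      _ = _ := by ring
  have hp : ∀ s ≤ T, ‖p s - q s‖ ≤ (L * D + e) / 2 * Real.exp (2 * s) * weight L s :=
    fun s hs => by
      have := (norm_sub_le_of_weight hL0 (by positivity) hxy.hasDerivAt_snd hxy.lim_snd hb hs).1
      simpa using this
  have hz : ∀ s ≤ T, ‖z s - (x₀ - y₀)‖ ≤ (L * D + e) / 2 / (2 * L) * weight L s :=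
    fun s hs => (norm_sub_le_of_weight hL0 (by positivity) hxy.hasDerivAt_fst hxy.lim_fst hp
      hs).2
  have hDle : D ≤ d + (L * D + e) / 2 / (2 * L) := by
    refine csSup_le ⟨_, T, le_refl T, rfl⟩ ?_
    rintro _ ⟨s, hs, rfl⟩
    rw [div_le_iff₀ (weight_pos _ _)]
    have hw := one_le_weight hL0.le s
    have h1 := norm_sub_norm_le (z s) (x₀ - y₀)
    nlinarith [hz s hs]
  have hDle2 : D ≤ 2 * (d + e) - e := by
    have : (L * D + e) / 2 / (2 * L) ≤ D / 4 + e / 4 := by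
      rw [div_div, div_le_iff₀ (by positivity)]
      nlinarith [mul_nonneg hL0.le hD0]
    linarith
  have hwt := weight_mono hL0.le ht
  have hw0 := (weight_pos L t).le
  have het : Real.exp (2 * t) ≤ Real.exp (2 * T) := Real.exp_le_exp.2 (by linarith)
  constructor
  · calc ‖x t - y t‖ ≤ D * weight L t := hD1 t ht
      _ ≤ (2 * (d + e)) * weight L T :=
          mul_le_mul (by linarith) hwt hw0 (by positivity)
      _ = _ := by ring
  · calc ‖p t - q t‖ ≤ (L * D + e) / 2 * Real.exp (2 * t) * weight L t := hp t ht
      _ ≤ (2 * L * (d + e)) * Real.exp (2 * T) * weight L T := by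
          refine mul_le_mul (mul_le_mul ?_ het (Real.exp_pos _).le (by positivity)) hwt hw0
            (by positivity)
          nlinarith [mul_nonneg (sub_nonneg.2 hL) he, mul_nonneg hL0.le hd]
      _ = _ := by ring

theorem IsSol.eq_of_lipschitz {g h : ℝ → E} {x₀ : E} {x p y q : ℝ → E} (hx : IsSol g x₀ x p)
    (hy : IsSol h x₀ y q) {L : ℝ} (hL : 1 ≤ L)
    (hgh : ∀ t, ‖g t - h t‖ ≤ L * ‖x t - y t‖) : x = y ∧ p = q := by
  have key := fun t => IsSol.norm_sub_le hx hy (T := t) hL le_rfl le_rfl (by simp)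
    (fun s _ => by simpa using hgh s) (le_refl t)
  simp only [add_zero, mul_zero] at key
  constructor <;> funext t
  · exact sub_eq_zero.1 (norm_le_zero_iff.1 (key t).1)
  · exact sub_eq_zero.1 (norm_le_zero_iff.1 (key t).2)

end SingularIVP

/-! ### Truncation of the exponential at height one. -/

section Cap

/-- The exponential, truncated at height one. -/
def cap (s : ℝ) : ℝ := min (Real.exp s) 1

theorem cap_pos (s : ℝ) : 0 < cap s := lt_min (Real.exp_pos _) one_pos

theorem cap_le_one (s : ℝ) : cap s ≤ 1 := min_le_right _ _

theorem cap_le_exp (s : ℝ) : cap s ≤ Real.exp s := min_le_left _ _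

theorem cap_of_nonpos {s : ℝ} (h : s ≤ 0) : cap s = Real.exp s :=
  min_eq_left (Real.exp_le_one_iff.2 h)

theorem cap_of_nonneg {s : ℝ} (h : 0 ≤ s) : cap s = 1 := min_eq_right (Real.one_le_exp h)

theorem one_sub_cap_nonneg (s : ℝ) : 0 ≤ 1 - cap s := sub_nonneg.2 (cap_le_one s)

theorem continuous_cap : Continuous cap := by unfold cap; fun_prop

theorem cap_mono : Monotone cap := fun _ _ h => min_le_min_right _ (Real.exp_le_exp.2 h)

/-- Below zero this is convexity of the exponential. The factor `cap t`, rather than one, makes the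
Lipschitz constant small where both arguments are very negative. -/
theorem cap_sub_le {s t : ℝ} (h : s ≤ t) : cap t - cap s ≤ cap t * (t - s) := by
  rcases le_total t 0 with ht | ht
  · rw [cap_of_nonpos ht, cap_of_nonpos (h.trans ht)]
    have h1 := Real.add_one_le_exp (s - t)
    have h2 : Real.exp s = Real.exp (s - t) * Real.exp t := by rw [← Real.exp_add]; simp
    nlinarith [Real.exp_pos t]
  · rw [cap_of_nonneg ht]
    rcases le_total s 0 with hs | hs
    · rw [cap_of_nonpos hs]
      linarith [Real.add_one_le_exp s]
    · rw [cap_of_nonneg hs]; linarith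

theorem abs_cap_sub_le (s t : ℝ) : |cap s - cap t| ≤ |s - t| := by
  wlog h : s ≤ t generalizing s t
  · rw [abs_sub_comm, abs_sub_comm s]; exact this t s (le_of_not_ge h)
  rw [abs_sub_comm, abs_sub_comm s, abs_of_nonneg (sub_nonneg.2 (cap_mono h)),
    abs_of_nonneg (sub_nonneg.2 h)]
  have := cap_sub_le h
  nlinarith [cap_le_one t, cap_pos t]

theorem abs_cap_mul_sub_le (s t : ℝ) :
    |cap s * (1 - cap s) - cap t * (1 - cap t)| ≤ |s - t| := by
  have h1 : cap s * (1 - cap s) - cap t * (1 - cap t)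
      = (cap s - cap t) * (1 - cap s - cap t) := by ring
  rw [h1, abs_mul]
  have h2 : |1 - cap s - cap t| ≤ 1 := by
    rw [abs_le]
    constructor <;> linarith [cap_pos s, cap_pos t, cap_le_one s, cap_le_one t]
  nlinarith [abs_cap_sub_le s t, abs_nonneg (cap s - cap t)]

end Cap

/-! ### Shooting for the scalar Chern-Simons-Higgs equation. -/

section ScalarCSH

theorem exists_isSol_scalar (N : ℕ) (c : ℝ) : ∃ x p : ℝ → ℝ,
    IsSol (fun t => -(cap (2 * N * t + x t) * (1 - cap (2 * N * t + x t)))) c x p := by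
  refine exists_isSol (fun t x : ℝ => -(cap (2 * N * t + x) * (1 - cap (2 * N * t + x)))) c
    (L := 1) (C := 1) zero_le_one zero_le_one ?_ ?_ ?_
  · have := continuous_cap
    fun_prop
  · intro t x y
    rw [one_mul, Real.norm_eq_abs, Real.norm_eq_abs, neg_sub_neg, abs_sub_comm]
    refine (abs_cap_mul_sub_le _ _).trans_eq ?_
    congr 1; ring
  · intro t
    rw [Real.norm_eq_abs, abs_neg, abs_of_nonneg (mul_nonneg (cap_pos _).le
      (one_sub_cap_nonneg _))]
    nlinarith [cap_pos (2 * N * t + 0), cap_le_one (2 * N * t + 0)]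

/-- The regular part of the radial solution of the truncated Chern-Simons-Higgs equation
`u'' + e^{2t} e^u (1 - e^u) = 0`, `u = 2 N t + c + o(1)` at `-∞`, where `t = log r`. -/
def shootX (N : ℕ) (c : ℝ) : ℝ → ℝ := (exists_isSol_scalar N c).choose

/-- The derivative of `shootX`. -/
def shootP (N : ℕ) (c : ℝ) : ℝ → ℝ := (exists_isSol_scalar N c).choose_spec.choose

/-- The radial solution of the truncated Chern-Simons-Higgs equation. -/
def shootU (N : ℕ) (c t : ℝ) : ℝ := 2 * N * t + shootX N c t

/-- The derivative of `shootU`. -/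
def shootD (N : ℕ) (c t : ℝ) : ℝ := 2 * N + shootP N c t

variable {N : ℕ} {c : ℝ}

theorem isSol_shoot (N : ℕ) (c : ℝ) : IsSol
    (fun t => -(cap (shootU N c t) * (1 - cap (shootU N c t)))) c (shootX N c) (shootP N c) :=
  (exists_isSol_scalar N c).choose_spec.choose_spec

theorem hasDerivAt_shootU (N : ℕ) (c t : ℝ) : HasDerivAt (shootU N c) (shootD N c t) t := by
  have h := ((hasDerivAt_id t).const_mul (2 * N : ℝ)).add ((isSol_shoot N c).hasDerivAt_fst t)
  rw [mul_one] at h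
  exact h

theorem hasDerivAt_shootD (N : ℕ) (c t : ℝ) : HasDerivAt (shootD N c)
    (-(Real.exp (2 * t) * (cap (shootU N c t) * (1 - cap (shootU N c t))))) t := by
  have h := ((isSol_shoot N c).hasDerivAt_snd t).const_add (2 * N : ℝ)
  rw [smul_eq_mul, mul_neg] at h
  exact h

theorem hasDerivAt_shootD_of_nonpos {t : ℝ} (h : shootU N c t ≤ 0) : HasDerivAt (shootD N c)
    (-(Real.exp (shootU N c t + 2 * t) * (1 - Real.exp (shootU N c t)))) t := by
  have := hasDerivAt_shootD N c t
  rw [cap_of_nonpos h] at this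
  refine this.congr_deriv ?_
  rw [Real.exp_add]; ring

theorem continuous_shootU (N : ℕ) (c : ℝ) : Continuous (shootU N c) :=
  continuous_iff_continuousAt.2 fun t => (hasDerivAt_shootU N c t).continuousAt

theorem continuous_shootD (N : ℕ) (c : ℝ) : Continuous (shootD N c) :=
  continuous_iff_continuousAt.2 fun t => (hasDerivAt_shootD N c t).continuousAt

theorem tendsto_shootD_atBot (N : ℕ) (c : ℝ) : Tendsto (shootD N c) atBot (𝓝 (2 * N)) := by
  have := (isSol_shoot N c).lim_snd.const_add (2 * N : ℝ)
  rwa [add_zero] at this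

theorem antitone_shootD (N : ℕ) (c : ℝ) : Antitone (shootD N c) := by
  intro s t hst
  have := sub_le_of_hasDerivAt hst (hasDerivAt_shootD N c) (fun r => hasDerivAt_const r (0 : ℝ))
    (fun r _ => by
      have := mul_nonneg (Real.exp_pos (2 * r)).le
        (mul_nonneg (cap_pos (shootU N c r)).le (one_sub_cap_nonneg (shootU N c r)))
      linarith)
  linarith

theorem shootD_le (N : ℕ) (c t : ℝ) : shootD N c t ≤ 2 * N :=
  (antitone_shootD N c).ge_of_tendsto (tendsto_shootD_atBot N c) t

theorem shootU_le (N : ℕ) (c t : ℝ) : shootU N c t ≤ 2 * N * t + c := by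
  have h : shootX N c t ≤ c := by
    have := sub_lim_le_of_hasDerivAt (t := t) (isSol_shoot N c).hasDerivAt_fst
      (fun r => hasDerivAt_const r (0 : ℝ)) (fun r _ => ?_) (isSol_shoot N c).lim_fst
      tendsto_const_nhds
    · linarith
    · have := shootD_le N c r
      unfold shootD at this
      linarith
  unfold shootU; linarith

/-- Continuous dependence on the shooting parameter. -/
theorem exists_shoot_lipschitz (N : ℕ) (T : ℝ) : ∃ C > 0, ∀ c c' t, t ≤ T →
    |shootU N c t - shootU N c' t| ≤ C * |c - c'| ∧
    |shootD N c t - shootD N c' t| ≤ C * |c - c'| := by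
  refine ⟨2 * weight 1 T + 2 * 1 * Real.exp (2 * T) * weight 1 T, ?_, fun c c' t ht => ?_⟩
  · have := weight_pos 1 T
    positivity
  have key := IsSol.norm_sub_le (isSol_shoot N c) (isSol_shoot N c') (L := 1) (d := |c - c'|)
    (e := 0) le_rfl (abs_nonneg _) le_rfl (Real.norm_eq_abs _).le (fun s _ => by
      rw [one_mul, add_zero, Real.norm_eq_abs, Real.norm_eq_abs, neg_sub_neg, abs_sub_comm]
      refine (abs_cap_mul_sub_le _ _).trans_eq ?_
      congr 1; unfold shootU; ring) ht
  rw [Real.norm_eq_abs, Real.norm_eq_abs, add_zero] at key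
  have h1 : shootU N c t - shootU N c' t = shootX N c t - shootX N c' t := by
    unfold shootU; ring
  have h2 : shootD N c t - shootD N c' t = shootP N c t - shootP N c' t := by
    unfold shootD; ring
  rw [h1, h2]
  have hw := weight_pos 1 T
  have h3 : 0 ≤ 2 * weight 1 T * |c - c'| := by positivity
  have h4 : 0 ≤ 2 * 1 * Real.exp (2 * T) * weight 1 T * |c - c'| := by positivity
  constructor <;> linarith [key.1, key.2]

theorem tendsto_shootU_param (N : ℕ) (c t : ℝ) :
    Tendsto (fun b => shootU N b t) (𝓝 c) (𝓝 (shootU N c t)) := by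
  obtain ⟨C, _, h⟩ := exists_shoot_lipschitz N t
  rw [tendsto_iff_norm_sub_tendsto_zero]
  refine squeeze_zero (fun _ => norm_nonneg _) (fun b => (h b c t le_rfl).1) ?_
  have : Continuous fun b => C * |b - c| := by fun_prop
  simpa using this.tendsto c

theorem tendsto_shootD_param (N : ℕ) (c t : ℝ) :
    Tendsto (fun b => shootD N b t) (𝓝 c) (𝓝 (shootD N c t)) := by
  obtain ⟨C, _, h⟩ := exists_shoot_lipschitz N t
  rw [tendsto_iff_norm_sub_tendsto_zero]
  refine squeeze_zero (fun _ => norm_nonneg _) (fun b => (h b c t le_rfl).2) ?_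
  have : Continuous fun b => C * |b - c| := by fun_prop
  simpa using this.tendsto c

/-- The shooting parameters that lead to a non-topological solution. -/
def Good (N : ℕ) (c : ℝ) : Prop := ∃ t, shootD N c t < 0

theorem isOpen_good (N : ℕ) : IsOpen {c | Good N c} := by
  rw [isOpen_iff_mem_nhds]
  rintro c ⟨t, ht⟩
  filter_upwards [(tendsto_shootD_param N c t).eventually_lt_const ht] with b hb using ⟨t, hb⟩

/-- Above height zero the truncated force vanishes, so a trajectory with positive slope there rises
along a straight line forever and its slope never becomes negative. -/
theorem Good.shootD_nonpos_of_nonneg (h : Good N c) {s : ℝ} (hs : 0 ≤ shootU N c s) :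
    shootD N c s ≤ 0 := by
  by_contra! hD
  obtain ⟨b, hb⟩ := h
  have hsb : s ≤ b := by
    by_contra! hbs
    linarith [antitone_shootD N c hbs.le]
  have := forall_ge_of_isOpen (Q := fun t => 0 < shootD N c t) (a := s)
    (isOpen_lt continuous_const (continuous_shootD N c)) (fun t ht hq => by
      have hu : ∀ r ∈ Icc s t, 0 ≤ shootU N c r := fun r hr => by
        have := sub_le_of_hasDerivAt hr.1 (fun r => hasDerivAt_const r (0 : ℝ))
          (hasDerivAt_shootU N c) (fun q hq' => (hq q ⟨hq'.1.le, hq'.2.trans_le hr.2⟩).le)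
        linarith
      have := sub_le_of_hasDerivAt ht (fun r => hasDerivAt_const r (0 : ℝ))
          (hasDerivAt_shootD N c) (fun q hq' => by
            rw [cap_of_nonneg (hu q (Ioo_subset_Icc_self hq'))]; simp)
      linarith) b hsb
  linarith

/-- Rest at a nonnegative height would be permanent. Let `a` be the last time before `b` with slope
zero and `m < 0` the slope at `a + ρ`. On this interval the height is at least `ρ m`, so the force
is at most `K ρ |m|` in size and changes the slope by at most `K ρ² |m|`. That is less than `|m|`
for small `ρ`. -/
theorem Good.false_of_nonneg_of_eq_zero (h : Good N c) {s : ℝ} (hs : 0 ≤ shootU N c s)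
    (hD : shootD N c s = 0) : False := by
  obtain ⟨b, hb⟩ := h
  have hsb : s ≤ b := by
    by_contra! hbs
    linarith [antitone_shootD N c hbs.le]
  set S := Icc s b ∩ {t | shootD N c t = 0}
  have hS : IsCompact S := isCompact_Icc.inter_right
    (isClosed_eq (continuous_shootD N c) continuous_const)
  obtain ⟨⟨h1, h2⟩, h3⟩ := hS.sSup_mem ⟨s, ⟨le_rfl, hsb⟩, hD⟩
  set a := sSup S
  have hz : ∀ r ∈ Icc s a, shootD N c r = 0 := fun r hr =>
    le_antisymm ((antitone_shootD N c hr.1).trans_eq hD)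
      ((h3.symm.le).trans (antitone_shootD N c hr.2))
  have hua : 0 ≤ shootU N c a := by
    have := sub_le_of_hasDerivAt h1 (fun r => hasDerivAt_const r (0 : ℝ))
      (hasDerivAt_shootU N c) (fun q hq' => (hz q (Ioo_subset_Icc_self hq')).ge)
    linarith
  have hab : a < b := lt_of_le_of_ne h2 (fun hab => by
    have h3' : shootD N c a = 0 := h3
    rw [hab] at h3'; linarith)
  set K := Real.exp (2 * b) with hK
  have hK0 : 0 < K := Real.exp_pos _
  obtain ⟨ρ, hρ0, hρb, hρ⟩ : ∃ ρ > 0, a + ρ ≤ b ∧ K * ρ * ρ < 1 := by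
    refine ⟨min (b - a) (min 1 (1 / (2 * K))), lt_min (by linarith) (by positivity), ?_, ?_⟩
    · linarith [min_le_left (b - a) (min 1 (1 / (2 * K)))]
    · set ρ := min (b - a) (min 1 (1 / (2 * K)))
      have h4 : ρ ≤ 1 := (min_le_right _ _).trans (min_le_left _ _)
      have h5 : ρ ≤ 1 / (2 * K) := (min_le_right _ _).trans (min_le_right _ _)
      have h6 : 0 < ρ := lt_min (by linarith) (by positivity)
      have h7 : K * ρ ≤ 1 / 2 := by
        calc K * ρ ≤ K * (1 / (2 * K)) := by gcongr
          _ = 1 / 2 := by field_simp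
      nlinarith
  have h3' : shootD N c a = 0 := h3
  set m := shootD N c (a + ρ) with hm
  have hm0 : m < 0 := by
    refine lt_of_le_of_ne ((antitone_shootD N c (by linarith)).trans_eq h3') fun h0 => ?_
    have : a + ρ ≤ a := le_csSup hS.bddAbove ⟨⟨by linarith, hρb⟩, h0⟩
    linarith
  have hu : ∀ r ∈ Icc a (a + ρ), ρ * m ≤ shootU N c r := fun r hr => by
    have := sub_le_of_hasDerivAt hr.1 (fun r => (hasDerivAt_id r).const_mul m)
      (hasDerivAt_shootU N c) (fun q hq' => by
        rw [mul_one]; exact antitone_shootD N c (hq'.2.le.trans hr.2))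
    simp only [id] at this
    nlinarith [hr.2]
  have := sub_le_of_hasDerivAt (by linarith : a ≤ a + ρ)
    (fun r => (hasDerivAt_id r).const_mul (K * (ρ * m)))
    (hasDerivAt_shootD N c) (fun q hq' => by
      have e1 := hu q (Ioo_subset_Icc_self hq')
      have e2 : 1 - cap (shootU N c q) ≤ -(ρ * m) := by
        rcases le_total (shootU N c q) 0 with h0 | h0
        · rw [cap_of_nonpos h0]; linarith [Real.add_one_le_exp (shootU N c q)]
        · rw [cap_of_nonneg h0]; nlinarith
      have e3 : cap (shootU N c q) * (1 - cap (shootU N c q)) ≤ -(ρ * m) := by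
        nlinarith [cap_le_one (shootU N c q), cap_pos (shootU N c q)]
      have e4 : Real.exp (2 * q) ≤ K := Real.exp_le_exp.2 (by linarith [hq'.2])
      have e5 : Real.exp (2 * q) * (cap (shootU N c q) * (1 - cap (shootU N c q)))
          ≤ K * -(ρ * m) := mul_le_mul e4 e3
        (mul_nonneg (cap_pos _).le (one_sub_cap_nonneg _)) hK0.le
      linarith)
  simp only [id] at this
  nlinarith

/-- When the trajectory first reaches height zero, its slope is nonpositive because the parameter is
good, and nonnegative because it comes from below; slope zero is excluded. If it was never below
zero, the slope is constantly `2 N` up to `t`, and again has to vanish. For good parameters the cap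
is therefore invisible. -/
theorem Good.shootU_neg (h : Good N c) (t : ℝ) : shootU N c t < 0 := by
  by_contra! ht
  have hall : ∀ s ≤ t, 0 ≤ shootU N c s := by
    by_contra! hc
    obtain ⟨s, hst, hs⟩ := hc
    obtain ⟨a, ⟨ha1, ha2⟩, ha3, ha4⟩ := exists_first_of_isClosed
      (Q := fun r => 0 ≤ shootU N c r)
      (isClosed_le continuous_const (continuous_shootU N c)) hst ht
    have hsa : s < a := lt_of_le_of_ne ha1 (fun h => by subst h; linarith)
    refine h.false_of_nonneg_of_eq_zero ha3 (le_antisymm (h.shootD_nonpos_of_nonneg ha3) ?_)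
    by_contra! hD
    obtain ⟨δ, hδ0, hδ⟩ := Metric.eventually_nhds_iff.1
      ((continuous_shootD N c).continuousAt.eventually_lt_const hD)
    set q := max s (a - δ / 2)
    have hq : q < a := max_lt hsa (by linarith)
    have := lt_of_hasDerivAt_neg hq (hasDerivAt_shootU N c) (fun r hr => hδ (by
      rw [Real.dist_eq, abs_lt]
      have := le_max_right s (a - δ / 2)
      constructor <;> linarith [hr.1, hr.2]))
    exact ha4 q ⟨le_max_left _ _, hq⟩ (by linarith)
  have hconst : ∀ s ≤ t, shootD N c s = shootD N c t := fun s hs => by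
    refine le_antisymm ?_ (antitone_shootD N c hs)
    have := sub_le_of_hasDerivAt hs (fun r => hasDerivAt_const r (0 : ℝ))
          (hasDerivAt_shootD N c) (fun q hq' => by
            rw [cap_of_nonneg (hall q hq'.2.le)]; simp)
    linarith
  have hlim : Tendsto (shootD N c) atBot (𝓝 (shootD N c t)) :=
    tendsto_const_nhds.congr' (by
      filter_upwards [eventually_le_atBot t] with s hs using (hconst s hs).symm)
  have h2 := tendsto_nhds_unique hlim (tendsto_shootD_atBot N c)
  refine h.false_of_nonneg_of_eq_zero ht (le_antisymm (h.shootD_nonpos_of_nonneg ht) ?_)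
  rw [h2]; positivity

theorem Good.hasDerivAt_shootD (h : Good N c) (t : ℝ) : HasDerivAt (shootD N c)
    (-(Real.exp (shootU N c t + 2 * t) * (1 - Real.exp (shootU N c t)))) t :=
  hasDerivAt_shootD_of_nonpos (h.shootU_neg t).le

theorem Good.one_sub_exp_pos (h : Good N c) (t : ℝ) : 0 < 1 - Real.exp (shootU N c t) :=
  sub_pos.2 (Real.exp_lt_one_iff.2 (h.shootU_neg t))

theorem Good.strictAnti_shootD (h : Good N c) : StrictAnti (shootD N c) := fun s t hst =>
  lt_of_hasDerivAt_neg hst h.hasDerivAt_shootD fun r _ => by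
    have := mul_pos (Real.exp_pos (shootU N c r + 2 * r)) (h.one_sub_exp_pos r)
    linarith

theorem hasDerivAt_exp_shootW (N : ℕ) (c t : ℝ) :
    HasDerivAt (fun t => Real.exp (shootU N c t + 2 * t))
      (Real.exp (shootU N c t + 2 * t) * (shootD N c t + 2)) t := by
  have := ((hasDerivAt_shootU N c t).fun_add ((hasDerivAt_id t).const_mul 2)).exp
  simpa using this

theorem hasDerivAt_exp_shootE (N : ℕ) (c t : ℝ) :
    HasDerivAt (fun t => Real.exp (2 * shootU N c t + 2 * t))
      (Real.exp (2 * shootU N c t + 2 * t) * (2 * shootD N c t + 2)) t := by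
  have := (((hasDerivAt_shootU N c t).const_mul 2).fun_add ((hasDerivAt_id t).const_mul 2)).exp
  simpa using this

theorem exp_shootE (N : ℕ) (c t : ℝ) : Real.exp (2 * shootU N c t + 2 * t)
    = Real.exp (shootU N c t + 2 * t) * Real.exp (shootU N c t) := by
  rw [← Real.exp_add]; ring_nf

/-- Bounds for the slope after a time at which it is less than `-2`. -/
theorem Good.shootD_tail (h : Good N c) {T η : ℝ} (hη : 0 < η)
    (hT : shootD N c T ≤ -2 - η) {t : ℝ} (ht : T ≤ t) :
    shootD N c T - Real.exp (shootU N c T + 2 * T) / η ≤ shootD N c t ∧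
    shootD N c t ≤ shootD N c T ∧
    shootU N c t + 2 * t ≤ shootU N c T + 2 * T - η * (t - T) := by
  have hd : ∀ r ≥ T, shootD N c r ≤ -2 - η := fun r hr => (antitone_shootD N c hr).trans hT
  refine ⟨?_, antitone_shootD N c ht, ?_⟩
  -- With slope at most `-2 - η`, the derivative of `e^{u+2t} / η` is at most `-e^{u+2t}`, hence at
  -- most the force.
  · have := sub_le_of_hasDerivAt ht (fun r => (hasDerivAt_exp_shootW N c r).div_const η)
      h.hasDerivAt_shootD (fun r hr => by
        have h1 := hd r hr.1.le
        rw [div_le_iff₀ hη]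
        nlinarith [Real.exp_pos (shootU N c r + 2 * r), Real.exp_pos (shootU N c r),
          mul_pos (Real.exp_pos (shootU N c r + 2 * r)) (Real.exp_pos (shootU N c r))])
    have h2 : 0 < Real.exp (shootU N c t + 2 * t) / η := by positivity
    linarith
  · have := sub_le_of_hasDerivAt ht (hasDerivAt_shootU N c)
      (fun r => (hasDerivAt_id r).const_mul (-2 - η))
      (fun r hr => by rw [mul_one]; exact hd r hr.1.le)
    simp only [id] at this
    linarith

/-- With slope at least `-2` forever, `u + 2t` would not decrease, the force would stay away from
zero once `u` is falling, and the slope would tend to `-∞`. -/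
theorem Good.exists_shootD_lt (h : Good N c) : ∃ T, shootD N c T < -2 := by
  by_contra! hc
  obtain ⟨b, hb⟩ := h
  have h : Good N c := ⟨b, hb⟩
  set k := Real.exp (shootU N c b + 2 * b) * (1 - Real.exp (shootU N c b)) with hk
  have hk0 : 0 < k := mul_pos (Real.exp_pos _) (h.one_sub_exp_pos b)
  have hw : ∀ t ≥ b, shootU N c b + 2 * b ≤ shootU N c t + 2 * t := fun t ht => by
    have := sub_le_of_hasDerivAt ht (fun r => (hasDerivAt_id r).const_mul (-2))
      (hasDerivAt_shootU N c) (fun r _ => by rw [mul_one]; exact hc r)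
    simp only [id] at this
    linarith
  have hu : ∀ t ≥ b, shootU N c t ≤ shootU N c b := fun t ht => by
    have := sub_le_of_hasDerivAt ht (hasDerivAt_shootU N c)
      (fun r => hasDerivAt_const r (0 : ℝ))
      (fun r hr => (antitone_shootD N c hr.1.le).trans hb.le)
    linarith
  set t := b + (2 * N + 3) / k with ht
  have hbt : b ≤ t := by
    have : 0 < (2 * N + 3) / k := by positivity
    linarith
  have := sub_le_of_hasDerivAt hbt h.hasDerivAt_shootD
    (fun r => (hasDerivAt_id r).const_mul (-k)) (fun r hr => by
      have e1 := Real.exp_le_exp.2 (hw r hr.1.le)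
      have e2 := Real.exp_le_exp.2 (hu r hr.1.le)
      have e3 : k ≤ Real.exp (shootU N c r + 2 * r) * (1 - Real.exp (shootU N c r)) :=
        mul_le_mul e1 (by linarith) (h.one_sub_exp_pos b).le (Real.exp_pos _).le
      linarith)
  simp only [id] at this
  have e4 : k * (t - b) = 2 * N + 3 := by rw [ht]; field_simp; ring
  have := hc t
  have := shootD_le N c b
  nlinarith

/-- The slope at infinity. -/
def ell (N : ℕ) (c : ℝ) : ℝ := ⨅ t, shootD N c t

theorem Good.bddBelow (h : Good N c) : BddBelow (range (shootD N c)) := by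
  obtain ⟨T, hT⟩ := h.exists_shootD_lt
  set η := -2 - shootD N c T with hη
  refine ⟨shootD N c T - Real.exp (shootU N c T + 2 * T) / η, ?_⟩
  rintro _ ⟨t, rfl⟩
  have hη0 : 0 < η := by linarith
  rcases le_total T t with h1 | h1
  · exact (h.shootD_tail hη0 (by linarith) h1).1
  · have : 0 < Real.exp (shootU N c T + 2 * T) / η := by positivity
    linarith [antitone_shootD N c h1]

theorem Good.tendsto_shootD (h : Good N c) : Tendsto (shootD N c) atTop (𝓝 (ell N c)) :=
  tendsto_atTop_ciInf (antitone_shootD N c) h.bddBelow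

theorem Good.ell_le (h : Good N c) (t : ℝ) : ell N c ≤ shootD N c t := ciInf_le h.bddBelow t

theorem Good.ell_lt (h : Good N c) : ell N c < -2 := by
  obtain ⟨T, hT⟩ := h.exists_shootD_lt
  exact (h.ell_le T).trans_lt hT

theorem Good.le_ell (h : Good N c) {T η : ℝ} (hη : 0 < η) (hT : shootD N c T ≤ -2 - η) :
    shootD N c T - Real.exp (shootU N c T + 2 * T) / η ≤ ell N c :=
  ge_of_tendsto h.tendsto_shootD (by
    filter_upwards [eventually_ge_atTop T] with t ht using (h.shootD_tail hη hT ht).1)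

theorem Good.tendsto_shootW (h : Good N c) :
    Tendsto (fun t => shootU N c t + 2 * t) atTop atBot := by
  obtain ⟨T, hT⟩ := h.exists_shootD_lt
  have hη : 0 < -2 - shootD N c T := by linarith
  refine tendsto_atBot_mono' atTop (f₁ := fun t => shootU N c T + 2 * T
    - (-2 - shootD N c T) * (t - T)) ?_ ?_
  · filter_upwards [eventually_ge_atTop T] with t ht using (h.shootD_tail hη (by linarith) ht).2.2
  · have h1 : Tendsto (fun t => (-2 - shootD N c T) * (t - T)) atTop atTop :=
      (tendsto_atTop_add_const_right _ (-T) tendsto_id).const_mul_atTop hη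
    exact tendsto_atBot_add_const_left atTop _ (tendsto_neg_atTop_atBot.comp h1)

theorem tendsto_shootW_atBot (N : ℕ) (c : ℝ) :
    Tendsto (fun t => shootU N c t + 2 * t) atBot atBot := by
  refine tendsto_atBot_mono' atBot (f₁ := fun t => c + 2 * t) ?_
    (tendsto_atBot_add_const_left _ _ (tendsto_id.const_mul_atBot two_pos))
  filter_upwards [eventually_le_atBot 0] with t ht
  have := shootU_le N c t
  have : 2 * N * t ≤ 0 := mul_nonpos_of_nonneg_of_nonpos (by positivity) ht
  linarith

theorem tendsto_shootE_atBot (N : ℕ) (c : ℝ) :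
    Tendsto (fun t => 2 * shootU N c t + 2 * t) atBot atBot := by
  refine tendsto_atBot_mono' atBot (f₁ := fun t => 2 * c + 2 * t) ?_
    (tendsto_atBot_add_const_left _ _ (tendsto_id.const_mul_atBot two_pos))
  filter_upwards [eventually_le_atBot 0] with t ht
  have := shootU_le N c t
  have : 2 * N * t ≤ 0 := mul_nonpos_of_nonneg_of_nonpos (by positivity) ht
  linarith

/-- The Pohozaev function. -/
def poho (N : ℕ) (c t : ℝ) : ℝ := (shootD N c t + 2) ^ 2 / 2 + Real.exp (shootU N c t + 2 * t)
  - Real.exp (2 * shootU N c t + 2 * t) / 2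

/-- The equation is multiplied by `u' + 2`, which generates the scaling. Only the quadratic
exponential breaks scale invariance, so only this term survives. -/
theorem Good.hasDerivAt_poho (h : Good N c) (t : ℝ) :
    HasDerivAt (poho N c) (Real.exp (2 * shootU N c t + 2 * t)) t := by
  have := ((((h.hasDerivAt_shootD t).add_const 2).fun_pow 2).div_const 2).fun_add
    (hasDerivAt_exp_shootW N c t) |>.fun_sub ((hasDerivAt_exp_shootE N c t).div_const 2)
  refine this.congr_deriv ?_
  rw [exp_shootE]
  push_cast; ring

theorem tendsto_poho_atBot (N : ℕ) (c : ℝ) :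
    Tendsto (poho N c) atBot (𝓝 ((2 * N + 2) ^ 2 / 2)) := by
  have := ((((tendsto_shootD_atBot N c).add_const 2).pow 2).div_const 2).add
    (Real.tendsto_exp_atBot.comp (tendsto_shootW_atBot N c)) |>.sub
    ((Real.tendsto_exp_atBot.comp (tendsto_shootE_atBot N c)).div_const 2)
  unfold poho
  simpa using this

theorem Good.tendsto_shootE (h : Good N c) :
    Tendsto (fun t => Real.exp (2 * shootU N c t + 2 * t)) atTop (𝓝 0) := by
  refine squeeze_zero (fun t => (Real.exp_pos _).le) (fun t => ?_)
    (Real.tendsto_exp_atBot.comp h.tendsto_shootW)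
  exact Real.exp_le_exp.2 (by linarith [h.shootU_neg t])

theorem Good.tendsto_poho (h : Good N c) :
    Tendsto (poho N c) atTop (𝓝 ((ell N c + 2) ^ 2 / 2)) := by
  have := ((((h.tendsto_shootD).add_const 2).pow 2).div_const 2).add
    (Real.tendsto_exp_atBot.comp h.tendsto_shootW) |>.sub (h.tendsto_shootE.div_const 2)
  unfold poho
  simpa using this

theorem Good.monotone_poho (h : Good N c) : Monotone (poho N c) := fun s t hst => by
  have := sub_le_of_hasDerivAt hst (fun r => hasDerivAt_const r (0 : ℝ)) h.hasDerivAt_poho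
    (fun r _ => (Real.exp_pos _).le)
  linarith

theorem Good.strictMono_poho (h : Good N c) : StrictMono (poho N c) := fun _ _ hst =>
  lt_of_hasDerivAt_pos hst h.hasDerivAt_poho fun _ _ => Real.exp_pos _

theorem Good.lt_poho (h : Good N c) (t : ℝ) : ((2 : ℝ) * N + 2) ^ 2 / 2 < poho N c t := by
  have h1 := h.monotone_poho.le_of_tendsto (tendsto_poho_atBot N c) (t - 1)
  exact h1.trans_lt (h.strictMono_poho (by linarith))

/-- The Pohozaev function increases to `(ℓ + 2)² / 2`, and `e^u < 1` leaves at least half of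
`e^{u+2t}` in it. A trajectory that is high at a late time must therefore have a steep final slope.
-/
theorem Good.exp_shootW_le (h : Good N c) (t : ℝ) :
    Real.exp (shootU N c t + 2 * t) ≤ (ell N c + 2) ^ 2 := by
  have h1 := h.monotone_poho.ge_of_tendsto h.tendsto_poho t
  unfold poho at h1
  rw [exp_shootE] at h1
  nlinarith [sq_nonneg (shootD N c t + 2), h.one_sub_exp_pos t,
    mul_pos (Real.exp_pos (shootU N c t + 2 * t)) (h.one_sub_exp_pos t)]

theorem shootD_nonneg_of_not_good (h : ¬ Good N c) (t : ℝ) : 0 ≤ shootD N c t := by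
  by_contra! hc
  exact h ⟨t, hc⟩

/-- A bad trajectory is nondecreasing. If it stayed at or below `-κ`, the force would be bounded
away from zero for positive times and the slope would become negative. -/
theorem exists_shootU_gt_of_not_good (h : ¬ Good N c) {κ : ℝ} (hκ : 0 < κ) :
    ∃ T, ∀ t ≥ T, -κ < shootU N c t := by
  have hmono : ∀ s t, s ≤ t → shootU N c s ≤ shootU N c t := fun s t hst => by
    have := sub_le_of_hasDerivAt hst (fun r => hasDerivAt_const r (0 : ℝ))
      (hasDerivAt_shootU N c) (fun r _ => shootD_nonneg_of_not_good h r)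
    linarith
  suffices ∃ T, -κ < shootU N c T from this.imp fun T hT t ht => hT.trans_le (hmono T t ht)
  by_contra! hc
  set k := Real.exp (shootU N c 0) * (1 - Real.exp (-κ)) with hk
  have hκ1 : 0 < 1 - Real.exp (-κ) := sub_pos.2 (Real.exp_lt_one_iff.2 (by linarith))
  have hk0 : 0 < k := mul_pos (Real.exp_pos _) hκ1
  set t := (2 * N + 1) / k with ht
  have ht0 : 0 ≤ t := by positivity
  have := sub_le_of_hasDerivAt ht0 (hasDerivAt_shootD N c)
    (fun r => (hasDerivAt_id r).const_mul (-k)) (fun r hr => by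
      rw [cap_of_nonpos (by linarith [hc r])]
      have e1 := Real.exp_le_exp.2 (hmono 0 r hr.1.le)
      have e2 := Real.exp_le_exp.2 (hc r)
      have e3 : k ≤ Real.exp (shootU N c r) * (1 - Real.exp (shootU N c r)) :=
        mul_le_mul e1 (by linarith) hκ1.le (Real.exp_pos _).le
      have e4 : 1 ≤ Real.exp (2 * r) := Real.one_le_exp (by linarith [hr.1])
      nlinarith)
  simp only [id] at this
  have e4 : k * t = 2 * N + 1 := by rw [ht]; field_simp
  have := shootD_nonneg_of_not_good h t
  have := shootD_le N c 0
  nlinarith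

/-- The slope at infinity blows up at the boundary of the set of good parameters. -/
theorem eventually_ell_lt_of_not_good (h : ¬ Good N c) {K : ℝ} (hK : 0 ≤ K) :
    ∀ᶠ b in 𝓝 c, Good N b → ell N b < -K := by
  obtain ⟨T₀, hT₀⟩ := exists_shootU_gt_of_not_good h one_pos
  -- For parameters near `c`, `u + 2t` exceeds `2 K + 7` at this time, and `e^{2K+7}` is larger than
  -- any `(ℓ + 2)²` with `-K ≤ ℓ < -2`.
  set T := max T₀ (K + 4) with hT
  have hu : -1 < shootU N c T := hT₀ T (le_max_left _ _)
  filter_upwards [(tendsto_shootU_param N c T).eventually_const_lt hu] with b hb hG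
  have h1 := hG.exp_shootW_le T
  have h2 : K + 4 ≤ T := le_max_right _ _
  have h3 := Real.add_one_le_exp ((shootU N b T + 2 * T) / 2)
  have h4 : Real.exp (shootU N b T + 2 * T) = Real.exp ((shootU N b T + 2 * T) / 2) ^ 2 := by
    rw [← Real.exp_nat_mul]; congr 1; push_cast; ring
  rw [h4] at h1
  have h5 := hG.ell_lt
  by_contra! hc
  nlinarith

/-- The truncated force is at most `e^{2t} / 4`, which lowers the regular part by at most `1 / 16`
up to time zero. The height is then still positive, while good trajectories are negative. -/
theorem not_good_of_one_le (hc : 1 ≤ c) : ¬ Good N c := by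
  intro h
  have hP : ∀ t, -(Real.exp (2 * t) / 8) ≤ shootP N c t := fun t => by
    have := sub_lim_le_of_hasDerivAt (t := t)
      (fun r => ((hasDerivAt_exp_two_mul r).div_const 8).fun_neg)
      (isSol_shoot N c).hasDerivAt_snd (fun r _ => by
        rw [smul_eq_mul]
        nlinarith [Real.exp_pos (2 * r), sq_nonneg (cap (shootU N c r) - 1 / 2)])
      ((tendsto_exp_two_mul_atBot.div_const 8).neg) (isSol_shoot N c).lim_snd
    simp only [zero_div, neg_zero, sub_zero] at this
    exact this
  have := sub_lim_le_of_hasDerivAt (t := 0)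
      (fun r => ((hasDerivAt_exp_two_mul r).div_const 16).fun_neg)
      (isSol_shoot N c).hasDerivAt_fst (fun r _ => by linarith [hP r])
      ((tendsto_exp_two_mul_atBot.div_const 16).neg) (isSol_shoot N c).lim_fst
  have h2 := h.shootU_neg 0
  unfold shootU at h2
  norm_num at this h2
  linarith

/-- While `u` rises below `-M ≤ -1`, one has `e^u ≤ 1/2`, and `(u'+2)²/2 + e^{u+2t}/2` does not
increase from its limit `(2N+2)²/2`. At a first time with `u ≥ -M` this gives `e^{u+2t} ≤ (2N+2)²`,
which bounds the time; then `u ≤ 2Nt + c` contradicts the choice of `c`. A trajectory that stays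
below `-M` cannot belong to a bad parameter. -/
theorem exists_good_of_le (N : ℕ) {M : ℝ} (hM : 1 ≤ M) :
    ∃ c₁, ∀ c ≤ c₁, Good N c ∧ ∀ t, shootU N c t < -M := by
  set n : ℝ := 2 * N + 2 with hn
  have hn2 : 2 ≤ n := by rw [hn]; linarith [show (0 : ℝ) ≤ N from Nat.cast_nonneg N]
  have hln : 0 < Real.log n := Real.log_pos (by linarith)
  refine ⟨-M - 1 - N * (2 * Real.log n + M), fun c hc => ?_⟩
  have hN : (0 : ℝ) ≤ N := Nat.cast_nonneg N
  have hNn : 0 ≤ N * (2 * Real.log n + M) := by positivity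
  have hall : ∀ t, shootU N c t < -M := by
    refine forall_of_isOpen_of_eventually_atBot (Q := fun t => shootU N c t < -M)
      (isOpen_lt (continuous_shootU N c) continuous_const) ?_ ?_
    · filter_upwards [eventually_le_atBot 0] with t ht
      have := shootU_le N c t
      have : 2 * N * t ≤ 0 := mul_nonpos_of_nonneg_of_nonpos (by positivity) ht
      linarith
    intro t ht
    by_contra! hcon
    have hD : ∀ r < t, 0 < shootD N c r := fun r hr => by
      by_contra! hD
      have := sub_le_of_hasDerivAt hr.le (hasDerivAt_shootU N c)
        (fun r => hasDerivAt_const r (0 : ℝ))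
        (fun q hq => (antitone_shootD N c hq.1.le).trans hD)
      linarith [ht r hr]
    have hH : ∀ r, HasDerivAt
        (fun r => (shootD N c r + 2) ^ 2 / 2 + Real.exp (shootU N c r + 2 * r) / 2) _ r :=
      fun r => ((((hasDerivAt_shootD N c r).add_const 2).fun_pow 2).div_const 2).fun_add
        ((hasDerivAt_exp_shootW N c r).div_const 2)
    have hlim := ((((tendsto_shootD_atBot N c).add_const 2).pow 2).div_const 2).add
      ((Real.tendsto_exp_atBot.comp (tendsto_shootW_atBot N c)).div_const 2)
    have := sub_lim_le_of_hasDerivAt (t := t) hH (fun r => hasDerivAt_const r (0 : ℝ))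
      (fun r hr => by
        have e1 := hD r hr
        have e2 := ht r hr
        rw [cap_of_nonpos (by linarith)]
        have e3 : Real.exp (shootU N c r) ≤ 1 / 2 := by
          have h1 : Real.exp (shootU N c r) ≤ Real.exp (-1) := Real.exp_le_exp.2 (by linarith)
          have h2 := Real.exp_one_gt_d9
          have h3 : Real.exp (-1) * Real.exp 1 = 1 := by rw [← Real.exp_add]; simp
          nlinarith [Real.exp_pos (-1 : ℝ)]
        have e4 : Real.exp (shootU N c r + 2 * r)
            = Real.exp (2 * r) * Real.exp (shootU N c r) := by rw [add_comm, Real.exp_add]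
        rw [e4]
        have e5 := mul_pos (Real.exp_pos (2 * r)) (Real.exp_pos (shootU N c r))
        push_cast
        have e6 : 0 ≤ (Real.exp (2 * r) * Real.exp (shootU N c r)) * (shootD N c r + 2)
          * (1 / 2 - Real.exp (shootU N c r)) :=
          mul_nonneg (mul_nonneg e5.le (by linarith)) (by linarith)
        nlinarith) hlim tendsto_const_nhds
    simp only [sub_self, zero_div, add_zero] at this
    have e1 : Real.exp (shootU N c t + 2 * t) ≤ n ^ 2 := by
      nlinarith [sq_nonneg (shootD N c t + 2)]
    have e2 : shootU N c t + 2 * t ≤ 2 * Real.log n := by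
      have := Real.log_le_log (Real.exp_pos _) e1
      rw [Real.log_exp, Real.log_pow] at this
      exact_mod_cast this
    have e3 := shootU_le N c t
    have e4 : 2 * t ≤ 2 * Real.log n + M := by linarith
    have e5 : N * (2 * t) ≤ N * (2 * Real.log n + M) := mul_le_mul_of_nonneg_left e4 hN
    linarith
  refine ⟨?_, hall⟩
  by_contra hG
  obtain ⟨T, hT⟩ := exists_shootU_gt_of_not_good hG (show (0 : ℝ) < M by linarith)
  linarith [hT T le_rfl, hall T]

/-- The slope at infinity approaches the Liouville value for very negative parameters. -/
theorem exists_lt_ell (N : ℕ) {l : ℝ} (hl : l < -2 * (N + 2)) :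
    ∃ c₁, ∀ c ≤ c₁, Good N c ∧ l < ell N c := by
  set κ := min (1 / 2) ((-2 * (N + 2) - l) / 8) with hκ
  have hκ0 : 0 < κ := lt_min (by norm_num) (by linarith)
  have hκ1 : κ ≤ 1 / 2 := min_le_left _ _
  have hκ2 : κ ≤ (-2 * (N + 2) - l) / 8 := min_le_right _ _
  obtain ⟨c₁, h⟩ := exists_good_of_le N (le_max_left 1 (-Real.log κ))
  refine ⟨c₁, fun c hc => ⟨(h c hc).1, ?_⟩⟩
  obtain ⟨hG, hu⟩ := h c hc
  have hexp : ∀ t, Real.exp (shootU N c t) ≤ κ := fun t => by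
    rw [← Real.le_log_iff_exp_le hκ0]
    linarith [hu t, le_max_right 1 (-Real.log κ)]
  -- Where `e^u ≤ κ ≤ 1/2`, the growth of the Pohozaev function is paid for by `2κ` times the loss
  -- of slope. Comparing the limits at both ends gives `(-ℓ - 2(N+2)) (2N - ℓ) ≤ 4κ (2N - ℓ)`.
  have hanti : ∀ s t, s ≤ t → poho N c t + 2 * κ * shootD N c t
      ≤ poho N c s + 2 * κ * shootD N c s := fun s t hst => by
    have := sub_le_of_hasDerivAt hst
      (fun r => (hG.hasDerivAt_poho r).fun_add ((hG.hasDerivAt_shootD r).const_mul (2 * κ)))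
      (fun r => hasDerivAt_const r (0 : ℝ)) (fun r _ => by
        rw [exp_shootE]
        have e1 := Real.exp_pos (shootU N c r + 2 * r)
        have e2 := hexp r
        have e3 : 0 ≤ Real.exp (shootU N c r + 2 * r) *
          (2 * κ * (1 - Real.exp (shootU N c r)) - Real.exp (shootU N c r)) :=
          mul_nonneg e1.le (by nlinarith)
        nlinarith)
    linarith
  have hle : (ell N c + 2) ^ 2 / 2 + 2 * κ * ell N c ≤ (2 * N + 2) ^ 2 / 2 + 2 * κ * (2 * N) := by
    have ha : Antitone fun t => poho N c t + 2 * κ * shootD N c t := fun s t hst => hanti s t hst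
    have h1 := ha.ge_of_tendsto ((tendsto_poho_atBot N c).add
      ((tendsto_shootD_atBot N c).const_mul (2 * κ))) 0
    have h2 := ha.le_of_tendsto (hG.tendsto_poho.add (hG.tendsto_shootD.const_mul (2 * κ))) 0
    exact h2.trans h1
  have h3 := hG.ell_lt
  have hN : (0 : ℝ) ≤ N := Nat.cast_nonneg N
  have h4 : (-ell N c - 2 * (N + 2)) * (2 * N - ell N c) ≤ 4 * κ * (2 * N - ell N c) := by
    nlinarith
  have h5 := le_of_mul_le_mul_right h4 (by linarith)
  linarith

/-- At one late time `T`, the tail bound `0 ≤ u'(T) - ℓ ≤ e^{u(T)+2T} / η` holds with a small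
right-hand side for all nearby parameters. Continuity of `ℓ` thus reduces to continuity of `u'(T)`.
-/
theorem Good.continuousAt_ell (h : Good N c) : ContinuousAt (ell N) c := by
  obtain ⟨T₀, hT₀⟩ := h.exists_shootD_lt
  set η := (-2 - shootD N c T₀) / 2 with hη
  have hη0 : 0 < η := by linarith
  rw [Metric.continuousAt_iff']
  intro ε hε
  have h1 : ∀ᶠ T in atTop, Real.exp (shootU N c T + 2 * T) < η * (ε / 3) :=
    (Real.tendsto_exp_atBot.comp h.tendsto_shootW).eventually_lt_const (by positivity)
  obtain ⟨T, hT, hTT⟩ := (h1.and (eventually_ge_atTop T₀)).exists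
  have hD : shootD N c T < -2 - η := by linarith [antitone_shootD N c hTT]
  have e1 := (tendsto_shootD_param N c T).eventually_lt_const hD
  have e2 : ∀ᶠ b in 𝓝 c, Real.exp (shootU N b T + 2 * T) < η * (ε / 3) := by
    have := ((tendsto_shootU_param N c T).add_const (2 * T)).rexp
    exact this.eventually_lt_const hT
  have e3 := Metric.tendsto_nhds.1 (tendsto_shootD_param N c T) (ε / 3) (by positivity)
  filter_upwards [e1, e2, e3, (isOpen_good N).mem_nhds h] with b h1 h2 h3 hb
  have hb' : Good N b := hb
  have k1 := hb'.le_ell hη0 h1.le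
  have k2 := hb'.ell_le T
  have k3 := h.le_ell hη0 hD.le
  have k4 := h.ell_le T
  have k5 : Real.exp (shootU N b T + 2 * T) / η < ε / 3 := by
    rw [div_lt_iff₀ hη0]; linarith
  have k6 : Real.exp (shootU N c T + 2 * T) / η < ε / 3 := by
    rw [div_lt_iff₀ hη0]; linarith
  rw [Real.dist_eq, abs_lt] at *
  constructor <;> linarith [h3.1, h3.2]

end ScalarCSH

/-! ### The linearization in the shooting parameter. -/

section Linearization

theorem sub_le_of_hasDerivAt_Icc {f f' g g' : ℝ → ℝ} {s t : ℝ} (hst : s ≤ t)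
    (hf : ∀ r ∈ Icc s t, HasDerivAt f (f' r) r) (hg : ∀ r ∈ Icc s t, HasDerivAt g (g' r) r)
    (h : ∀ r ∈ Ioo s t, f' r ≤ g' r) : f t - f s ≤ g t - g s := by
  have hm : MonotoneOn (fun r => g r - f r) (Icc s t) := by
    apply monotoneOn_of_deriv_nonneg (convex_Icc s t)
    · exact fun r hr => ((hg r hr).sub (hf r hr)).continuousAt.continuousWithinAt
    · exact fun r hr => ((hg r (interior_subset hr)).sub
        (hf r (interior_subset hr))).differentiableAt.differentiableWithinAt
    · intro r hr
      rw [((hg r (interior_subset hr)).fun_sub (hf r (interior_subset hr))).deriv]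
      rw [interior_Icc] at hr
      linarith [h r hr]
  have := hm ⟨le_rfl, hst⟩ ⟨hst, le_rfl⟩ hst
  simp only at this
  linarith

theorem nonneg_of_forall_lt {f : ℝ → ℝ} (hf : Continuous f) {t : ℝ} (h : ∀ s < t, 0 ≤ f s) :
    0 ≤ f t :=
  ge_of_tendsto (hf.continuousAt.continuousWithinAt (s := Iio t))
    (by filter_upwards [self_mem_nhdsWithin] with s hs using h s hs)

theorem deriv_nonpos_of_forall_lt {f f' : ℝ → ℝ} (hf : ∀ t, HasDerivAt f (f' t) t)
    (hf' : Continuous f') {t : ℝ} (h : ∀ s < t, f t ≤ f s) : f' t ≤ 0 := by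
  by_contra! hD
  obtain ⟨δ, hδ0, hδ⟩ := Metric.eventually_nhds_iff.1 (hf'.continuousAt.eventually_const_lt hD)
  have := lt_of_hasDerivAt_pos (show t - δ / 2 < t by linarith) hf (fun r hr => hδ (by
    rw [Real.dist_eq, abs_lt]
    constructor <;> linarith [hr.1, hr.2]))
  linarith [h (t - δ / 2) (by linarith)]

theorem exists_isSol_linearized (N : ℕ) (c : ℝ) : ∃ x p : ℝ → ℝ,
    IsSol (fun t => -(cap (shootU N c t) * (1 - 2 * cap (shootU N c t)) * x t)) 1 x p := by
  refine exists_isSol (fun t x : ℝ =>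
    -(cap (shootU N c t) * (1 - 2 * cap (shootU N c t)) * x)) 1
    (L := 1) (C := 0) zero_le_one le_rfl ?_ ?_ ?_
  · have := continuous_cap
    have := continuous_shootU N c
    fun_prop
  · intro t x y
    have h1 := cap_pos (shootU N c t)
    have h2 := cap_le_one (shootU N c t)
    rw [Real.norm_eq_abs, Real.norm_eq_abs, neg_sub_neg, ← mul_sub, abs_mul, abs_sub_comm y]
    gcongr
    rw [abs_le]
    constructor <;> nlinarith
  · simp

variable {N : ℕ} {c : ℝ}

set_option maxHeartbeats 1000000 in
/-- The linearization of a non-topological solution with respect to the shooting parameter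
eventually is negative, decreasing with slope bounded away from zero, and grows at most
linearly. -/
theorem Good.linearized (h : Good N c) {x p : ℝ → ℝ}
    (hx : IsSol (fun t => -(cap (shootU N c t) * (1 - 2 * cap (shootU N c t)) * x t)) 1 x p) :
    ∃ T ω C, 0 < ω ∧ 0 < C ∧ shootD N c T < -2 ∧
      ∀ t ≥ T, x t < 0 ∧ p t ≤ -ω ∧ -(C * (t - T + 1)) ≤ x t := by
  set u := shootU N c with hu
  set z := fun t => shootD N c t + 2 with hz
  set w := fun t => Real.exp (u t + 2 * t) with hw
  have hw0 : ∀ t, 0 < w t := fun t => Real.exp_pos _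
  have hu1 : ∀ t, Real.exp (u t) < 1 := fun t => Real.exp_lt_one_iff.2 (h.shootU_neg t)
  have hu0 : ∀ t, 0 < Real.exp (u t) := fun t => Real.exp_pos _
  have hwd : ∀ t, HasDerivAt w (w t * z t) t := hasDerivAt_exp_shootW N c
  have hzd : ∀ t, HasDerivAt z (-(w t * (1 - Real.exp (u t)))) t := fun t =>
    (h.hasDerivAt_shootD t).add_const 2
  have hxd := hx.hasDerivAt_fst
  have hpd : ∀ t, HasDerivAt p (-(w t * (1 - 2 * Real.exp (u t)) * x t)) t := fun t => by
    have := hx.hasDerivAt_snd t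
    rw [cap_of_nonpos (h.shootU_neg t).le] at this
    refine this.congr_deriv ?_
    simp only [hw, smul_eq_mul]
    rw [Real.exp_add]; ring
  have hEd : ∀ t, HasDerivAt (fun t => w t * Real.exp (u t))
      (w t * Real.exp (u t) * (2 * z t - 2)) t := fun t => by
    have := (hwd t).fun_mul (hasDerivAt_shootU N c t).exp
    refine this.congr_deriv ?_
    simp only [hz]; ring
  have hxc := hx.continuous_fst
  have hpc := hx.continuous_snd
  have hzc : Continuous z := continuous_iff_continuousAt.2 fun t => (hzd t).continuousAt
  have huc : Continuous u := continuous_shootU N c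
  have hwc : Continuous w := continuous_iff_continuousAt.2 fun t => (hwd t).continuousAt
  -- The Wronskian of `x` and `z = u' + 2`. The function `z` solves the linearized equation up to
  -- the source `-2 w e^u`, so `W' = 2 w e^u x` and `(x / z)' = W / z²`.
  set W := fun t => z t * p t + (w t - w t * Real.exp (u t)) * x t with hW
  have hWd : ∀ t, HasDerivAt W (2 * (w t * Real.exp (u t)) * x t) t := fun t => by
    have := ((hzd t).fun_mul (hpd t)).fun_add (((hwd t).fun_sub (hEd t)).fun_mul (hxd t))
    refine this.congr_deriv ?_
    ring
  have hWc : Continuous W := continuous_iff_continuousAt.2 fun t => (hWd t).continuousAt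
  have hwlim : Tendsto w atBot (𝓝 0) := Real.tendsto_exp_atBot.comp (tendsto_shootW_atBot N c)
  have hElim : Tendsto (fun t => w t * Real.exp (u t)) atBot (𝓝 0) := by
    refine squeeze_zero (fun t => (mul_pos (hw0 t) (hu0 t)).le) (fun t => ?_) hwlim
    nlinarith [hw0 t, hu1 t]
  have hzlim : Tendsto z atBot (𝓝 (2 * N + 2)) := (tendsto_shootD_atBot N c).add_const 2
  have hWlim : Tendsto W atBot (𝓝 0) := by
    have := (hzlim.mul hx.lim_snd).add ((hwlim.sub hElim).mul hx.lim_fst)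
    simpa using this
  have hzanti : StrictAnti z := fun s t hst => by
    have := h.strictAnti_shootD hst
    simp only [hz]; linarith
  set Z := -(ell N c + 2) with hZ
  have hZ0 : 0 < Z := by have := h.ell_lt; linarith
  have hzZ : ∀ t, -Z ≤ z t := fun t => by
    have := h.ell_le t
    simp only [hz]; linarith
  have hWpos : ∀ t, (∀ s < t, 0 < x s) → 0 < W t := fun t ht => by
    have h1 := sub_lim_le_of_hasDerivAt (t := t - 1) (fun r => hasDerivAt_const r (0 : ℝ)) hWd
      (fun r hr => mul_nonneg (mul_nonneg two_pos.le (mul_pos (hw0 r) (hu0 r)).le)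
        (ht r (by linarith)).le) tendsto_const_nhds hWlim
    have h2 := lt_of_hasDerivAt_pos (show t - 1 < t by linarith) hWd (fun r hr =>
      mul_pos (mul_pos two_pos (mul_pos (hw0 r) (hu0 r))) (ht r hr.2))
    linarith
  have hyd : ∀ t, z t ≠ 0 → HasDerivAt (fun t => x t / z t) (W t / z t ^ 2) t := fun t ht => by
    refine ((hxd t).fun_div (hzd t) ht).congr_deriv ?_
    simp only [hW]; ring
  obtain ⟨T₁, hT₁⟩ := h.exists_shootD_lt
  have hzT₁ : z T₁ < 0 := by simp only [hz]; linarith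
  -- Without such a time `W` stays above `W T₁ > 0`, so `x / z` increases at least linearly although
  -- it remains negative.
  have hzero : ∃ t, x t ≤ 0 := by
    by_contra! hpos
    have hW1 := fun t => hWpos t fun s _ => hpos s
    have hWm : ∀ t ≥ T₁, W T₁ ≤ W t := fun t ht => by
      have := sub_le_of_hasDerivAt ht (fun r => hasDerivAt_const r (0 : ℝ)) hWd (fun r _ =>
        mul_nonneg (mul_nonneg two_pos.le (mul_pos (hw0 r) (hu0 r)).le) (hpos r).le)
      linarith
    have hzn : ∀ t ≥ T₁, z t < 0 := fun t ht => (hzanti.antitone ht).trans_lt hzT₁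
    set k := W T₁ / Z ^ 2 with hk
    have hk0 : 0 < k := div_pos (hW1 _) (by positivity)
    have hle : ∀ t ≥ T₁, k * (t - T₁) ≤ x t / z t - x T₁ / z T₁ := fun t ht => by
      have := sub_le_of_hasDerivAt_Icc ht (fun r _ => (hasDerivAt_id r).const_mul k)
        (fun r hr => hyd r (hzn r hr.1).ne) (fun r hr => by
          rw [mul_one]
          refine div_le_div₀ (hW1 r).le (hWm r hr.1.le) ?_ ?_
          · have := (hzn r hr.1.le).ne; positivity
          · have := hzn r hr.1.le
            have := hzZ r
            nlinarith)
      simp only [id] at this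
      linarith
    set t := T₁ - x T₁ / z T₁ / k with ht
    have hneg : x T₁ / z T₁ < 0 := div_neg_of_pos_of_neg (hpos _) hzT₁
    have htT : T₁ ≤ t := by
      have : x T₁ / z T₁ / k < 0 := div_neg_of_neg_of_pos hneg hk0
      linarith
    have h1 := hle t htT
    have h2 : k * (t - T₁) = -(x T₁ / z T₁) := by rw [ht]; field_simp; ring
    have h3 : x t / z t < 0 := div_neg_of_pos_of_neg (hpos _) (hzn t htT)
    linarith
  obtain ⟨b, hb⟩ := hzero
  obtain ⟨a₀, ha₀⟩ := eventually_atBot.1 (hx.lim_fst.eventually_const_lt one_pos)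
  have hab : a₀ ≤ b := by
    by_contra! hlt
    linarith [ha₀ b hlt.le]
  obtain ⟨t₂, ⟨ht₂a, -⟩, hxt₂, hfirst⟩ := exists_first_of_isClosed (Q := fun t => x t ≤ 0)
    (isClosed_le hxc continuous_const) hab hb
  have hpos : ∀ s < t₂, 0 < x s := fun s hs => by
    rcases le_total s a₀ with hsa | hsa
    · exact ha₀ s hsa
    · exact not_le.1 (hfirst s ⟨hsa, hs⟩)
  have hx2 : x t₂ = 0 := le_antisymm hxt₂ (nonneg_of_forall_lt hxc fun s hs => (hpos s hs).le)
  have hp2 : p t₂ ≤ 0 := deriv_nonpos_of_forall_lt hxd hpc fun s hs => by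
    rw [hx2]; exact (hpos s hs).le
  have hW2 := hWpos t₂ hpos
  have hW2eq : W t₂ = z t₂ * p t₂ := by simp [hW, hx2]
  have hz2 : z t₂ < 0 := by
    by_contra! hc
    nlinarith
  have hp2' : p t₂ < 0 := by
    refine lt_of_le_of_ne hp2 fun h0 => ?_
    rw [h0] at hW2eq; linarith
  set κ := Real.exp (u t₂) with hκ
  have hκ0 : 0 < κ := hu0 _
  have hκ1 : κ < 1 := hu1 _
  -- `Q` and the function `R` below have derivatives `w (2 e^u - κ) x` and `w (2 e^u - κ) z`. The
  -- Pohozaev inequality at `t₂` says that `R t₂` is at least the limit of `R` at `-∞`, and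
  -- comparison will give `0 ≤ Q t₂`. This is the bound `κ / (1 - κ) ≤ -z t₂`.
  set Q := fun t => (1 - κ) * W t + κ * p t with hQ
  have hQd : ∀ t, HasDerivAt Q (w t * (2 * Real.exp (u t) - κ) * x t) t := fun t => by
    refine (((hWd t).const_mul (1 - κ)).fun_add ((hpd t).const_mul κ)).congr_deriv ?_
    ring
  have hQlim : Tendsto Q atBot (𝓝 0) := by
    simpa using (hWlim.const_mul (1 - κ)).add (hx.lim_snd.const_mul κ)
  set R := fun t => z t ^ 2 + (2 - κ) * w t with hR
  have hRd : ∀ t, HasDerivAt R (w t * (2 * Real.exp (u t) - κ) * z t) t := fun t => by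
    refine (((hzd t).fun_pow 2).fun_add ((hwd t).const_mul (2 - κ))).congr_deriv ?_
    push_cast; ring
  have hRlim : Tendsto R atBot (𝓝 ((2 * N + 2) ^ 2)) := by
    simpa using (hzlim.pow 2).add (hwlim.const_mul (2 - κ))
  have hR2 : (2 * (N : ℝ) + 2) ^ 2 ≤ R t₂ := by
    have := h.lt_poho t₂
    unfold poho at this
    rw [exp_shootE] at this
    simp only [hR, hz, hw, hκ, hu]
    linarith
  -- If `2 e^u - κ` is negative somewhere before `t₂`, it changes sign once there, at `t₀`, because
  -- `u` first rises and then falls. With `m = x t₀ / z t₀` the difference `x - m z` changes sign at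
  -- the same time and in the same direction, since `x / z` is nondecreasing while `z > 0`. Hence
  -- `Q' ≥ m R'` up to `t₂`.
  have hQ2 : 0 ≤ Q t₂ := by
    by_cases hcase : ∀ t < t₂, κ ≤ 2 * Real.exp (u t)
    · have := sub_lim_le_of_hasDerivAt (t := t₂) (fun r => hasDerivAt_const r (0 : ℝ)) hQd
        (fun r hr => mul_nonneg (mul_nonneg (hw0 r).le (by linarith [hcase r hr]))
          (hpos r hr).le) tendsto_const_nhds hQlim
      linarith
    push Not at hcase
    obtain ⟨s, hs, hsu⟩ := hcase
    have hud := hasDerivAt_shootU N c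
    obtain ⟨t₀, ⟨ht0s, ht02⟩, ht₀⟩ : ∃ t ∈ Icc s t₂, 2 * Real.exp (u t) = κ := by
      have hcont : ContinuousOn (fun t => 2 * Real.exp (u t)) (Icc s t₂) := by fun_prop
      exact intermediate_value_Icc hs.le hcont ⟨hsu.le, by linarith⟩
    have ht02' : t₀ < t₂ := lt_of_le_of_ne ht02 fun h0 => by
      rw [h0] at ht₀; linarith
    have hu02 : u t₀ < u t₂ := by
      rw [← Real.exp_lt_exp]; linarith
    have hD0 : 0 < shootD N c t₀ := by
      by_contra! hc
      have := sub_le_of_hasDerivAt ht02 hud (fun r => hasDerivAt_const r (0 : ℝ))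
        (fun r hr => (antitone_shootD N c hr.1.le).trans hc)
      linarith
    have hz0 : 0 < z t₀ := by simp only [hz]; linarith
    have hbefore : ∀ r < t₀, 2 * Real.exp (u r) ≤ κ := fun r hr => by
      have := sub_le_of_hasDerivAt hr.le (fun r => hasDerivAt_const r (0 : ℝ)) hud
        (fun q hq => hD0.le.trans (antitone_shootD N c hq.2.le))
      have := Real.exp_le_exp.2 (show u r ≤ u t₀ by linarith)
      linarith
    have hafter : ∀ r, t₀ ≤ r → r < t₂ → κ ≤ 2 * Real.exp (u r) := fun r hr hr2 => by
      suffices u t₀ ≤ u r by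
        have := Real.exp_le_exp.2 this
        linarith
      rcases le_total 0 (shootD N c r) with h0 | h0
      · have := sub_le_of_hasDerivAt hr (fun r => hasDerivAt_const r (0 : ℝ)) hud
          (fun q hq => h0.trans (antitone_shootD N c hq.2.le))
        linarith
      · have := sub_le_of_hasDerivAt hr2.le hud (fun r => hasDerivAt_const r (0 : ℝ))
          (fun q hq => (antitone_shootD N c hq.1.le).trans h0)
        linarith
    set m := x t₀ / z t₀ with hm
    have hm0 : 0 < m := div_pos (hpos _ ht02') hz0
    have hymono : ∀ q r, q ≤ r → r < t₂ → 0 < z r → x q / z q ≤ x r / z r :=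
      fun q r hqr hr2 hzr => by
        have := sub_le_of_hasDerivAt_Icc hqr (fun r _ => hasDerivAt_const r (0 : ℝ))
          (fun k hk => hyd k (hzr.trans_le (hzanti.antitone hk.2)).ne') (fun k hk =>
            div_nonneg (hWpos k fun s hs => hpos s (by linarith [hk.2])).le (sq_nonneg _))
        linarith
    have := sub_lim_le_of_hasDerivAt (t := t₂) (fun r => (hRd r).const_mul m) hQd
        (fun r hr => by
          rcases lt_or_ge r t₀ with h0 | h0
          · have e1 := hymono r t₀ h0.le ht02' hz0
            have e2 : 0 < z r := hz0.trans (hzanti h0)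
            rw [div_le_iff₀ e2] at e1
            have e3 := hbefore r h0
            nlinarith [mul_nonneg (mul_nonneg (hw0 r).le (sub_nonneg.2 e3)) (sub_nonneg.2 e1)]
          · have e3 := hafter r h0 hr
            have e1 : m * z r ≤ x r := by
              rcases lt_or_ge 0 (z r) with e2 | e2
              · have := hymono t₀ r h0 hr e2
                rwa [le_div_iff₀ e2] at this
              · nlinarith [hpos r hr]
            nlinarith [mul_nonneg (mul_nonneg (hw0 r).le (sub_nonneg.2 e3)) (sub_nonneg.2 e1)])
        (hRlim.const_mul m) hQlim
    nlinarith
  have hkey : κ ≤ (1 - κ) * (-z t₂) := by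
    simp only [hQ] at hQ2
    rw [hW2eq] at hQ2
    by_contra! hc
    nlinarith
  set k := κ / (1 - κ) with hk
  have hk1 : 0 < 1 - κ := by linarith
  have hk0 : 0 < k := div_pos hκ0 hk1
  have hkz : k ≤ -z t₂ := by rw [hk, div_le_iff₀ hk1]; linarith
  -- The lower bound for `W` after `t₂`. It comes from comparing `W - w e^u (x / z)` with `-(W t₂) k
  -- / z`. The derivatives are ordered because `W ≤ W t₂` and `e^u ≤ k (1 - e^u)` there, and `k ≤ -z
  -- t₂` takes care of the initial values.
  set ω₀ := W t₂ * k / Z with hω₀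
  have hω₀0 : 0 < ω₀ := by positivity
  have hzn : ∀ t ≥ t₂, z t < 0 := fun t ht => (hzanti.antitone ht).trans_lt hz2
  have huk : ∀ t ≥ t₂, Real.exp (u t) ≤ κ := fun t ht => by
    rw [hκ, Real.exp_le_exp]
    have := sub_le_of_hasDerivAt ht (hasDerivAt_shootU N c)
      (fun r => hasDerivAt_const r (0 : ℝ)) (fun r hr => by
        have := hzn r hr.1.le
        simp only [hz] at this
        linarith)
    linarith
  have hstep : ∀ t ≥ t₂, (∀ s ∈ Ico t₂ t, 0 < W s) →
      0 ≤ x t / z t ∧ W t ≤ W t₂ ∧ ω₀ ≤ W t := fun t ht hs => by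
    have hy : ∀ r ∈ Icc t₂ t, 0 ≤ x r / z r := fun r hr => by
      have := sub_le_of_hasDerivAt_Icc hr.1 (fun r _ => hasDerivAt_const r (0 : ℝ))
        (fun q hq => hyd q (hzn q hq.1).ne) (fun q hq => div_nonneg
          (hs q ⟨hq.1.le, hq.2.trans_le hr.2⟩).le (sq_nonneg _))
      rw [hx2] at this
      simpa using this
    have hxr : ∀ r ∈ Icc t₂ t, x r ≤ 0 := fun r hr => by
      by_contra! hc
      linarith [hy r hr, div_neg_of_pos_of_neg hc (hzn r hr.1)]
    have hWle : ∀ r ∈ Icc t₂ t, W r ≤ W t₂ := fun r hr => by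
      have := sub_le_of_hasDerivAt hr.1 hWd (fun r => hasDerivAt_const r (0 : ℝ))
        (fun q hq => mul_nonpos_of_nonneg_of_nonpos
          (mul_nonneg two_pos.le (mul_pos (hw0 q) (hu0 q)).le)
          (hxr q ⟨hq.1.le, hq.2.le.trans hr.2⟩))
      linarith
    refine ⟨hy t ⟨ht, le_rfl⟩, hWle t ⟨ht, le_rfl⟩, ?_⟩
    have := sub_le_of_hasDerivAt_Icc ht
      (fun r hr => ((hzd r).fun_inv (hzn r hr.1).ne).const_mul (-(W t₂ * k)))
      (fun r hr => (hWd r).fun_sub ((hEd r).fun_mul (hyd r (hzn r hr.1).ne)))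
      (fun r hr => by
        have hr' := Ioo_subset_Icc_self hr
        have e1 := hzn r hr'.1
        have e2 : x r = z r * (x r / z r) := (mul_div_cancel₀ _ e1.ne).symm
        have e3 := hy r hr'
        set y := x r / z r
        have e4 : Real.exp (u r) * W r ≤ W t₂ * k * (1 - Real.exp (u r)) := by
          have e5 : Real.exp (u r) ≤ k * (1 - Real.exp (u r)) := by
            rw [hk, div_mul_eq_mul_div, le_div_iff₀ hk1]
            linarith [huk r hr'.1]
          calc Real.exp (u r) * W r ≤ Real.exp (u r) * W t₂ :=
                mul_le_mul_of_nonneg_left (hWle r hr') (hu0 r).le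
            _ ≤ k * (1 - Real.exp (u r)) * W t₂ := mul_le_mul_of_nonneg_right e5 hW2.le
            _ = _ := by ring
        have e6 : 0 < z r ^ 2 := by have := e1.ne; positivity
        have e7 : w r * (Real.exp (u r) * W r) / z r ^ 2
            ≤ w r * (W t₂ * k * (1 - Real.exp (u r))) / z r ^ 2 := by
          have := (hw0 r).le
          gcongr
        have e8 : 0 ≤ 2 * (w r * Real.exp (u r)) * y :=
          mul_nonneg (mul_nonneg two_pos.le (mul_pos (hw0 r) (hu0 r)).le) e3
        have e9 : 2 * (w r * Real.exp (u r)) * x r - (w r * Real.exp (u r) * (2 * z r - 2) * y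
            + w r * Real.exp (u r) * (W r / z r ^ 2))
            = 2 * (w r * Real.exp (u r)) * y - w r * (Real.exp (u r) * W r) / z r ^ 2 := by
          rw [e2]; ring
        have e10 : -(W t₂ * k) * (-(-(w r * (1 - Real.exp (u r)))) / z r ^ 2)
            = -(w r * (W t₂ * k * (1 - Real.exp (u r))) / z r ^ 2) := by ring
        rw [e9, e10]
        linarith)
    rw [hx2] at this
    simp only [zero_div, mul_zero, sub_zero] at this
    have hzt := hzn t ht
    have e1 : 0 ≤ w t * Real.exp (u t) * (x t / z t) :=
      mul_nonneg (mul_pos (hw0 t) (hu0 t)).le (hy t ⟨ht, le_rfl⟩)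
    have e2 : Z⁻¹ ≤ -(z t)⁻¹ := by
      rw [← inv_neg]
      exact inv_anti₀ (by linarith) (by linarith [hzZ t])
    have e3 : k * -(z t₂)⁻¹ ≤ 1 := by
      rw [← inv_neg, ← div_eq_mul_inv, div_le_one (by linarith)]
      exact hkz
    have e4 : W t₂ * (k * -(z t₂)⁻¹) ≤ W t₂ * 1 := mul_le_mul_of_nonneg_left e3 hW2.le
    have e5 : W t₂ * k * Z⁻¹ ≤ W t₂ * k * -(z t)⁻¹ :=
      mul_le_mul_of_nonneg_left e2 (by positivity)
    rw [hω₀, div_eq_mul_inv]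
    linarith
  have hall := forall_ge_of_isOpen (Q := fun t => 0 < W t) (a := t₂)
    (isOpen_lt continuous_const hWc) (fun t ht hs => hω₀0.trans_le (hstep t ht hs).2.2)
  have hW' : ∀ t ≥ t₂, 0 ≤ x t / z t ∧ W t ≤ W t₂ ∧ ω₀ ≤ W t := fun t ht =>
    hstep t ht fun s hs => hall s hs.1
  have hylow : ∀ t ≥ t₂, ω₀ / Z ^ 2 * (t - t₂) ≤ x t / z t := fun t ht => by
    have := sub_le_of_hasDerivAt_Icc ht (fun r _ => (hasDerivAt_id r).const_mul (ω₀ / Z ^ 2))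
      (fun r hr => hyd r (hzn r hr.1).ne) (fun r hr => by
        have e1 := hzn r hr.1.le
        rw [mul_one]
        have e2 := e1.ne
        refine div_le_div₀ (hall r hr.1.le).le (hW' r hr.1.le).2.2 (by positivity) ?_
        nlinarith [hzZ r])
    rw [hx2] at this
    simp only [id, zero_div, sub_zero] at this
    linarith
  have hyup : ∀ t ≥ t₂, x t / z t ≤ W t₂ / z t₂ ^ 2 * (t - t₂) := fun t ht => by
    have := sub_le_of_hasDerivAt_Icc ht (fun r hr => hyd r (hzn r hr.1).ne)
      (fun r _ => (hasDerivAt_id r).const_mul (W t₂ / z t₂ ^ 2)) (fun r hr => by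
        have e1 := hzanti.antitone hr.1.le
        rw [mul_one]
        have e2 := hz2.ne
        refine div_le_div₀ hW2.le (hW' r hr.1.le).2.1 (by positivity) ?_
        nlinarith)
    rw [hx2] at this
    simp only [id, zero_div, sub_zero] at this
    linarith
  have hz2' := hz2.ne
  -- One unit of time after its zero, `x / z` is strictly positive, so `x` is strictly negative from
  -- then on.
  refine ⟨t₂ + 1, ω₀ / Z, Z * (W t₂ / z t₂ ^ 2), by positivity, by positivity, ?_,
    fun t ht => ?_⟩
  · have := hzn (t₂ + 1) (by linarith)
    simp only [hz] at this
    linarith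
  have htt : t₂ ≤ t := by linarith
  have hzt := hzn t htt
  have hy1 := hylow t htt
  have hy2 := hyup t htt
  have hxy : x t = z t * (x t / z t) := (mul_div_cancel₀ _ hzt.ne).symm
  have hy0 : 0 < x t / z t := by
    have : 0 < ω₀ / Z ^ 2 * (t - t₂) := mul_pos (by positivity) (by linarith)
    linarith
  have hxt : x t < 0 := by rw [hxy]; exact mul_neg_of_neg_of_pos hzt hy0
  refine ⟨hxt, ?_, ?_⟩
  · have e1 := (hW' t htt).2.2
    have e2 : 0 ≤ -((w t - w t * Real.exp (u t)) * x t) := by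
      have : 0 ≤ w t * (1 - Real.exp (u t)) := mul_nonneg (hw0 t).le (by linarith [hu1 t])
      nlinarith
    have e3 : ω₀ ≤ z t * p t := by
      have : W t = z t * p t + (w t - w t * Real.exp (u t)) * x t := rfl
      linarith
    have e4 : p t < 0 := by
      by_contra! hc
      nlinarith
    rw [le_neg, div_le_iff₀ hZ0]
    nlinarith [hzZ t]
  · have e5 : t - (t₂ + 1) + 1 = t - t₂ := by ring
    rw [e5, hxy]
    set y := x t / z t
    nlinarith [hzZ t]

end Linearization

/-! ### Strict monotonicity of the final slope. -/

section Uniqueness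

/-- By convexity the remainder lies between zero and `(e^s - e^t) (s - t)`. -/
theorem abs_exp_taylor_le {s t : ℝ} (hs : s ≤ 0) (ht : t ≤ 0) :
    |Real.exp s - Real.exp t - Real.exp t * (s - t)| ≤ (s - t) ^ 2 := by
  have key : ∀ {a b : ℝ}, Real.exp b * (a - b) ≤ Real.exp a - Real.exp b := fun {a b} => by
    have h1 := Real.add_one_le_exp (a - b)
    have h2 : Real.exp a = Real.exp (a - b) * Real.exp b := by rw [← Real.exp_add]; simp
    nlinarith [Real.exp_pos b]
  have h1 := @key s t
  have h2 := @key t s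
  have h3 := abs_cap_sub_le s t
  rw [cap_of_nonpos hs, cap_of_nonpos ht] at h3
  rw [abs_of_nonneg (by linarith)]
  have h4 : (Real.exp s - Real.exp t) * (s - t) ≤ |s - t| * |s - t| := by
    refine (le_abs_self _).trans ?_
    rw [abs_mul]
    gcongr
  rw [abs_mul_abs_self] at h4
  nlinarith

theorem abs_csh_taylor_le {s t : ℝ} (hs : s ≤ 0) (ht : t ≤ 0) :
    |cap s * (1 - cap s) - cap t * (1 - cap t) - cap t * (1 - 2 * cap t) * (s - t)|
      ≤ 5 * (s - t) ^ 2 := by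
  rw [cap_of_nonpos hs, cap_of_nonpos ht]
  have h1 := abs_exp_taylor_le hs ht
  have h2 := abs_exp_taylor_le (show 2 * s ≤ 0 by linarith) (show 2 * t ≤ 0 by linarith)
  have h3 : ∀ a : ℝ, Real.exp (2 * a) = Real.exp a * Real.exp a := fun a => by
    rw [← Real.exp_add]; ring_nf
  rw [h3, h3] at h2
  have h4 : Real.exp s * (1 - Real.exp s) - Real.exp t * (1 - Real.exp t)
      - Real.exp t * (1 - 2 * Real.exp t) * (s - t)
      = (Real.exp s - Real.exp t - Real.exp t * (s - t))
        - (Real.exp s * Real.exp s - Real.exp t * Real.exp t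
          - Real.exp t * Real.exp t * (2 * s - 2 * t)) := by ring
  rw [h4]
  refine (abs_sub _ _).trans ?_
  nlinarith

/-- The coefficient `e^M` is small when both solutions are low. In the tail it makes the equation
for the difference of two solutions nearly `d'' = 0`. -/
theorem abs_csh_sub_le {s t M : ℝ} (hs : s ≤ 0) (ht : t ≤ 0) (hsM : s ≤ M) (htM : t ≤ M) :
    |cap s * (1 - cap s) - cap t * (1 - cap t)| ≤ Real.exp M * |s - t| := by
  wlog h : s ≤ t generalizing s t
  · rw [abs_sub_comm, abs_sub_comm s]; exact this ht hs htM hsM (le_of_not_ge h)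
  have h1 := cap_sub_le h
  have h2 := cap_mono h
  have h3 : cap t ≤ Real.exp M := (cap_le_exp t).trans (Real.exp_le_exp.2 htM)
  have e : cap s * (1 - cap s) - cap t * (1 - cap t)
      = -((cap t - cap s) * (1 - cap s - cap t)) := by ring
  have h4 : |1 - cap s - cap t| ≤ 1 := by
    rw [abs_le]
    constructor <;> linarith [cap_pos s, cap_pos t, cap_le_one s, cap_le_one t]
  rw [e, abs_neg, abs_mul, abs_of_nonneg (sub_nonneg.2 h2), abs_sub_comm s,
    abs_of_nonneg (sub_nonneg.2 h)]
  calc (cap t - cap s) * |1 - cap s - cap t| ≤ (cap t - cap s) * 1 :=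
        mul_le_mul_of_nonneg_left h4 (by linarith)
    _ ≤ cap t * (t - s) := by linarith
    _ ≤ _ := mul_le_mul_of_nonneg_right h3 (by linarith)

/-- A function whose second derivative is controlled by an exponentially small multiple of
itself keeps a negative slope. -/
theorem deriv_le_of_small_tail {d p g : ℝ → ℝ} {T η K D m M : ℝ} (hη : 0 < η) (hK : 0 ≤ K)
    (hm : 0 < m) (hd : ∀ t, HasDerivAt d (p t) t) (hp : ∀ t, HasDerivAt p (g t) t)
    (hg : ∀ t ≥ T, |g t| ≤ K * Real.exp (-η * (t - T)) * |d t|) (hD : |d T| ≤ D)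
    (hpm : p T ≤ -m) (hpM : |p T| ≤ M)
    (hsmall : K * (D / η + 2 * M / η ^ 2) < m / 2) : ∀ t ≥ T, p t ≤ -(m / 2) := by
  have hpc : Continuous p := continuous_iff_continuousAt.2 fun t => (hp t).continuousAt
  have hmM : m ≤ M := by rw [abs_le] at hpM; linarith [hpM.1]
  have hD0 : 0 ≤ D := (abs_nonneg _).trans hD
  have hM0 : 0 < M := by linarith
  -- A primitive of the bound for `|g|` under the provisional hypothesis `|p| ≤ 2 M`, that is, `|d|
  -- ≤ D + 2 M (t - T)`. Its total increase is `K (D / η + 2 M / η²)`, the quantity assumed to be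
  -- small.
  have hB : ∀ t, HasDerivAt (fun t => -(K * Real.exp (-η * (t - T)) *
      (D / η + 2 * M * ((t - T) / η + 1 / η ^ 2))))
      (K * Real.exp (-η * (t - T)) * (D + 2 * M * (t - T))) t := fun t => by
    have h1 := (((hasDerivAt_id t).sub_const T).const_mul (-η)).exp.const_mul K
    have h2 := ((((hasDerivAt_id t).sub_const T).div_const η).add_const (1 / η ^ 2)).const_mul
      (2 * M) |>.const_add (D / η)
    refine (h1.fun_mul h2).fun_neg.congr_deriv ?_
    simp only [id]
    field_simp
    ring
  have hall := forall_ge_of_isOpen (Q := fun t => |p t - p T| < m / 2) (a := T)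
    (isOpen_lt (by fun_prop) continuous_const) (fun t ht hs => by
      have hpb : ∀ s ∈ Ico T t, |p s| ≤ 2 * M := fun s hs' => by
        have := hs s hs'
        rw [abs_lt] at this
        rw [abs_le] at hpM ⊢
        constructor <;> linarith [hpM.1, hpM.2, this.1, this.2]
      have hdb : ∀ s ∈ Ico T t, |d s| ≤ D + 2 * M * (s - T) := fun s hs' => by
        have := norm_sub_le_of_hasDerivAt hs'.1 hd (fun r => (hasDerivAt_id r).const_mul (2 * M))
          (fun r hr => by
            rw [mul_one]; exact hpb r ⟨hr.1, hr.2.trans hs'.2⟩)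
        simp only [id, Real.norm_eq_abs] at this
        have h1 := abs_sub_abs_le_abs_sub (d s) (d T)
        linarith
      have := norm_sub_le_of_hasDerivAt ht hp hB (fun r hr => by
        refine (hg r hr.1).trans ?_
        have := hdb r hr
        gcongr)
      rw [Real.norm_eq_abs] at this
      refine lt_of_le_of_lt this (lt_of_le_of_lt ?_ hsmall)
      have hpos : 0 ≤ K * Real.exp (-η * (t - T)) *
          (D / η + 2 * M * ((t - T) / η + 1 / η ^ 2)) := by
        have : 0 ≤ t - T := sub_nonneg.2 ht
        positivity
      simp only [sub_self, mul_zero, Real.exp_zero, mul_one, zero_div, zero_add]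
      have e : 2 * M * (1 / η ^ 2) = 2 * M / η ^ 2 := by ring
      rw [e]
      linarith)
  intro t ht
  have := hall t ht
  rw [abs_lt] at this
  linarith [this.2]

variable {N : ℕ} {c : ℝ}

/-- Difference quotients in the shooting parameter converge to the linearization. -/
theorem Good.tendsto_difference_quotient (h : Good N c) {x p : ℝ → ℝ}
    (hx : IsSol (fun t => -(cap (shootU N c t) * (1 - 2 * cap (shootU N c t)) * x t)) 1 x p)
    (T : ℝ) :
    Tendsto (fun b => (b - c)⁻¹ * (shootU N b T - shootU N c T)) (𝓝[>] c) (𝓝 (x T)) ∧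
    Tendsto (fun b => (b - c)⁻¹ * (shootD N b T - shootD N c T)) (𝓝[>] c) (𝓝 (p T)) := by
  obtain ⟨C, hC0, hC⟩ := exists_shoot_lipschitz N T
  set K := (2 * weight 1 T + 2 * Real.exp (2 * T) * weight 1 T) * (5 * C ^ 2) with hK
  have hw := weight_pos 1 T
  have key : ∀ᶠ b in 𝓝[>] c,
      ‖(b - c)⁻¹ * (shootU N b T - shootU N c T) - x T‖ ≤ K * (b - c) ∧
      ‖(b - c)⁻¹ * (shootD N b T - shootD N c T) - p T‖ ≤ K * (b - c) := by
    filter_upwards [nhdsWithin_le_nhds ((isOpen_good N).mem_nhds h), self_mem_nhdsWithin]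
      with b hb hbc
    have hb' : Good N b := hb
    have hbc0 : 0 < b - c := sub_pos.2 hbc
    -- The difference quotient solves the linearized problem up to the quadratic Taylor remainder
    -- divided by `b - c`, an error of order `b - c`.
    have hs := ((isSol_shoot N b).sub (isSol_shoot N c)).const_smul (b - c)⁻¹
    have := IsSol.norm_sub_le hs hx (T := T) (t := T) (L := 1) (d := 0)
      (e := 5 * C ^ 2 * (b - c)) le_rfl le_rfl (by positivity)
      (by rw [smul_eq_mul, inv_mul_cancel₀ hbc0.ne']; simp)
      (fun t ht => by
        have e1 := abs_csh_taylor_le (hb'.shootU_neg t).le (h.shootU_neg t).le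
        set F := cap (shootU N b t) * (1 - cap (shootU N b t))
          - cap (shootU N c t) * (1 - cap (shootU N c t)) with hF
        set G := cap (shootU N c t) * (1 - 2 * cap (shootU N c t)) with hG
        have e2 := (hC b c t ht).1
        rw [abs_of_pos hbc0] at e2
        have e3 : shootX N b t - shootX N c t = shootU N b t - shootU N c t := by
          unfold shootU; ring
        have e4 : (shootU N b t - shootU N c t) ^ 2 ≤ (C * (b - c)) ^ 2 := sq_le_sq.2
          (by rwa [abs_of_pos (mul_pos hC0 hbc0)])
        have e5 : |G| ≤ 1 := by
          have h1 := cap_pos (shootU N c t)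
          have h2 := cap_le_one (shootU N c t)
          rw [hG, abs_le]
          constructor <;> nlinarith
        simp only [smul_eq_mul]
        rw [e3]
        set v := shootU N b t - shootU N c t
        have e6 : (b - c)⁻¹ * (-(cap (shootU N b t) * (1 - cap (shootU N b t)))
            - -(cap (shootU N c t) * (1 - cap (shootU N c t)))) - -(G * x t)
            = -((b - c)⁻¹ * (F - G * v)) - G * ((b - c)⁻¹ * v - x t) := by
          rw [hF]; ring
        rw [e6]
        refine (norm_sub_le _ _).trans ?_
        rw [norm_neg, norm_mul, norm_mul, norm_inv, Real.norm_eq_abs, Real.norm_eq_abs,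
          Real.norm_eq_abs, Real.norm_eq_abs, abs_of_pos hbc0]
        have e7 : (b - c)⁻¹ * |F - G * v| ≤ 5 * C ^ 2 * (b - c) := by
          rw [inv_mul_le_iff₀ hbc0]
          nlinarith
        have e8 : |G| * |(b - c)⁻¹ * v - x t| ≤ 1 * |(b - c)⁻¹ * v - x t| :=
          mul_le_mul_of_nonneg_right e5 (abs_nonneg _)
        linarith)
      le_rfl
    simp only [smul_eq_mul, zero_add, mul_one] at this
    have e3 : shootX N b T - shootX N c T = shootU N b T - shootU N c T := by
      unfold shootU; ring
    have e4 : shootP N b T - shootP N c T = shootD N b T - shootD N c T := by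
      unfold shootD; ring
    rw [e3, e4] at this
    have e5 : 0 ≤ 5 * C ^ 2 * (b - c) := by positivity
    constructor
    · refine this.1.trans ?_
      have : 0 ≤ 2 * Real.exp (2 * T) * weight 1 T * (5 * C ^ 2 * (b - c)) := by positivity
      rw [hK]; linarith
    · refine this.2.trans ?_
      have : 0 ≤ 2 * weight 1 T * (5 * C ^ 2 * (b - c)) := by positivity
      rw [hK]; linarith
  have hlim : Tendsto (fun b => K * (b - c)) (𝓝[>] c) (𝓝 0) := by
    have : Continuous fun b => K * (b - c) := by fun_prop
    have := (this.tendsto c).mono_left (nhdsWithin_le_nhds (s := Ioi c))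
    simpa using this
  constructor
  · rw [tendsto_iff_norm_sub_tendsto_zero]
    exact squeeze_zero' (.of_forall fun _ => norm_nonneg _) (key.mono fun _ hb => hb.1) hlim
  · rw [tendsto_iff_norm_sub_tendsto_zero]
    exact squeeze_zero' (.of_forall fun _ => norm_nonneg _) (key.mono fun _ hb => hb.2) hlim

/-- The slope at infinity decreases strictly to the right of every good parameter. -/
theorem Good.eventually_ell_lt (h : Good N c) : ∀ᶠ b in 𝓝[>] c, ell N b < ell N c := by
  obtain ⟨x, p, hx⟩ := exists_isSol_linearized N c
  obtain ⟨T₂, ω, C, hω, hC, hT₂, hlin⟩ := h.linearized hx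
  set η := (-2 - shootD N c T₂) / 2 with hη
  have hη0 : 0 < η := by linarith
  -- choose the time after which the equation is negligible
  obtain ⟨T, hTT, hsm⟩ : ∃ T ≥ T₂, Real.exp (shootU N c T + 2 * T + 1) *
      (2 * (C * (T - T₂ + 1)) / (η * ω) + 4 / η ^ 2) < 1 / 4 := by
    set A := Real.exp (shootU N c T₂ + 2 * T₂ + 1) with hA
    have hA0 : 0 < A := Real.exp_pos _
    have hlim : Tendsto (fun y : ℝ => A * (2 * C / (η * ω) * (y * Real.exp (-(η * 2) * y))
        + (2 * C / (η * ω) + 4 / η ^ 2) * Real.exp (-(η * 2) * y))) atTop (𝓝 0) := by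
      have h1 : Tendsto (fun y : ℝ => Real.exp (-(η * 2) * y)) atTop (𝓝 0) :=
        Real.tendsto_exp_atBot.comp (tendsto_id.const_mul_atTop_of_neg (by linarith))
      have h2 : Tendsto (fun y : ℝ => y * Real.exp (-(η * 2) * y)) atTop (𝓝 0) := by
        have := Real.tendsto_pow_mul_exp_neg_atTop_nhds_zero 1
        have h3 := (this.comp (tendsto_id.const_mul_atTop (show 0 < η * 2 by linarith))).const_mul
          (η * 2)⁻¹
        rw [mul_zero] at h3
        refine h3.congr fun y => ?_
        simp only [Function.comp, id, pow_one]
        field_simp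
      have := ((h2.const_mul (2 * C / (η * ω))).add
        (h1.const_mul (2 * C / (η * ω) + 4 / η ^ 2))).const_mul A
      simpa using this
    obtain ⟨y, hy, hy0⟩ := ((hlim.eventually_lt_const (show (0 : ℝ) < 1 / 4 by norm_num)).and
      (eventually_ge_atTop 0)).exists
    refine ⟨T₂ + y, by linarith, lt_of_le_of_lt ?_ hy⟩
    have h1 := (h.shootD_tail (T := T₂) (η := η * 2) (by linarith) (by rw [hη]; linarith)
      (show T₂ ≤ T₂ + y by linarith)).2.2
    have h2 : Real.exp (shootU N c (T₂ + y) + 2 * (T₂ + y) + 1) ≤ A * Real.exp (-(η * 2) * y) := by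
      rw [hA, ← Real.exp_add, Real.exp_le_exp]
      linarith
    have e1 : T₂ + y - T₂ + 1 = y + 1 := by ring
    rw [e1]
    calc _ ≤ A * Real.exp (-(η * 2) * y) * (2 * (C * (y + 1)) / (η * ω) + 4 / η ^ 2) := by
          gcongr
      _ = _ := by ring
  have hDT : shootD N c T < -2 - η := by
    have := antitone_shootD N c hTT
    linarith
  obtain ⟨hxT, hpT, hxC⟩ := hlin T hTT
  obtain ⟨hq1, hq2⟩ := h.tendsto_difference_quotient hx T
  filter_upwards [self_mem_nhdsWithin, nhdsWithin_le_nhds ((isOpen_good N).mem_nhds h),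
    nhdsWithin_le_nhds ((tendsto_shootD_param N c T).eventually_lt_const hDT),
    nhdsWithin_le_nhds ((tendsto_shootU_param N c T).eventually_lt_const (lt_add_one _)),
    hq1.eventually_const_lt (show 2 * x T < x T by linarith),
    hq1.eventually_lt_const hxT,
    hq2.eventually_const_lt (show 2 * p T < p T by linarith),
    hq2.eventually_lt_const (show p T < p T / 2 by linarith)] with b hbc hb h1 h2 h3 h4 h5 h6
  have hb' : Good N b := hb
  have hbc0 : 0 < b - c := sub_pos.2 hbc
  have hinv : 0 < (b - c)⁻¹ := inv_pos.2 hbc0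
  -- At time `T` the difference quotient is close to the linearization. Afterwards its second
  -- derivative is exponentially small, and its slope stays below `p T / 4 < 0`.
  have htail := deriv_le_of_small_tail
    (d := fun t => (b - c)⁻¹ * (shootU N b t - shootU N c t))
    (p := fun t => (b - c)⁻¹ * (shootD N b t - shootD N c t)) (T := T) (η := η)
    (K := Real.exp (shootU N c T + 2 * T + 1)) (D := 2 * (C * (T - T₂ + 1)))
    (m := -p T / 2) (M := -2 * p T) hη0 (Real.exp_pos _).le (by linarith)
    (fun t => ((hasDerivAt_shootU N b t).fun_sub (hasDerivAt_shootU N c t)).const_mul _)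
    (fun t => ((ChernSimons.hasDerivAt_shootD N b t).fun_sub
      (ChernSimons.hasDerivAt_shootD N c t)).const_mul _)
    (fun t ht => by
      have e1 := (h.shootD_tail hη0 hDT.le ht).2.2
      have e2 := (hb'.shootD_tail hη0 h1.le ht).2.2
      set M := shootU N c T + 2 * T + 1 - η * (t - T) - 2 * t with hM
      have e3 := abs_csh_sub_le (M := M) (hb'.shootU_neg t).le (h.shootU_neg t).le
        (by linarith) (by linarith)
      have e4 : Real.exp (2 * t) * Real.exp M
          = Real.exp (shootU N c T + 2 * T + 1) * Real.exp (-η * (t - T)) := by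
        rw [← Real.exp_add, ← Real.exp_add, hM]; ring_nf
      set F₁ := cap (shootU N b t) * (1 - cap (shootU N b t))
      set F₂ := cap (shootU N c t) * (1 - cap (shootU N c t))
      have e5 : (b - c)⁻¹ * (-(Real.exp (2 * t) * F₁) - -(Real.exp (2 * t) * F₂))
          = -((b - c)⁻¹ * (Real.exp (2 * t) * (F₁ - F₂))) := by ring
      rw [e5, abs_neg, abs_mul, abs_mul, abs_mul, abs_of_pos hinv,
        abs_of_pos (Real.exp_pos (2 * t)), ← e4]
      calc (b - c)⁻¹ * (Real.exp (2 * t) * |F₁ - F₂|)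
          ≤ (b - c)⁻¹ * (Real.exp (2 * t) * (Real.exp M * |shootU N b t - shootU N c t|)) := by
            gcongr
        _ = _ := by ring)
    (by rw [abs_le]; constructor <;> linarith)
    (by linarith)
    (by rw [abs_le]; constructor <;> linarith)
    (by
      have hω' : 0 < -p T := by linarith
      have e1 : 2 * (C * (T - T₂ + 1)) / η ≤ -p T * (2 * (C * (T - T₂ + 1)) / (η * ω)) := by
        have : 0 ≤ T - T₂ := sub_nonneg.2 hTT
        have e2 : 2 * (C * (T - T₂ + 1)) / η = ω * (2 * (C * (T - T₂ + 1)) / (η * ω)) := by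
          field_simp
        rw [e2]
        gcongr
        linarith
      have e3 : 2 * (-2 * p T) / η ^ 2 = -p T * (4 / η ^ 2) := by ring
      rw [e3]
      have e4 := Real.exp_pos (shootU N c T + 2 * T + 1)
      nlinarith [mul_le_mul_of_nonneg_left e1 e4.le, mul_lt_mul_of_pos_left hsm hω'])
  have hlim := (hb'.tendsto_shootD.sub h.tendsto_shootD).const_mul (b - c)⁻¹
  have hle : (b - c)⁻¹ * (ell N b - ell N c) ≤ -(-p T / 2 / 2) :=
    le_of_tendsto hlim (by filter_upwards [eventually_ge_atTop T] with t ht using htail t ht)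
  by_contra! hc
  have : 0 ≤ (b - c)⁻¹ * (ell N b - ell N c) := mul_nonneg hinv.le (by linarith)
  linarith

/-- A continuous function that takes smaller values arbitrarily close to the right of each point
attains its minimum over a compact interval only at the right end. -/
theorem ell_lt_of_forall_good {a b : ℝ} (hab : a < b) (h : ∀ c ∈ Icc a b, Good N c) :
    ell N b < ell N a := by
  have hc : ContinuousOn (ell N) (Icc a b) := fun c hc =>
    (h c hc).continuousAt_ell.continuousWithinAt
  obtain ⟨m, hm, hmin⟩ := isCompact_Icc.exists_isMinOn (nonempty_Icc.2 hab.le) hc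
  have hright : ∀ c ∈ Ico a b, ell N m < ell N c := fun c hc' => by
    have h1 := (h c (Ico_subset_Icc_self hc')).eventually_ell_lt
    obtain ⟨d, hd1, hd2⟩ := (h1.and (Ioo_mem_nhdsGT hc'.2)).exists
    exact lt_of_le_of_lt (hmin ⟨hc'.1.trans hd2.1.le, hd2.2.le⟩) hd1
  have hmb : m = b := by
    by_contra hne
    exact lt_irrefl _ (hright m ⟨hm.1, lt_of_le_of_ne hm.2 hne⟩)
  rw [← hmb]
  exact hright a ⟨le_rfl, hab⟩

/-- If bad parameters lie in between, let `a` be the last of them. Just to the right of `a` the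
slope is already below `ell N b`, since it blows down there, and yet it must decrease strictly up to
`b`. -/
theorem Good.ell_ne_of_lt {b : ℝ} (_h : Good N c) (hb : Good N b) (hcb : c < b) :
    ell N c ≠ ell N b := by
  intro heq
  by_cases hall : ∀ d ∈ Icc c b, Good N d
  · exact (ell_lt_of_forall_good hcb hall).ne' heq
  push Not at hall
  obtain ⟨d, hd, hdG⟩ := hall
  set S := Icc c b ∩ {c | Good N c}ᶜ
  have hS : IsCompact S := isCompact_Icc.inter_right (isOpen_good N).isClosed_compl
  obtain ⟨⟨h1, h2⟩, h3⟩ := hS.sSup_mem ⟨d, hd, hdG⟩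
  set a := sSup S with ha
  have hab : a < b := lt_of_le_of_ne h2 fun h0 => h3 (by rw [h0]; exact hb)
  have hgood : ∀ e, a < e → e ≤ b → Good N e := fun e hae heb => by
    by_contra hc
    exact absurd (le_csSup hS.bddAbove ⟨⟨h1.trans hae.le, heb⟩, hc⟩) (not_le.2 hae)
  have hblow := eventually_ell_lt_of_not_good h3 (K := -ell N b)
    (by linarith [hb.ell_lt])
  have h4 : ∀ᶠ e in 𝓝[>] a, e ∈ Ioo a b := Ioo_mem_nhdsGT hab
  obtain ⟨e, he1, he2⟩ := ((hblow.filter_mono nhdsWithin_le_nhds).and h4).exists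
  have h5 := he1 (hgood e he2.1 he2.2.le)
  have h6 := ell_lt_of_forall_good he2.2 fun f hf => hgood f (he2.1.trans_le hf.1) hf.2
  linarith

theorem ell_injective {b : ℝ} (h : Good N c) (hb : Good N b) (heq : ell N c = ell N b) :
    c = b := by
  rcases lt_trichotomy c b with h1 | h1 | h1
  · exact absurd heq (h.ell_ne_of_lt hb h1)
  · exact h1
  · exact absurd heq.symm (hb.ell_ne_of_lt h h1)

/-- Every slope below the Liouville value is attained. -/
theorem exists_good_ell_eq (N : ℕ) {l : ℝ} (hl : l < -2 * (N + 2)) :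
    ∃ c, Good N c ∧ ell N c = l := by
  obtain ⟨c₁, h1⟩ := exists_lt_ell N hl
  set a := min c₁ 0 with ha
  obtain ⟨haG, hal⟩ := h1 a (min_le_left _ _)
  have ha1 : a ≤ 1 := (min_le_right _ _).trans zero_le_one
  -- From `a`, where the slope exceeds `l`, up to the first bad parameter all parameters are good
  -- and the slope falls to `-∞`, so it passes through `l`.
  set S := Icc a 1 ∩ {c | Good N c}ᶜ
  have hS : IsCompact S := isCompact_Icc.inter_right (isOpen_good N).isClosed_compl
  obtain ⟨⟨h2, h3⟩, h4⟩ := hS.sInf_mem ⟨1, ⟨ha1, le_rfl⟩, not_good_of_one_le le_rfl⟩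
  set b := sInf S with hb
  have hab : a < b := lt_of_le_of_ne h2 fun h0 => h4 (by rw [← h0]; exact haG)
  have hgood : ∀ e, a ≤ e → e < b → Good N e := fun e hae heb => by
    by_contra hc
    exact absurd (csInf_le hS.bddBelow ⟨⟨hae, heb.le.trans h3⟩, hc⟩) (not_le.2 heb)
  have hN : (0 : ℝ) ≤ N := Nat.cast_nonneg N
  have hblow := eventually_ell_lt_of_not_good h4 (K := -l) (by linarith)
  have h5 : ∀ᶠ e in 𝓝[<] b, e ∈ Ioo a b := Ioo_mem_nhdsLT hab
  obtain ⟨e, he1, he2⟩ := ((hblow.filter_mono nhdsWithin_le_nhds).and h5).exists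
  have h6 := he1 (hgood e he2.1.le he2.2)
  have hcont : ContinuousOn (ell N) (Icc a e) := fun c hc =>
    (hgood c hc.1 (hc.2.trans_lt he2.2)).continuousAt_ell.continuousWithinAt
  obtain ⟨c, hc, hcl⟩ := intermediate_value_Icc' he2.1.le hcont
    (show l ∈ Icc (ell N e) (ell N a) from ⟨by linarith, hal.le⟩)
  exact ⟨c, hgood c hc.1 (hc.2.trans_lt he2.2), hcl⟩

end Uniqueness

/-! ### Radial functions on a Euclidean space and their `C²` regularity. -/

section RadialPlane

section

variable {V : Type*} [NormedAddCommGroup V]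

theorem exp_two_mul_log_norm {y : V} (hy : y ≠ 0) :
    Real.exp (2 * Real.log ‖y‖) = ‖y‖ ^ 2 := by
  rw [mul_comm, Real.exp_mul, Real.exp_log (norm_pos_iff.2 hy)]
  norm_num

theorem tendsto_log_norm : Tendsto (fun y : V => Real.log ‖y‖) (𝓝[≠] 0) atBot := by
  refine Real.tendsto_log_nhdsGT_zero.comp ?_
  exact tendsto_norm_nhdsNE_zero

open Classical in
/-- The extension of `x (log ‖y‖)` to the origin by the value `x₀`. -/
def radialExt (x₀ : ℝ) (x : ℝ → ℝ) : V → ℝ := fun y =>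
  if y = 0 then x₀ else x (Real.log ‖y‖)

theorem radialExt_of_ne {x₀ : ℝ} {x : ℝ → ℝ} {y : V} (hy : y ≠ 0) :
    radialExt x₀ x y = x (Real.log ‖y‖) := if_neg hy

@[simp]
theorem radialExt_zero {x₀ : ℝ} {x : ℝ → ℝ} : radialExt x₀ x (0 : V) = x₀ := if_pos rfl

end

variable {V : Type*} [NormedAddCommGroup V] [InnerProductSpace ℝ V] [FiniteDimensional ℝ V]

variable (V) in
/-- The duality map of a Euclidean space. -/
def dualMap : V →L[ℝ] V →L[ℝ] ℝ :=
  LinearMap.toContinuousLinearMap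
    { toFun := fun y => innerSL ℝ y
      map_add' := fun y z => by simp
      map_smul' := fun c y => by simp }

@[simp]
theorem dualMap_apply (y z : V) : dualMap V y z = inner ℝ y z := by
  simp [dualMap]

theorem norm_dualMap_apply (y : V) : ‖dualMap V y‖ = ‖y‖ := by
  have : dualMap V y = innerSL ℝ y := by simp [dualMap]
  rw [this, innerSL_apply_norm]

theorem hasFDerivAt_comp_log_norm {F : ℝ → ℝ} {F' : ℝ} {y : V} (hy : y ≠ 0)
    (hF : HasDerivAt F F' (Real.log ‖y‖)) :
    HasFDerivAt (fun y : V => F (Real.log ‖y‖)) ((F' / ‖y‖ ^ 2) • dualMap V y) y := by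
  have hy0 : ‖y‖ ≠ 0 := norm_ne_zero_iff.2 hy
  have h1 := (hasStrictFDerivAt_norm_sq y).hasFDerivAt.log (pow_ne_zero 2 hy0)
  have h2 := h1.const_mul (1 / 2 : ℝ)
  have h3 : (fun y : V => (1 / 2 : ℝ) * Real.log (‖y‖ ^ 2)) = fun y => Real.log ‖y‖ := by
    funext z
    rw [Real.log_pow]; push_cast; ring
  rw [h3] at h2
  refine (hF.comp_hasFDerivAt y h2).congr_fderiv ?_
  ext v
  simp
  field_simp

theorem continuous_radialExt {x₀ : ℝ} {x : ℝ → ℝ} (hx : Continuous x)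
    (h : Tendsto x atBot (𝓝 x₀)) : Continuous (radialExt x₀ x : V → ℝ) := by
  rw [continuous_iff_continuousAt]
  intro y
  by_cases hy : y = 0
  · subst hy
    rw [continuousAt_iff_punctured_nhds, radialExt_zero]
    refine (h.comp tendsto_log_norm).congr' ?_
    filter_upwards [self_mem_nhdsWithin] with z hz
    exact (radialExt_of_ne hz).symm
  · have h1 : ContinuousAt (fun y : V => x (Real.log ‖y‖)) y :=
      hx.continuousAt.comp (continuousAt_id.norm.log (norm_ne_zero_iff.2 hy))
    refine h1.congr ?_
    filter_upwards [isOpen_ne.mem_nhds hy] with z hz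
    exact (radialExt_of_ne hz).symm

theorem IsSol.abs_le {g : ℝ → ℝ} {x₀ : ℝ} {x p : ℝ → ℝ} (h : IsSol g x₀ x p) {K T : ℝ}
    (hK : ∀ t ≤ T, |g t| ≤ K) {t : ℝ} (ht : t ≤ T) :
    |p t| ≤ K / 2 * Real.exp (2 * t) ∧ |x t - x₀| ≤ K / 4 * Real.exp (2 * t) := by
  have hp : ∀ t ≤ T, |p t| ≤ K / 2 * Real.exp (2 * t) := fun t ht => by
    have := norm_sub_lim_le_of_hasDerivAt (t := t) h.hasDerivAt_snd
      (fun r => (hasDerivAt_exp_two_mul r).const_mul (K / 2)) (fun r hr => by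
        rw [norm_smul, Real.norm_of_nonneg (Real.exp_pos _).le, Real.norm_eq_abs]
        have := hK r (hr.le.trans ht)
        nlinarith [Real.exp_pos (2 * r)]) h.lim_snd (tendsto_exp_two_mul_atBot.const_mul (K / 2))
    simpa using this
  refine ⟨hp t ht, ?_⟩
  have := norm_sub_lim_le_of_hasDerivAt (t := t) h.hasDerivAt_fst
    (fun r => (hasDerivAt_exp_two_mul r).const_mul (K / 4)) (fun r hr => by
      rw [Real.norm_eq_abs]
      have := hp r (hr.le.trans ht)
      linarith) h.lim_fst (tendsto_exp_two_mul_atBot.const_mul (K / 4))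
  simpa using this

/-- `p e^{-2t}` is `u'(r) / r`, which is half of the mean of `g` over the disc of radius `r`. -/
theorem IsSol.tendsto_snd_mul_exp {g : ℝ → ℝ} {x₀ g₀ : ℝ} {x p : ℝ → ℝ} (h : IsSol g x₀ x p)
    (hg : Tendsto g atBot (𝓝 g₀)) :
    Tendsto (fun t => p t * Real.exp (-(2 * t))) atBot (𝓝 (g₀ / 2)) := by
  rw [Metric.tendsto_nhds]
  intro ε hε
  obtain ⟨a, ha⟩ := eventually_atBot.1 (Metric.tendsto_nhds.1 hg ε hε)
  filter_upwards [eventually_le_atBot a] with t ht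
  have := norm_sub_lim_le_of_hasDerivAt (t := t)
    (fun r => (h.hasDerivAt_snd r).fun_sub ((hasDerivAt_exp_two_mul r).const_mul (g₀ / 2)))
    (fun r => (hasDerivAt_exp_two_mul r).const_mul (ε / 2)) (fun r hr => by
      have h1 := (ha r (hr.le.trans ht)).le
      rw [Real.dist_eq] at h1
      have h2 : Real.exp (2 * r) • g r - g₀ / 2 * (2 * Real.exp (2 * r))
          = Real.exp (2 * r) * (g r - g₀) := by rw [smul_eq_mul]; ring
      rw [h2, norm_mul, Real.norm_of_nonneg (Real.exp_pos _).le, Real.norm_eq_abs]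
      nlinarith [Real.exp_pos (2 * r)]) (h.lim_snd.sub (tendsto_exp_two_mul_atBot.const_mul _))
    (tendsto_exp_two_mul_atBot.const_mul (ε / 2))
  simp only [mul_zero, sub_zero, Real.norm_eq_abs] at this
  have h3 : p t * Real.exp (-(2 * t)) - g₀ / 2
      = (p t - g₀ / 2 * Real.exp (2 * t)) * Real.exp (-(2 * t)) := by
    rw [sub_mul, mul_assoc (g₀ / 2), ← Real.exp_add]; simp
  rw [Real.dist_eq, h3, abs_mul, abs_of_pos (Real.exp_pos _)]
  calc _ ≤ ε / 2 * Real.exp (2 * t) * Real.exp (-(2 * t)) := by gcongr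
    _ = ε / 2 := by rw [mul_assoc, ← Real.exp_add]; simp
    _ < ε := by linarith

/-- The coefficient `u'(r) / r` of the gradient of a radial function. -/
def gradCoeff (g₀ : ℝ) (p : ℝ → ℝ) : V → ℝ :=
  radialExt (g₀ / 2) fun t => p t * Real.exp (-(2 * t))

variable {H : Type*} [NormedAddCommGroup H] [NormedSpace ℝ H]

/-- The derivative of `y ↦ (u'(r) / r) • D y`, which is the Hessian of the radial function `u`
if `D` is the duality map. -/
def radialHess (D : V →L[ℝ] H) (g₀ : ℝ) (g p : ℝ → ℝ) (y : V) : V →L[ℝ] H :=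
  gradCoeff g₀ p y • D +
    (((radialExt g₀ g y - 2 * gradCoeff g₀ p y) / ‖y‖ ^ 2) • dualMap V y).smulRight (D y)

variable {g : ℝ → ℝ} {x₀ g₀ : ℝ} {x p : ℝ → ℝ}

/-- Off the origin this is the chain rule. At the origin `|x - x₀|` is bounded by a multiple of
`‖y‖²`, so the derivative vanishes, and so does the formula. -/
theorem IsSol.hasFDerivAt_radialExt (h : IsSol g x₀ x p) (hg : Tendsto g atBot (𝓝 g₀))
    (y : V) :
    HasFDerivAt (radialExt x₀ x) (gradCoeff g₀ p y • dualMap V y) y := by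
  by_cases hy : y = 0
  · subst hy
    obtain ⟨a, ha⟩ := eventually_atBot.1 ((hg.abs).eventually_lt_const (lt_add_one |g₀|))
    have h1 : (fun y : V => radialExt x₀ x y - x₀) =O[𝓝 0] fun y => ‖y - 0‖ ^ 2 := by
      refine Asymptotics.IsBigO.of_bound ((|g₀| + 1) / 4) ?_
      filter_upwards [Metric.ball_mem_nhds (0 : V) (Real.exp_pos a)] with z hz
      rw [sub_zero, norm_pow, norm_norm, Real.norm_eq_abs]
      by_cases hz0 : z = 0
      · subst hz0; simp
      · rw [radialExt_of_ne hz0, ← exp_two_mul_log_norm hz0]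
        refine (h.abs_le (T := a) (fun t ht => (ha t ht).le) ?_).2
        rw [Real.log_le_iff_le_exp (norm_pos_iff.2 hz0)]
        simpa using (mem_ball_zero_iff.1 hz).le
    have h2 := (h1.hasFDerivAt (𝕜 := ℝ) (by norm_num)).add_const x₀
    simpa using h2
  · have h1 := hasFDerivAt_comp_log_norm hy (h.hasDerivAt_fst (Real.log ‖y‖))
    have h2 : gradCoeff g₀ p y = p (Real.log ‖y‖) / ‖y‖ ^ 2 := by
      rw [gradCoeff, radialExt_of_ne hy, Real.exp_neg, exp_two_mul_log_norm hy, div_eq_mul_inv]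
    rw [h2]
    refine h1.congr_of_eventuallyEq ?_
    filter_upwards [isOpen_ne.mem_nhds hy] with z hz
    exact radialExt_of_ne hz

theorem IsSol.continuous_gradCoeff (h : IsSol g x₀ x p) (hg : Tendsto g atBot (𝓝 g₀)) :
    Continuous (gradCoeff g₀ p : V → ℝ) := by
  have := h.continuous_snd
  exact continuous_radialExt (by fun_prop) (h.tendsto_snd_mul_exp hg)

theorem radialHess_zero (D : V →L[ℝ] H) :
    radialHess D g₀ g p 0 = gradCoeff g₀ p (0 : V) • D := by
  ext v
  simp [radialHess]

theorem IsSol.hasFDerivAt_gradCoeff_smul (h : IsSol g x₀ x p) (hg : Tendsto g atBot (𝓝 g₀))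
    (D : V →L[ℝ] H) (y : V) :
    HasFDerivAt (fun y => gradCoeff g₀ p y • D y) (radialHess D g₀ g p y) y := by
  by_cases hy : y = 0
  · subst hy
    rw [radialHess_zero, hasFDerivAt_iff_isLittleO_nhds_zero]
    have h1 : (fun v : V => gradCoeff g₀ p v - gradCoeff g₀ p (0 : V)) =o[𝓝 0]
        fun _ => (1 : ℝ) := by
      rw [Asymptotics.isLittleO_one_iff]
      have := ((h.continuous_gradCoeff hg).tendsto (0 : V)).sub_const (gradCoeff g₀ p (0 : V))
      rwa [sub_self] at this
    have h2 : (fun v : V => D v) =O[𝓝 0] fun v => v := D.isBigO_id _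
    have h3 := h1.smul_isBigO h2
    simp only [one_smul] at h3
    refine h3.congr_left fun v => ?_
    simp [sub_smul]
  · have h1 : HasDerivAt (fun t => p t * Real.exp (-(2 * t)))
        (g (Real.log ‖y‖) - 2 * (p (Real.log ‖y‖) * Real.exp (-(2 * Real.log ‖y‖))))
        (Real.log ‖y‖) := by
      refine ((h.hasDerivAt_snd _).fun_mul
        ((hasDerivAt_id (Real.log ‖y‖)).const_mul 2).fun_neg.exp).congr_deriv ?_
      simp only [id, smul_eq_mul]
      have : Real.exp (2 * Real.log ‖y‖) * Real.exp (-(2 * Real.log ‖y‖)) = 1 := by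
        rw [← Real.exp_add]; simp
      linear_combination (g (Real.log ‖y‖)) * this
    have h2 := hasFDerivAt_comp_log_norm hy h1
    have h3 : HasFDerivAt (gradCoeff g₀ p)
        (((radialExt g₀ g y - 2 * gradCoeff g₀ p y) / ‖y‖ ^ 2) • dualMap V y) y := by
      rw [radialExt_of_ne hy, gradCoeff, radialExt_of_ne hy]
      refine h2.congr_of_eventuallyEq ?_
      filter_upwards [isOpen_ne.mem_nhds hy] with z hz
      exact radialExt_of_ne hz
    exact h3.smul D.hasFDerivAt

/-- The rank-one part contains `y` twice, which absorbs the denominator `‖y‖²`. The remaining scalar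
tends to `g₀ - 2 (g₀ / 2) = 0` at the origin, and this gives continuity of the Hessian there. -/
theorem norm_radialHess_sub_le {D : V →L[ℝ] H} (hD : ∀ y, ‖D y‖ ≤ ‖y‖) (y : V) :
    ‖radialHess D g₀ g p y - gradCoeff g₀ p y • D‖ ≤
      |radialExt g₀ g y - 2 * gradCoeff g₀ p y| := by
  rw [radialHess, add_sub_cancel_left, ContinuousLinearMap.norm_smulRight_apply, norm_smul,
    norm_dualMap_apply, norm_div, norm_pow, norm_norm, Real.norm_eq_abs]
  by_cases hy : ‖y‖ = 0
  · rw [hy]; simp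
  · have : 0 < ‖y‖ := lt_of_le_of_ne (norm_nonneg _) (Ne.symm hy)
    calc _ ≤ |radialExt g₀ g y - 2 * gradCoeff g₀ p y| / ‖y‖ ^ 2 * ‖y‖ * ‖y‖ := by
          gcongr; exact hD y
      _ = _ := by field_simp

theorem norm_radialHess_le {D : V →L[ℝ] H} (hD : ∀ y, ‖D y‖ ≤ ‖y‖) (y : V) :
    ‖radialHess D g₀ g p y‖ ≤
      |gradCoeff g₀ p y| + |radialExt g₀ g y - 2 * gradCoeff g₀ p y| := by
  have h1 := norm_radialHess_sub_le (g₀ := g₀) (g := g) (p := p) hD y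
  have h2 := norm_sub_norm_le (radialHess D g₀ g p y) (gradCoeff g₀ p y • D)
  have h3 : ‖gradCoeff g₀ p y • D‖ ≤ |gradCoeff g₀ p y| * 1 := by
    rw [norm_smul, Real.norm_eq_abs]
    refine mul_le_mul_of_nonneg_left ?_ (abs_nonneg _)
    exact D.opNorm_le_bound zero_le_one fun y => by rw [one_mul]; exact hD y
  linarith

theorem IsSol.continuous_radialHess (h : IsSol g x₀ x p) (hgc : Continuous g)
    (hg : Tendsto g atBot (𝓝 g₀)) {D : V →L[ℝ] H} (hD : ∀ y, ‖D y‖ ≤ ‖y‖) :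
    Continuous (radialHess D g₀ g p) := by
  have hκ : Continuous (gradCoeff g₀ p : V → ℝ) := h.continuous_gradCoeff hg
  have hG : Continuous (radialExt g₀ g : V → ℝ) := continuous_radialExt hgc hg
  rw [continuous_iff_continuousAt]
  intro y
  by_cases hy : y = 0
  · subst hy
    have h1 : Tendsto (fun y => radialHess D g₀ g p y - gradCoeff g₀ p y • D) (𝓝 0)
        (𝓝 0) := by
      refine squeeze_zero_norm (norm_radialHess_sub_le hD) ?_
      have : Continuous fun y : V => |radialExt g₀ g y - 2 * gradCoeff g₀ p y| := by fun_prop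
      convert this.tendsto 0 using 2
      simp only [gradCoeff, radialExt_zero]
      rw [mul_div_cancel₀ g₀ two_ne_zero, sub_self, abs_zero]
    have h2 := h1.add ((hκ.smul (continuous_const (y := D))).tendsto 0)
    rw [ContinuousAt, radialHess_zero]
    simpa using h2
  · have hy0 : ‖y‖ ^ 2 ≠ 0 := pow_ne_zero 2 (norm_ne_zero_iff.2 hy)
    have h1 : ContinuousAt (fun y : V =>
        (radialExt g₀ g y - 2 * gradCoeff g₀ p y) / ‖y‖ ^ 2) y :=
      ContinuousAt.div (by fun_prop) (by fun_prop) hy0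
    have h2 : ContinuousAt (fun y : V => dualMap V y) y := (dualMap V).continuous.continuousAt
    have h3 : ContinuousAt (fun y : V => (((radialExt g₀ g y - 2 * gradCoeff g₀ p y)
        / ‖y‖ ^ 2) • dualMap V y).smulRight (D y)) y :=
      ((ContinuousLinearMap.smulRightL ℝ V H).continuous₂.continuousAt).comp
        ((h1.smul h2).prodMk D.continuous.continuousAt)
    exact (hκ.continuousAt.smul continuousAt_const).add h3

theorem IsSol.fderiv_radialExt (h : IsSol g x₀ x p) (hg : Tendsto g atBot (𝓝 g₀)) :
    fderiv ℝ (radialExt x₀ x : V → ℝ) = fun y => gradCoeff g₀ p y • dualMap V y :=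
  funext fun y => (h.hasFDerivAt_radialExt hg y).fderiv

theorem IsSol.fderiv_fderiv_radialExt (h : IsSol g x₀ x p) (hg : Tendsto g atBot (𝓝 g₀)) :
    fderiv ℝ (fderiv ℝ (radialExt x₀ x : V → ℝ)) = radialHess (dualMap V) g₀ g p := by
  rw [h.fderiv_radialExt hg]
  exact funext fun y => (h.hasFDerivAt_gradCoeff_smul hg (dualMap V) y).fderiv

theorem IsSol.contDiff_radialExt (h : IsSol g x₀ x p) (hgc : Continuous g)
    (hg : Tendsto g atBot (𝓝 g₀)) : ContDiff ℝ 2 (radialExt x₀ x : V → ℝ) := by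
  rw [show (2 : WithTop ℕ∞) = 1 + 1 by norm_num, contDiff_succ_iff_fderiv]
  refine ⟨fun y => (h.hasFDerivAt_radialExt hg y).differentiableAt, by simp, ?_⟩
  rw [contDiff_one_iff_fderiv, h.fderiv_fderiv_radialExt hg]
  refine ⟨fun y => ?_, h.continuous_radialHess hgc hg fun y => (norm_dualMap_apply y).le⟩
  rw [h.fderiv_radialExt hg]
  exact (h.hasFDerivAt_gradCoeff_smul hg (dualMap V) y).differentiableAt

/-- The radial extension is small in `C²` if the right-hand side is small. -/
theorem IsSol.norm_iteratedFDeriv_le (h : IsSol g 0 x p) (hg : Tendsto g atBot (𝓝 g₀))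
    {K R : ℝ} (hR : 1 ≤ R) (hK : ∀ t ≤ Real.log R, |g t| ≤ K) {y : V} (hy : ‖y‖ ≤ R) {k : ℕ}
    (hk : k ≤ 2) : ‖iteratedFDeriv ℝ k (radialExt 0 x) y‖ ≤ 3 * K * R ^ 2 := by
  have hK0 : 0 ≤ K := (abs_nonneg _).trans (hK _ le_rfl)
  have hg0 : |g₀| ≤ K := le_of_tendsto hg.abs (by
    filter_upwards [eventually_le_atBot (Real.log R)] with t ht using hK t ht)
  have hlog : ∀ z : V, z ≠ 0 → ‖z‖ ≤ R → Real.log ‖z‖ ≤ Real.log R := fun z hz hzR =>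
    Real.log_le_log (norm_pos_iff.2 hz) hzR
  have hκ : |gradCoeff g₀ p y| ≤ K / 2 := by
    by_cases hy0 : y = 0
    · subst hy0
      rw [gradCoeff, radialExt_zero, abs_div, abs_two]
      linarith
    · rw [gradCoeff, radialExt_of_ne hy0, abs_mul, abs_of_pos (Real.exp_pos _)]
      have := (h.abs_le hK (hlog y hy0 hy)).1
      calc _ ≤ K / 2 * Real.exp (2 * Real.log ‖y‖) * Real.exp (-(2 * Real.log ‖y‖)) := by gcongr
        _ = K / 2 := by rw [mul_assoc, ← Real.exp_add]; simp
  have hG : |radialExt g₀ g y| ≤ K := by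
    by_cases hy0 : y = 0
    · subst hy0; simpa using hg0
    · rw [radialExt_of_ne hy0]; exact hK _ (hlog y hy0 hy)
  have hR2 : 1 ≤ R ^ 2 := one_le_pow₀ hR
  have hRR : R ≤ R ^ 2 := by nlinarith
  interval_cases k
  · rw [norm_iteratedFDeriv_zero]
    by_cases hy0 : y = 0
    · subst hy0
      rw [radialExt_zero, norm_zero]; positivity
    · rw [radialExt_of_ne hy0, Real.norm_eq_abs]
      have := (h.abs_le hK (hlog y hy0 hy)).2
      rw [exp_two_mul_log_norm hy0, sub_zero] at this
      have h2 : ‖y‖ ^ 2 ≤ R ^ 2 := pow_le_pow_left₀ (norm_nonneg _) hy 2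
      nlinarith
  · rw [norm_iteratedFDeriv_one, h.fderiv_radialExt hg, norm_smul, norm_dualMap_apply,
      Real.norm_eq_abs]
    have : |gradCoeff g₀ p y| * ‖y‖ ≤ K / 2 * R :=
      mul_le_mul hκ hy (norm_nonneg _) (by linarith)
    nlinarith
  · rw [← norm_iteratedFDeriv_fderiv, norm_iteratedFDeriv_one, h.fderiv_fderiv_radialExt hg]
    have h1 := norm_radialHess_le (D := dualMap V) (g₀ := g₀) (g := g) (p := p)
      (fun y => (norm_dualMap_apply y).le) y
    have h4 : |radialExt g₀ g y - 2 * gradCoeff g₀ p y| ≤ K + K := by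
      refine (abs_sub _ _).trans (add_le_add hG ?_)
      rw [abs_mul, abs_two]; linarith
    nlinarith

/-- In dimension two the multiple of the identity contributes twice the gradient coefficient to the
trace, and the rank-one part contributes `g` minus that amount. -/
theorem IsSol.laplacian_radialExt (h : IsSol g x₀ x p) (hg : Tendsto g atBot (𝓝 g₀))
    {y : Plane} (hy : y ≠ 0) :
    Laplacian.laplacian (radialExt x₀ x : Plane → ℝ) y = g (Real.log ‖y‖) := by
  rw [InnerProductSpace.laplacian_eq_iteratedFDeriv_orthonormalBasis _
    (EuclideanSpace.basisFun (Fin 2) ℝ)]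
  simp only [iteratedFDeriv_two_apply, h.fderiv_fderiv_radialExt hg, Fin.sum_univ_two]
  have hy0 : ‖y‖ ^ 2 ≠ 0 := pow_ne_zero 2 (norm_ne_zero_iff.2 hy)
  have hn : ‖y‖ ^ 2 = y 0 ^ 2 + y 1 ^ 2 := by
    rw [EuclideanSpace.norm_sq_eq]; simp
  have hr : radialExt g₀ g y = g (Real.log ‖y‖) := radialExt_of_ne hy
  simp [radialHess, hr, EuclideanSpace.inner_single_right]
  rw [hn] at hy0 ⊢
  field_simp
  ring

end RadialPlane

/-! ### Integration in polar coordinates. -/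

section PlaneIntegral

/-- The unit vector of the plane with polar angle `θ`. -/
def unitVec (θ : ℝ) : Plane :=
  Real.cos θ • EuclideanSpace.single 0 1 + Real.sin θ • EuclideanSpace.single 1 1

/-- The derivative of `unitVec`. -/
def tangentVec (θ : ℝ) : Plane :=
  -Real.sin θ • EuclideanSpace.single 0 1 + Real.cos θ • EuclideanSpace.single 1 1

theorem hasDerivAt_unitVec (θ : ℝ) : HasDerivAt unitVec (tangentVec θ) θ :=
  ((Real.hasDerivAt_cos θ).smul_const _).fun_add ((Real.hasDerivAt_sin θ).smul_const _)

theorem hasDerivAt_tangentVec (θ : ℝ) : HasDerivAt tangentVec (-unitVec θ) θ := by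
  refine (((Real.hasDerivAt_sin θ).fun_neg.smul_const _).fun_add
    ((Real.hasDerivAt_cos θ).smul_const _)).congr_deriv ?_
  rw [unitVec, neg_add, neg_smul, neg_smul]

theorem continuous_unitVec : Continuous unitVec := by unfold unitVec; fun_prop

theorem continuous_tangentVec : Continuous tangentVec := by unfold tangentVec; fun_prop

@[simp]
theorem norm_unitVec (θ : ℝ) : ‖unitVec θ‖ = 1 := by
  have : ‖unitVec θ‖ ^ 2 = 1 := by
    rw [EuclideanSpace.norm_sq_eq]
    simp [unitVec]
  nlinarith [norm_nonneg (unitVec θ)]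

theorem tangentVec_pi : tangentVec Real.pi = tangentVec (-Real.pi) := by
  simp [tangentVec]

theorem unitVec_pi : unitVec Real.pi = unitVec (-Real.pi) := by
  simp [unitVec]

theorem integral_plane_eq (f : Plane → ℝ) :
    ∫ y, f y = ∫ q in Ioi (0 : ℝ) ×ˢ Ioo (-Real.pi) Real.pi, q.1 * f (q.1 • unitVec q.2) := by
  rw [← Complex.orthonormalBasisOneI.measurePreserving_repr.integral_comp
    Complex.orthonormalBasisOneI.repr.toHomeomorph.measurableEmbedding,
    ← Complex.integral_comp_polarCoord_symm, ← polarCoord_target]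
  refine setIntegral_congr_fun polarCoord.open_target.measurableSet fun q _ => ?_
  simp only [smul_eq_mul]
  congr 2
  ext i
  fin_cases i <;> simp [unitVec, Complex.cos_ofReal_re, Complex.sin_ofReal_re]

/-- The trace of the Hessian is the same in every orthonormal frame, here the radial and tangential
one. -/
theorem laplacian_eq_polar (φ : Plane → ℝ) (y : Plane) (θ : ℝ) :
    Laplacian.laplacian φ y = fderiv ℝ (fderiv ℝ φ) y (unitVec θ) (unitVec θ) +
      fderiv ℝ (fderiv ℝ φ) y (tangentVec θ) (tangentVec θ) := by
  rw [InnerProductSpace.laplacian_eq_iteratedFDeriv_orthonormalBasis _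
    (EuclideanSpace.basisFun (Fin 2) ℝ)]
  simp only [iteratedFDeriv_two_apply, Fin.sum_univ_two, unitVec, tangentVec]
  simp
  linear_combination -((fderiv ℝ (fderiv ℝ φ) y (EuclideanSpace.single 0 1)
    (EuclideanSpace.single 0 1)) + (fderiv ℝ (fderiv ℝ φ) y (EuclideanSpace.single 1 1)
    (EuclideanSpace.single 1 1))) * (Real.sin_sq_add_cos_sq θ)

theorem locallyIntegrable_radial {w : ℝ → ℝ} (hw : ContinuousOn w (Ioi 0))
    (hb : ∀ R, ∃ C, ∀ r ∈ Ioc 0 R, |r * w r| ≤ C) : LocallyIntegrable (radial w) volume := by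
  intro y
  refine ⟨Metric.ball 0 (‖y‖ + 1), Metric.isOpen_ball.mem_nhds (by simp), ?_⟩
  rw [show radial w = fun y => w ‖y‖ from rfl, integrableOn_fun_norm_addHaar]
  obtain ⟨C, hC⟩ := hb (‖y‖ + 1)
  rw [finrank_euclideanSpace, Fintype.card_fin]
  refine IntegrableOn.of_bound (by simp) (C := C) ?_ ?_
  · refine ContinuousOn.aestronglyMeasurable ?_ measurableSet_Ioo
    exact ContinuousOn.mono (s := Ioi 0) (by fun_prop) Ioo_subset_Ioi_self
  · filter_upwards [ae_restrict_mem measurableSet_Ioo] with r hr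
    simpa using hC r ⟨hr.1, hr.2.le⟩

theorem abs_log_le {r : ℝ} (hr : 0 < r) : |Real.log r| ≤ r + r⁻¹ := by
  have h1 := Real.log_le_sub_one_of_pos hr
  have h2 := Real.log_le_sub_one_of_pos (inv_pos.2 hr)
  rw [Real.log_inv] at h2
  have := inv_pos.2 hr
  rw [abs_le]
  constructor <;> linarith

theorem integral_Ioi_of_hasDerivAt_of_tendsto_nhdsGT {f f' : ℝ → ℝ} {a l m : ℝ}
    (hderiv : ∀ x ∈ Ioi a, HasDerivAt f (f' x) x) (hint : IntegrableOn f' (Ioi a))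
    (hl : Tendsto f (𝓝[>] a) (𝓝 l)) (hm : Tendsto f atTop (𝓝 m)) :
    ∫ x in Ioi a, f' x = m - l := by
  have h := integral_Ioi_of_hasDerivAt_of_tendsto (f := Function.update f a l) (f' := f') (m := m)
    (a := a) ?_ (fun x hx => ?_) hint ?_
  · simpa using h
  · rw [continuousWithinAt_update_same, Ici_sdiff_left]
    exact hl
  · refine (hderiv x hx).congr_of_eventuallyEq ?_
    filter_upwards [Ioi_mem_nhds hx] with z hz
    exact Function.update_of_ne (ne_of_gt hz) _ _
  · refine hm.congr' ?_
    filter_upwards [eventually_gt_atTop a] with z hz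
    exact (Function.update_of_ne (ne_of_gt hz) _ _).symm

theorem integrableOn_polar {w : ℝ → ℝ} {k : ℝ × ℝ → ℝ} {R : ℝ} (hw : ContinuousOn w (Ioi 0))
    (hwi : IntegrableOn w (Ioc 0 R)) (hk : Continuous k) (hR : ∀ r θ, R ≤ r → k (r, θ) = 0) :
    IntegrableOn (fun q : ℝ × ℝ => w q.1 * k q) (Ioi 0 ×ˢ Ioo (-Real.pi) Real.pi)
      (volume.prod volume) := by
  obtain ⟨C, hC⟩ := (isCompact_Icc.prod isCompact_Icc :
    IsCompact (Icc 0 R ×ˢ Icc (-Real.pi) Real.pi)).exists_bound_of_continuousOn hk.continuousOn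
  have h1 : Integrable ((Ioc 0 R).indicator fun r => |w r| * C) (volume.restrict (Ioi 0)) :=
    ((integrable_indicator_iff measurableSet_Ioc).2 (hwi.abs.mul_const C)).restrict
  have h2 : IntegrableOn (fun q : ℝ × ℝ => (Ioc 0 R).indicator (fun r => |w r| * C) q.1)
      (Ioi 0 ×ˢ Ioo (-Real.pi) Real.pi) (volume.prod volume) := by
    rw [IntegrableOn, ← Measure.prod_restrict]
    exact h1.comp_fst _
  have hm : MeasurableSet (Ioi (0 : ℝ) ×ˢ Ioo (-Real.pi) Real.pi) :=
    measurableSet_Ioi.prod measurableSet_Ioo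
  refine h2.mono' ?_ ?_
  · refine ContinuousOn.aestronglyMeasurable ?_ hm
    exact (hw.comp continuousOn_fst fun q hq => hq.1).mul hk.continuousOn
  · filter_upwards [ae_restrict_mem hm] with q hq
    rw [norm_mul, Real.norm_eq_abs]
    by_cases h : q.1 ≤ R
    · rw [indicator_of_mem (show q.1 ∈ Ioc 0 R from ⟨hq.1, h⟩)]
      have hmem : q ∈ Icc 0 R ×ˢ Icc (-Real.pi) Real.pi :=
        mk_mem_prod ⟨le_of_lt hq.1, h⟩ ⟨hq.2.1.le, hq.2.2.le⟩
      exact mul_le_mul_of_nonneg_left (hC q hmem) (abs_nonneg _)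
    · rw [hR q.1 q.2 (not_le.1 h).le, indicator_of_notMem fun h' => h h'.2]
      simp

/-- The integrand is the angular derivative of the tangential derivative of `φ`, a periodic function
of the angle. -/
theorem integral_polar_tangential {φ : Plane → ℝ} (hφ : ContDiff ℝ (⊤ : ℕ∞) φ) (r : ℝ) :
    ∫ θ in Ioo (-Real.pi) Real.pi, (r * fderiv ℝ (fderiv ℝ φ) (r • unitVec θ) (tangentVec θ)
      (tangentVec θ) - fderiv ℝ φ (r • unitVec θ) (unitVec θ)) = 0 := by
  have hφ1 : ContDiff ℝ (⊤ : ℕ∞) (fderiv ℝ φ) := hφ.fderiv_right (by simp)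
  have hφ2 : Continuous (fderiv ℝ (fderiv ℝ φ)) := hφ1.continuous_fderiv (by simp)
  have hE := continuous_unitVec
  have hE' := continuous_tangentVec
  have hc := hφ1.continuous
  have hd : ∀ θ, HasDerivAt (fun θ => fderiv ℝ φ (r • unitVec θ) (tangentVec θ))
      (r * fderiv ℝ (fderiv ℝ φ) (r • unitVec θ) (tangentVec θ)
      (tangentVec θ) - fderiv ℝ φ (r • unitVec θ) (unitVec θ)) θ := fun θ => by
    have h1 := ((hφ1.differentiable (by simp)) (r • unitVec θ)).hasFDerivAt.comp_hasDerivAt θ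
      ((hasDerivAt_unitVec θ).const_smul r)
    refine (h1.clm_apply (hasDerivAt_tangentVec θ)).congr_deriv ?_
    simp [sub_eq_add_neg]
  rw [← integral_Ioc_eq_integral_Ioo, ← intervalIntegral.integral_of_le
    (by linarith [Real.pi_pos]), intervalIntegral.integral_eq_sub_of_hasDerivAt
    (fun θ _ => hd θ) (Continuous.intervalIntegrable (by fun_prop) _ _)]
  simp [tangentVec_pi, unitVec_pi]

theorem exists_radius_of_hasCompactSupport {φ : Plane → ℝ} (h : HasCompactSupport φ) :
    ∃ R > 0, ∀ y : Plane, R ≤ ‖y‖ → φ y = 0 ∧ fderiv ℝ φ y = 0 ∧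
      fderiv ℝ (fderiv ℝ φ) y = 0 := by
  obtain ⟨R, hR, hs⟩ := h.isBounded.subset_ball_lt 0 (0 : Plane)
  refine ⟨R, hR, fun y hy => ?_⟩
  have hy' : y ∉ tsupport φ := fun hm => by
    have := hs hm
    rw [mem_ball_zero_iff] at this
    linarith
  have h1 : y ∉ tsupport (fderiv ℝ φ) := fun hm => hy' (tsupport_fderiv_subset ℝ hm)
  have h2 : y ∉ tsupport (fderiv ℝ (fderiv ℝ φ)) := fun hm => h1 (tsupport_fderiv_subset ℝ hm)
  exact ⟨image_eq_zero_of_notMem_tsupport hy', image_eq_zero_of_notMem_tsupport h1,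
    image_eq_zero_of_notMem_tsupport h2⟩

/-! ### Logarithmic singularities and Dirac masses. -/

section Dirac

variable {g : ℝ → ℝ} {x₀ : ℝ} {x p : ℝ → ℝ}

theorem continuousOn_comp_log {f : ℝ → ℝ} (hf : Continuous f) :
    ContinuousOn (fun r => f (Real.log r)) (Ioi 0) :=
  hf.comp_continuousOn (Real.continuousOn_log.mono fun _ hr => ne_of_gt hr)

theorem tendsto_log_nhdsGT : Tendsto Real.log (𝓝[>] 0) atBot := Real.tendsto_log_nhdsGT_zero

theorem IsSol.exists_bound (h : IsSol g x₀ x p) (hg : ∀ T, ∃ K, ∀ t ≤ T, |g t| ≤ K) (R : ℝ) :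
    ∃ C, ∀ r ∈ Ioc 0 R, |x (Real.log r)| ≤ C := by
  obtain ⟨K, hK⟩ := hg (Real.log R)
  refine ⟨|x₀| + K / 4 * Real.exp (2 * Real.log R), fun r hr => ?_⟩
  have hlog := Real.log_le_log hr.1 hr.2
  have h1 := (h.abs_le hK hlog).2
  have hK0 := (abs_nonneg _).trans (hK _ le_rfl)
  have h2 : K / 4 * Real.exp (2 * Real.log r) ≤ K / 4 * Real.exp (2 * Real.log R) := by gcongr
  have h3 := abs_sub_abs_le_abs_sub (x (Real.log r)) x₀
  linarith

theorem IsSol.hasDerivAt_radial (h : IsSol g x₀ x p) (N : ℝ) {r : ℝ} (hr : 0 < r) :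
    HasDerivAt (fun r => 2 * N * Real.log r + x (Real.log r))
      ((2 * N + p (Real.log r)) / r) r := by
  have h1 := Real.hasDerivAt_log hr.ne'
  refine ((h1.const_mul (2 * N)).fun_add ((h.hasDerivAt_fst _).comp r h1)).congr_deriv ?_
  field_simp

theorem IsSol.hasDerivAt_snd_log (h : IsSol g x₀ x p) {r : ℝ} (hr : 0 < r) :
    HasDerivAt (fun r => p (Real.log r)) (r * g (Real.log r)) r := by
  refine ((h.hasDerivAt_snd _).comp r (Real.hasDerivAt_log hr.ne')).congr_deriv ?_
  rw [two_mul, Real.exp_add, Real.exp_log hr, smul_eq_mul]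
  field_simp

/-- Along a ray the integrand is the derivative of `r u ∂ᵣφ - (r u') φ`. This vanishes far out, and
at the origin `r u → 0` while `r u' → 2 N`, so only the singular part of `u` contributes. -/
theorem IsSol.integral_polar_radial (h : IsSol g x₀ x p)
    (hg : ∀ T, ∃ K, ∀ t ≤ T, |g t| ≤ K) (N : ℝ)
    {φ : Plane → ℝ} (hφ : ContDiff ℝ (⊤ : ℕ∞) φ) (hφc : HasCompactSupport φ) (θ : ℝ)
    (hi : IntegrableOn (fun r => (2 * N * Real.log r + x (Real.log r)) *
        (fderiv ℝ φ (r • unitVec θ) (unitVec θ) +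
          r * fderiv ℝ (fderiv ℝ φ) (r • unitVec θ) (unitVec θ) (unitVec θ)) +
        -(r * g (Real.log r)) * φ (r • unitVec θ)) (Ioi 0)) :
    ∫ r in Ioi 0, ((2 * N * Real.log r + x (Real.log r)) *
        (fderiv ℝ φ (r • unitVec θ) (unitVec θ) +
          r * fderiv ℝ (fderiv ℝ φ) (r • unitVec θ) (unitVec θ) (unitVec θ)) +
        -(r * g (Real.log r)) * φ (r • unitVec θ)) = 2 * N * φ 0 := by
  have hφ1 : ContDiff ℝ (⊤ : ℕ∞) (fderiv ℝ φ) := hφ.fderiv_right (by simp)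
  have hc := hφ1.continuous
  have hφ0 := hφ.continuous
  have hray : ∀ r : ℝ, HasDerivAt (fun r : ℝ => r • unitVec θ) (unitVec θ) r := fun r => by
    simpa using (hasDerivAt_id r).smul_const (unitVec θ)
  obtain ⟨C, hC⟩ := h.exists_bound hg 1
  have hrx : Tendsto (fun r => r * (2 * N * Real.log r + x (Real.log r))) (𝓝[>] 0) (𝓝 0) := by
    have h1 := tendsto_log_mul_rpow_nhdsGT_zero one_pos
    simp only [Real.rpow_one] at h1
    have h2 : Tendsto (fun r : ℝ => r * x (Real.log r)) (𝓝[>] 0) (𝓝 0) := by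
      have := (tendsto_nhdsWithin_of_tendsto_nhds (a := (0 : ℝ)) (s := Ioi 0) tendsto_id).mul
        (h.lim_fst.comp tendsto_log_nhdsGT)
      simpa using this
    have h3 := (h1.const_mul (2 * N)).add h2
    simp only [mul_zero, add_zero] at h3
    refine h3.congr fun r => by ring
  have hray0 : Tendsto (fun r : ℝ => r • unitVec θ) (𝓝[>] 0) (𝓝 0) := by
    have : Continuous fun r : ℝ => r • unitVec θ := by fun_prop
    simpa using tendsto_nhdsWithin_of_tendsto_nhds (s := Ioi 0) (this.tendsto 0)
  have hlim : Tendsto (fun r => r * (2 * N * Real.log r + x (Real.log r)) *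
      fderiv ℝ φ (r • unitVec θ) (unitVec θ) - (2 * N + p (Real.log r)) * φ (r • unitVec θ))
      (𝓝[>] 0) (𝓝 (-(2 * N * φ 0))) := by
    have h1 := hrx.mul (((hc.clm_apply continuous_const).tendsto 0).comp hray0 :
      Tendsto (fun r : ℝ => fderiv ℝ φ (r • unitVec θ) (unitVec θ)) _ _)
    have h2 := ((h.lim_snd.comp tendsto_log_nhdsGT).const_add (2 * N)).mul
      ((hφ0.tendsto 0).comp hray0)
    simpa using h1.sub h2
  obtain ⟨R, hR, hzero⟩ := exists_radius_of_hasCompactSupport hφc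
  have htop : Tendsto (fun r => r * (2 * N * Real.log r + x (Real.log r)) *
      fderiv ℝ φ (r • unitVec θ) (unitVec θ) - (2 * N + p (Real.log r)) * φ (r • unitVec θ))
      atTop (𝓝 0) := by
    refine tendsto_const_nhds.congr' ?_
    filter_upwards [eventually_ge_atTop R] with r hr
    obtain ⟨h0, h1, -⟩ := hzero (r • unitVec θ) (by
      rw [norm_smul, norm_unitVec, mul_one]; exact hr.trans (le_abs_self r))
    rw [h0, h1]; simp
  rw [integral_Ioi_of_hasDerivAt_of_tendsto_nhdsGT ?_ hi hlim htop]
  · ring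
  intro r hr
  have hr0 : (0 : ℝ) < r := hr
  have h1 := ((hφ1.differentiable (by simp)) (r • unitVec θ)).hasFDerivAt.comp_hasDerivAt r (hray r)
  have h2 := h1.clm_apply (hasDerivAt_const r (unitVec θ))
  have h3 := ((hφ.differentiable (by simp)) (r • unitVec θ)).hasFDerivAt.comp_hasDerivAt r (hray r)
  refine ((((hasDerivAt_id r).fun_mul (h.hasDerivAt_radial N hr0)).fun_mul h2).fun_sub
    (((h.hasDerivAt_snd_log hr0).const_add (2 * N)).fun_mul h3)).congr_deriv ?_
  simp
  field_simp
  ring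

/-- The classical solution with logarithmic singularity solves the distributional equation. -/
theorem IsSol.solvesWithDirac (h : IsSol g x₀ x p) (hgc : Continuous g)
    (hg : ∀ T, ∃ K, ∀ t ≤ T, |g t| ≤ K) (N : ℝ) :
    SolvesWithDirac (radial fun r => 2 * N * Real.log r + x (Real.log r))
      (radial fun r => -g (Real.log r)) (4 * Real.pi * N) := by
  have hxc : ContinuousOn (fun r => x (Real.log r)) (Ioi 0) :=
    continuousOn_comp_log h.continuous_fst
  have hlogc : ContinuousOn Real.log (Ioi 0) := Real.continuousOn_log.mono fun _ hr => ne_of_gt hr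
  have huc : ContinuousOn (fun r => 2 * N * Real.log r + x (Real.log r)) (Ioi 0) :=
    (hlogc.const_smul (2 * N)).add hxc
  have hfc : ContinuousOn (fun r => -(r * g (Real.log r))) (Ioi 0) :=
    (continuousOn_id.mul (continuousOn_comp_log hgc)).neg
  have hlu : LocallyIntegrable
      (radial fun r => 2 * N * Real.log r + x (Real.log r)) volume := by
    refine locallyIntegrable_radial huc fun R => ?_
    obtain ⟨C, hC⟩ := h.exists_bound hg R
    refine ⟨2 * |N| * (R ^ 2 + 1) + R * C, fun r hr => ?_⟩
    have h1 : r * |Real.log r| ≤ R ^ 2 + 1 := by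
      have h2 := mul_le_mul_of_nonneg_left (abs_log_le hr.1) hr.1.le
      have h3 : r * (r + r⁻¹) = r ^ 2 + 1 := by
        have := hr.1.ne'
        field_simp
      have h4 := pow_le_pow_left₀ hr.1.le hr.2 2
      linarith
    have h5 : r * |x (Real.log r)| ≤ R * C :=
      mul_le_mul hr.2 (hC r hr) (abs_nonneg _) (hr.1.le.trans hr.2)
    rw [abs_mul, abs_of_pos hr.1]
    calc _ ≤ r * (|2 * N * Real.log r| + |x (Real.log r)|) := by
          gcongr; exacts [hr.1.le, abs_add_le _ _]
      _ = 2 * |N| * (r * |Real.log r|) + r * |x (Real.log r)| := by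
          rw [abs_mul, abs_mul, abs_two]; ring
      _ ≤ _ := by gcongr
  have hlf : LocallyIntegrable (radial fun r => -g (Real.log r)) volume := by
    refine locallyIntegrable_radial (continuousOn_comp_log hgc).neg fun R => ?_
    obtain ⟨K, hK⟩ := hg (Real.log R)
    refine ⟨R * K, fun r hr => ?_⟩
    rw [abs_mul, abs_neg, abs_of_pos hr.1]
    exact mul_le_mul hr.2 (hK _ (Real.log_le_log hr.1 hr.2)) (abs_nonneg _) (hr.1.le.trans hr.2)
  refine ⟨hlu, hlf, fun φ hφ hφc => ?_⟩
  have hφ1 : ContDiff ℝ (⊤ : ℕ∞) (fderiv ℝ φ) := hφ.fderiv_right (by simp)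
  have hφ2 : Continuous (fderiv ℝ (fderiv ℝ φ)) := hφ1.continuous_fderiv (by simp)
  have hE := continuous_unitVec
  have hE' := continuous_tangentVec
  have hc := hφ1.continuous
  have hφ0 := hφ.continuous
  obtain ⟨R, hR, hzero⟩ := exists_radius_of_hasCompactSupport hφc
  have hnorm : ∀ r θ, R ≤ r → R ≤ ‖r • unitVec θ‖ := fun r θ hr => by
    rw [norm_smul, norm_unitVec, mul_one]; exact hr.trans (le_abs_self r)
  have hui : IntegrableOn (fun r => 2 * N * Real.log r + x (Real.log r)) (Ioc 0 R) := by
    refine Integrable.add ?_ ?_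
    · exact ((intervalIntegrable_iff_integrableOn_Ioc_of_le hR.le).1
        intervalIntegral.intervalIntegrable_log').const_mul (2 * N)
    · obtain ⟨C, hC⟩ := h.exists_bound hg R
      refine IntegrableOn.of_bound (C := C) (by simp)
        ((hxc.mono Ioc_subset_Ioi_self).aestronglyMeasurable measurableSet_Ioc) ?_
      filter_upwards [ae_restrict_mem measurableSet_Ioc] with r hr using hC r hr
  have hfi : IntegrableOn (fun r => -(r * g (Real.log r))) (Ioc 0 R) := by
    obtain ⟨K, hK⟩ := hg (Real.log R)
    refine IntegrableOn.of_bound (C := R * K) (by simp)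
      ((hfc.mono Ioc_subset_Ioi_self).aestronglyMeasurable measurableSet_Ioc) ?_
    filter_upwards [ae_restrict_mem measurableSet_Ioc] with r hr
    rw [Real.norm_eq_abs, abs_neg, abs_mul, abs_of_pos hr.1]
    exact mul_le_mul hr.2 (hK _ (Real.log_le_log hr.1 hr.2)) (abs_nonneg _) (hr.1.le.trans hr.2)
  have hI1 := integrableOn_polar (k := fun q : ℝ × ℝ => fderiv ℝ φ (q.1 • unitVec q.2)
    (unitVec q.2) + q.1 * fderiv ℝ (fderiv ℝ φ) (q.1 • unitVec q.2) (unitVec q.2) (unitVec q.2))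
    huc hui (by fun_prop) fun r θ hr => by
      obtain ⟨-, h1, h2⟩ := hzero _ (hnorm r θ hr)
      simp [h1, h2]
  have hI3 := integrableOn_polar (k := fun q : ℝ × ℝ =>
    q.1 * fderiv ℝ (fderiv ℝ φ) (q.1 • unitVec q.2) (tangentVec q.2) (tangentVec q.2) -
    fderiv ℝ φ (q.1 • unitVec q.2) (unitVec q.2))
    huc hui (by fun_prop) fun r θ hr => by
      obtain ⟨-, h1, h2⟩ := hzero _ (hnorm r θ hr)
      simp [h1, h2]
  have hI2 := integrableOn_polar (k := fun q : ℝ × ℝ => φ (q.1 • unitVec q.2))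
    hfc hfi (by fun_prop) fun r θ hr => (hzero _ (hnorm r θ hr)).1
  have hm : MeasurableSet (Ioi (0 : ℝ) ×ˢ Ioo (-Real.pi) Real.pi) :=
    measurableSet_Ioi.prod measurableSet_Ioo
  have hnr : ∀ q ∈ Ioi (0 : ℝ) ×ˢ Ioo (-Real.pi) Real.pi, ‖q.1 • unitVec q.2‖ = q.1 :=
    fun q hq => by
      rw [norm_smul, norm_unitVec, mul_one, Real.norm_eq_abs, abs_of_pos hq.1]
  -- The Laplacian is split into a radial part and a tangential part of zero mean on every circle.
  -- The first-order term `∂ᵣφ` is added to one and subtracted from the other.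
  have e1 : ∫ y, radial (fun r => 2 * N * Real.log r + x (Real.log r)) y *
      Laplacian.laplacian φ y = ∫ q in Ioi (0 : ℝ) ×ˢ Ioo (-Real.pi) Real.pi,
      ((2 * N * Real.log q.1 + x (Real.log q.1)) * (fderiv ℝ φ (q.1 • unitVec q.2)
        (unitVec q.2) + q.1 * fderiv ℝ (fderiv ℝ φ) (q.1 • unitVec q.2) (unitVec q.2)
        (unitVec q.2)) + (2 * N * Real.log q.1 + x (Real.log q.1)) *
        (q.1 * fderiv ℝ (fderiv ℝ φ) (q.1 • unitVec q.2) (tangentVec q.2) (tangentVec q.2) -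
        fderiv ℝ φ (q.1 • unitVec q.2) (unitVec q.2))) := by
    rw [integral_plane_eq]
    refine setIntegral_congr_fun hm fun q hq => ?_
    simp only [radial, hnr q hq, laplacian_eq_polar φ _ q.2]
    ring
  have e2 : ∫ y, radial (fun r => -g (Real.log r)) y * φ y =
      ∫ q in Ioi (0 : ℝ) ×ˢ Ioo (-Real.pi) Real.pi,
      -(q.1 * g (Real.log q.1)) * φ (q.1 • unitVec q.2) := by
    rw [integral_plane_eq]
    refine setIntegral_congr_fun hm fun q hq => ?_
    simp only [radial, hnr q hq]
    ring
  have e3 : ∫ q in Ioi (0 : ℝ) ×ˢ Ioo (-Real.pi) Real.pi,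
      (2 * N * Real.log q.1 + x (Real.log q.1)) *
        (q.1 * fderiv ℝ (fderiv ℝ φ) (q.1 • unitVec q.2) (tangentVec q.2) (tangentVec q.2) -
        fderiv ℝ φ (q.1 • unitVec q.2) (unitVec q.2)) = 0 := by
    rw [Measure.volume_eq_prod, setIntegral_prod _ hI3]
    simp only [integral_const_mul, integral_polar_tangential hφ, mul_zero, integral_zero]
  rw [Measure.volume_eq_prod] at e1 e2 e3
  rw [e1, e2, integral_add hI1 hI3, e3, add_zero, ← integral_add hI1 hI2]
  have hI12 := Integrable.add hI1 hI2
  rw [Pi.add_def] at hI12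
  rw [← Measure.prod_restrict] at hI12 ⊢
  rw [integral_prod_symm _ hI12]
  have hae := hI12.prod_left_ae
  calc _ = ∫ θ in Ioo (-Real.pi) Real.pi, 2 * N * φ 0 := by
        refine integral_congr_ae ?_
        filter_upwards [hae] with θ hθ
        exact h.integral_polar_radial hg N hφ hφc θ hθ
    _ = 4 * Real.pi * N * φ 0 := by
        rw [setIntegral_const, Real.volume_real_Ioo_of_le (by linarith [Real.pi_pos]), smul_eq_mul]
        ring

end Dirac

end PlaneIntegral

/-! ### From the distributional equation to the integrated radial equation. -/

section Converse

theorem integral_radial_plane (w : ℝ → ℝ) :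
    ∫ y : Plane, w ‖y‖ = 2 * Real.pi * ∫ r in Ioi 0, r * w r := by
  rw [integral_fun_norm_addHaar, finrank_euclideanSpace, Fintype.card_fin, measureReal_def,
    EuclideanSpace.volume_ball_fin_two]
  simp [Real.pi_pos.le, mul_assoc]

theorem locallyIntegrable_radial_iff {w : ℝ → ℝ} (h : LocallyIntegrable (radial w) volume)
    (R : ℝ) : IntegrableOn (fun r => r * w r) (Ioc 0 R) := by
  have h1 : IntegrableOn (fun y : Plane => w ‖y‖) (Metric.ball 0 (R + 1)) volume :=
    (h.integrableOn_isCompact (isCompact_closedBall 0 (R + 1))).mono_set Metric.ball_subset_closedBall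
  rw [integrableOn_fun_norm_addHaar, finrank_euclideanSpace, Fintype.card_fin] at h1
  simp only [smul_eq_mul, Nat.add_one_sub_one, pow_one] at h1
  exact h1.mono_set fun r hr => ⟨hr.1, hr.2.trans_lt (lt_add_one R)⟩

theorem integrable_of_continuousOn_Icc {f : ℝ → ℝ} {a b : ℝ} (hf : ContinuousOn f (Icc a b))
    (h0 : ∀ r, r ∉ Icc a b → f r = 0) : Integrable f volume :=
  (integrableOn_iff_integrable_of_support_subset fun r hr => by
    by_contra hc
    exact hr (h0 r hc)).1 hf.integrableOn_Icc

/-- The smooth radial test function whose radial derivative is `k`. -/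
theorem exists_radial_test {k : ℝ → ℝ} (hk : ContDiff ℝ (⊤ : ℕ∞) k) {a b : ℝ} (ha : 0 < a)
    (h0 : ∀ r, r ∉ Icc a b → k r = 0) :
    ∃ η : ℝ → ℝ, (∀ r, HasDerivAt η (k r) r) ∧ (∀ r, b ≤ r → η r = 0) ∧
      ContDiff ℝ (⊤ : ℕ∞) (fun y : Plane => η ‖y‖) ∧ HasCompactSupport (fun y : Plane => η ‖y‖) ∧
      ∀ y : Plane, y ≠ 0 →
        Laplacian.laplacian (fun y : Plane => η ‖y‖) y = k ‖y‖ / ‖y‖ + deriv k ‖y‖ := by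
  set η : ℝ → ℝ := fun r => ∫ s in b..r, k s with hη
  have hd : ∀ r, HasDerivAt η (k r) r := fun r => by
    exact intervalIntegral.integral_hasDerivAt_right (hk.continuous.intervalIntegrable _ _)
      (hk.continuous.stronglyMeasurableAtFilter _ _) hk.continuous.continuousAt
  have hsm : ContDiff ℝ (⊤ : ℕ∞) η := by
    rw [contDiff_infty_iff_deriv]
    refine ⟨fun r => (hd r).differentiableAt, ?_⟩
    rwa [funext fun r => (hd r).deriv]
  have hb : ∀ r, b ≤ r → η r = 0 := fun r hr => by
    rw [hη]
    refine intervalIntegral.integral_zero_ae ?_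
    have hne : ∀ᵐ s ∂(volume : Measure ℝ), s ≠ b := by simp [ae_iff]
    filter_upwards [hne] with s hs hs'
    rw [uIoc_of_le hr] at hs'
    exact h0 s fun h => absurd hs'.1 (not_lt.2 h.2)
  -- Below `a` the function `k` vanishes at nonnegative radii and at negative ones alike, so `η` is
  -- constant near the origin; the test function is smooth there although the norm is not.
  have hη0 : ∀ r, r ≤ a → η r = η 0 := fun r hr => by
    have h1 : η r - η 0 = ∫ s in (0 : ℝ)..r, k s := by
      rw [hη]
      exact intervalIntegral.integral_interval_sub_left (hk.continuous.intervalIntegrable _ _)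
        (hk.continuous.intervalIntegrable _ _)
    have h2 : ∫ s in (0 : ℝ)..r, k s = 0 := by
      refine intervalIntegral.integral_zero_ae ?_
      have hne : ∀ᵐ s ∂(volume : Measure ℝ), s ≠ a := by simp [ae_iff]
      filter_upwards [hne] with s hs hs'
      rw [mem_uIoc] at hs'
      refine h0 s fun h => ?_
      rcases hs' with h3 | h3
      · exact hs (le_antisymm (h3.2.trans hr) h.1)
      · linarith [h3.2, h.1]
    linarith
  have hkd : Continuous (deriv k) := hk.continuous_deriv (by simp)
  have hsol : IsSol (fun t => Real.exp (-t) * k (Real.exp t) + deriv k (Real.exp t)) (η 0)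
      (fun t => η (Real.exp t)) (fun t => Real.exp t * k (Real.exp t)) := by
    refine ⟨?_, ?_, fun t => ?_, fun t => ?_⟩
    · exact (hsm.continuous.tendsto 0).comp Real.tendsto_exp_atBot
    · have := Real.tendsto_exp_atBot.mul ((hk.continuous.tendsto 0).comp Real.tendsto_exp_atBot)
      rwa [zero_mul] at this
    · refine ((hd _).comp t (Real.hasDerivAt_exp t)).congr_deriv (mul_comm _ _)
    · have h1 := (hk.differentiable (by simp) (Real.exp t)).hasDerivAt.comp t (Real.hasDerivAt_exp t)
      refine ((Real.hasDerivAt_exp t).fun_mul h1).congr_deriv ?_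
      rw [smul_eq_mul, two_mul, Real.exp_add, Real.exp_neg]
      have := Real.exp_ne_zero t
      simp only [Function.comp]
      field_simp
  have hlim : Tendsto (fun t => Real.exp (-t) * k (Real.exp t) + deriv k (Real.exp t)) atBot
      (𝓝 0) := by
    refine tendsto_const_nhds.congr' ?_
    filter_upwards [Real.tendsto_exp_atBot.eventually_lt_const ha] with t ht
    have h1 : k =ᶠ[𝓝 (Real.exp t)] fun _ => 0 := by
      filter_upwards [Iio_mem_nhds ht] with s hs
      exact h0 s fun h => absurd h.1 (not_le.2 hs)
    rw [h1.eq_of_nhds, h1.deriv_eq]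
    simp
  have hext : (fun y : Plane => η ‖y‖) = radialExt (η 0) fun t => η (Real.exp t) := by
    funext y
    by_cases hy : y = 0
    · subst hy; simp
    · rw [radialExt_of_ne hy, Real.exp_log (norm_pos_iff.2 hy)]
  refine ⟨η, hd, hb, ?_, ?_, fun y hy => ?_⟩
  · rw [contDiff_iff_contDiffAt]
    intro y
    by_cases hy : y = 0
    · refine (contDiffAt_const (c := η 0)).congr_of_eventuallyEq ?_
      rw [hy]
      filter_upwards [Metric.ball_mem_nhds (0 : Plane) ha] with z hz
      exact hη0 _ (mem_ball_zero_iff.1 hz).le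
    · exact hsm.contDiffAt.comp y (contDiffAt_norm ℝ hy)
  · refine HasCompactSupport.of_support_subset_isCompact (isCompact_closedBall (0 : Plane) b) ?_
    intro y hy
    rw [mem_closedBall_zero_iff]
    by_contra! hc
    exact hy (hb _ hc.le)
  · rw [hext, hsol.laplacian_radialExt hlim hy, Real.exp_neg, Real.exp_log (norm_pos_iff.2 hy)]
    ring

variable {w f : ℝ → ℝ}

theorem hasDerivAt_mass (hf : ContinuousOn f (Ioi 0))
    (hfi : ∀ R, IntegrableOn (fun r => r * f r) (Ioc 0 R)) {r : ℝ} (hr : 0 < r) :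
    HasDerivAt (fun r => ∫ s in (0 : ℝ)..r, s * f s) (r * f r) r := by
  have hc : ContinuousOn (fun s => s * f s) (Ioi 0) := continuousOn_id.mul hf
  refine intervalIntegral.integral_hasDerivAt_right
    ((intervalIntegrable_iff_integrableOn_Ioc_of_le hr.le).2 (hfi r)) ?_
    (hc.continuousAt (Ioi_mem_nhds hr))
  exact hc.stronglyMeasurableAtFilter isOpen_Ioi r hr

theorem tendsto_mass (hfi : ∀ R, IntegrableOn (fun r => r * f r) (Ioc 0 R)) :
    Tendsto (fun r => ∫ s in (0 : ℝ)..r, s * f s) (𝓝[>] 0) (𝓝 0) := by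
  have h1 : ContinuousOn (fun r => ∫ s in (0 : ℝ)..r, s * f s) (uIcc 0 1) := by
    refine intervalIntegral.continuousOn_primitive_interval' ?_ left_mem_uIcc
    exact (intervalIntegrable_iff_integrableOn_Ioc_of_le zero_le_one).2 (hfi 1)
  have h2 := h1 0 left_mem_uIcc
  rw [ContinuousWithinAt, intervalIntegral.integral_same, uIcc_of_le zero_le_one] at h2
  exact h2.mono_left (nhdsWithin_le_of_mem (Icc_mem_nhdsGT zero_lt_one))

/-- A radial distributional solution satisfies the integrated equation. -/
theorem SolvesWithDirac.integrated {N : ℝ} (hw : ContDiffOn ℝ 2 w (Ioi 0))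
    (hf : ContinuousOn f (Ioi 0))
    (h : SolvesWithDirac (radial w) (radial f) (4 * Real.pi * N)) {r : ℝ} (hr : 0 < r) :
    r * deriv w r + ∫ s in (0 : ℝ)..r, s * f s = 2 * N := by
  have hfi := locallyIntegrable_radial_iff h.locallyIntegrable_f
  have hwd : ∀ r, 0 < r → HasDerivAt w (deriv w r) r := fun r hr =>
    ((hw.differentiableOn (by norm_num)).differentiableAt (Ioi_mem_nhds hr)).hasDerivAt
  have hwc : ContinuousOn w (Ioi 0) := hw.continuousOn
  have hdc : ContinuousOn (deriv w) (Ioi 0) := hw.continuousOn_deriv_of_isOpen isOpen_Ioi (by norm_num)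
  set M : ℝ → ℝ := fun r => ∫ s in (0 : ℝ)..r, s * f s with hM
  have hMd : ∀ r, 0 < r → HasDerivAt M (r * f r) r := fun r hr => hasDerivAt_mass hf hfi hr
  have hMc : ContinuousOn M (Ioi 0) := fun r hr => (hMd r hr).continuousAt.continuousWithinAt
  have hcont : ContinuousOn (fun r => r * deriv w r + M r - 2 * N) (Ioi 0) :=
    ((continuousOn_id.mul hdc).add hMc).sub continuousOn_const
  -- Tested against the radial function with radial derivative `k`, the equation says after
  -- integration by parts that `r w' + M - 2 N` is orthogonal to `k`. Since `k` is an arbitrary test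
  -- function on the half-line, the expression vanishes almost everywhere.
  have hae : ∀ᵐ r ∂(volume : Measure ℝ), r ∈ Ioi (0 : ℝ) → r * deriv w r + M r - 2 * N = 0 := by
    refine isOpen_Ioi.ae_eq_zero_of_integral_contDiff_smul_eq_zero
      (hcont.locallyIntegrableOn measurableSet_Ioi) fun k hk hkc hks => ?_
    obtain ⟨a, b, ha, hab, h0⟩ : ∃ a b : ℝ, 0 < a ∧ a ≤ b ∧ ∀ r, r ∉ Icc a b → k r = 0 := by
      rcases (tsupport k).eq_empty_or_nonempty with he | hne
      · refine ⟨1, 1, one_pos, le_rfl, fun r _ => ?_⟩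
        exact image_eq_zero_of_notMem_tsupport (by rw [he]; exact notMem_empty r)
      · obtain ⟨a, ha, ha'⟩ := hkc.exists_isLeast hne
        obtain ⟨b, hb, hb'⟩ := hkc.exists_isGreatest hne
        refine ⟨a, b, hks ha, ha' hb, fun r hr => ?_⟩
        exact image_eq_zero_of_notMem_tsupport fun h => hr ⟨ha' h, hb' h⟩
    obtain ⟨η, hηd, hηb, hφ, hφc, hlap⟩ := exists_radial_test hk ha h0
    have hηc : Continuous η := continuous_iff_continuousAt.2 fun r => (hηd r).continuousAt
    have hkd : Continuous (deriv k) := hk.continuous_deriv (by simp)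
    have hkd' : ∀ r, HasDerivAt k (deriv k r) r := fun r =>
      (hk.differentiable (by simp) r).hasDerivAt
    have h0' : ∀ r, r ∉ Icc a b → deriv k r = 0 := fun r hr => by
      have : k =ᶠ[𝓝 r] fun _ => 0 := by
        filter_upwards [isClosed_Icc.isOpen_compl.mem_nhds hr] with s hs using h0 s hs
      rw [this.deriv_eq, deriv_const]
    have hIcc : Icc a b ⊆ Ioi 0 := fun r hr => ha.trans_le hr.1
    have e := h.eq _ hφ hφc
    have e1 : ∫ y : Plane, radial w y * Laplacian.laplacian (fun y : Plane => η ‖y‖) y =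
        2 * Real.pi * ∫ r in Ioi 0, (w r * k r + r * w r * deriv k r) := by
      have : ∀ᵐ y : Plane, radial w y * Laplacian.laplacian (fun y : Plane => η ‖y‖) y =
          (fun r => w r * (k r / r + deriv k r)) ‖y‖ := by
        have hne : ∀ᵐ y : Plane, y ≠ 0 := by simp [ae_iff]
        filter_upwards [hne] with y hy
        rw [hlap y hy, radial]
      rw [integral_congr_ae this]
      refine (integral_radial_plane fun r => w r * (k r / r + deriv k r)).trans ?_
      congr 1
      refine setIntegral_congr_fun measurableSet_Ioi fun r hr => ?_
      have : r ≠ 0 := ne_of_gt hr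

      field_simp
    have e2 : ∫ y : Plane, radial f y * η ‖y‖ = 2 * Real.pi * ∫ r in Ioi 0, r * f r * η r := by
      refine (integral_radial_plane fun r => f r * η r).trans ?_
      congr 1
      exact setIntegral_congr_fun measurableSet_Ioi fun r hr => (mul_assoc _ _ _).symm
    have hI1 : IntegrableOn (fun r => w r * k r + r * w r * deriv k r) (Ioi 0) := by
      refine (integrable_of_continuousOn_Icc (a := a) (b := b) ?_ fun r hr => ?_).integrableOn
      · have := hwc.mono hIcc
        have hk' := hk.continuous
        fun_prop
      · rw [h0 r hr, h0' r hr]; ring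
    have hI2 : IntegrableOn (fun r => r * deriv w r * k r) (Ioi 0) := by
      refine (integrable_of_continuousOn_Icc (a := a) (b := b) ?_ fun r hr => ?_).integrableOn
      · have := hdc.mono hIcc
        have hk' := hk.continuous
        fun_prop
      · rw [h0 r hr]; ring
    have hI3 : IntegrableOn (fun r => M r * k r) (Ioi 0) := by
      refine (integrable_of_continuousOn_Icc (a := a) (b := b) ?_ fun r hr => ?_).integrableOn
      · have := hMc.mono hIcc
        have hk' := hk.continuous
        fun_prop
      · rw [h0 r hr]; ring
    have hI4 : IntegrableOn k (Ioi 0) :=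
      (integrable_of_continuousOn_Icc hk.continuous.continuousOn h0).integrableOn
    have hI5 : IntegrableOn (fun r => r * f r * η r) (Ioi 0) := by
      have h1 : IntegrableOn (fun r => r * f r * η r) (Ioc 0 b) := by
        obtain ⟨C, hC⟩ := isCompact_Icc.exists_bound_of_continuousOn
          (hηc.continuousOn (s := Icc 0 b))
        refine (hfi b).mul_bdd (c := C) hηc.aestronglyMeasurable ?_
        filter_upwards [ae_restrict_mem measurableSet_Ioc] with r hr using hC r ⟨hr.1.le, hr.2⟩
      refine (integrableOn_congr_set_ae ?_).1 (h1.union (integrableOn_zero.congr_fun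
        (f := fun _ => 0) (s := Ioi b) (fun r hr => ?_) measurableSet_Ioi))
      · rw [Ioc_union_Ioi_eq_Ioi (ha.le.trans hab)]
        exact EventuallyEq.rfl
      · simp [hηb r (le_of_lt hr)]
    have hkz : ∀ᶠ r in 𝓝[>] (0 : ℝ), k r = 0 := by
      filter_upwards [Ioo_mem_nhdsGT ha] with r hr
      exact h0 r fun h => absurd h.1 (not_le.2 hr.2)
    have hkt : ∀ᶠ r in atTop, k r = 0 := by
      filter_upwards [eventually_gt_atTop b] with r hr
      exact h0 r fun h => absurd h.2 (not_le.2 hr)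
    have hηt : ∀ᶠ r in atTop, η r = 0 := by
      filter_upwards [eventually_ge_atTop b] with r hr using hηb r hr
    have i1 : ∫ r in Ioi 0, ((w r * k r + r * w r * deriv k r) + r * deriv w r * k r) = 0 - 0 := by
      refine integral_Ioi_of_hasDerivAt_of_tendsto_nhdsGT (f := fun r => r * w r * k r)
        (fun r hr => ?_) (hI1.add hI2) (tendsto_const_nhds.congr' ?_) (tendsto_const_nhds.congr' ?_)
      · refine ((((hasDerivAt_id r).fun_mul (hwd r hr))).fun_mul (hkd' r)).congr_deriv ?_
        simp only [id]; ring
      · filter_upwards [hkz] with r hr; rw [hr, mul_zero]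
      · filter_upwards [hkt] with r hr; rw [hr, mul_zero]
    have i2 : ∫ r in Ioi 0, (r * f r * η r + M r * k r) = 0 - 0 := by
      refine integral_Ioi_of_hasDerivAt_of_tendsto_nhdsGT (f := fun r => M r * η r)
        (fun r hr => (hMd r hr).fun_mul (hηd r)) (hI5.add hI3) ?_ (tendsto_const_nhds.congr' ?_)
      · have := (tendsto_mass hfi).mul ((hηc.tendsto 0).mono_left nhdsWithin_le_nhds)
        rwa [zero_mul] at this
      · filter_upwards [hηt] with r hr; rw [hr, mul_zero]
    have i3 : ∫ r in Ioi 0, k r = 0 - η 0 := by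
      refine integral_Ioi_of_hasDerivAt_of_tendsto_nhdsGT (f := η)
        (fun r hr => hηd r) hI4 ((hηc.tendsto 0).mono_left nhdsWithin_le_nhds)
        (tendsto_const_nhds.congr' ?_)
      filter_upwards [hηt] with r hr; rw [hr]
    rw [integral_add hI1 hI2] at i1
    rw [integral_add hI5 hI3] at i2
    rw [e1, e2, norm_zero] at e
    have hpi := Real.pi_pos.ne'
    have e' : (∫ r in Ioi 0, (w r * k r + r * w r * deriv k r)) + ∫ r in Ioi 0, r * f r * η r
        = 2 * N * η 0 := by
      apply mul_left_cancel₀ (mul_ne_zero two_ne_zero hpi)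
      linear_combination e
    rw [← setIntegral_eq_integral_of_forall_compl_eq_zero (s := Ioi (0 : ℝ)) fun r hr => by
      rw [h0 r fun h => hr (hIcc h), zero_smul]]
    have : ∫ r in Ioi 0, k r • (r * deriv w r + M r - 2 * N) =
        (∫ r in Ioi 0, r * deriv w r * k r) + (∫ r in Ioi 0, M r * k r) -
          2 * N * ∫ r in Ioi 0, k r := by
      have hI6 := hI2.add hI3
      rw [Pi.add_def] at hI6
      rw [← integral_const_mul, ← integral_add hI2 hI3, ← integral_sub hI6 (hI4.const_mul _)]
      refine integral_congr_ae (ae_of_all _ fun r => ?_)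
      simp only [smul_eq_mul]; ring
    rw [this]
    linear_combination i1 + i2 - e' - 2 * N * i3
  have := Measure.eqOn_open_of_ae_eq (f := fun r => r * deriv w r + M r - 2 * N)
    (g := fun _ => 0) (U := Ioi 0) (μ := volume) ?_ isOpen_Ioi hcont continuousOn_const hr
  · simp only at this
    linarith
  · rw [Filter.EventuallyEq, ae_restrict_iff' measurableSet_Ioi]
    exact hae

end Converse

/-! ### Identification of radial scalar solutions with shooting profiles. -/

section ScalarProfile

theorem eq_zero_of_tendsto_deriv_of_isBigO {f f' : ℝ → ℝ} {L : ℝ}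
    (hf : ∀ t, HasDerivAt f (f' t) t) (hL : Tendsto f' atTop (𝓝 L))
    (hb : f =O[atTop] fun _ => (1 : ℝ)) : L = 0 := by
  by_contra hne
  obtain ⟨C, hC⟩ := hb.bound
  obtain ⟨T, hT⟩ := eventually_atTop.1 (hC.and (Metric.tendsto_nhds.1 hL (|L| / 2) (by positivity)))
  have hL0 : 0 < |L| := abs_pos.2 hne
  have hC0 : 0 ≤ C := by
    have := (hT T le_rfl).1
    simp only [norm_one, mul_one] at this
    exact (norm_nonneg _).trans this
  set t := T + (4 * C + 1) / |L| with ht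
  have hTt : T ≤ t := by rw [ht]; have : 0 ≤ (4 * C + 1) / |L| := by positivity
                         linarith
  have h1 := norm_sub_le_of_hasDerivAt hTt (f := fun t => f t - L * t)
    (f' := fun t => f' t - L) (B := fun t => |L| / 2 * t) (B' := fun _ => |L| / 2)
    (fun r => by simpa using (hf r).fun_sub ((hasDerivAt_id r).const_mul L))
    (fun r => by simpa using (hasDerivAt_id r).const_mul (|L| / 2))
    (fun r hr => by
      have := (hT r hr.1).2
      rw [Real.dist_eq] at this
      exact this.le)
  have h2 := (hT T le_rfl).1
  have h3 := (hT t hTt).1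
  simp only [norm_one, mul_one, Real.norm_eq_abs] at h1 h2 h3
  have h4 : |L| * (t - T) = 4 * C + 1 := by
    rw [ht]; field_simp; ring
  have h5 : |L * (t - T)| = |L| * (t - T) := by
    rw [abs_mul, abs_of_nonneg (sub_nonneg.2 hTt)]
  have h6 : |L * (t - T)| ≤ |f t| + |f T| + |f t - L * t - (f T - L * T)| := by
    have : L * (t - T) = f t - f T - (f t - L * t - (f T - L * T)) := by ring
    rw [this]
    exact (abs_sub _ _).trans (add_le_add_left (abs_sub _ _) _)
  have h7 : |L| / 2 * t - |L| / 2 * T = |L| * (t - T) / 2 := by ring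
  linarith

/-- A solution which becomes negative with negative slope was nonpositive all along. -/
theorem nonpos_of_tendsto_atBot {w P : ℝ → ℝ} {n : ℝ} (hn : 0 ≤ n)
    (hw : ∀ t, HasDerivAt w (P t) t)
    (hP : ∀ t, HasDerivAt P (-(Real.exp (2 * t) * (Real.exp (w t) * (1 - Real.exp (w t))))) t)
    (hlim : Tendsto P atBot (𝓝 n)) (htop : Tendsto w atTop atBot) (t : ℝ) : w t ≤ 0 := by
  by_contra! ht
  have hwc : Continuous w := continuous_iff_continuousAt.2 fun t => (hw t).continuousAt
  obtain ⟨b, hb⟩ := eventually_atTop.1 (htop.eventually_le_atBot 0)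
  obtain ⟨s, ⟨hs1, hs2⟩, hs3, hs4⟩ := exists_first_of_isClosed (Q := fun r => w r ≤ 0)
    (isClosed_le hwc continuous_const) (le_max_left t b) (hb _ (le_max_right t b))
  have hts : t < s := lt_of_le_of_ne hs1 fun h => by rw [h] at ht; linarith
  -- At `c` the height is positive and the slope negative. Above zero the force of the untruncated
  -- equation points upwards, so going backwards the slope stays at most `P c` and the height
  -- positive, down to `-∞`. This contradicts the limit `n ≥ 0` of the slope.
  obtain ⟨c, hc, hc'⟩ := exists_hasDerivAt_eq_slope w P hts hwc.continuousOn fun r _ => hw r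
  have hwc0 : 0 < w c := not_le.1 (hs4 c ⟨hc.1.le, hc.2⟩)
  have hPc : P c < 0 := by
    rw [hc']
    exact div_neg_of_neg_of_pos (by linarith) (by linarith)
  have hall : ∀ r ≤ c, 0 < w r := by
    by_contra! hcon
    obtain ⟨r, hrc, hr⟩ := hcon
    -- Time is reversed: the last nonpositive height before `c` occurs at `-a`.
    obtain ⟨a, ⟨ha1, ha2⟩, ha3, ha4⟩ := exists_first_of_isClosed (Q := fun q => w (-q) ≤ 0)
      (a := -c) (b := -r) (isClosed_le (hwc.comp continuous_neg) continuous_const)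
      (by linarith) (by simpa using hr)
    have hpos : ∀ q ∈ Ioc (-a) c, 0 < w q := fun q hq => by
      have := ha4 (-q) ⟨by linarith [hq.2], by linarith [hq.1]⟩
      rw [neg_neg] at this
      exact not_le.1 this
    have hPle : ∀ q ∈ Ioc (-a) c, P q ≤ 0 := fun q hq => by
      have := sub_le_of_hasDerivAt hq.2 (fun r => hasDerivAt_const r (0 : ℝ)) hP
        (fun v hv => by
          have h1 := Real.one_le_exp (hpos v ⟨hq.1.trans hv.1, hv.2.le⟩).le
          have := mul_nonneg (Real.exp_pos (2 * v)).le
            (mul_nonneg (Real.exp_pos (w v)).le (sub_nonneg.2 h1))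
          linarith)
      linarith
    have := sub_le_of_hasDerivAt (show -a ≤ c by linarith) hw (fun r => hasDerivAt_const r (0 : ℝ))
      (fun v hv => hPle v ⟨hv.1, hv.2.le⟩)
    linarith
  have hPle : ∀ q ≤ c, P q ≤ P c := fun q hq => by
    have := sub_le_of_hasDerivAt hq (fun r => hasDerivAt_const r (0 : ℝ)) hP
      (fun v hv => by
        have h1 := Real.one_le_exp (hall v hv.2.le).le
        have := mul_nonneg (Real.exp_pos (2 * v)).le
          (mul_nonneg (Real.exp_pos (w v)).le (sub_nonneg.2 h1))
        linarith)
    linarith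
  have := le_of_tendsto hlim (by
    filter_upwards [eventually_le_atBot c] with q hq using hPle q hq)
  linarith

theorem exists_tendsto_atBot_of_deriv_le {x p : ℝ → ℝ} {K : ℝ} (hx : ∀ t, HasDerivAt x (p t) t)
    (hp : Continuous p) (hb : ∀ t ≤ 0, |p t| ≤ K * Real.exp (2 * t)) :
    ∃ c, Tendsto x atBot (𝓝 c) :=
  ⟨_, tendsto_limUnder_of_hasDerivAt_of_integrableOn_Iic (a := 0) (fun t _ => hx t)
    (integrableOn_Iic_of_le_exp hp hb)⟩

variable {a γ : ℝ} {N : ℕ} {W : ℝ → ℝ}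

/-- The profile of the scalar solution with shooting parameter `c`. -/
def profile (a : ℝ) (N : ℕ) (c r : ℝ) : ℝ := shootU N c (Real.log r) - Real.log (1 + a)

theorem tendsto_sub_log_of_hasDecayRate (hγ : 0 < γ) (h : HasDecayRate W γ) :
    Tendsto (fun t => W (Real.exp t)) atTop atBot := by
  obtain ⟨C, hC⟩ := h.bound
  have h1 : Tendsto (fun t : ℝ => C + -2 * γ * t) atTop atBot :=
    tendsto_atBot_add_const_left _ _ (tendsto_id.const_mul_atTop_of_neg (by linarith))
  refine tendsto_atBot_mono' atTop ?_ h1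
  filter_upwards [Real.tendsto_exp_atTop.eventually hC] with t ht
  rw [Real.log_exp, norm_one, mul_one, Real.norm_eq_abs] at ht
  linarith [(abs_le.1 ht).2]

/-- In the variable `log r`, and shifted by `log (1 + a)`, the integrated equation is the shooting
equation without cap. Decay makes the solution nonpositive, so the cap may be inserted and
uniqueness for the truncated problem applies. Decay also excludes bad parameters, and the `O(1)`
remainder determines the final slope. -/
theorem IsRadialCSH.exists_eq_profile (ha : 0 < a) (hγ : 0 < γ) (h : IsRadialCSH a N γ W) :
    ∃ c, Good N c ∧ ell N c = -2 * γ ∧ EqOn W (profile a N c) (Ioi 0) := by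
  have ha1 : 0 < 1 + a := by linarith
  have hWd : ∀ r, 0 < r → HasDerivAt W (deriv W r) r := fun r hr =>
    ((h.contDiffOn.differentiableOn (by norm_num)).differentiableAt (Ioi_mem_nhds hr)).hasDerivAt
  set f : ℝ → ℝ := fun r => (1 + a) * Real.exp (W r) - (1 + a) ^ 2 * Real.exp (2 * W r) with hf
  have hfc : ContinuousOn f (Ioi 0) := by
    have := h.contDiffOn.continuousOn
    rw [hf]; fun_prop
  have hs : SolvesWithDirac (radial W) (radial f) (4 * Real.pi * N) := h.solves
  have hfi := locallyIntegrable_radial_iff hs.locallyIntegrable_f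
  have hint := fun r (hr : 0 < r) => hs.integrated h.contDiffOn hfc hr
  set u : ℝ → ℝ := fun t => W (Real.exp t) + Real.log (1 + a) with hu
  set P : ℝ → ℝ := fun t => 2 * N - ∫ s in (0 : ℝ)..Real.exp t, s * f s with hP
  have hud : ∀ t, HasDerivAt u (P t) t := fun t => by
    refine (((hWd _ (Real.exp_pos t)).comp t (Real.hasDerivAt_exp t)).add_const _).congr_deriv ?_
    have := hint _ (Real.exp_pos t)
    rw [hP]; simp only; linarith
  have hE : ∀ t, Real.exp (u t) = (1 + a) * Real.exp (W (Real.exp t)) := fun t => by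
    rw [hu]; simp only; rw [Real.exp_add, Real.exp_log ha1, mul_comm]
  have hPd : ∀ t, HasDerivAt P
      (-(Real.exp (2 * t) * (Real.exp (u t) * (1 - Real.exp (u t))))) t := fun t => by
    refine (((hasDerivAt_mass hfc hfi (Real.exp_pos t)).comp t
      (Real.hasDerivAt_exp t)).const_sub (2 * (N : ℝ))).congr_deriv ?_
    rw [hE, two_mul t, Real.exp_add, hf]
    simp only
    rw [two_mul (W _), Real.exp_add]
    ring
  have hPlim : Tendsto P atBot (𝓝 (2 * N)) := by
    have h1 : Tendsto Real.exp atBot (𝓝[>] 0) := Real.tendsto_exp_atBot_nhdsGT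
    have := ((tendsto_mass hfi).comp h1).const_sub (2 * (N : ℝ))
    rwa [sub_zero] at this
  have htop : Tendsto u atTop atBot :=
    tendsto_atBot_add_const_right _ _ (tendsto_sub_log_of_hasDecayRate hγ h.decay)
  have hneg := nonpos_of_tendsto_atBot (by positivity) hud hPd hPlim htop
  have hcap : ∀ t, cap (u t) = Real.exp (u t) := fun t => cap_of_nonpos (hneg t)
  have huc : Continuous u := continuous_iff_continuousAt.2 fun t => (hud t).continuousAt
  have hPc : Continuous P := continuous_iff_continuousAt.2 fun t => (hPd t).continuousAt
  have hpd : ∀ t, HasDerivAt (fun t => P t - 2 * N)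
      (Real.exp (2 * t) • -(cap (u t) * (1 - cap (u t)))) t := fun t => by
    refine ((hPd t).sub_const _).congr_deriv ?_
    rw [hcap, smul_eq_mul]; ring
  have hplim : Tendsto (fun t => P t - 2 * N) atBot (𝓝 0) := by
    have := hPlim.sub_const (2 * (N : ℝ))
    rwa [sub_self] at this
  have hxd : ∀ t, HasDerivAt (fun t => u t - 2 * N * t) (P t - 2 * N) t := fun t => by
    simpa using (hud t).fun_sub ((hasDerivAt_id t).const_mul (2 * (N : ℝ)))
  have hpb : ∀ t ≤ 0, |P t - 2 * N| ≤ 1 / 2 * Real.exp (2 * t) := fun t _ => by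
    have := norm_sub_lim_le_of_hasDerivAt (t := t) hpd
      (fun r => (hasDerivAt_exp_two_mul r).const_mul (1 / 2)) (fun r hr => by
        rw [norm_smul, Real.norm_of_nonneg (Real.exp_pos _).le, Real.norm_eq_abs, abs_neg, abs_mul,
          abs_of_pos (cap_pos _), abs_of_nonneg (one_sub_cap_nonneg _)]
        have h1 : cap (u r) * (1 - cap (u r)) ≤ 1 := by
          nlinarith [cap_pos (u r), cap_le_one (u r)]
        have h2 := mul_le_mul_of_nonneg_left h1 (Real.exp_pos (2 * r)).le
        linarith) hplim
      (tendsto_exp_two_mul_atBot.const_mul (1 / 2))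
    simpa using this
  obtain ⟨c, hc⟩ := exists_tendsto_atBot_of_deriv_le hxd (hPc.sub continuous_const) hpb
  have hsol : IsSol (fun t => -(cap (u t) * (1 - cap (u t)))) c (fun t => u t - 2 * N * t)
      (fun t => P t - 2 * N) := ⟨hc, hplim, hxd, hpd⟩
  have heq := IsSol.eq_of_lipschitz hsol (isSol_shoot N c) (L := 1) le_rfl fun t => by
    have h1 : u t - shootU N c t = (u t - 2 * N * t) - shootX N c t := by unfold shootU; ring
    have h2 := abs_cap_mul_sub_le (u t) (shootU N c t)
    rw [h1] at h2
    rw [Real.norm_eq_abs, Real.norm_eq_abs, one_mul, ← abs_neg]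
    refine le_trans (le_of_eq ?_) h2
    ring_nf
  have hU : ∀ t, u t = shootU N c t := fun t => by
    have : u t - 2 * N * t = shootX N c t := congrFun heq.1 t
    unfold shootU; linarith
  have hD : ∀ t, P t = shootD N c t := fun t => by
    have : P t - 2 * N = shootP N c t := congrFun heq.2 t
    unfold shootD; linarith
  have hgood : Good N c := by
    by_contra hng
    obtain ⟨T, hT⟩ := exists_shootU_gt_of_not_good hng one_pos
    obtain ⟨t, ht1, ht2⟩ := ((htop.eventually_lt_atBot (-1)).and (eventually_ge_atTop T)).exists
    rw [hU] at ht1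
    linarith [hT t ht2]
  refine ⟨c, hgood, ?_, fun r hr => ?_⟩
  · have h1 : ∀ t, HasDerivAt (fun t => W (Real.exp t) - -2 * γ * t) (shootD N c t - -2 * γ) t :=
      fun t => by
        have h2 := (hud t).fun_sub ((hasDerivAt_id t).const_mul (-2 * γ))
        rw [hD, mul_one] at h2
        have h3 := h2.sub_const (Real.log (1 + a))
        refine h3.congr_of_eventuallyEq (Eventually.of_forall fun s => ?_)
        simp only [hu, id]; ring
    have h2 := eq_zero_of_tendsto_deriv_of_isBigO h1 (hgood.tendsto_shootD.sub_const _) ?_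
    · linarith
    · have := h.decay.comp_tendsto Real.tendsto_exp_atTop
      refine this.congr_left fun t => ?_
      simp [Real.log_exp]
  · have := hU (Real.log r)
    rw [hu] at this
    simp only [Real.exp_log hr] at this
    rw [profile, ← this]; ring

/-- In the tail `0 ≤ u' - ℓ ≤ e^{u+2t} / η`, and the right-hand side is integrable. -/
theorem Good.isBigO_shootU {c : ℝ} (h : Good N c) :
    (fun t => shootU N c t - ell N c * t) =O[atTop] fun _ => (1 : ℝ) := by
  obtain ⟨T, hT⟩ := h.exists_shootD_lt
  set η := -2 - shootD N c T with hη
  have hη0 : 0 < η := by linarith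
  have hmain : ∀ t ≥ T, 0 ≤ shootD N c t - ell N c ∧
      shootD N c t - ell N c ≤ Real.exp (shootU N c t + 2 * t) / η := fun t ht => by
    refine ⟨sub_nonneg.2 (h.ell_le t), ?_⟩
    have h1 : shootD N c t ≤ -2 - η := by
      have := antitone_shootD N c ht
      linarith
    linarith [h.le_ell hη0 h1]
  have hd : ∀ r, HasDerivAt (fun t => shootU N c t - ell N c * t) (shootD N c r - ell N c) r :=
    fun r => by simpa using (hasDerivAt_shootU N c r).fun_sub ((hasDerivAt_id r).const_mul _)
  refine Asymptotics.IsBigO.of_bound (|shootU N c T - ell N c * T| +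
    Real.exp (shootU N c T + 2 * T) / η / η) ?_
  filter_upwards [eventually_ge_atTop T] with t ht
  have h1 := sub_le_of_hasDerivAt ht (fun r => hasDerivAt_const r (0 : ℝ)) hd
    (fun r hr => (hmain r hr.1.le).1)
  have h2 := sub_le_of_hasDerivAt ht hd
    (fun r => (((hasDerivAt_exp_shootW N c r).div_const η).div_const η).fun_neg) (fun r hr => by
      refine (hmain r hr.1.le).2.trans ?_
      have h3 : shootD N c r + 2 ≤ -η := by
        have := antitone_shootD N c hr.1.le
        linarith
      rw [← neg_div, ← neg_div]
      refine div_le_div_of_nonneg_right ?_ hη0.le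
      rw [le_div_iff₀ hη0]
      nlinarith [Real.exp_pos (shootU N c r + 2 * r)])
  have h4 : 0 ≤ Real.exp (shootU N c t + 2 * t) / η / η := by positivity
  have h5 : 0 ≤ Real.exp (shootU N c T + 2 * T) / η / η := by positivity
  rw [norm_one, mul_one, Real.norm_eq_abs, abs_le]
  have h6 := neg_abs_le (shootU N c T - ell N c * T)
  have h7 := le_abs_self (shootU N c T - ell N c * T)
  constructor <;> linarith

end ScalarProfile

/-! ### Existence and uniqueness for the scalar problem. -/

section ScalarExistence

theorem IsSol.add_const {E : Type*} [NormedAddCommGroup E] [NormedSpace ℝ E] {g : ℝ → E} {x₀ : E}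
    {x p : ℝ → E} (h : IsSol g x₀ x p) (k : E) : IsSol g (x₀ + k) (fun t => x t + k) p :=
  ⟨h.lim_fst.add_const k, h.lim_snd, fun t => (h.hasDerivAt_fst t).add_const k, h.hasDerivAt_snd⟩

theorem IsSol.contDiff_fst {g : ℝ → ℝ} {x₀ : ℝ} {x p : ℝ → ℝ} (h : IsSol g x₀ x p)
    (hg : Continuous g) : ContDiff ℝ 2 x := by
  rw [show (2 : WithTop ℕ∞) = 1 + 1 by norm_num, contDiff_succ_iff_deriv]
  refine ⟨fun t => (h.hasDerivAt_fst t).differentiableAt, by simp, ?_⟩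
  rw [funext fun t => (h.hasDerivAt_fst t).deriv, contDiff_one_iff_deriv]
  refine ⟨fun t => (h.hasDerivAt_snd t).differentiableAt, ?_⟩
  rw [funext fun t => (h.hasDerivAt_snd t).deriv]
  fun_prop

theorem IsSol.contDiffOn_radial {g : ℝ → ℝ} {x₀ : ℝ} {x p : ℝ → ℝ} (h : IsSol g x₀ x p)
    (hg : Continuous g) (N : ℝ) :
    ContDiffOn ℝ 2 (fun r => 2 * N * Real.log r + x (Real.log r)) (Ioi 0) := by
  have hlog : ContDiffOn ℝ 2 Real.log (Ioi 0) :=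
    Real.contDiffOn_log.mono fun r hr => ne_of_gt hr
  exact (contDiffOn_const.mul hlog).add ((h.contDiff_fst hg).comp_contDiffOn hlog)

variable {a γ : ℝ} {N : ℕ} {c : ℝ}

theorem continuous_shootG (N : ℕ) (c : ℝ) :
    Continuous fun t => -(cap (shootU N c t) * (1 - cap (shootU N c t))) := by
  have h1 := continuous_cap.comp (continuous_shootU N c)
  exact (h1.mul (continuous_const.sub h1)).neg

theorem abs_shootG_le (N : ℕ) (c t : ℝ) :
    |-(cap (shootU N c t) * (1 - cap (shootU N c t)))| ≤ 1 := by
  have h1 := cap_pos (shootU N c t)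
  have h2 := cap_le_one (shootU N c t)
  rw [abs_neg, abs_of_nonneg (mul_nonneg h1.le (by linarith))]
  nlinarith

theorem profile_eq (a : ℝ) (N : ℕ) (c : ℝ) : profile a N c = fun r =>
    2 * (N : ℝ) * Real.log r + (shootX N c (Real.log r) + -Real.log (1 + a)) := by
  funext r
  rw [profile, shootU]; ring

theorem Good.isRadialCSH_profile (ha : 0 < a) (h : Good N c) (hc : ell N c = -2 * γ) :
    IsRadialCSH a N γ (profile a N c) := by
  have ha1 : 0 < 1 + a := by linarith
  have hsol := (isSol_shoot N c).add_const (-Real.log (1 + a))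
  refine ⟨?_, ?_, ?_⟩
  · rw [profile_eq]
    exact hsol.contDiffOn_radial (continuous_shootG N c) N
  · have h1 := hsol.solvesWithDirac (continuous_shootG N c)
      (fun T => ⟨1, fun t _ => abs_shootG_le N c t⟩) N
    rw [← profile_eq] at h1
    convert h1 using 1
    funext y
    simp only [radial, profile, neg_neg]
    rw [cap_of_nonpos (h.shootU_neg _).le, mul_sub 2, Real.exp_sub, Real.exp_sub, two_mul, two_mul,
      Real.exp_add, Real.exp_add, Real.exp_log ha1]
    field_simp
  · have h1 := h.isBigO_shootU.comp_tendsto Real.tendsto_log_atTop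
    have h2 : (fun _ : ℝ => -Real.log (1 + a)) =O[atTop] fun _ => (1 : ℝ) :=
      Asymptotics.isBigO_const_const _ one_ne_zero _
    refine (h1.add h2).congr_left fun r => ?_
    simp only [Function.comp, profile, hc]
    ring

theorem tendsto_profile (a : ℝ) (N : ℕ) (c : ℝ) :
    Tendsto (fun r => profile a N c r - 2 * N * Real.log r) (𝓝[>] 0)
      (𝓝 (c - Real.log (1 + a))) := by
  have h1 := ((isSol_shoot N c).lim_fst.comp tendsto_log_nhdsGT).sub_const (Real.log (1 + a))
  refine h1.congr fun r => ?_
  simp only [Function.comp, profile, shootU]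
  ring

/-- Existence and uniqueness of the scalar radial solution with given decay rate. -/
theorem exists_unique_radialCSH (ha : 0 < a) (hγ : (N : ℝ) + 2 < γ) :
    ∃ c, Good N c ∧ ell N c = -2 * γ ∧ IsRadialCSH a N γ (profile a N c) ∧
      ∀ W, IsRadialCSH a N γ W → EqOn W (profile a N c) (Ioi 0) := by
  have hN : (0 : ℝ) ≤ N := Nat.cast_nonneg N
  obtain ⟨c, hc, hl⟩ := exists_good_ell_eq N (l := -2 * γ) (by linarith)
  refine ⟨c, hc, hl, hc.isRadialCSH_profile ha hl, fun W hW => ?_⟩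
  obtain ⟨b, hb, hlb, heq⟩ := hW.exists_eq_profile ha (by linarith)
  rwa [ell_injective hb hc (hlb.trans hl.symm)] at heq

end ScalarExistence

/-! ### Perturbations of the Liouville system and their conserved quantities. -/

section Flow

/-- The energy of the autonomous Liouville system. -/
def energy (a₁ a₂ X Y x y : ℝ) : ℝ :=
  J a₁ a₂ x y + (1 + a₁ + a₂) * (a₂ * Real.exp X + a₁ * Real.exp Y)

theorem J_comm (a₁ a₂ x y : ℝ) : J a₁ a₂ x y = J a₂ a₁ y x := by unfold J; ring

theorem energy_comm (a₁ a₂ X Y x y : ℝ) : energy a₁ a₂ X Y x y = energy a₂ a₁ Y X y x := by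
  unfold energy; rw [J_comm]; ring

/-- A perturbation of the autonomous Liouville system after the time `T`, with bound `C` and
error `δ`. The functions `m₁` and `m₂` are the masses of the two components. -/
structure Flow (a₁ a₂ C δ T : ℝ) (X Y x y m₁ m₂ θ₁ θ₂ : ℝ → ℝ) : Prop where
  pos₁ : 0 < a₁
  pos₂ : 0 < a₂
  le_half : δ ≤ 1 / 2
  hX : ∀ t, HasDerivAt X (x t) t
  hY : ∀ t, HasDerivAt Y (y t) t
  hx : ∀ t, HasDerivAt x
    (-(1 + a₁) * θ₁ t * Real.exp (X t) + a₁ * θ₂ t * Real.exp (Y t)) t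
  hy : ∀ t, HasDerivAt y
    (-(1 + a₂) * θ₂ t * Real.exp (Y t) + a₂ * θ₁ t * Real.exp (X t)) t
  hm₁ : ∀ t, HasDerivAt m₁ (Real.exp (X t)) t
  hm₂ : ∀ t, HasDerivAt m₂ (Real.exp (Y t)) t
  hθ₁ : ∀ t ≥ T, |θ₁ t - 1| ≤ δ
  hθ₂ : ∀ t ≥ T, |θ₂ t - 1| ≤ δ
  energy_le : ∀ t ≥ T, |energy a₁ a₂ (X t) (Y t) (x t) (y t) -
    energy a₁ a₂ (X T) (Y T) (x T) (y T)| ≤ δ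
  exp_X_le : ∀ t ≥ T, Real.exp (X t) ≤ C
  exp_Y_le : ∀ t ≥ T, Real.exp (Y t) ≤ C
  abs_x_le : ∀ t ≥ T, |x t| ≤ C
  abs_y_le : ∀ t ≥ T, |y t| ≤ C

variable {a₁ a₂ C δ T : ℝ} {X Y x y m₁ m₂ θ₁ θ₂ : ℝ → ℝ}

namespace Flow

theorem symm (h : Flow a₁ a₂ C δ T X Y x y m₁ m₂ θ₁ θ₂) :
    Flow a₂ a₁ C δ T Y X y x m₂ m₁ θ₂ θ₁ where
  pos₁ := h.pos₂
  pos₂ := h.pos₁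
  le_half := h.le_half
  hX := h.hY
  hY := h.hX
  hx := h.hy
  hy := h.hx
  hm₁ := h.hm₂
  hm₂ := h.hm₁
  hθ₁ := h.hθ₂
  hθ₂ := h.hθ₁
  energy_le t ht := by
    rw [energy_comm a₂, energy_comm a₂]; exact h.energy_le t ht
  exp_X_le := h.exp_Y_le
  exp_Y_le := h.exp_X_le
  abs_x_le := h.abs_y_le
  abs_y_le := h.abs_x_le

theorem continuous_X (h : Flow a₁ a₂ C δ T X Y x y m₁ m₂ θ₁ θ₂) :
    Continuous X := continuous_iff_continuousAt.2 fun t => (h.hX t).continuousAt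

theorem continuous_x (h : Flow a₁ a₂ C δ T X Y x y m₁ m₂ θ₁ θ₂) :
    Continuous x := continuous_iff_continuousAt.2 fun t => (h.hx t).continuousAt

theorem θ₁_mem (h : Flow a₁ a₂ C δ T X Y x y m₁ m₂ θ₁ θ₂)
    {t : ℝ} (ht : T ≤ t) : 1 - δ ≤ θ₁ t ∧ θ₁ t ≤ 1 + δ := by
  have := abs_le.1 (h.hθ₁ t ht)
  constructor <;> linarith [this.1, this.2]

theorem θ₁_mem' (h : Flow a₁ a₂ C δ T X Y x y m₁ m₂ θ₁ θ₂)
    {t : ℝ} (ht : T ≤ t) : 1 / 2 ≤ θ₁ t ∧ θ₁ t ≤ 3 / 2 := by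
  have := h.θ₁_mem ht
  have := h.le_half
  constructor <;> linarith

theorem C_pos (h : Flow a₁ a₂ C δ T X Y x y m₁ m₂ θ₁ θ₂) :
    0 < C := (Real.exp_pos _).trans_le (h.exp_X_le T le_rfl)

theorem mass_mono (h : Flow a₁ a₂ C δ T X Y x y m₁ m₂ θ₁ θ₂)
    {s t : ℝ} (hst : s ≤ t) : m₁ s ≤ m₁ t := by
  have := sub_le_of_hasDerivAt hst (fun r => hasDerivAt_const r (0 : ℝ)) h.hm₁
    (fun r _ => (Real.exp_pos _).le)
  linarith

/-- A component with negative slope has small mass. -/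
theorem decay (h : Flow a₁ a₂ C δ T X Y x y m₁ m₂ θ₁ θ₂)
    {k s t : ℝ} (hk : 0 < k) (hst : s ≤ t) (hx : ∀ r ∈ Ioo s t, x r ≤ -k) :
    m₁ t - m₁ s ≤ Real.exp (X s) / k ∧ X t ≤ X s - k * (t - s) := by
  constructor
  · have := sub_le_of_hasDerivAt hst h.hm₁ (fun r => ((h.hX r).exp.div_const k).fun_neg)
      (fun r hr => by
        rw [← neg_div, le_div_iff₀ hk]
        nlinarith [hx r hr, Real.exp_pos (X r)])
    have h2 : 0 ≤ Real.exp (X t) / k := by positivity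
    linarith
  · have := sub_le_of_hasDerivAt hst h.hX (fun r => (hasDerivAt_id r).const_mul (-k))
      (fun r hr => by simpa using hx r hr)
    simp only [id] at this
    linarith

theorem X_sub_le (h : Flow a₁ a₂ C δ T X Y x y m₁ m₂ θ₁ θ₂)
    {s t : ℝ} (hs : T ≤ s) (hst : s ≤ t) : |X t - X s| ≤ C * (t - s) := by
  have := norm_sub_le_of_hasDerivAt hst h.hX (fun r => (hasDerivAt_id r).const_mul C)
    (fun r hr => by simpa using h.abs_x_le r (hs.trans hr.1))
  simp only [id, Real.norm_eq_abs] at this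
  linarith

/-- The combination of slopes that is driven by the first component only. -/
theorem lin_sub (h : Flow a₁ a₂ C δ T X Y x y m₁ m₂ θ₁ θ₂)
    {s t : ℝ} (hs : T ≤ s) (hst : s ≤ t) :
    (1 + a₂) * x t + a₁ * y t ≤ (1 + a₂) * x s + a₁ * y s ∧
    (1 + a₂) * x s + a₁ * y s - 3 / 2 * (1 + a₁ + a₂) * (m₁ t - m₁ s)
      ≤ (1 + a₂) * x t + a₁ * y t := by
  have hd : ∀ r, HasDerivAt (fun r => (1 + a₂) * x r + a₁ * y r)
      (-((1 + a₁ + a₂) * θ₁ r * Real.exp (X r))) r := fun r => by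
    refine (((h.hx r).const_mul (1 + a₂)).fun_add ((h.hy r).const_mul a₁)).congr_deriv ?_
    ring
  have hD : 0 < 1 + a₁ + a₂ := by linarith [h.pos₁, h.pos₂]
  constructor
  · have := sub_le_of_hasDerivAt hst hd (fun r => hasDerivAt_const r (0 : ℝ)) (fun r hr => by
      have h1 := (h.θ₁_mem' (hs.trans hr.1.le)).1
      have : 0 ≤ (1 + a₁ + a₂) * θ₁ r * Real.exp (X r) := by positivity
      linarith)
    linarith
  · have := sub_le_of_hasDerivAt hst
      (fun r => ((h.hm₁ r).const_mul (3 / 2 * (1 + a₁ + a₂))).fun_neg) hd (fun r hr => by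
        have h1 := (h.θ₁_mem' (hs.trans hr.1.le)).2
        have h2 := mul_le_mul_of_nonneg_left h1
          (mul_pos hD (Real.exp_pos (X r))).le
        linarith)
    linarith

/-- Each weight is replaced by its worst value. The crude `3 / 2` is enough where the first mass is
small, whereas the sharp factor `1 - δ` on the second mass is needed for its limit. -/
theorem y_sub_le (h : Flow a₁ a₂ C δ T X Y x y m₁ m₂ θ₁ θ₂)
    {s t : ℝ} (hs : T ≤ s) (hst : s ≤ t) :
    y t - y s ≤ 3 / 2 * a₂ * (m₁ t - m₁ s) - (1 - δ) * (1 + a₂) * (m₂ t - m₂ s) := by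
  have := sub_le_of_hasDerivAt hst h.hy (fun r => ((h.hm₁ r).const_mul (3 / 2 * a₂)).fun_sub
    ((h.hm₂ r).const_mul ((1 - δ) * (1 + a₂)))) (fun r hr => by
      have hr' := hs.trans hr.1.le
      have h1 := mul_le_mul_of_nonneg_left (h.θ₁_mem' hr').2
        (mul_pos h.pos₂ (Real.exp_pos (X r))).le
      have h2 := mul_le_mul_of_nonneg_left (h.symm.θ₁_mem hr').1
        (mul_pos (by linarith [h.pos₂] : 0 < 1 + a₂) (Real.exp_pos (Y r))).le
      linarith)
  linarith

/-- The first component only pushes `y` upwards, so it may be dropped from the lower bound. -/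
theorem le_y_sub (h : Flow a₁ a₂ C δ T X Y x y m₁ m₂ θ₁ θ₂)
    {s t : ℝ} (hs : T ≤ s) (hst : s ≤ t) :
    -((1 + δ) * (1 + a₂) * (m₂ t - m₂ s)) ≤ y t - y s := by
  have := sub_le_of_hasDerivAt hst
    (fun r => ((h.hm₂ r).const_mul ((1 + δ) * (1 + a₂))).fun_neg) h.hy (fun r hr => by
      have hr' := hs.trans hr.1.le
      have h1 : 0 ≤ a₂ * θ₁ r * Real.exp (X r) := by
        have := (h.θ₁_mem' hr').1
        have := h.pos₂
        positivity
      have h2 := mul_le_mul_of_nonneg_left (h.symm.θ₁_mem hr').2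
        (mul_pos (by linarith [h.pos₂] : 0 < 1 + a₂) (Real.exp_pos (Y r))).le
      linarith)
  linarith

end Flow

/-- The first integral of the second component, up to errors. -/
theorem abs_first_integral_le {a₁ a₂ X Y x y l σ η : ℝ} (h₁ : 0 < a₁) (h₂ : 0 < a₂)
    (hη : η ≤ 1)
    (hl : |(1 + a₂) * x + a₁ * y - l| ≤ η) (hX : Real.exp X ≤ η)
    (hE : |energy a₁ a₂ X Y x y -
      (a₂ / (2 * (1 + a₂)) * l ^ 2 + a₁ * (1 + a₁ + a₂) / (2 * (1 + a₂)) * σ ^ 2)| ≤ η) :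
    |y ^ 2 + 2 * (1 + a₂) * Real.exp Y - σ ^ 2| ≤
      (2 * (1 + a₂) * (1 + (1 + a₁ + a₂) * a₂) + a₂ * (2 * |l| + 1)) / (a₁ * (1 + a₁ + a₂)) * η := by
  set L := (1 + a₂) * x + a₁ * y with hL
  set D := 1 + a₁ + a₂ with hD
  have hD0 : 0 < D := by linarith
  have hb : 0 < 1 + a₂ := by linarith
  have hη0 : 0 ≤ η := (abs_nonneg _).trans hl
  -- `J` is a sum of squares of `(1 + a₂) x + a₁ y` and `y`. Removing the first square and the term
  -- with `e^X` from the energy leaves the energy of the scalar Liouville equation for `Y`.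
  have key : a₁ * D * (y ^ 2 + 2 * (1 + a₂) * Real.exp Y - σ ^ 2) =
      2 * (1 + a₂) * (energy a₁ a₂ X Y x y -
      (a₂ / (2 * (1 + a₂)) * l ^ 2 + a₁ * D / (2 * (1 + a₂)) * σ ^ 2))
      - 2 * (1 + a₂) * D * a₂ * Real.exp X - a₂ * (L - l) * (L + l) := by
    rw [hL]
    unfold energy J
    rw [← hD]
    field_simp
    rw [hD]
    ring
  have hLl : |L + l| ≤ 2 * |l| + 1 := by
    have h1 : L + l = (L - l) + 2 * l := by ring
    rw [h1]
    refine (abs_add_le _ _).trans ?_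
    rw [abs_mul, abs_two]
    linarith
  have h1 : |a₂ * (L - l) * (L + l)| ≤ a₂ * η * (2 * |l| + 1) := by
    rw [abs_mul, abs_mul, abs_of_pos h₂]
    gcongr
  have h2 : |2 * (1 + a₂) * D * a₂ * Real.exp X| ≤ 2 * (1 + a₂) * D * a₂ * η := by
    rw [abs_of_pos (by positivity)]
    gcongr
  have h3 : |a₁ * D * (y ^ 2 + 2 * (1 + a₂) * Real.exp Y - σ ^ 2)| ≤
      2 * (1 + a₂) * η + 2 * (1 + a₂) * D * a₂ * η + a₂ * η * (2 * |l| + 1) := by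
    rw [key]
    refine (abs_sub _ _).trans (add_le_add ((abs_sub _ _).trans (add_le_add ?_ h2)) h1)
    rw [abs_mul, abs_of_pos (by positivity : 0 < 2 * (1 + a₂))]
    gcongr
  rw [abs_mul, abs_of_pos (by positivity)] at h3
  rw [div_mul_eq_mul_div, le_div_iff₀ (by positivity)]
  linarith

end Flow

/-! ### Rise, turn, descent and final decay of the second component. -/

section Phases

namespace Flow

variable {a₁ a₂ C δ T : ℝ} {X Y x y m₁ m₂ θ₁ θ₂ : ℝ → ℝ}

/-- The second component rises with constant slope while the first one decays. -/
theorem rise (h : Flow a₁ a₂ C δ T X Y x y m₁ m₂ θ₁ θ₂) {ρ σ κ η l : ℝ} (hρ : 0 < ρ)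
    (hκ : 0 < κ) (hκσ : κ ≤ σ / 2) (hl : l = -(1 + a₂) * ρ + a₁ * σ)
    (hL : |(1 + a₂) * x T + a₁ * y T - l| ≤ η / 2)
    (hX : 3 * (1 + a₁ + a₂) * (Real.exp (X T) / ρ) ≤ η / 2)
    (hηκ : a₁ * κ + η < (1 + a₂) * ρ / 2) (hy : σ - κ < y T) :
    ∃ s, T ≤ s ∧ y s = σ - κ ∧ ∀ t ∈ Icc T s, σ - κ ≤ y t ∧ x t ≤ -(ρ / 2) ∧
      |(1 + a₂) * x t + a₁ * y t - l| ≤ η := by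
  have hb : 0 < 1 + a₂ := by linarith [h.pos₂]
  have hest : ∀ t ≥ T, (∀ r ∈ Ioo T t, x r ≤ -(ρ / 2)) →
      |(1 + a₂) * x t + a₁ * y t - l| ≤ η := fun t ht hr => by
    have h1 := (h.decay (half_pos hρ) ht hr).1
    obtain ⟨h2, h3⟩ := h.lin_sub le_rfl ht
    have hD : 0 < 3 / 2 * (1 + a₁ + a₂) := by linarith [h.pos₁, h.pos₂]
    have h4 := mul_le_mul_of_nonneg_left h1 hD.le
    have h5 : 3 / 2 * (1 + a₁ + a₂) * (Real.exp (X T) / (ρ / 2)) =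
        3 * (1 + a₁ + a₂) * (Real.exp (X T) / ρ) := by field_simp
    obtain ⟨h6, h7⟩ := abs_le.1 hL
    rw [abs_le]
    constructor <;> linarith
  -- As long as `y ≥ σ - κ`, near-conservation of `(1 + a₂) x + a₁ y` prevents `x` from climbing to
  -- `-ρ / 2`.
  have hclaim : ∀ t ≥ T, (∀ r ∈ Icc T t, σ - κ ≤ y r) → x t < -(ρ / 2) := fun t ht hr => by
    by_contra! hc
    obtain ⟨s, hs, hs1, hs2⟩ := exists_first_of_isClosed (Q := fun r => -(ρ / 2) ≤ x r)
      (isClosed_le continuous_const h.continuous_x) ht hc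
    have h1 := (abs_le.1 (hest s hs.1 fun r hr => (not_le.1 (hs2 r ⟨hr.1.le, hr.2⟩)).le)).2
    have h2 := mul_le_mul_of_nonneg_left (hr s hs) h.pos₁.le
    have h3 := mul_le_mul_of_nonneg_left hs1 hb.le
    rw [hl] at h1
    linarith
  -- Otherwise `Y` would rise with slope at least `σ / 2` forever and pass its upper bound `log C`.
  obtain ⟨b, hb1, hb2⟩ : ∃ b ≥ T, y b ≤ σ - κ := by
    by_contra! hc
    have hYT : Y T ≤ Real.log C := (Real.le_log_iff_exp_le h.C_pos).2 (h.exp_Y_le T le_rfl)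
    have hσ : 0 < σ / 2 := by linarith
    set t := T + (Real.log C - Y T + 1) / (σ / 2) with ht
    have hTt : T ≤ t := by
      rw [ht]
      have : 0 ≤ (Real.log C - Y T + 1) / (σ / 2) := div_nonneg (by linarith) hσ.le
      linarith
    have h1 := sub_le_of_hasDerivAt hTt (fun r => (hasDerivAt_id r).const_mul (σ / 2)) h.hY
      (fun r hr => by
        have := hc r hr.1.le
        simp only [mul_one]; linarith)
    have h2 : Y t ≤ Real.log C := (Real.le_log_iff_exp_le h.C_pos).2 (h.exp_Y_le t hTt)
    have h3 : σ / 2 * (t - T) = Real.log C - Y T + 1 := by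
      rw [ht, add_sub_cancel_left, mul_div_cancel₀ _ hσ.ne']
    simp only [id] at h1
    linarith
  obtain ⟨s, hs, hs1, hs2⟩ := exists_first_of_isClosed (Q := fun r => y r ≤ σ - κ)
    (isClosed_le h.symm.continuous_x continuous_const) hb1 hb2
  have hTs : T < s := lt_of_le_of_ne hs.1 fun he => by rw [← he] at hs1; linarith
  have hys : σ - κ ≤ y s := by
    have hcl : s ∈ closure (Ico T s) := by
      rw [closure_Ico hTs.ne]; exact right_mem_Icc.2 hTs.le
    exact closure_minimal (fun r hr => (not_le.1 (hs2 r hr)).le)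
      (isClosed_le continuous_const h.symm.continuous_x) hcl
  have hy' : ∀ r ∈ Icc T s, σ - κ ≤ y r := fun r hr => by
    rcases hr.2.eq_or_lt with he | hlt
    · rw [he]; exact hys
    · exact (not_le.1 (hs2 r ⟨hr.1, hlt⟩)).le
  have hx' : ∀ r ∈ Icc T s, x r ≤ -(ρ / 2) := fun r hr =>
    (hclaim r hr.1 fun q hq => hy' q ⟨hq.1, hq.2.trans hr.2⟩).le
  exact ⟨s, hs.1, le_antisymm hs1 hys, fun t ht => ⟨hy' t ht, hx' t ht,
    hest t ht.1 fun r hr => hx' r ⟨hr.1.le, hr.2.le.trans ht.2⟩⟩⟩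

/-- The slope of the second component is reversed within a bounded time. -/
theorem turn (h : Flow a₁ a₂ C δ T X Y x y m₁ m₂ θ₁ θ₂) {σ κ η ν l K s : ℝ} (hTs : T ≤ s)
    (hκ : 0 < κ) (hκσ : κ ≤ σ / 2) (hη : η ≤ 1) (hys : y s = σ - κ)
    (hL : |(1 + a₂) * x s + a₁ * y s - l| ≤ η / 2)
    (hX : Real.exp (X s + C * (32 / κ)) ≤ ν) (hνη : ν ≤ η)
    (hντ : 3 / 2 * (1 + a₁ + a₂) * (ν * (32 / κ)) ≤ η / 2)
    (hE : ∀ t ≥ T, |energy a₁ a₂ (X t) (Y t) (x t) (y t) -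
      (a₂ / (2 * (1 + a₂)) * l ^ 2 + a₁ * (1 + a₁ + a₂) / (2 * (1 + a₂)) * σ ^ 2)| ≤ η)
    (hK : (2 * (1 + a₂) * (1 + (1 + a₁ + a₂) * a₂) + a₂ * (2 * |l| + 1)) /
      (a₁ * (1 + a₁ + a₂)) = K)
    (hKη : K * η ≤ σ * κ / 4) (hν : 3 / 2 * a₂ * ν ≤ σ * κ / 16) :
    ∃ t ∈ Icc s (s + 32 / κ), y t = -(σ - κ) ∧ |(1 + a₂) * x t + a₁ * y t - l| ≤ η ∧
      m₁ t - m₁ s ≤ ν * (32 / κ) ∧ Real.exp (X t) ≤ ν ∧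
      |y t ^ 2 + 2 * (1 + a₂) * Real.exp (Y t) - σ ^ 2| ≤ K * η := by
  have hb : 0 < 1 + a₂ := by linarith [h.pos₂]
  have hσ : 0 < σ := by linarith
  have hτ : 0 < 32 / κ := by positivity
  have hXt : ∀ t ∈ Icc s (s + 32 / κ), Real.exp (X t) ≤ ν := fun t ht => by
    refine le_trans (Real.exp_le_exp.2 ?_) hX
    have h1 := (abs_le.1 (h.X_sub_le hTs ht.1)).2
    have h2 := mul_le_mul_of_nonneg_left (show t - s ≤ 32 / κ by linarith [ht.2]) h.C_pos.le
    linarith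
  have hν0 : 0 < ν := (Real.exp_pos _).trans_le hX
  have hm : ∀ t ∈ Icc s (s + 32 / κ), m₁ t - m₁ s ≤ ν * (32 / κ) := fun t ht => by
    have h1 := sub_le_of_hasDerivAt ht.1 h.hm₁ (fun r => (hasDerivAt_id r).const_mul ν)
      (fun r hr => by simpa using hXt r ⟨hr.1.le, hr.2.le.trans ht.2⟩)
    have h2 := mul_le_mul_of_nonneg_left (show t - s ≤ 32 / κ by linarith [ht.2]) hν0.le
    simp only [id] at h1
    linarith
  have hLt : ∀ t ∈ Icc s (s + 32 / κ), |(1 + a₂) * x t + a₁ * y t - l| ≤ η := fun t ht => by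
    obtain ⟨h2, h3⟩ := h.lin_sub hTs ht.1
    have hD : 0 < 3 / 2 * (1 + a₁ + a₂) := by linarith [h.pos₁, h.pos₂]
    have h4 := mul_le_mul_of_nonneg_left (hm t ht) hD.le
    obtain ⟨h6, h7⟩ := abs_le.1 hL
    rw [abs_le]
    constructor <;> linarith
  have hG : ∀ t ∈ Icc s (s + 32 / κ),
      |y t ^ 2 + 2 * (1 + a₂) * Real.exp (Y t) - σ ^ 2| ≤ K * η := fun t ht => by
    rw [← hK]
    exact abs_first_integral_le h.pos₁ h.pos₂ hη (hLt t ht) ((hXt t ht).trans hνη)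
      (hE t (hTs.trans ht.1))
  -- For these `y` the first integral forces `2 (1 + a₂) e^Y ≥ σ κ / 2`, so `y` falls at rate at
  -- least `σ κ / 16`. The required drop is less than `2 σ`, whence the time `32 / κ`.
  have hder : ∀ t ∈ Icc s (s + 32 / κ), -(σ - κ) ≤ y t → y t ≤ σ - κ / 2 →
      -(1 + a₂) * θ₂ t * Real.exp (Y t) + a₂ * θ₁ t * Real.exp (X t) ≤ -(σ * κ / 16) := by
    intro t ht h1 h2
    have h3 := (abs_le.1 (hG t ht)).1
    have h4 : y t ^ 2 ≤ (σ - κ / 2) ^ 2 := sq_le_sq' (by linarith) h2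
    have h5 : σ * κ / 2 ≤ 2 * (1 + a₂) * Real.exp (Y t) := by nlinarith
    have h6 := mul_le_mul_of_nonneg_right (h.symm.θ₁_mem' (hTs.trans ht.1)).1
      (mul_pos hb (Real.exp_pos (Y t))).le
    have h7 := mul_le_mul (h.θ₁_mem' (hTs.trans ht.1)).2 (hXt t ht) (Real.exp_pos _).le
      (by norm_num)
    have h8 := mul_le_mul_of_nonneg_left h7 h.pos₂.le
    linarith
  have hclaim : ∀ t ∈ Icc s (s + 32 / κ), (∀ r ∈ Ico s t, -(σ - κ) ≤ y r) →
      y t ≤ σ - κ - σ * κ / 16 * (t - s) := by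
    intro t ht hr
    have hlt : ∀ q ∈ Icc s t, y q < σ - κ / 2 := by
      by_contra! hc
      obtain ⟨q, hq, hq1⟩ := hc
      obtain ⟨p, hp, hp1, hp2⟩ := exists_first_of_isClosed (Q := fun r => σ - κ / 2 ≤ y r)
        (isClosed_le continuous_const h.symm.continuous_x) hq.1 hq1
      have := sub_le_of_hasDerivAt hp.1 h.hy (fun r => hasDerivAt_const r (0 : ℝ))
        (fun r hr' => by
          have := hder r ⟨hr'.1.le, hr'.2.le.trans (hp.2.trans (hq.2.trans ht.2))⟩
            (hr r ⟨hr'.1.le, hr'.2.trans_le (hp.2.trans hq.2)⟩)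
            (not_le.1 (hp2 r ⟨hr'.1.le, hr'.2⟩)).le
          have : 0 < σ * κ / 16 := by positivity
          linarith)
      linarith
    have := sub_le_of_hasDerivAt ht.1 h.hy (fun r => (hasDerivAt_id r).const_mul (-(σ * κ / 16)))
      (fun r hr' => by
        rw [mul_one]
        exact hder r ⟨hr'.1.le, hr'.2.le.trans ht.2⟩ (hr r ⟨hr'.1.le, hr'.2⟩)
          (hlt r ⟨hr'.1.le, hr'.2.le⟩).le)
    simp only [id] at this
    linarith
  obtain ⟨b, hb1, hb2⟩ : ∃ b ∈ Icc s (s + 32 / κ), y b ≤ -(σ - κ) := by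
    by_contra! hc
    have hend : s + 32 / κ ∈ Icc s (s + 32 / κ) := right_mem_Icc.2 (by linarith)
    have h1 := hclaim _ hend fun r hr => (hc r ⟨hr.1, hr.2.le⟩).le
    have h2 := hc _ hend
    have h3 : σ * κ / 16 * (s + 32 / κ - s) = 2 * σ := by field_simp; ring
    linarith
  obtain ⟨t, ht, ht1, ht2⟩ := exists_first_of_isClosed (Q := fun r => y r ≤ -(σ - κ))
    (isClosed_le h.symm.continuous_x continuous_const) hb1.1 hb2
  have ht' : t ∈ Icc s (s + 32 / κ) := ⟨ht.1, ht.2.trans hb1.2⟩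
  have hst : s < t := lt_of_le_of_ne ht.1 fun he => by rw [← he] at ht1; linarith
  have hyt : -(σ - κ) ≤ y t := by
    have hcl : t ∈ closure (Ico s t) := by
      rw [closure_Ico hst.ne]; exact right_mem_Icc.2 hst.le
    exact closure_minimal (fun r hr => (not_le.1 (ht2 r hr)).le)
      (isClosed_le continuous_const h.symm.continuous_x) hcl
  exact ⟨t, ht', le_antisymm ht1 hyt, hLt t ht', hm t ht', hXt t ht', hG t ht'⟩

/-- The second component decays with constant slope until it meets the first one. -/
theorem descend (h : Flow a₁ a₂ C δ T X Y x y m₁ m₂ θ₁ θ₂) {σ κ η ω ξ l A s : ℝ} (hTs : T ≤ s)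
    (hσ : 0 < σ) (hA : 0 ≤ A) (hl : l = (1 + a₂) * A - a₁ * σ) (hys : y s ≤ -σ + κ)
    (hL : |(1 + a₂) * x s + a₁ * y s - l| ≤ η) (hY : Real.exp (Y s) ≤ ω) (hXY : X s ≤ Y s)
    (hκξ : κ + 3 / 2 * a₂ * (ω / (σ / 2)) ≤ ξ)
    (hηξ : η + 3 / 2 * (1 + a₁ + a₂) * (ω / (σ / 2)) ≤ ξ)
    (hξ : ξ * (2 + a₁ + a₂) ≤ (1 + a₂) * σ / 2) (hξσ : ξ < σ / 2) :
    ∃ t ≥ s, X t = Y t ∧ y t ≤ -σ + ξ ∧ |(1 + a₂) * x t + a₁ * y t - l| ≤ ξ ∧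
      m₁ t - m₁ s ≤ ω / (σ / 2) ∧ m₂ t - m₂ s ≤ ω / (σ / 2) ∧ Y t ≤ Y s := by
  have hb : 0 < 1 + a₂ := by linarith [h.pos₂]
  -- While `X ≤ Y` the first mass is dominated by the second, which is small because `Y` decays;
  -- both slopes are then nearly constant.
  have hm : ∀ t ≥ s, (∀ r ∈ Ioo s t, X r ≤ Y r) → m₁ t - m₁ s ≤ m₂ t - m₂ s := fun t ht hr =>
    sub_le_of_hasDerivAt ht h.hm₁ h.hm₂ fun r hr' => Real.exp_le_exp.2 (hr r hr')
  have hest : ∀ t ≥ s, (∀ r ∈ Ioo s t, X r ≤ Y r) → (∀ r ∈ Ioo s t, y r ≤ -(σ / 2)) →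
      m₂ t - m₂ s ≤ ω / (σ / 2) ∧ y t ≤ -σ + ξ ∧ |(1 + a₂) * x t + a₁ * y t - l| ≤ ξ := by
    intro t ht hr hr'
    have h1 := (h.symm.decay (half_pos hσ) ht hr').1.trans
      (div_le_div_of_nonneg_right hY (half_pos hσ).le)
    have h2 := (hm t ht hr).trans h1
    refine ⟨h1, ?_, ?_⟩
    · have h3 := h.y_sub_le hTs ht
      have h4 : 0 ≤ (1 - δ) * (1 + a₂) * (m₂ t - m₂ s) :=
        mul_nonneg (mul_nonneg (by linarith [h.le_half]) hb.le)
          (sub_nonneg.2 (h.symm.mass_mono ht))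
      have h5 := mul_le_mul_of_nonneg_left h2 (by linarith [h.pos₂] : 0 ≤ 3 / 2 * a₂)
      linarith
    · obtain ⟨h3, h4⟩ := h.lin_sub hTs ht
      have hD : 0 < 3 / 2 * (1 + a₁ + a₂) := by linarith [h.pos₁, h.pos₂]
      have h5 := mul_le_mul_of_nonneg_left h2 hD.le
      have h8 := mul_nonneg hD.le (sub_nonneg.2 (h.mass_mono ht))
      obtain ⟨h6, h7⟩ := abs_le.1 hL
      rw [abs_le]
      constructor <;> linarith
  have hclaim : ∀ t ≥ s, (∀ r ∈ Ioo s t, X r ≤ Y r) → y t < -(σ / 2) := by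
    intro t ht hr
    by_contra! hc
    obtain ⟨q, hq, hq1, hq2⟩ := exists_first_of_isClosed (Q := fun r => -(σ / 2) ≤ y r)
      (isClosed_le continuous_const h.symm.continuous_x) ht hc
    have := (hest q hq.1 (fun r hr' => hr r ⟨hr'.1, hr'.2.trans_le hq.2⟩)
      (fun r hr' => (not_le.1 (hq2 r ⟨hr'.1.le, hr'.2⟩)).le)).2.1
    linarith
  have hall : ∀ t ≥ s, (∀ r ∈ Ioo s t, X r ≤ Y r) →
      m₂ t - m₂ s ≤ ω / (σ / 2) ∧ y t ≤ -σ + ξ ∧ |(1 + a₂) * x t + a₁ * y t - l| ≤ ξ :=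
    fun t ht hr => hest t ht hr fun r hr' =>
      (hclaim r hr'.1.le fun q hq => hr q ⟨hq.1, hq.2.trans hr'.2⟩).le
  -- Since `A ≥ 0`, the relative slope `x - y` is at least `σ / 2`, so the gap closes in finite
  -- time.
  obtain ⟨b, hb1, hb2⟩ : ∃ b ≥ s, Y b ≤ X b := by
    by_contra! hc
    set t := s + (Y s - X s) / (σ / 2) with ht
    have hst : s ≤ t := by
      rw [ht]
      have : 0 ≤ (Y s - X s) / (σ / 2) := div_nonneg (by linarith) (by linarith)
      linarith
    have h1 := sub_le_of_hasDerivAt hst (fun r => (hasDerivAt_id r).const_mul (σ / 2))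
      (fun r => (h.hX r).fun_sub (h.hY r)) (fun r hr => by
        rw [mul_one]
        obtain ⟨-, h2, h3⟩ := hall r hr.1.le fun q hq => (hc q hq.1.le).le
        have h4 := (abs_le.1 h3).1
        have h5 := mul_le_mul_of_nonneg_left h2 (by linarith [h.pos₁] : 0 ≤ 1 + a₁ + a₂)
        have h6 := mul_nonneg hb.le hA
        have h7 : (1 + a₂) * (σ / 2) ≤ (1 + a₂) * (x r - y r) := by
          rw [hl] at h4
          linarith
        exact le_of_mul_le_mul_left h7 hb)
    have h2 := hc t hst
    have h3 : σ / 2 * (t - s) = Y s - X s := by rw [ht]; field_simp; ring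
    simp only [id] at h1
    linarith
  obtain ⟨t, ht, ht1, ht2⟩ := exists_first_of_isClosed (Q := fun r => Y r ≤ X r)
    (isClosed_le h.symm.continuous_X h.continuous_X) hb1 hb2
  have hXY' : ∀ r ∈ Ico s t, X r ≤ Y r := fun r hr => (not_le.1 (ht2 r hr)).le
  have hXYt : X t ≤ Y t := by
    rcases ht.1.eq_or_lt with he | hst
    · rw [← he]; exact hXY
    · have hcl : t ∈ closure (Ico s t) := by
        rw [closure_Ico hst.ne]; exact right_mem_Icc.2 hst.le
      exact closure_minimal hXY' (isClosed_le h.continuous_X h.symm.continuous_X) hcl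
  have hXYo : ∀ r ∈ Ioo s t, X r ≤ Y r := fun r hr => hXY' r ⟨hr.1.le, hr.2⟩
  obtain ⟨h1, h2, h3⟩ := hall t ht.1 hXYo
  refine ⟨t, ht.1, le_antisymm hXYt ht1, h2, h3, (hm t ht.1 hXYo).trans h1, h1, ?_⟩
  have := (h.symm.decay (half_pos hσ) ht.1 fun r hr' =>
      (hclaim r hr'.1.le fun q hq => hXYo q ⟨hq.1, hq.2.trans hr'.2⟩).le).2
  have : 0 ≤ σ / 2 * (t - s) := mul_nonneg (by linarith) (by linarith [ht.1])
  linarith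

set_option maxHeartbeats 400000 in
/-- After the second meeting the second component decays forever. -/
theorem final (h : Flow a₁ a₂ C δ T X Y x y m₁ m₂ θ₁ θ₂) {A B η ξ ω l s : ℝ} (hTs : T ≤ s)
    (hA : 0 ≤ A) (hB : 0 < B) (hl : l = -(1 + a₁) * B - a₂ * A) (hξ : 0 ≤ ξ) (hη : η ≤ 1)
    (hL : |(1 + a₁) * y s + a₂ * x s - l| ≤ η / 2) (hY : Real.exp (Y s) ≤ ω) (hωη : ω ≤ η)
    (hω : 3 / 2 * (1 + a₁ + a₂) * (ω / (B / 2)) ≤ η / 2)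
    (hE : ∀ t ≥ T, |energy a₁ a₂ (X t) (Y t) (x t) (y t) -
      (a₁ / (2 * (1 + a₁)) * l ^ 2 + a₂ * (1 + a₁ + a₂) / (2 * (1 + a₁)) * A ^ 2)| ≤ η)
    (hηl : η ≤ (1 + a₁) * B)
    (hηξ : (2 * (1 + a₁) + a₁ * |l|) * η ≤ a₂ * (1 + a₁ + a₂) * ξ ^ 2)
    (hξB : η / 2 + a₂ * ξ ≤ (1 + a₁) * B / 2) :
    ∀ t ≥ s, y t ≤ -(B / 2) ∧ m₂ t - m₂ s ≤ ω / (B / 2) ∧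
      |(1 + a₁) * y t + a₂ * x t - l| ≤ η ∧
      |x t ^ 2 + 2 * (1 + a₁) * Real.exp (X t) - A ^ 2| ≤
        (2 * (1 + a₁) * (1 + (1 + a₂ + a₁) * a₁) + a₁ * (2 * |l| + 1)) /
          (a₂ * (1 + a₂ + a₁)) * η := by
  have h1 := h.pos₁
  have h2 := h.pos₂
  have hb : 0 < 1 + a₁ := by linarith
  have hD : 0 < 1 + a₁ + a₂ := by linarith
  have hη0 : 0 ≤ η := by linarith [(abs_nonneg _).trans hL]
  have hl0 : l ≤ -((1 + a₁) * B) := by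
    have := mul_nonneg h2.le hA
    linarith
  -- No knowledge of `X` is needed. The negative quantity `(1 + a₁) y + a₂ x` does not increase, so
  -- its square stays almost at least `l²`. The energy then leaves at most `A² + ξ²` for `x²`. Hence
  -- `x ≥ -(A + ξ)`, and `y` is bounded through the same combination.
  have hy : ∀ t ≥ s, y t ≤ -(B / 2) := fun t ht => by
    have h3 := (h.symm.lin_sub hTs ht).1
    have h4 := (abs_le.1 hL).2
    have h5 := (abs_le.1 (hE t (hTs.trans ht))).2
    set L := (1 + a₁) * y t + a₂ * x t with hLdef
    have h6 : L ≤ l + η / 2 := by linarith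
    have h7 : (l + η / 2) ^ 2 ≤ L ^ 2 := by
      have h0 := mul_pos hb hB
      nlinarith [mul_nonneg (sub_nonneg.2 h6) (by linarith : 0 ≤ -(l + η / 2) - L)]
    have habs : |l| = -l := abs_of_nonpos (by linarith [mul_pos hb hB])
    have h8 : energy a₁ a₂ (X t) (Y t) (x t) (y t) = a₁ / (2 * (1 + a₁)) * L ^ 2 +
        a₂ * (1 + a₁ + a₂) / (2 * (1 + a₁)) * x t ^ 2 +
        (1 + a₁ + a₂) * (a₂ * Real.exp (X t) + a₁ * Real.exp (Y t)) := by
      rw [hLdef]; unfold energy J; field_simp; ring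
    have h9 : 0 < (1 + a₁ + a₂) * (a₂ * Real.exp (X t) + a₁ * Real.exp (Y t)) := by positivity
    have h10 : a₁ * L ^ 2 + a₂ * (1 + a₁ + a₂) * x t ^ 2 ≤
        a₁ * l ^ 2 + a₂ * (1 + a₁ + a₂) * A ^ 2 + 2 * (1 + a₁) * η := by
      have e1 : a₁ * L ^ 2 + a₂ * (1 + a₁ + a₂) * x t ^ 2 = 2 * (1 + a₁) *
          (a₁ / (2 * (1 + a₁)) * L ^ 2 + a₂ * (1 + a₁ + a₂) / (2 * (1 + a₁)) * x t ^ 2) := by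
        field_simp
      have e2 : a₁ * l ^ 2 + a₂ * (1 + a₁ + a₂) * A ^ 2 + 2 * (1 + a₁) * η = 2 * (1 + a₁) *
          (a₁ / (2 * (1 + a₁)) * l ^ 2 + a₂ * (1 + a₁ + a₂) / (2 * (1 + a₁)) * A ^ 2 + η) := by
        field_simp
      rw [e1, e2]
      exact mul_le_mul_of_nonneg_left (by linarith) (by linarith)
    have h11 : a₂ * (1 + a₁ + a₂) * x t ^ 2 ≤ a₂ * (1 + a₁ + a₂) * (A ^ 2 + ξ ^ 2) := by
      rw [habs] at hηξ
      have e1 := mul_le_mul_of_nonneg_left h7 h1.le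
      have e2 := mul_nonneg h1.le (sq_nonneg η)
      linarith
    have h12 : x t ^ 2 ≤ A ^ 2 + ξ ^ 2 := le_of_mul_le_mul_left h11 (by positivity)
    have h13 : -(A + ξ) ≤ x t := (abs_le.1 (abs_le_of_sq_le_sq
      (by linarith [mul_nonneg hA hξ] : x t ^ 2 ≤ (A + ξ) ^ 2) (by linarith))).1
    have h14 : (1 + a₁) * y t ≤ (1 + a₁) * -(B / 2) := by
      have := mul_le_mul_of_nonneg_left h13 h2.le
      have h15 : L = (1 + a₁) * y t + a₂ * x t := hLdef
      linarith
    exact le_of_mul_le_mul_left h14 hb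
  intro t ht
  obtain ⟨h3, h4⟩ := h.symm.decay (half_pos hB) ht fun r hr => hy r hr.1.le
  have h5 : m₂ t - m₂ s ≤ ω / (B / 2) :=
    h3.trans (div_le_div_of_nonneg_right hY (half_pos hB).le)
  have h6 : |(1 + a₁) * y t + a₂ * x t - l| ≤ η := by
    obtain ⟨h7, h8⟩ := h.symm.lin_sub hTs ht
    obtain ⟨h9, h10⟩ := abs_le.1 hL
    have h11 := mul_le_mul_of_nonneg_left h5 (by linarith : 0 ≤ 3 / 2 * (1 + a₂ + a₁))
    rw [abs_le]
    constructor <;> linarith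
  refine ⟨hy t ht, h5, h6, ?_⟩
  refine abs_first_integral_le h2 h1 hη h6 ?_ ?_ (X := Y t)
  · refine le_trans (Real.exp_le_exp.2 ?_) (hY.trans hωη)
    have : 0 ≤ B / 2 * (t - s) := mul_nonneg (by linarith) (by linarith)
    linarith
  · rw [energy_comm, show 1 + a₂ + a₁ = 1 + a₁ + a₂ by ring]
    exact hE t (hTs.trans ht)

end Flow

end Phases

/-! ### Asymptotics of decaying trajectories. -/

section Tail

theorem exists_tendsto_of_antitoneOn {f : ℝ → ℝ} {T c : ℝ} (hf : AntitoneOn f (Ici T))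
    (hc : ∀ t ≥ T, c ≤ f t) : ∃ l, Tendsto f atTop (𝓝 l) := by
  have hanti : Antitone fun t => f (max t T) := fun s t hst =>
    hf (mem_Ici.2 (le_max_right _ _)) (mem_Ici.2 (le_max_right _ _)) (max_le_max_right T hst)
  refine ⟨_, (tendsto_atTop_ciInf hanti ⟨c, ?_⟩).congr' ?_⟩
  · rintro _ ⟨t, rfl⟩
    exact hc _ (le_max_right _ _)
  · filter_upwards [eventually_ge_atTop T] with t ht
    rw [max_eq_left ht]

theorem tendsto_atBot_of_hasDerivAt_le {f f' : ℝ → ℝ} {c : ℝ} (hc : c < 0)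
    (hf : ∀ t, HasDerivAt f (f' t) t) (h : ∀ᶠ t in atTop, f' t ≤ c) :
    Tendsto f atTop atBot := by
  obtain ⟨T, hT⟩ := eventually_atTop.1 h
  have h1 : Tendsto (fun t => c * (t - T) + f T) atTop atBot :=
    tendsto_atBot_add_const_right _ _
      ((tendsto_atTop_add_const_right _ _ tendsto_id).const_mul_atTop_of_neg hc)
  refine tendsto_atBot_mono' _ ?_ h1
  filter_upwards [eventually_ge_atTop T] with t ht
  have := sub_le_of_hasDerivAt ht hf (fun r => (hasDerivAt_id r).const_mul c)
    fun r hr => by simpa using hT r hr.1.le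
  simp only [id] at this
  linarith

namespace Flow

variable {a₁ a₂ C δ T : ℝ} {X Y x y m₁ m₂ θ₁ θ₂ : ℝ → ℝ}

theorem exists_tendsto_mass (h : Flow a₁ a₂ C δ T X Y x y m₁ m₂ θ₁ θ₂) {s c : ℝ}
    (hc : ∀ t ≥ s, m₁ t ≤ c) : ∃ M, Tendsto m₁ atTop (𝓝 M) :=
  ⟨_, tendsto_atTop_ciSup (fun _ _ => h.mass_mono) ⟨c, by
    rintro _ ⟨t, rfl⟩
    exact (h.mass_mono (le_max_left t s)).trans (hc _ (le_max_right _ _))⟩⟩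

theorem mass_le (h : Flow a₁ a₂ C δ T X Y x y m₁ m₂ θ₁ θ₂) {M : ℝ}
    (hM : Tendsto m₁ atTop (𝓝 M)) (t : ℝ) : m₁ t ≤ M :=
  Monotone.ge_of_tendsto (fun _ _ => h.mass_mono) hM t

/-- Each of the two combinations driven by a single component is nonincreasing and bounded. They
determine both slopes, the determinant being `1 + a₁ + a₂`. -/
theorem exists_tendsto_slopes (h : Flow a₁ a₂ C δ T X Y x y m₁ m₂ θ₁ θ₂) :
    ∃ ξ υ, Tendsto x atTop (𝓝 ξ) ∧ Tendsto y atTop (𝓝 υ) := by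
  have key : ∀ {a₁ a₂ : ℝ} {X Y x y m₁ m₂ θ₁ θ₂ : ℝ → ℝ},
      Flow a₁ a₂ C δ T X Y x y m₁ m₂ θ₁ θ₂ →
      ∃ l, Tendsto (fun t => (1 + a₂) * x t + a₁ * y t) atTop (𝓝 l) := by
    intro a₁ a₂ X Y x y m₁ m₂ θ₁ θ₂ h
    refine exists_tendsto_of_antitoneOn (T := T) (c := -((1 + a₂) * C + a₁ * C))
      (fun s hs t _ hst => (h.lin_sub hs hst).1) fun t ht => ?_
    have h1 := mul_le_mul_of_nonneg_left (abs_le.1 (h.abs_x_le t ht)).1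
      (by linarith [h.pos₂] : 0 ≤ 1 + a₂)
    have h2 := mul_le_mul_of_nonneg_left (abs_le.1 (h.abs_y_le t ht)).1 h.pos₁.le
    linarith
  obtain ⟨l, hl⟩ := key h
  obtain ⟨l', hl'⟩ := key h.symm
  have hD : 1 + a₁ + a₂ ≠ 0 := by linarith [h.pos₁, h.pos₂]
  refine ⟨_, _, (((hl.const_mul (1 + a₁)).sub (hl'.const_mul a₁)).div_const
    (1 + a₁ + a₂)).congr fun t => ?_, (((hl'.const_mul (1 + a₂)).sub
    (hl.const_mul a₂)).div_const (1 + a₁ + a₂)).congr fun t => ?_⟩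
  · field_simp; ring
  · field_simp; ring

/-- The distance of `x` from its limit is controlled by the remaining masses, hence by `e^X / k +
e^Y / k'`. This is the derivative of a combination of the masses, which has a finite limit. -/
theorem isBigO_of_slopes (h : Flow a₁ a₂ C δ T X Y x y m₁ m₂ θ₁ θ₂) {s k k' ξ M₁ M₂ : ℝ}
    (hTs : T ≤ s) (hk : 0 < k) (hk' : 0 < k') (hx : ∀ t ≥ s, x t ≤ -k)
    (hy : ∀ t ≥ s, y t ≤ -k') (hξ : Tendsto x atTop (𝓝 ξ))
    (hM₁ : Tendsto m₁ atTop (𝓝 M₁)) (hM₂ : Tendsto m₂ atTop (𝓝 M₂)) :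
    (fun t => X t - ξ * t) =O[atTop] fun _ => (1 : ℝ) := by
  set c := 2 * (1 + a₁) with hc
  have hb : 0 < 1 + a₁ := by linarith [h.pos₁]
  have hc0 : 0 < c := by linarith
  have h1 : ∀ t ≥ s, |x t - ξ| ≤ c * (Real.exp (X t) / k + Real.exp (Y t) / k') := by
    intro t ht
    rw [abs_sub_comm]
    refine le_of_tendsto (hξ.sub_const (x t)).abs ?_
    filter_upwards [eventually_ge_atTop t] with r hr
    have e1 := h.symm.y_sub_le (hTs.trans ht) hr
    have e2 := h.symm.le_y_sub (hTs.trans ht) hr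
    have e3 := (h.decay hk hr fun q hq => hx q (ht.trans hq.1.le)).1
    have e4 := (h.symm.decay hk' hr fun q hq => hy q (ht.trans hq.1.le)).1
    have e5 := sub_nonneg.2 (h.mass_mono hr)
    have e6 := sub_nonneg.2 (h.symm.mass_mono hr)
    have e7 : 0 ≤ (1 - δ) * (1 + a₁) * (m₁ r - m₁ t) :=
      mul_nonneg (mul_nonneg (by linarith [h.le_half]) hb.le) e5
    have e8 : (1 + δ) * (1 + a₁) * (m₁ r - m₁ t) ≤ c * (m₁ r - m₁ t) := by
      refine mul_le_mul_of_nonneg_right ?_ e5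
      rw [hc]
      exact mul_le_mul_of_nonneg_right (by linarith [h.le_half]) hb.le
    have e9 : 3 / 2 * a₁ * (m₂ r - m₂ t) ≤ c * (m₂ r - m₂ t) :=
      mul_le_mul_of_nonneg_right (by linarith [h.pos₁]) e6
    have e10 := mul_le_mul_of_nonneg_left (add_le_add e3 e4) hc0.le
    have e11 := mul_nonneg hc0.le e5
    have e12 := mul_nonneg hc0.le e6
    rw [abs_le]
    constructor <;> linarith
  have h2 : ∀ t ≥ s, |X t - ξ * t - (X s - ξ * s)| ≤
      c * (M₁ / k + M₂ / k') - c * (m₁ s / k + m₂ s / k') := by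
    intro t ht
    have := norm_sub_le_of_hasDerivAt ht
      (fun r => (h.hX r).fun_sub ((hasDerivAt_id r).const_mul ξ))
      (fun r => (((h.hm₁ r).div_const k).fun_add ((h.hm₂ r).div_const k')).const_mul c)
      (fun r hr => by simpa using h1 r hr.1)
    simp only [id, Real.norm_eq_abs] at this
    have e1 := (h.mass_le hM₁ t)
    have e2 := (h.symm.mass_le hM₂ t)
    have e3 := add_le_add (div_le_div_of_nonneg_right e1 hk.le)
      (div_le_div_of_nonneg_right e2 hk'.le)
    have e4 := mul_le_mul_of_nonneg_left e3 hc0.le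
    linarith
  refine Asymptotics.IsBigO.of_bound
    (c * (M₁ / k + M₂ / k') - c * (m₁ s / k + m₂ s / k') + |X s - ξ * s|) ?_
  filter_upwards [eventually_ge_atTop s] with t ht
  have := abs_sub_abs_le_abs_sub (X t - ξ * t) (X s - ξ * s)
  have := h2 t ht
  rw [norm_one, mul_one, Real.norm_eq_abs]
  linarith

/-- Once the second component decays, both components decay, with finite masses. -/
theorem tail (h : Flow a₁ a₂ C δ T X Y x y m₁ m₂ θ₁ θ₂) {s k : ℝ} (hTs : T ≤ s) (hk : 0 < k)
    (hy : ∀ t ≥ s, y t ≤ -k) :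
    ∃ M₁ M₂ ξ υ, Tendsto m₁ atTop (𝓝 M₁) ∧ Tendsto m₂ atTop (𝓝 M₂) ∧
      Tendsto x atTop (𝓝 ξ) ∧ Tendsto y atTop (𝓝 υ) ∧ ξ < 0 ∧ υ < 0 ∧
      ((fun t => X t - ξ * t) =O[atTop] fun _ => (1 : ℝ)) ∧
      ((fun t => Y t - υ * t) =O[atTop] fun _ => (1 : ℝ)) := by
  have hb : 0 < 1 + a₁ := by linarith [h.pos₁]
  have hm₂ : ∀ t ≥ s, m₂ t - m₂ s ≤ Real.exp (Y s) / k := fun t ht =>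
    (h.symm.decay hk ht fun r hr => hy r hr.1.le).1
  obtain ⟨M₂, hM₂⟩ := h.symm.exists_tendsto_mass (s := s) (c := m₂ s + Real.exp (Y s) / k)
    fun t ht => by linarith [hm₂ t ht]
  -- The first mass lowers `x`, which is bounded, and only the finite second mass can compensate.
  have hm₁ : ∀ t ≥ s, m₁ t ≤
      m₁ s + (3 / 2 * a₁ * (Real.exp (Y s) / k) + 2 * C) / (1 / 2 * (1 + a₁)) := by
    intro t ht
    have h1 := h.symm.y_sub_le hTs ht
    have h2 := (abs_le.1 (h.abs_x_le t (hTs.trans ht))).1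
    have h3 := (abs_le.1 (h.abs_x_le s hTs)).2
    have h4 := mul_le_mul_of_nonneg_left (hm₂ t ht) (by linarith [h.pos₁] : 0 ≤ 3 / 2 * a₁)
    have h5 : 1 / 2 * (1 + a₁) * (m₁ t - m₁ s) ≤ (1 - δ) * (1 + a₁) * (m₁ t - m₁ s) :=
      mul_le_mul_of_nonneg_right (mul_le_mul_of_nonneg_right (by linarith [h.le_half]) hb.le)
        (sub_nonneg.2 (h.mass_mono ht))
    have h6 : m₁ t - m₁ s ≤
        (3 / 2 * a₁ * (Real.exp (Y s) / k) + 2 * C) / (1 / 2 * (1 + a₁)) := by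
      rw [le_div_iff₀ (by linarith)]
      linarith
    linarith
  obtain ⟨M₁, hM₁⟩ := h.exists_tendsto_mass hm₁
  obtain ⟨ξ, υ, hξ, hυ⟩ := h.exists_tendsto_slopes
  have hυk : υ ≤ -k := le_of_tendsto hυ (by
    filter_upwards [eventually_ge_atTop s] with t ht using hy t ht)
  -- If `ξ ≥ 0`, then `Y - X → -∞` and eventually `x' ≤ 0`, so `x ≥ ξ ≥ 0` and `X` no longer
  -- decreases. The first mass would then grow linearly, although it is finite.
  have hξ0 : ξ < 0 := by
    by_contra! hξ0
    have hXY : Tendsto (fun t => Y t - X t) atTop atBot := by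
      refine tendsto_atBot_of_hasDerivAt_le (c := (υ - ξ) / 2) (by linarith)
        (fun t => (h.hY t).fun_sub (h.hX t)) ?_
      exact (hυ.sub hξ).eventually_le_const (by linarith)
    obtain ⟨t₀, ht₀⟩ := eventually_atTop.1
      ((hXY.eventually_le_atBot (-2)).and (eventually_ge_atTop s))
    have hxd : ∀ t ≥ t₀, -(1 + a₁) * θ₁ t * Real.exp (X t) + a₁ * θ₂ t * Real.exp (Y t) ≤ 0 := by
      intro t ht
      obtain ⟨h1, h2⟩ := ht₀ t ht
      have h3 := (h.θ₁_mem' (hTs.trans h2)).1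
      have h4 := (h.symm.θ₁_mem' (hTs.trans h2)).2
      have h5 : 3 * Real.exp (Y t) ≤ Real.exp (X t) := by
        have e1 : Real.exp (2 + Y t) ≤ Real.exp (X t) := Real.exp_le_exp.2 (by linarith)
        rw [Real.exp_add] at e1
        have e2 := Real.add_one_le_exp (2 : ℝ)
        nlinarith [Real.exp_pos (Y t)]
      have h6 := mul_le_mul_of_nonneg_right h3 (mul_pos hb (Real.exp_pos (X t))).le
      have h7 := mul_le_mul_of_nonneg_right h4 (mul_pos h.pos₁ (Real.exp_pos (Y t))).le
      have h8 := mul_le_mul_of_nonneg_left h5 h.pos₁.le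
      have h9 := Real.exp_pos (X t)
      linarith
    have hx0 : ∀ t ≥ t₀, 0 ≤ x t := fun t ht => by
      refine hξ0.trans (le_of_tendsto hξ ?_)
      filter_upwards [eventually_ge_atTop t] with r hr
      have := sub_le_of_hasDerivAt hr h.hx (fun r => hasDerivAt_const r (0 : ℝ))
        fun q hq => hxd q (ht.trans hq.1.le)
      linarith
    have hX : ∀ t ≥ t₀, X t₀ ≤ X t := fun t ht => by
      have := sub_le_of_hasDerivAt ht (fun r => hasDerivAt_const r (0 : ℝ)) h.hX
        fun q hq => hx0 q hq.1.le
      linarith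
    have hm : ∀ t ≥ t₀, Real.exp (X t₀) * (t - t₀) ≤ m₁ t - m₁ t₀ := fun t ht => by
      have := sub_le_of_hasDerivAt ht
        (fun r => (hasDerivAt_id r).const_mul (Real.exp (X t₀))) h.hm₁
        fun q hq => by simpa using hX q hq.1.le
      simp only [id] at this
      linarith
    have h1 : Tendsto (fun t => Real.exp (X t₀) * (t - t₀)) atTop atTop :=
      (tendsto_atTop_add_const_right _ _ tendsto_id).const_mul_atTop (Real.exp_pos _)
    refine not_tendsto_nhds_of_tendsto_atTop (tendsto_atTop_mono' _ ?_ h1) _ (hM₁.sub_const (m₁ t₀))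
    filter_upwards [eventually_ge_atTop t₀] with t ht using hm t ht
  obtain ⟨t₁, ht₁⟩ := eventually_atTop.1
    ((hξ.eventually_le_const (by linarith : ξ < -(-ξ / 2))).and (eventually_ge_atTop s))
  have hTt : T ≤ t₁ := hTs.trans (ht₁ t₁ le_rfl).2
  have hx₁ : ∀ t ≥ t₁, x t ≤ -(-ξ / 2) := fun t ht => (ht₁ t ht).1
  have hy₁ : ∀ t ≥ t₁, y t ≤ -k := fun t ht => hy t (ht₁ t ht).2
  exact ⟨M₁, M₂, ξ, υ, hM₁, hM₂, hξ, hυ, hξ0, by linarith,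
    h.isBigO_of_slopes hTt (by linarith) hk hx₁ hy₁ hξ hM₁ hM₂,
    h.symm.isBigO_of_slopes hTt hk (by linarith) hy₁ hx₁ hυ hM₂ hM₁⟩

end Flow

end Tail

/-! ### The two meetings and the reflection in between. -/

section Meeting

theorem eventually_le_of_linear (c : ℝ) {b : ℝ} (hb : 0 < b) :
    ∀ᶠ η in 𝓝[>] (0 : ℝ), c * η < b :=
  (((continuous_const.mul continuous_id).tendsto' (0 : ℝ) 0 (by simp)).mono_left
    nhdsWithin_le_nhds).eventually_lt_const hb

theorem eventually_neg_inv_le (c : ℝ) : ∀ᶠ μ in 𝓝[>] (0 : ℝ), -μ⁻¹ ≤ c :=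
  (tendsto_neg_atTop_atBot.comp tendsto_inv_nhdsGT_zero).eventually_le_atBot c

theorem eventually_abs_J_sub_le (a₁ a₂ x₀ y₀ : ℝ) {η : ℝ} (hη : 0 < η) :
    ∀ᶠ μ in 𝓝[>] (0 : ℝ), ∀ x y, |x - x₀| ≤ μ → |y - y₀| ≤ μ →
      |J a₁ a₂ x y - J a₁ a₂ x₀ y₀| ≤ η := by
  have hc : Continuous fun p : ℝ × ℝ => J a₁ a₂ p.1 p.2 := by unfold J; fun_prop
  obtain ⟨d, hd, h⟩ := Metric.continuousAt_iff.1 (hc.continuousAt (x := (x₀, y₀))) η hη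
  filter_upwards [Ioo_mem_nhdsGT hd] with μ hμ x y hx hy
  have := @h (x, y) (by
    rw [Prod.dist_eq, Real.dist_eq, Real.dist_eq]
    exact max_lt (hx.trans_lt hμ.2) (hy.trans_lt hμ.2))
  rw [Real.dist_eq] at this
  exact this.le

set_option maxHeartbeats 2000000 in
/-- Starting from a state close to `x = -ρ`, `y = σ` with both components small, the two
components meet twice: first while the second one rises, and again after its slope has been
reversed. -/
theorem exists_meeting {a₁ a₂ C ρ σ A : ℝ} (h₁ : 0 < a₁) (h₂ : 0 < a₂) (hC : 0 < C)
    (hρ : 0 < ρ) (hσ : 0 < σ) (hA : 0 ≤ A)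
    (hl : (1 + a₂) * A - a₁ * σ = -(1 + a₂) * ρ + a₁ * σ) :
    ∃ K > 0, ∀ᶠ η in 𝓝[>] (0 : ℝ), ∀ᶠ μ in 𝓝[>] (0 : ℝ),
      ∀ (T : ℝ) (X Y x y m₁ m₂ θ₁ θ₂ : ℝ → ℝ), Flow a₁ a₂ C μ T X Y x y m₁ m₂ θ₁ θ₂ →
      |x T - -ρ| ≤ μ → |y T - σ| ≤ μ → X T ≤ -μ⁻¹ → Y T ≤ X T →
      (∀ t ≥ T, |energy a₁ a₂ (X t) (Y t) (x t) (y t) - J a₁ a₂ (-ρ) σ| ≤ η) ∧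
      ∃ t₁ t₃, T ≤ t₁ ∧ η⁻¹ ≤ t₃ - t₁ ∧ X t₁ = Y t₁ ∧ X t₃ = Y t₃ ∧
        |y t₁ - σ| ≤ K * η ∧ |y t₃ + σ| ≤ K * η ∧ |x t₃ - A| ≤ K * η ∧
        m₁ t₃ - m₁ t₁ ≤ K * η ∧ Real.exp (Y t₃) ≤ K * η := by
  obtain ⟨D, hD⟩ : ∃ D, D = 1 + a₁ + a₂ := ⟨_, rfl⟩
  -- The common value of `(1 + a₂) x + a₁ y` before and after the reflection of `Y`.
  obtain ⟨l, hl'⟩ : ∃ l, l = (1 + a₂) * A - a₁ * σ := ⟨_, rfl⟩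
  have hD0 : 0 < D := by linarith
  have hb : 0 < 1 + a₂ := by linarith
  obtain ⟨K, hK⟩ : ∃ K, (2 * (1 + a₂) * (1 + (1 + a₁ + a₂) * a₂) + a₂ * (2 * |l| + 1)) /
      (a₁ * (1 + a₁ + a₂)) = K := ⟨_, rfl⟩
  have hK0 : 0 < K := by rw [← hK]; positivity
  -- The slope margin will be `κ = k η`. This `k` keeps the error `K η` of the first integral below
  -- `σ κ / 4`.
  obtain ⟨k, hk⟩ : ∃ k, k = 4 * K / σ + 1 := ⟨_, rfl⟩
  have hk1 : 1 < k := by rw [hk]; have : 0 < 4 * K / σ := by positivity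
                         linarith
  have hk0 : 0 < k := by linarith
  have hKk : K ≤ σ * k / 4 := by
    have : σ * k = 4 * K + σ := by rw [hk]; field_simp
    linarith
  -- `w η` bounds `e^Y` at both ends of the turn, `v η` the masses gained in the descent, `z η` the
  -- resulting slope errors, and `c η` the two-sided error of `y` at the second meeting.
  obtain ⟨w, hw⟩ : ∃ w, w = (2 * σ * k + K) / (2 * (1 + a₂)) := ⟨_, rfl⟩
  have hw0 : 0 < w := by rw [hw]; positivity
  have hw' : 2 * (1 + a₂) * w = 2 * σ * k + K := by rw [hw]; field_simp
  obtain ⟨v, hv⟩ : ∃ v, v = w / (σ / 2) := ⟨_, rfl⟩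
  have hv0 : 0 < v := by rw [hv]; positivity
  obtain ⟨z, hz⟩ : ∃ z, z = k + 1 + (3 / 2 * a₂ + 3 / 2 * D) * v := ⟨_, rfl⟩
  have ha₂v : 0 < a₂ * v := by positivity
  have hDv : 0 < D * v := by positivity
  have hz0 : 0 < z := by linarith
  obtain ⟨c, hc⟩ : ∃ c, c = z + 3 / 2 * (1 + a₂) * v := ⟨_, rfl⟩
  have hc0 : 0 < c := by rw [hc]; positivity
  refine ⟨k + c + (z + a₁ * c) / (1 + a₂) + w + 2 + v, by positivity, ?_⟩
  filter_upwards [self_mem_nhdsWithin, eventually_le_of_linear 1 one_pos,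
    eventually_le_of_linear k (half_pos hσ),
    eventually_le_of_linear (a₁ * k + 1) (by positivity : 0 < (1 + a₂) * ρ / 2),
    eventually_le_of_linear (z * (2 + a₁ + a₂)) (by positivity : 0 < (1 + a₂) * σ / 2),
    eventually_le_of_linear z (half_pos hσ)] with η hη0 hη1 hκσ hηκ hξ hξσ
  rw [mem_Ioi] at hη0
  obtain ⟨κ, hκ⟩ : ∃ κ, κ = k * η := ⟨_, rfl⟩
  rw [← hκ] at hκσ
  have hκ0 : 0 < κ := by rw [hκ]; positivity
  have hηκ' : η ≤ κ := by rw [hκ]; nlinarith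
  have hKη : K * η ≤ σ * κ / 4 := by
    have := mul_le_mul_of_nonneg_right hKk hη0.le
    rw [hκ]; linarith
  -- A level for `e^X` during the turn, negligible over the turning time and below the values of
  -- `e^Y` at both ends of the turn.
  obtain ⟨ν, hν0, hν1, hν2, hν3, hν4⟩ : ∃ ν > 0, ν ≤ η ∧
      3 / 2 * (1 + a₁ + a₂) * (ν * (32 / κ)) ≤ η / 2 ∧ 3 / 2 * a₂ * ν ≤ σ * κ / 16 ∧
      ν < σ * κ / (2 * (1 + a₂)) := by
    have hev : ∀ {f : ℝ} {b : ℝ}, 0 < b → ∀ᶠ ν in 𝓝[>] (0 : ℝ), f * ν < b :=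
      fun hb => eventually_le_of_linear _ hb
    obtain ⟨ν, e0, e1, e2, e3, e4⟩ := ((eventually_mem_nhdsWithin (a := (0:ℝ)) (s := Ioi 0)).and
      ((hev (f := 1) hη0).and ((hev (f := 3 / 2 * (1 + a₁ + a₂) * (32 / κ)) (half_pos hη0)).and
      ((hev (f := 3 / 2 * a₂) (by positivity : 0 < σ * κ / 16)).and
        (hev (f := 1) (by positivity : 0 < σ * κ / (2 * (1 + a₂)))))))).exists
    exact ⟨ν, e0, by linarith, by linarith, e3.le, by linarith⟩
  have hντ : ν * (32 / κ) ≤ η := by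
    have : 0 < ν * (32 / κ) := by positivity
    nlinarith
  -- `μ` is chosen last, so that `X T ≤ -μ⁻¹` beats all constants fixed before, including the gap `2
  -- C / η` that separates the meetings.
  filter_upwards [self_mem_nhdsWithin, eventually_le_of_linear (1 + a₂ + a₁)
      (by positivity : 0 < η / 4),
    eventually_le_of_linear 1 hκ0, eventually_le_of_linear 1 (by positivity : 0 < η / 4),
    eventually_abs_J_sub_le a₁ a₂ (-ρ) σ (by positivity : 0 < η / 4),
    eventually_neg_inv_le (Real.log (η / 4 / (3 * (1 + a₁ + a₂) / ρ))),
    eventually_neg_inv_le (Real.log (η / 4 / ((1 + a₁ + a₂) * (a₂ + a₁)))),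
    eventually_neg_inv_le (Real.log ν - C * (32 / κ)),
    eventually_neg_inv_le (Real.log (σ * κ / (2 * (1 + a₂))) - 2 * C * η⁻¹)] with
    μ hμ0 hμ1 hμκ hμη hμJ hμ2 hμ3 hμ4 hμ5 T X Y x y m₁ m₂ θ₁ θ₂ h hxT hyT hXT hYX
  rw [mem_Ioi] at hμ0
  have hexp : ∀ {q : ℝ}, 0 < q → -μ⁻¹ ≤ Real.log q → Real.exp (X T) ≤ q := fun hq hle => by
    rw [← Real.le_log_iff_exp_le hq]; linarith
  have hX2 : Real.exp (X T) * (3 * (1 + a₁ + a₂) / ρ) ≤ η / 4 := by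
    rw [← le_div_iff₀ (by positivity)]; exact hexp (by positivity) hμ2
  have hX3 : Real.exp (X T) * ((1 + a₁ + a₂) * (a₂ + a₁)) ≤ η / 4 := by
    rw [← le_div_iff₀ (by positivity)]; exact hexp (by positivity) hμ3
  have hE : ∀ t ≥ T, |energy a₁ a₂ (X t) (Y t) (x t) (y t) - J a₁ a₂ (-ρ) σ| ≤ η := by
    intro t ht
    obtain ⟨e1, e2⟩ := abs_le.1 (h.energy_le t ht)
    obtain ⟨e3, e4⟩ := abs_le.1 (hμJ _ _ hxT hyT)
    have e5 : energy a₁ a₂ (X T) (Y T) (x T) (y T) = J a₁ a₂ (x T) (y T) +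
      (1 + a₁ + a₂) * (a₂ * Real.exp (X T) + a₁ * Real.exp (Y T)) := rfl
    have e6 : 0 < (1 + a₁ + a₂) * (a₂ * Real.exp (X T) + a₁ * Real.exp (Y T)) := by positivity
    have e7 : (1 + a₁ + a₂) * (a₂ * Real.exp (X T) + a₁ * Real.exp (Y T)) ≤
        Real.exp (X T) * ((1 + a₁ + a₂) * (a₂ + a₁)) := by
      have := mul_le_mul_of_nonneg_left (Real.exp_le_exp.2 hYX) h₁.le
      have := mul_le_mul_of_nonneg_left this (by linarith : 0 ≤ 1 + a₁ + a₂)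
      linarith
    rw [abs_le]
    constructor <;> linarith
  refine ⟨hE, ?_⟩
  have hEl : J a₁ a₂ (-ρ) σ =
      a₂ / (2 * (1 + a₂)) * l ^ 2 + a₁ * (1 + a₁ + a₂) / (2 * (1 + a₂)) * σ ^ 2 := by
    rw [hl', hl]; unfold J; field_simp; ring
  rw [hEl] at hE
  obtain ⟨hx1, hx2⟩ := abs_le.1 hxT
  obtain ⟨hy1, hy2⟩ := abs_le.1 hyT
  have hLT : |(1 + a₂) * x T + a₁ * y T - l| ≤ η / 2 / 2 := by
    have e1 := mul_le_mul_of_nonneg_left hx1 hb.le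
    have e2 := mul_le_mul_of_nonneg_left hx2 hb.le
    have e3 := mul_le_mul_of_nonneg_left hy1 h₁.le
    have e4 := mul_le_mul_of_nonneg_left hy2 h₁.le
    rw [hl', hl, abs_le]
    constructor <;> linarith
  have hX2' : 3 * (1 + a₁ + a₂) * (Real.exp (X T) / ρ) ≤ η / 4 := by
    refine le_trans (le_of_eq ?_) hX2; ring
  have hη2 : a₁ * κ + η / 2 < (1 + a₂) * ρ / 2 := by rw [hκ]; linarith
  obtain ⟨s, hTs, hys, hs⟩ := h.rise (η := η / 2) hρ hκ0 hκσ.le (hl'.trans hl) hLT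
    (by linarith) (by linarith) (by linarith)
  have hdec : ∀ t ∈ Icc T s, m₁ t - m₁ T ≤ Real.exp (X T) / (ρ / 2) ∧ X t ≤ X T := by
    intro t ht
    obtain ⟨e1, e2⟩ := h.decay (half_pos hρ) ht.1 fun r hr =>
      (hs r ⟨hr.1.le, hr.2.le.trans ht.2⟩).2.1
    have : 0 ≤ ρ / 2 * (t - T) := mul_nonneg (half_pos hρ).le (by linarith [ht.1])
    exact ⟨e1, by linarith⟩
  have hsI : s ∈ Icc T s := right_mem_Icc.2 hTs
  have hXν : Real.exp (X s + C * (32 / κ)) ≤ ν := by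
    rw [← Real.le_log_iff_exp_le hν0]
    linarith [(hdec s hsI).2]
  have hXsν : Real.exp (X s) ≤ ν :=
    (Real.exp_le_exp.2 (le_add_of_nonneg_right (by positivity))).trans hXν
  have hGs := abs_first_integral_le h₁ h₂ (X := X s) (Y := Y s) (σ := σ) (l := l)
    (x := x s) (y := y s) (η := η) (by linarith) ((hs s hsI).2.2.trans (by linarith))
    (hXsν.trans hν1) (hE s hTs)
  rw [hK] at hGs
  have hbig : ∀ {t : ℝ}, y t ^ 2 = (σ - κ) ^ 2 →
      |y t ^ 2 + 2 * (1 + a₂) * Real.exp (Y t) - σ ^ 2| ≤ K * η →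
      σ * κ / (2 * (1 + a₂)) ≤ Real.exp (Y t) ∧ Real.exp (Y t) ≤ w * η := by
    intro t e1 e2
    obtain ⟨e3, e4⟩ := abs_le.1 e2
    rw [e1] at e3 e4
    have e5 : κ * κ ≤ σ / 2 * κ := mul_le_mul_of_nonneg_right hκσ.le hκ0.le
    constructor
    · rw [div_le_iff₀ (by positivity)]
      linarith
    · have e6 : 2 * (1 + a₂) * Real.exp (Y t) ≤ 2 * (1 + a₂) * (w * η) := by
        have e7 : 2 * (1 + a₂) * (w * η) = 2 * σ * κ + K * η := by
          rw [← mul_assoc, hw', hκ]; ring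
        rw [e7]
        linarith [mul_pos hκ0 hκ0]
      exact le_of_mul_le_mul_left e6 (by positivity)
  have hYs := (hbig (by rw [hys]) hGs).1
  have hXYs : X s < Y s := Real.exp_lt_exp.1 ((hXsν.trans_lt hν4).trans_le hYs)
  obtain ⟨r, hr, hyr, hLr, hmr, hXr, hGr⟩ := h.turn hTs hκ0 hκσ.le (by linarith) hys
    ((hs s hsI).2.2.trans le_rfl) hXν hν1 hν2 hE hK hKη hν3
  have hTr : T ≤ r := hTs.trans hr.1
  obtain ⟨hYr, hYrw⟩ := hbig (by rw [hyr, neg_sq]) hGr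
  have hXYr : X r < Y r := Real.exp_lt_exp.1 ((hXr.trans_lt hν4).trans_le hYr)
  have hvη : w * η / (σ / 2) = v * η := by rw [hv]; ring
  have hzη : z * η = k * η + η + (3 / 2 * a₂ + 3 / 2 * D) * v * η := by rw [hz]; ring
  have p1 : 0 < a₂ * v * η := by positivity
  have p2 : 0 < D * v * η := by positivity
  obtain ⟨t₃, hrt, hXY₃, hy₃, hL₃, hm₁₃, hm₂₃, hY₃⟩ := h.descend (A := A) (ξ := z * η) (κ := κ)
    hTr hσ hA hl' (by linarith) hLr hYrw hXYr.le
    (by rw [hvη, hzη, hκ]; linarith) (by rw [hvη, hzη, ← hD, ← hκ]; linarith)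
    (by linarith) hξσ
  obtain ⟨t₁, ht₁, hXY₁⟩ : ∃ t ∈ Icc T s, X t - Y t = 0 :=
    intermediate_value_Icc' hTs (h.continuous_X.sub h.symm.continuous_X).continuousOn
      ⟨(sub_neg.2 hXYs).le, sub_nonneg.2 hYX⟩
  have hst₃ : s ≤ t₃ := hr.1.trans hrt
  obtain ⟨d1, d2⟩ := hdec t₁ ht₁
  have hXTη : Real.exp (X T) / (ρ / 2) ≤ η / (6 * D) := by
    rw [le_div_iff₀ (by positivity), hD]
    have : Real.exp (X T) / (ρ / 2) * (6 * (1 + a₁ + a₂)) =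
      4 * (3 * (1 + a₁ + a₂) * (Real.exp (X T) / ρ)) := by ring
    linarith
  have hηD : η / (6 * D) ≤ η / 6 :=
    div_le_div_of_nonneg_left hη0.le (by norm_num) (by linarith)
  have hDη : 6 * D * (η / (6 * D)) = η := by field_simp
  have hcη : c * η = z * η + 3 / 2 * (1 + a₂) * (v * η) := by rw [hc]; ring
  have hy₃' : -σ - c * η ≤ y t₃ := by
    have e1 := h.le_y_sub hTr hrt
    have e2 : (1 + μ) * (1 + a₂) * (m₂ t₃ - m₂ r) ≤ 3 / 2 * (1 + a₂) * (v * η) := by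
      rw [hvη] at hm₂₃
      exact mul_le_mul (mul_le_mul_of_nonneg_right (by linarith [h.le_half]) hb.le) hm₂₃
        (sub_nonneg.2 (h.symm.mass_mono hrt)) (by positivity)
    have e3 : 0 < z * η := by positivity
    linarith
  have q1 : 0 < k * η := by positivity
  have q2 : 0 < c * η := by positivity
  have q3 : 0 < (z + a₁ * c) / (1 + a₂) * η := by positivity
  have q4 : 0 < w * η := by positivity
  have q5 : 0 < v * η := by positivity
  have q6 : 0 < 3 / 2 * (1 + a₂) * (v * η) := by positivity
  have hsum : (k + c + (z + a₁ * c) / (1 + a₂) + w + 2 + v) * η =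
      k * η + c * η + (z + a₁ * c) / (1 + a₂) * η + w * η + 2 * η + v * η := by ring
  rw [hsum]
  refine ⟨t₁, t₃, ht₁.1, ?_, by linarith, hXY₃, ?_, ?_, ?_, ?_, ?_⟩
  -- At `s` the gap `Y - X` is at least `2 C / η`, and the relative speed is at most `2 C`.
  · have e1 := h.X_sub_le hTs hst₃
    have e2 := h.symm.X_sub_le hTs hst₃
    have e3 : Real.log (σ * κ / (2 * (1 + a₂))) ≤ Y s :=
      (Real.log_le_iff_le_exp (by positivity)).2 hYs
    have e4 := (hdec s hsI).2
    have e5 := (abs_le.1 e1).2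
    have e6 := (abs_le.1 e2).1
    have e7 : 2 * C * η⁻¹ ≤ 2 * C * (t₃ - s) := by linarith
    have e8 := le_of_mul_le_mul_left e7 (by positivity)
    linarith [ht₁.2]
  · have e1 := h.y_sub_le le_rfl ht₁.1
    have e2 := (hs t₁ ht₁).1
    have e3 : 0 ≤ (1 - μ) * (1 + a₂) * (m₂ t₁ - m₂ T) :=
      mul_nonneg (mul_nonneg (by linarith [h.le_half]) hb.le)
        (sub_nonneg.2 (h.symm.mass_mono ht₁.1))
    have e4 := mul_le_mul_of_nonneg_left (d1.trans hXTη) (by linarith : 0 ≤ 3 / 2 * a₂)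
    have e5 : 3 / 2 * a₂ * (η / (6 * D)) ≤ 3 / 2 * D * (η / (6 * D)) :=
      mul_le_mul_of_nonneg_right (by linarith) (by positivity)
    rw [abs_le]
    constructor <;> linarith
  · rw [abs_le]
    constructor <;> linarith
  · obtain ⟨e1, e2⟩ := abs_le.1 hL₃
    have e3 := mul_le_mul_of_nonneg_left (show -(c * η) ≤ y t₃ + σ by linarith) h₁.le
    have e4 := mul_le_mul_of_nonneg_left (show y t₃ + σ ≤ c * η by linarith) h₁.le
    have e5 : |x t₃ - A| ≤ (z + a₁ * c) / (1 + a₂) * η := by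
      have e6 : |x t₃ - A| * (1 + a₂) = |(x t₃ - A) * (1 + a₂)| := by
        rw [abs_mul, abs_of_pos hb]
      rw [div_mul_eq_mul_div, le_div_iff₀ hb, e6, abs_le]
      constructor <;> linarith
    linarith
  · have e1 := h.mass_mono ht₁.1
    have e2 := (hdec s hsI).1
    rw [hvη] at hm₁₃
    linarith
  · have := Real.exp_le_exp.2 hY₃
    linarith

end Meeting

/-! ### The reflection of the first component and the final slopes. -/

section Departure

set_option maxHeartbeats 1000000 in
/-- From the second meeting on, the first component carries all the mass, and the slopes tend to
`-A` and `-B`. -/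
theorem exists_departure {a₁ a₂ C σ A B K κ : ℝ} (h₁ : 0 < a₁) (h₂ : 0 < a₂) (hA : 0 ≤ A)
    (hB : 0 < B) (hl : -(1 + a₁) * σ + a₂ * A = -(1 + a₁) * B - a₂ * A) (hK : 0 < K)
    (hκ : 0 < κ) :
    ∀ᶠ η in 𝓝[>] (0 : ℝ), ∀ (δ T s : ℝ) (X Y x y m₁ m₂ θ₁ θ₂ : ℝ → ℝ),
      Flow a₁ a₂ C δ T X Y x y m₁ m₂ θ₁ θ₂ → δ ≤ η → T ≤ s →
      (∀ t ≥ T, |energy a₁ a₂ (X t) (Y t) (x t) (y t) - J a₁ a₂ A (-σ)| ≤ η) →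
      |y s + σ| ≤ K * η → |x s - A| ≤ K * η → Real.exp (Y s) ≤ K * η →
      ∃ M₁ M₂ ξ υ, Tendsto m₁ atTop (𝓝 M₁) ∧ Tendsto m₂ atTop (𝓝 M₂) ∧
        Tendsto x atTop (𝓝 ξ) ∧ Tendsto y atTop (𝓝 υ) ∧ ξ < 0 ∧ υ < 0 ∧
        ((fun t => X t - ξ * t) =O[atTop] fun _ => (1 : ℝ)) ∧
        ((fun t => Y t - υ * t) =O[atTop] fun _ => (1 : ℝ)) ∧
        |ξ + A| ≤ κ ∧ |υ + B| ≤ κ ∧ |M₂ - m₂ s| ≤ κ ∧ |M₁ - m₁ s - 2 * A / (1 + a₁)| ≤ κ := by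
  obtain ⟨D, hD⟩ : ∃ D, D = 1 + a₁ + a₂ := ⟨_, rfl⟩
  have hD0 : 0 < D := by linarith
  have hb : 0 < 1 + a₁ := by linarith
  obtain ⟨l, hl'⟩ : ∃ l, l = -(1 + a₁) * B - a₂ * A := ⟨_, rfl⟩
  obtain ⟨k, hk⟩ : ∃ k, (2 * (1 + a₁) * (1 + (1 + a₂ + a₁) * a₁) + a₁ * (2 * |l| + 1)) /
          (a₂ * (1 + a₂ + a₁)) = k := ⟨_, rfl⟩
  have hk0 : 0 < k := by rw [← hk]; positivity
  obtain ⟨v, hv⟩ : ∃ v, v = K / (B / 2) := ⟨_, rfl⟩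
  have hv0 : 0 < v := by rw [hv]; positivity
  -- `e η` is the accuracy handed to `Flow.final`, `ξ₀` the overshoot of `x` that keeps `y` below
  -- `-B / 2`, and `q` the accuracy required of the limit of `x`.
  obtain ⟨e, he⟩ : ∃ e, e = 2 * ((1 + a₁) * K + a₂ * K) + K + 3 * D * v + 1 := ⟨_, rfl⟩
  have he0 : 0 < e := by rw [he]; positivity
  obtain ⟨ξ₀, hξ₀⟩ : ∃ z, z = (1 + a₁) * B / (4 * a₂) := ⟨_, rfl⟩
  have hξ₀0 : 0 < ξ₀ := by rw [hξ₀]; positivity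
  have hξ₀' : a₂ * ξ₀ = (1 + a₁) * B / 4 := by rw [hξ₀]; field_simp
  obtain ⟨q, hq0, hqκ, hqb, hq1, hqa⟩ : ∃ q > 0, q ≤ κ ∧ q ≤ (1 + a₁) * κ / 4 ∧ q ≤ 1 / 2 ∧
      a₂ * q ≤ (1 + a₁) * κ / 4 := by
    obtain ⟨q, e0, e1, e2, e3, e4⟩ := ((eventually_mem_nhdsWithin (a := (0:ℝ)) (s := Ioi 0)).and
      ((eventually_le_of_linear 1 hκ).and
      ((eventually_le_of_linear 1 (by positivity : 0 < (1 + a₁) * κ / 4)).and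
      ((eventually_le_of_linear 1 one_half_pos).and
        (eventually_le_of_linear a₂ (by positivity : 0 < (1 + a₁) * κ / 4)))))).exists
    exact ⟨q, e0, by linarith, by linarith, by linarith, e4.le⟩
  filter_upwards [self_mem_nhdsWithin, eventually_le_of_linear e one_pos,
    eventually_le_of_linear e (by positivity : 0 < (1 + a₁) * B / 2),
    eventually_le_of_linear ((2 * (1 + a₁) + a₁ * |l|) * e)
      (by positivity : 0 < a₂ * (1 + a₁ + a₂) * ξ₀ ^ 2),
    eventually_le_of_linear (k * e) (by positivity : 0 < q ^ 2),
    eventually_le_of_linear e (by positivity : 0 < (1 + a₁) * κ / 4),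
    eventually_le_of_linear (K + 3 / 2 * a₁ * v) one_half_pos,
    eventually_le_of_linear (K + 3 / 2 * a₁ * v + 2 * (2 * A + 1))
      (by positivity : 0 < (1 + a₁) * κ / 2), eventually_le_of_linear v hκ] with
    η hη0 hη1 hη2 hη3 hη4 hη5 hη6 hη7 hη8 δ T s X Y x y m₁ m₂ θ₁ θ₂ h hδ hTs hE hy hx hY
  rw [mem_Ioi] at hη0
  have heη : e * η = 2 * ((1 + a₁) * (K * η) + a₂ * (K * η)) + K * η + 3 * D * v * η + η := by
    rw [he]; ring
  have hvη : K * η / (B / 2) = v * η := by rw [hv]; ring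
  have p1 : 0 < (1 + a₁) * (K * η) := by positivity
  have p2 : 0 < a₂ * (K * η) := by positivity
  have p3 : 0 < K * η := by positivity
  have p4 : 0 < D * v * η := by positivity
  have p5 : 0 < v * η := by positivity
  have p6 : 0 < a₁ * v * η := by positivity
  have hEl : J a₁ a₂ A (-σ) =
      a₁ / (2 * (1 + a₁)) * l ^ 2 + a₂ * (1 + a₁ + a₂) / (2 * (1 + a₁)) * A ^ 2 := by
    rw [hl', ← hl]; unfold J; field_simp; ring
  obtain ⟨hy1, hy2⟩ := abs_le.1 hy
  obtain ⟨hx1, hx2⟩ := abs_le.1 hx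
  have hL : |(1 + a₁) * y s + a₂ * x s - l| ≤ e * η / 2 := by
    have e1 := mul_le_mul_of_nonneg_left hy1 hb.le
    have e2 := mul_le_mul_of_nonneg_left hy2 hb.le
    have e3 := mul_le_mul_of_nonneg_left hx1 h₂.le
    have e4 := mul_le_mul_of_nonneg_left hx2 h₂.le
    rw [hl', ← hl, heη, abs_le]
    constructor <;> linarith
  have hfin := h.final hTs hA hB hl' hξ₀0.le hη1.le hL hY (by linarith)
    (by rw [hvη, heη, ← hD]; linarith)
    (fun t ht => by rw [← hEl]; exact (hE t ht).trans (by linarith)) (by linarith)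
    (by linarith) (by linarith)
  rw [hk, hvη] at hfin
  obtain ⟨M₁, M₂, ξ, υ, hM₁, hM₂, hξ, hυ, hξ0, hυ0, hXO, hYO⟩ :=
    h.tail hTs (half_pos hB) fun t ht => (hfin t ht).1
  have hXbot : Tendsto X atTop atBot := tendsto_atBot_of_hasDerivAt_le (c := ξ / 2) (by linarith)
    h.hX (hξ.eventually_le_const (by linarith))
  -- As `X → -∞` the first integral becomes `ξ² ≈ A²`. Since `-ξ` and `A` are nonnegative, `(ξ + A)²
  -- ≤ |ξ² - A²|`.
  have hξq : |ξ + A| ≤ q := by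
    have e1 : |ξ ^ 2 + 2 * (1 + a₁) * 0 - A ^ 2| ≤ k * (e * η) := by
      refine le_of_tendsto (((hξ.pow 2).add ((Real.tendsto_exp_atBot.comp hXbot).const_mul
        (2 * (1 + a₁)))).sub_const (A ^ 2)).abs ?_
      filter_upwards [eventually_ge_atTop s] with t ht using (hfin t ht).2.2.2
    have e2 := abs_le.1 e1
    refine abs_le_of_sq_le_sq ?_ hq0.le
    rcases le_total (-ξ) A with e3 | e3
    · nlinarith [mul_nonneg hA (by linarith : 0 ≤ A + ξ), mul_nonneg_of_nonpos_of_nonpos hξ0.le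
        (by linarith : -(A + ξ) ≤ 0)]
    · nlinarith [mul_nonneg hA (by linarith : 0 ≤ -ξ - A)]
  have hm₂ : M₂ - m₂ s ≤ v * η := by
    refine le_of_tendsto (hM₂.sub_const _) ?_
    filter_upwards [eventually_ge_atTop s] with t ht using (hfin t ht).2.1
  have hm₂' := h.symm.mass_le hM₂ s
  obtain ⟨hξ1, hξ2⟩ := abs_le.1 hξq
  refine ⟨M₁, M₂, ξ, υ, hM₁, hM₂, hξ, hυ, hξ0, hυ0, hXO, hYO, hξq.trans hqκ, ?_, ?_, ?_⟩
  · have e1 : |(1 + a₁) * υ + a₂ * ξ - l| ≤ e * η := by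
      refine le_of_tendsto (((hυ.const_mul _).add (hξ.const_mul _)).sub_const l).abs ?_
      filter_upwards [eventually_ge_atTop s] with t ht using (hfin t ht).2.2.1
    obtain ⟨e2, e3⟩ := abs_le.1 e1
    have e4 := mul_le_mul_of_nonneg_left hξ1 h₂.le
    have e5 := mul_le_mul_of_nonneg_left hξ2 h₂.le
    rw [hl'] at e2 e3
    rw [abs_le]
    constructor
    · refine le_of_mul_le_mul_left (?_ : (1 + a₁) * _ ≤ (1 + a₁) * _) hb
      linarith
    · refine le_of_mul_le_mul_left (?_ : (1 + a₁) * _ ≤ (1 + a₁) * _) hb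
      linarith
  · rw [abs_le]
    constructor <;> linarith
  · obtain ⟨m, hm⟩ : ∃ m, m = M₁ - m₁ s := ⟨_, rfl⟩
    have hm0 : 0 ≤ m := by rw [hm]; exact sub_nonneg.2 (h.mass_le hM₁ s)
    have hM₁' : Tendsto (fun t => m₁ t - m₁ s) atTop (𝓝 m) := hm ▸ hM₁.sub_const _
    -- Up to errors, `1 + a₁` times the remaining first mass is the drop of `x` from `A` to `-A`.
    have e1 : -((1 + δ) * (1 + a₁) * m) ≤ ξ - x s := by
      refine le_of_tendsto_of_tendsto (hM₁'.const_mul _).neg (hξ.sub_const _) ?_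
      filter_upwards [eventually_ge_atTop s] with t ht using h.symm.le_y_sub hTs ht
    have e2 : ξ - x s ≤ 3 / 2 * a₁ * (M₂ - m₂ s) - (1 - δ) * (1 + a₁) * m := by
      refine le_of_tendsto_of_tendsto (hξ.sub_const _)
        (((hM₂.sub_const (m₂ s)).const_mul _).sub (hM₁'.const_mul _)) ?_
      filter_upwards [eventually_ge_atTop s] with t ht using h.symm.y_sub_le hTs ht
    have e3 := mul_le_mul_of_nonneg_left hm₂ (by linarith : 0 ≤ 3 / 2 * a₁)
    obtain ⟨n, hn⟩ : ∃ n, n = (1 + a₁) * m := ⟨_, rfl⟩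
    have hn0 : 0 ≤ n := by rw [hn]; positivity
    rw [mul_assoc (1 + δ), ← hn] at e1
    rw [mul_assoc (1 - δ), ← hn] at e2
    have e4 : n ≤ 2 * (2 * A + 1) := by
      have : 1 / 2 * n ≤ (1 - δ) * n := mul_le_mul_of_nonneg_right (by linarith [h.le_half]) hn0
      linarith
    have e5 : δ * n ≤ η * (2 * (2 * A + 1)) := mul_le_mul hδ e4 hn0 hη0.le
    rw [← hm]
    have e6 : (1 + a₁) * (2 * A / (1 + a₁)) = 2 * A := by field_simp
    rw [abs_le]
    constructor
    · refine le_of_mul_le_mul_left (?_ : (1 + a₁) * _ ≤ (1 + a₁) * _) hb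
      rw [mul_sub, e6, ← hn]
      linarith
    · refine le_of_mul_le_mul_left (?_ : (1 + a₁) * _ ≤ (1 + a₁) * _) hb
      rw [mul_sub, e6, ← hn]
      linarith

end Departure

/-! ### The full history of a trajectory. -/

section Phases

set_option maxHeartbeats 1000000 in
/-- The full history of a trajectory that starts close to `x = -ρ`, `y = σ` with both components
small. -/
theorem exists_phases {a₁ a₂ C ρ σ A B κ : ℝ} (h₁ : 0 < a₁) (h₂ : 0 < a₂) (hC : 0 < C)
    (hρ : 0 < ρ) (hσ : 0 < σ) (hA : 0 ≤ A) (hB : 0 < B)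
    (hl : (1 + a₂) * A - a₁ * σ = -(1 + a₂) * ρ + a₁ * σ)
    (hl' : -(1 + a₁) * σ + a₂ * A = -(1 + a₁) * B - a₂ * A) (hκ : 0 < κ) :
    ∀ᶠ μ in 𝓝[>] (0 : ℝ),
      ∀ (T : ℝ) (X Y x y m₁ m₂ θ₁ θ₂ : ℝ → ℝ), Flow a₁ a₂ C μ T X Y x y m₁ m₂ θ₁ θ₂ →
      |x T - -ρ| ≤ μ → |y T - σ| ≤ μ → X T ≤ -μ⁻¹ → Y T ≤ X T →
      ∃ t₁ t₃ M₁ M₂ ξ υ, T ≤ t₁ ∧ t₁ < t₃ ∧ κ⁻¹ ≤ t₃ - t₁ ∧ X t₁ = Y t₁ ∧ X t₃ = Y t₃ ∧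
        Tendsto m₁ atTop (𝓝 M₁) ∧ Tendsto m₂ atTop (𝓝 M₂) ∧
        Tendsto x atTop (𝓝 ξ) ∧ Tendsto y atTop (𝓝 υ) ∧ ξ < 0 ∧ υ < 0 ∧
        ((fun t => X t - ξ * t) =O[atTop] fun _ => (1 : ℝ)) ∧
        ((fun t => Y t - υ * t) =O[atTop] fun _ => (1 : ℝ)) ∧
        |ξ + A| ≤ κ ∧ |υ + B| ≤ κ ∧ |m₁ t₃ - m₁ t₁| ≤ κ ∧
        |m₂ t₃ - m₂ t₁ - 2 * σ / (1 + a₂)| ≤ κ ∧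
        |M₂ - m₂ t₃| ≤ κ ∧ |M₁ - m₁ t₃ - 2 * A / (1 + a₁)| ≤ κ := by
  have hb : 0 < 1 + a₂ := by linarith
  obtain ⟨K, hK, hmeet⟩ := exists_meeting h₁ h₂ hC hρ hσ hA hl
  obtain ⟨η, hη0, hmeet, hdep, hη1, hη2, hη3, hη4⟩ := ((eventually_mem_nhdsWithin (a := (0:ℝ))
    (s := Ioi 0)).and (hmeet.and ((exists_departure (C := C) h₁ h₂ hA hB hl' hK hκ).and
    ((eventually_le_of_linear K hκ).and ((eventually_le_of_linear 1 hκ).and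
    ((eventually_le_of_linear (2 * K + 3 / 2 * a₂ * K) one_pos).and (eventually_le_of_linear
      (2 * K + 3 / 2 * a₂ * K + 2 * (2 * σ + 1)) (mul_pos hb hκ)))))))).exists
  rw [mem_Ioi] at hη0
  filter_upwards [hmeet, eventually_le_of_linear 1 hη0] with
    μ hmeet hμ T X Y x y m₁ m₂ θ₁ θ₂ h hxT hyT hXT hYX
  obtain ⟨hE, t₁, t₃, hTt, ht, hXY₁, hXY₃, hy₁, hy₃, hx₃, hm, hY⟩ :=
    hmeet T X Y x y m₁ m₂ θ₁ θ₂ h hxT hyT hXT hYX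
  have hη' : 0 < η⁻¹ := inv_pos.2 hη0
  have hκη : κ⁻¹ ≤ η⁻¹ := inv_anti₀ hη0 (by linarith)
  have ht' : t₁ < t₃ := by linarith
  -- The reflection described by `hl` preserves `J`, so both halves of the history refer to the same
  -- energy level.
  have hJ : J a₁ a₂ (-ρ) σ = J a₁ a₂ A (-σ) := by
    unfold J
    linear_combination (-(a₂ / 2) * (A - ρ)) * hl
  rw [hJ] at hE
  obtain ⟨M₁, M₂, ξ, υ, hM₁, hM₂, hξ, hυ, hξ0, hυ0, hXO, hYO, h1, h2, h3, h4⟩ :=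
    hdep μ T t₃ X Y x y m₁ m₂ θ₁ θ₂ h (by linarith) (hTt.trans ht'.le) hE hy₃ hx₃ hY
  refine ⟨t₁, t₃, M₁, M₂, ξ, υ, hTt, ht', hκη.trans ht, hXY₁, hXY₃, hM₁, hM₂, hξ, hυ, hξ0, hυ0,
    hXO, hYO, h1, h2, ?_, ?_, h3, h4⟩
  · rw [abs_of_nonneg (sub_nonneg.2 (h.mass_mono ht'.le))]
    linarith
  · obtain ⟨n, hn⟩ : ∃ n, n = (1 + a₂) * (m₂ t₃ - m₂ t₁) := ⟨_, rfl⟩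
    have hn0 : 0 ≤ n := by
      rw [hn]; exact mul_nonneg hb.le (sub_nonneg.2 (h.symm.mass_mono ht'.le))
    -- The drop of `y` from `σ` to `-σ` is `1 + a₂` times the second mass, up to errors.
    have e1 := h.le_y_sub hTt ht'.le
    have e2 := h.y_sub_le hTt ht'.le
    rw [mul_assoc (1 + μ), ← hn] at e1
    rw [mul_assoc (1 - μ), ← hn] at e2
    obtain ⟨e3, e4⟩ := abs_le.1 hy₁
    obtain ⟨e5, e6⟩ := abs_le.1 hy₃
    have e7 := mul_le_mul_of_nonneg_left hm (by linarith : 0 ≤ 3 / 2 * a₂)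
    have e8 : 1 / 2 * n ≤ (1 - μ) * n := mul_le_mul_of_nonneg_right (by linarith [h.le_half]) hn0
    have e9 : n ≤ 2 * (2 * σ + 1) := by linarith
    have e10 : μ * n ≤ η * (2 * (2 * σ + 1)) :=
      mul_le_mul (by linarith) e9 hn0 hη0.le
    have e11 : (1 + a₂) * (2 * σ / (1 + a₂)) = 2 * σ := by field_simp
    have p1 : 0 < a₂ * (K * η) := by positivity
    rw [abs_le]
    constructor
    · refine le_of_mul_le_mul_left (?_ : (1 + a₂) * _ ≤ (1 + a₂) * _) hb
      rw [mul_sub, e11, ← hn]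
      linarith
    · refine le_of_mul_le_mul_left (?_ : (1 + a₂) * _ ≤ (1 + a₂) * _) hb
      rw [mul_sub, e11, ← hn]
      linarith

end Phases

/-! ### The truncated system as a perturbation of the Liouville system. -/

section Truncated

/-- A bounded Lipschitz nonlinearity that agrees with `-F a` for nonpositive arguments. -/
def truncF (a s t : ℝ) : ℝ := cap s * (1 - (1 + a) * cap s + a * cap t)

theorem truncF_of_nonpos {a s t : ℝ} (hs : s ≤ 0) (ht : t ≤ 0) :
    truncF a s t = Real.exp s * (1 - (1 + a) * Real.exp s + a * Real.exp t) := by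
  rw [truncF, cap_of_nonpos hs, cap_of_nonpos ht]

theorem truncF_eq_neg_F {a s t : ℝ} (hs : s ≤ 0) (ht : t ≤ 0) : truncF a s t = -F a s t := by
  rw [truncF_of_nonpos hs ht, F, two_mul, Real.exp_add, Real.exp_add]; ring

theorem abs_truncF_le {a : ℝ} (ha : 0 < a) (s t : ℝ) : |truncF a s t| ≤ (1 + a) * cap s := by
  have h1 := cap_pos s
  have h2 := cap_le_one s
  have h3 := cap_pos t
  have h4 := cap_le_one t
  rw [truncF, abs_mul, abs_of_pos h1, mul_comm]
  refine mul_le_mul_of_nonneg_right ?_ h1.le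
  rw [abs_le]
  constructor <;> nlinarith

theorem abs_truncF_sub_le {a : ℝ} (ha : 0 < a) (s t s' t' : ℝ) :
    |truncF a s t - truncF a s' t'| ≤ (3 + 4 * a) * (|s - s'| + |t - t'|) := by
  have h1 := cap_pos s
  have h2 := cap_le_one s
  have h3 := cap_pos t
  have h4 := cap_le_one t
  have h5 := cap_pos s'
  have h6 := cap_le_one s'
  have e1 := abs_cap_sub_le s s'
  have e2 := abs_cap_sub_le t t'
  have key : truncF a s t - truncF a s' t' =
      (1 - (1 + a) * (cap s + cap s') + a * cap t) * (cap s - cap s')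
        + a * cap s' * (cap t - cap t') := by unfold truncF; ring
  have e3 : |1 - (1 + a) * (cap s + cap s') + a * cap t| ≤ 3 + 4 * a := by
    rw [abs_le]
    constructor <;> nlinarith
  have e4 : |a * cap s'| ≤ 3 + 4 * a := by
    rw [abs_of_pos (mul_pos ha h5)]; nlinarith
  rw [key, mul_add (3 + 4 * a)]
  refine (abs_add_le _ _).trans (add_le_add ?_ ?_)
  · rw [abs_mul]
    exact mul_le_mul e3 e1 (abs_nonneg _) (by linarith)
  · rw [abs_mul]
    exact mul_le_mul e4 e2 (abs_nonneg _) (by linarith)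

theorem continuous_truncF (a : ℝ) : Continuous fun q : ℝ × ℝ => truncF a q.1 q.2 := by
  have := continuous_cap
  unfold truncF
  fun_prop

/-- The truncated system in logarithmic coordinates, with the masses of its components. -/
structure System (a₁ a₂ : ℝ) (X Y x y m₁ m₂ : ℝ → ℝ) : Prop where
  hX : ∀ t, HasDerivAt X (x t) t
  hY : ∀ t, HasDerivAt Y (y t) t
  hx : ∀ t, HasDerivAt x (Real.exp (2 * t) * (-(1 + a₁) * truncF a₁ (X t - 2 * t) (Y t - 2 * t)
    + a₁ * truncF a₂ (Y t - 2 * t) (X t - 2 * t))) t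
  hy : ∀ t, HasDerivAt y (Real.exp (2 * t) * (-(1 + a₂) * truncF a₂ (Y t - 2 * t) (X t - 2 * t)
    + a₂ * truncF a₁ (X t - 2 * t) (Y t - 2 * t))) t
  hm₁ : ∀ t, HasDerivAt m₁ (Real.exp (X t)) t
  hm₂ : ∀ t, HasDerivAt m₂ (Real.exp (Y t)) t

variable {a₁ a₂ : ℝ}

/-- Completion of the square in `J`. Through this bound the energy controls the slopes. -/
theorem sq_le_J (h₂ : 0 < a₂) (x y : ℝ) :
    a₁ * (1 + a₁ + a₂) / (2 * (1 + a₂)) * y ^ 2 ≤ J a₁ a₂ x y := by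
  have : J a₁ a₂ x y = a₂ / (2 * (1 + a₂)) * ((1 + a₂) * x + a₁ * y) ^ 2 +
      a₁ * (1 + a₁ + a₂) / (2 * (1 + a₂)) * y ^ 2 := by
    unfold J; field_simp; ring
  rw [this]
  have : 0 ≤ a₂ / (2 * (1 + a₂)) * ((1 + a₂) * x + a₁ * y) ^ 2 := by positivity
  linarith

/-- The weight of a component in the nonlinearity, relative to the Liouville system. -/
def theta (a : ℝ) (X Y : ℝ → ℝ) (t : ℝ) : ℝ :=
  Real.exp (2 * t) * truncF a (X t - 2 * t) (Y t - 2 * t) * Real.exp (-X t)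

theorem theta_mul_exp (a : ℝ) (X Y : ℝ → ℝ) (t : ℝ) :
    theta a X Y t * Real.exp (X t) = Real.exp (2 * t) * truncF a (X t - 2 * t) (Y t - 2 * t) := by
  rw [theta, mul_assoc, ← Real.exp_add]; simp

theorem theta_of_nonpos {a : ℝ} {X Y : ℝ → ℝ} {t : ℝ} (hX : X t - 2 * t ≤ 0)
    (hY : Y t - 2 * t ≤ 0) : theta a X Y t =
      1 - Real.exp (-2 * t) * ((1 + a) * Real.exp (X t) - a * Real.exp (Y t)) := by
  have e1 : Real.exp (X t - 2 * t) = Real.exp (X t) * Real.exp (-2 * t) := by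
    rw [← Real.exp_add]; ring_nf
  have e2 : Real.exp (Y t - 2 * t) = Real.exp (Y t) * Real.exp (-2 * t) := by
    rw [← Real.exp_add]; ring_nf
  have e3 : Real.exp (2 * t) * Real.exp (-2 * t) = 1 := by rw [← Real.exp_add]; simp
  have e4 : Real.exp (X t) * Real.exp (-X t) = 1 := by rw [← Real.exp_add]; simp
  rw [theta, truncF_of_nonpos hX hY, e1, e2]
  calc _ = (Real.exp (2 * t) * Real.exp (-2 * t)) * (Real.exp (X t) * Real.exp (-X t)) *
      (1 - (1 + a) * (Real.exp (X t) * Real.exp (-2 * t)) +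
        a * (Real.exp (Y t) * Real.exp (-2 * t))) := by ring
    _ = _ := by rw [e3, e4]; ring

/-- The correction of the energy. -/
def correction (a₁ a₂ X Y : ℝ) : ℝ :=
  a₂ * (1 + a₁) / 2 * Real.exp (2 * X) + a₁ * (1 + a₂) / 2 * Real.exp (2 * Y)
    - a₁ * a₂ * Real.exp (X + Y)

theorem abs_correction_le (h₁ : 0 < a₁) (h₂ : 0 < a₂) {X Y C : ℝ} (hX : Real.exp X ≤ C)
    (hY : Real.exp Y ≤ C) : |correction a₁ a₂ X Y| ≤
      (a₂ * (1 + a₁) / 2 + a₁ * (1 + a₂) / 2 + a₁ * a₂) * C ^ 2 := by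
  have e1 : Real.exp (2 * X) ≤ C ^ 2 := by
    rw [two_mul, Real.exp_add, sq]
    exact mul_self_le_mul_self (Real.exp_pos _).le hX
  have e2 : Real.exp (2 * Y) ≤ C ^ 2 := by
    rw [two_mul, Real.exp_add, sq]
    exact mul_self_le_mul_self (Real.exp_pos _).le hY
  have e3 : Real.exp (X + Y) ≤ C ^ 2 := by
    rw [Real.exp_add, sq]
    exact mul_le_mul hX hY (Real.exp_pos _).le ((Real.exp_pos _).le.trans hX)
  have p1 := mul_le_mul_of_nonneg_left e1 (by positivity : 0 ≤ a₂ * (1 + a₁) / 2)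
  have p2 := mul_le_mul_of_nonneg_left e2 (by positivity : 0 ≤ a₁ * (1 + a₂) / 2)
  have p3 := mul_le_mul_of_nonneg_left e3 (by positivity : 0 ≤ a₁ * a₂)
  have q1 : 0 ≤ a₂ * (1 + a₁) / 2 * Real.exp (2 * X) := by positivity
  have q2 : 0 ≤ a₁ * (1 + a₂) / 2 * Real.exp (2 * Y) := by positivity
  have q3 : 0 ≤ a₁ * a₂ * Real.exp (X + Y) := by positivity
  rw [correction, abs_le]
  constructor <;> linarith

variable {X Y x y m₁ m₂ : ℝ → ℝ}

namespace System

theorem symm (h : System a₁ a₂ X Y x y m₁ m₂) : System a₂ a₁ Y X y x m₂ m₁ :=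
  ⟨h.hY, h.hX, h.hy, h.hx, h.hm₂, h.hm₁⟩

theorem hasDerivAt_x (h : System a₁ a₂ X Y x y m₁ m₂) (t : ℝ) :
    HasDerivAt x (-(1 + a₁) * theta a₁ X Y t * Real.exp (X t)
      + a₁ * theta a₂ Y X t * Real.exp (Y t)) t := by
  refine (h.hx t).congr_deriv ?_
  rw [mul_assoc _ (theta a₁ X Y t), mul_assoc _ (theta a₂ Y X t), theta_mul_exp, theta_mul_exp]
  ring

/-- The Liouville terms cancel, and only the deviations `1 - θ` of the weights remain. -/
theorem hasDerivAt_energy (h : System a₁ a₂ X Y x y m₁ m₂) (t : ℝ) :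
    HasDerivAt (fun t => energy a₁ a₂ (X t) (Y t) (x t) (y t))
      ((1 + a₁ + a₂) * (a₂ * x t * Real.exp (X t) * (1 - theta a₁ X Y t)
        + a₁ * y t * Real.exp (Y t) * (1 - theta a₂ Y X t))) t := by
  have hx := h.hasDerivAt_x t
  have hy := h.symm.hasDerivAt_x t
  unfold energy J
  refine (((((hx.fun_pow 2).const_mul (a₂ * (1 + a₂) / 2)).fun_add
    ((hx.const_mul (a₁ * a₂)).fun_mul hy)).fun_add
    ((hy.fun_pow 2).const_mul (a₁ * (1 + a₁) / 2))).fun_add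
    ((((h.hX t).exp.const_mul a₂).fun_add ((h.hY t).exp.const_mul a₁)).const_mul
      (1 + a₁ + a₂))).congr_deriv ?_
  push_cast
  ring

/-- Apart from the derivative of `e^{-2t}`, this reproduces the defect of the energy when `1 - θ =
e^{-2t} ((1 + a) e^X - a e^Y)`. Subtracting the correction eliminates the slopes, for which no bound
is available at that stage. -/
theorem hasDerivAt_correction (h : System a₁ a₂ X Y x y m₁ m₂) (t : ℝ) :
    HasDerivAt (fun t => Real.exp (-2 * t) * correction a₁ a₂ (X t) (Y t))
      (Real.exp (-2 * t) * (a₂ * x t * Real.exp (X t) *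
          ((1 + a₁) * Real.exp (X t) - a₁ * Real.exp (Y t))
        + a₁ * y t * Real.exp (Y t) * ((1 + a₂) * Real.exp (Y t) - a₂ * Real.exp (X t)))
        - 2 * (Real.exp (-2 * t) * correction a₁ a₂ (X t) (Y t))) t := by
  have he : HasDerivAt (fun t : ℝ => Real.exp (-2 * t)) (Real.exp (-2 * t) * (-2)) t := by
    simpa using ((hasDerivAt_id t).const_mul (-2 : ℝ)).exp
  have := he.fun_mul ((((((h.hX t).const_mul 2).exp.const_mul (a₂ * (1 + a₁) / 2))).fun_add
    (((h.hY t).const_mul 2).exp.const_mul (a₁ * (1 + a₂) / 2))).fun_sub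
      (((h.hX t).fun_add (h.hY t)).exp.const_mul (a₁ * a₂)))
  unfold correction
  refine this.congr_deriv ?_
  have e : ∀ s : ℝ, Real.exp (2 * s) = Real.exp s * Real.exp s := fun s => by
    rw [two_mul, Real.exp_add]
  rw [e, e, Real.exp_add]
  ring

/-- The energy is almost conserved as long as both components stay bounded. -/
theorem abs_energy_sub_le (h : System a₁ a₂ X Y x y m₁ m₂) (h₁ : 0 < a₁) (h₂ : 0 < a₂)
    {C T t : ℝ} (hTt : T ≤ t) (hC : Real.log C ≤ 2 * T)
    (hX : ∀ r ∈ Icc T t, Real.exp (X r) ≤ C) (hY : ∀ r ∈ Icc T t, Real.exp (Y r) ≤ C) :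
    |energy a₁ a₂ (X t) (Y t) (x t) (y t) - energy a₁ a₂ (X T) (Y T) (x T) (y T)| ≤
      3 * (1 + a₁ + a₂) * ((a₂ * (1 + a₁) / 2 + a₁ * (1 + a₂) / 2 + a₁ * a₂) * C ^ 2) *
        Real.exp (-2 * T) := by
  obtain ⟨S, hS⟩ : ∃ S, S = (a₂ * (1 + a₁) / 2 + a₁ * (1 + a₂) / 2 + a₁ * a₂) * C ^ 2 := ⟨_, rfl⟩
  have hD : 0 < 1 + a₁ + a₂ := by linarith
  have hC0 : 0 < C := (Real.exp_pos _).trans_le (hX T ⟨le_rfl, hTt⟩)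
  have hcor : ∀ r ∈ Icc T t, |correction a₁ a₂ (X r) (Y r)| ≤ S := fun r hr => by
    rw [hS]; exact abs_correction_le h₁ h₂ (hX r hr) (hY r hr)
  have hS0 : 0 ≤ S := (abs_nonneg _).trans (hcor T ⟨le_rfl, hTt⟩)
  have hneg : ∀ r ∈ Icc T t, X r - 2 * r ≤ 0 ∧ Y r - 2 * r ≤ 0 := fun r hr => by
    have e1 := (Real.le_log_iff_exp_le hC0).2 (hX r hr)
    have e2 := (Real.le_log_iff_exp_le hC0).2 (hY r hr)
    constructor <;> linarith [hr.1]
  have he : ∀ r, HasDerivAt (fun r : ℝ => -((1 + a₁ + a₂) * S * Real.exp (-2 * r)))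
      (2 * (1 + a₁ + a₂) * S * Real.exp (-2 * r)) r := fun r => by
    have := (((hasDerivAt_id r).const_mul (-2 : ℝ)).exp.const_mul ((1 + a₁ + a₂) * S)).fun_neg
    refine this.congr_deriv ?_
    simp only [id]; ring
  have h1 := norm_sub_le_of_hasDerivAt hTt (fun r => (h.hasDerivAt_energy r).fun_sub
    ((h.hasDerivAt_correction r).const_mul (1 + a₁ + a₂))) he (fun r hr => by
      obtain ⟨e1, e2⟩ := hneg r ⟨hr.1, hr.2.le⟩
      rw [theta_of_nonpos e1 e2, theta_of_nonpos e2 e1, Real.norm_eq_abs]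
      have : ∀ A B G : ℝ, |A - (1 + a₁ + a₂) * (B - 2 * (Real.exp (-2 * r) * G))| =
          |A - (1 + a₁ + a₂) * B + 2 * (1 + a₁ + a₂) * Real.exp (-2 * r) * G| := fun A B G => by
        congr 1; ring
      rw [this]
      have e3 := hcor r ⟨hr.1, hr.2.le⟩
      generalize correction a₁ a₂ (X r) (Y r) = G at e3
      have e4 : ∀ A : ℝ, A = 0 → |A + 2 * (1 + a₁ + a₂) * Real.exp (-2 * r) * G| ≤
          2 * (1 + a₁ + a₂) * S * Real.exp (-2 * r) := fun A hA => by
        rw [hA, zero_add, abs_mul, abs_of_pos (by positivity)]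
        have := mul_le_mul_of_nonneg_left e3
          (by positivity : 0 ≤ 2 * (1 + a₁ + a₂) * Real.exp (-2 * r))
        linarith
      exact e4 _ (by ring))
  rw [Real.norm_eq_abs] at h1
  have hdec : ∀ r ∈ Icc T t, |(1 + a₁ + a₂) *
      (Real.exp (-2 * r) * correction a₁ a₂ (X r) (Y r))| ≤
      (1 + a₁ + a₂) * S * Real.exp (-2 * r) := fun r hr => by
    rw [abs_mul, abs_mul, abs_of_pos hD, abs_of_pos (Real.exp_pos _)]
    have := mul_le_mul_of_nonneg_left (hcor r hr)
      (by positivity : 0 ≤ (1 + a₁ + a₂) * Real.exp (-2 * r))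
    linarith
  have h2 := abs_le.1 (hdec t ⟨hTt, le_rfl⟩)
  have h3 := abs_le.1 (hdec T ⟨le_rfl, hTt⟩)
  have h4 := abs_le.1 h1
  have h5 : (1 + a₁ + a₂) * S * Real.exp (-2 * t) ≤ (1 + a₁ + a₂) * S * Real.exp (-2 * T) :=
    mul_le_mul_of_nonneg_left (Real.exp_le_exp.2 (by linarith)) (by positivity)
  have h6 : 0 ≤ (1 + a₁ + a₂) * S * Real.exp (-2 * t) := by positivity
  rw [← hS, abs_le]
  constructor <;> linarith [h2.1, h2.2, h3.1, h3.2, h4.1, h4.2]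

end System

set_option maxHeartbeats 1000000 in
/-- Late enough, the truncated system is a small perturbation of the Liouville system. -/
theorem exists_flow (h₁ : 0 < a₁) (h₂ : 0 < a₂) {E₀ : ℝ} (hE₀ : 0 ≤ E₀) :
    ∃ C > 0, ∀ μ > 0, μ ≤ 1 / 2 → ∀ᶠ T in atTop, ∀ X Y x y m₁ m₂ : ℝ → ℝ,
      System a₁ a₂ X Y x y m₁ m₂ → energy a₁ a₂ (X T) (Y T) (x T) (y T) ≤ E₀ →
      Flow a₁ a₂ C μ T X Y x y m₁ m₂ (theta a₁ X Y) (theta a₂ Y X) ∧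
      ∀ t ≥ T, X t - 2 * t ≤ 0 ∧ Y t - 2 * t ≤ 0 := by
  have hD : 0 < 1 + a₁ + a₂ := by linarith
  -- Since `J ≥ 0`, an energy below `E₀ + 1` keeps both exponentials below `C₁`.
  obtain ⟨C₁, hC₁0, hC₁⟩ : ∃ C₁ > 0, E₀ + 1 ≤ (1 + a₁ + a₂) * (min a₁ a₂ * C₁) := by
    have : 0 < min a₁ a₂ := lt_min h₁ h₂
    exact ⟨(E₀ + 1) / ((1 + a₁ + a₂) * min a₁ a₂), by positivity, by field_simp; rfl⟩
  set q₁ := (E₀ + 1) * (2 * (1 + a₂)) / (a₁ * (1 + a₁ + a₂)) with hq₁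
  set q₂ := (E₀ + 1) * (2 * (1 + a₁)) / (a₂ * (1 + a₂ + a₁)) with hq₂
  have hq₁0 : 0 < q₁ := by positivity
  have hq₂0 : 0 < q₂ := by positivity
  set S := (a₂ * (1 + a₁) / 2 + a₁ * (1 + a₂) / 2 + a₁ * a₂) * C₁ ^ 2 with hS
  have hS0 : 0 < S := by positivity
  refine ⟨C₁ + q₁ + q₂ + 1, by positivity, fun μ hμ0 hμ => ?_⟩
  have hexp : Tendsto (fun T : ℝ => Real.exp (-2 * T)) atTop (𝓝 0) :=
    Real.tendsto_exp_atBot.comp (tendsto_id.const_mul_atTop_of_neg (by norm_num))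
  have hsmall : ∀ k b : ℝ, 0 < b → ∀ᶠ T : ℝ in atTop, k * Real.exp (-2 * T) < b := fun k b hb =>
    (mul_zero k ▸ hexp.const_mul k : Tendsto (fun T : ℝ => k * Real.exp (-2 * T)) atTop
      (𝓝 0)).eventually_lt_const hb
  filter_upwards [hsmall (3 * (1 + a₁ + a₂) * S) μ hμ0,
    hsmall ((1 + a₁ + a₁ + (1 + a₂ + a₂)) * C₁) μ hμ0,
    eventually_ge_atTop (Real.log C₁ / 2)] with T hT1 hT2 hT3 X Y x y m₁ m₂ h hE
  have hXc : Continuous X := continuous_iff_continuousAt.2 fun t => (h.hX t).continuousAt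
  have hYc : Continuous Y := continuous_iff_continuousAt.2 fun t => (h.hY t).continuousAt
  have hmc : Continuous fun t => max (Real.exp (X t)) (Real.exp (Y t)) := by fun_prop
  have hJ : ∀ t, 0 ≤ J a₁ a₂ (x t) (y t) := fun t =>
    le_trans (by positivity) (sq_le_J h₂ (x t) (y t))
  have hlt : ∀ t, energy a₁ a₂ (X t) (Y t) (x t) (y t) < E₀ + 1 →
      Real.exp (X t) < C₁ ∧ Real.exp (Y t) < C₁ := fun t ht => by
    have e1 : (1 + a₁ + a₂) * (a₂ * Real.exp (X t) + a₁ * Real.exp (Y t)) <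
        (1 + a₁ + a₂) * (min a₁ a₂ * C₁) := by
      refine lt_of_le_of_lt ?_ (ht.trans_le hC₁)
      unfold energy
      linarith [hJ t]
    have e2 := lt_of_mul_lt_mul_left e1 hD.le
    have e3 : min a₁ a₂ * C₁ ≤ a₁ * C₁ := mul_le_mul_of_nonneg_right (min_le_left _ _) hC₁0.le
    have e4 : min a₁ a₂ * C₁ ≤ a₂ * C₁ := mul_le_mul_of_nonneg_right (min_le_right _ _) hC₁0.le
    have e5 : 0 < a₂ * Real.exp (X t) := by positivity
    have e6 : 0 < a₁ * Real.exp (Y t) := by positivity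
    exact ⟨lt_of_mul_lt_mul_left (by linarith) h₂.le, lt_of_mul_lt_mul_left (by linarith) h₁.le⟩
  have hen : ∀ t ≥ T, (∀ r ∈ Icc T t, Real.exp (X r) ≤ C₁ ∧ Real.exp (Y r) ≤ C₁) →
      |energy a₁ a₂ (X t) (Y t) (x t) (y t) - energy a₁ a₂ (X T) (Y T) (x T) (y T)| ≤ μ :=
    fun t ht hr => (h.abs_energy_sub_le h₁ h₂ ht (by linarith) (fun r hr' => (hr r hr').1)
      (fun r hr' => (hr r hr').2)).trans hT1.le
  -- Bootstrap: up to the first time at which an exponential reaches `C₁`, the energy has moved by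
  -- at most `μ < 1`, so at that time both exponentials are still strictly below `C₁`.
  have hbd : ∀ t ≥ T, Real.exp (X t) ≤ C₁ ∧ Real.exp (Y t) ≤ C₁ := by
    by_contra! hc
    obtain ⟨b, hb, hb1⟩ := hc
    have hb2 : C₁ ≤ max (Real.exp (X b)) (Real.exp (Y b)) := by
      by_contra! hlt'
      exact absurd (hb1 ((le_max_left _ _).trans hlt'.le))
        (not_lt.2 ((le_max_right _ _).trans hlt'.le))
    obtain ⟨t, ht, ht1, ht2⟩ := exists_first_of_isClosed
      (Q := fun t => C₁ ≤ max (Real.exp (X t)) (Real.exp (Y t)))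
      (isClosed_le continuous_const hmc) hb hb2
    have hTlt := hlt T (by linarith)
    have hTt : T < t := lt_of_le_of_ne ht.1 fun he => by
      rw [← he] at ht1
      exact absurd ht1 (not_le.2 (max_lt hTlt.1 hTlt.2))
    have hcl : t ∈ closure (Ico T t) := by
      rw [closure_Ico hTt.ne]; exact right_mem_Icc.2 hTt.le
    have hle : ∀ r ∈ Icc T t, max (Real.exp (X r)) (Real.exp (Y r)) ≤ C₁ := fun r hr => by
      rcases hr.2.eq_or_lt with he | hlt'
      · rw [he]
        exact closure_minimal (fun r hr => (not_le.1 (ht2 r hr)).le)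
          (isClosed_le hmc continuous_const) hcl
      · exact (not_le.1 (ht2 r ⟨hr.1, hlt'⟩)).le
    have e1 := (abs_le.1 (hen t ht.1 fun r hr => ⟨(le_max_left _ _).trans (hle r hr),
      (le_max_right _ _).trans (hle r hr)⟩)).2
    have e2 := hlt t (by linarith)
    exact absurd ht1 (not_le.2 (max_lt e2.1 e2.2))
  have hen' : ∀ t ≥ T, |energy a₁ a₂ (X t) (Y t) (x t) (y t) -
      energy a₁ a₂ (X T) (Y T) (x T) (y T)| ≤ μ := fun t ht =>
    hen t ht fun r hr => hbd r hr.1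
  have hneg : ∀ t ≥ T, X t - 2 * t ≤ 0 ∧ Y t - 2 * t ≤ 0 := fun t ht => by
    have e1 := (Real.le_log_iff_exp_le hC₁0).2 (hbd t ht).1
    have e2 := (Real.le_log_iff_exp_le hC₁0).2 (hbd t ht).2
    constructor <;> linarith
  have hJ' : ∀ t ≥ T, J a₁ a₂ (x t) (y t) ≤ E₀ + 1 := fun t ht => by
    have e1 := (abs_le.1 (hen' t ht)).2
    have e2 : energy a₁ a₂ (X t) (Y t) (x t) (y t) = J a₁ a₂ (x t) (y t) +
      (1 + a₁ + a₂) * (a₂ * Real.exp (X t) + a₁ * Real.exp (Y t)) := rfl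
    have e3 : 0 < (1 + a₁ + a₂) * (a₂ * Real.exp (X t) + a₁ * Real.exp (Y t)) := by positivity
    linarith
  have habs : ∀ {s q : ℝ}, 0 < q → s ^ 2 ≤ q → |s| ≤ q + 1 := fun {s q} hq hs =>
    abs_le_of_sq_le_sq (by nlinarith) (by linarith)
  have hy : ∀ t ≥ T, |y t| ≤ q₁ + 1 := fun t ht => habs hq₁0 (by
    have e1 := (sq_le_J h₂ (x t) (y t)).trans (hJ' t ht)
    rw [hq₁, le_div_iff₀ (by positivity)]
    rw [div_mul_eq_mul_div, div_le_iff₀ (by positivity)] at e1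
    linarith)
  have hx : ∀ t ≥ T, |x t| ≤ q₂ + 1 := fun t ht => habs hq₂0 (by
    have e1 := (sq_le_J h₁ (y t) (x t)).trans ((J_comm a₂ a₁ (y t) (x t)).le.trans (hJ' t ht))
    rw [hq₂, le_div_iff₀ (by positivity)]
    rw [div_mul_eq_mul_div, div_le_iff₀ (by positivity)] at e1
    linarith)
  have hθ : ∀ {a : ℝ} {U V : ℝ → ℝ} {t : ℝ}, 0 < a → T ≤ t → U t - 2 * t ≤ 0 →
      V t - 2 * t ≤ 0 → Real.exp (U t) ≤ C₁ → Real.exp (V t) ≤ C₁ →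
      (1 + a + a) * C₁ * Real.exp (-2 * T) ≤ μ → |theta a U V t - 1| ≤ μ := by
    intro a U V t ha ht e1 e2 e3 e4 e5
    rw [theta_of_nonpos e1 e2, sub_sub_cancel_left, abs_neg, abs_mul, abs_of_pos (Real.exp_pos _)]
    have e6 : |(1 + a) * Real.exp (U t) - a * Real.exp (V t)| ≤ (1 + a + a) * C₁ := by
      have p1 := mul_le_mul_of_nonneg_left e3 (by linarith : 0 ≤ 1 + a)
      have p2 := mul_le_mul_of_nonneg_left e4 ha.le
      have p3 : 0 < (1 + a) * Real.exp (U t) := by positivity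
      have p4 : 0 < a * Real.exp (V t) := by positivity
      have p5 : 0 < a * C₁ := by positivity
      rw [abs_le]
      constructor <;> linarith
    have e7 : Real.exp (-2 * t) ≤ Real.exp (-2 * T) := Real.exp_le_exp.2 (by linarith)
    have := mul_le_mul e7 e6 (abs_nonneg _) (Real.exp_pos _).le
    linarith
  have hcT := mul_pos hC₁0 (Real.exp_pos (-2 * T))
  have r1 : (1 + a₁ + a₁) * C₁ * Real.exp (-2 * T) ≤ μ := by
    have : 0 < (1 + a₂ + a₂) * (C₁ * Real.exp (-2 * T)) := by positivity
    linarith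
  have r2 : (1 + a₂ + a₂) * C₁ * Real.exp (-2 * T) ≤ μ := by
    have : 0 < (1 + a₁ + a₁) * (C₁ * Real.exp (-2 * T)) := by positivity
    linarith
  exact ⟨{
    pos₁ := h₁
    pos₂ := h₂
    le_half := hμ
    hX := h.hX
    hY := h.hY
    hx := h.hasDerivAt_x
    hy := h.symm.hasDerivAt_x
    hm₁ := h.hm₁
    hm₂ := h.hm₂
    hθ₁ := fun t ht => hθ h₁ ht (hneg t ht).1 (hneg t ht).2 (hbd t ht).1 (hbd t ht).2 r1
    hθ₂ := fun t ht => hθ h₂ ht (hneg t ht).2 (hneg t ht).1 (hbd t ht).2 (hbd t ht).1 r2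
    energy_le := hen'
    exp_X_le := fun t ht => by linarith [(hbd t ht).1]
    exp_Y_le := fun t ht => by linarith [(hbd t ht).2]
    abs_x_le := fun t ht => by linarith [hx t ht]
    abs_y_le := fun t ht => by linarith [hy t ht] }, hneg⟩

end Truncated

/-! ### Shooting for the truncated system and comparison with the scalar solution. -/

section Shooting

theorem IsSol.fst {E F : Type*} [NormedAddCommGroup E] [NormedSpace ℝ E] [NormedAddCommGroup F]
    [NormedSpace ℝ F] {g : ℝ → E × F} {z₀ : E × F} {z p : ℝ → E × F} (h : IsSol g z₀ z p) :
    IsSol (fun t => (g t).1) z₀.1 (fun t => (z t).1) (fun t => (p t).1) where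
  lim_fst := (_root_.continuous_fst.tendsto _).comp h.lim_fst
  lim_snd := (_root_.continuous_fst.tendsto (0 : E × F)).comp h.lim_snd
  hasDerivAt_fst t := (h.hasDerivAt_fst t).fst
  hasDerivAt_snd t := (h.hasDerivAt_snd t).fst

theorem IsSol.snd {E F : Type*} [NormedAddCommGroup E] [NormedSpace ℝ E] [NormedAddCommGroup F]
    [NormedSpace ℝ F] {g : ℝ → E × F} {z₀ : E × F} {z p : ℝ → E × F} (h : IsSol g z₀ z p) :
    IsSol (fun t => (g t).2) z₀.2 (fun t => (z t).2) (fun t => (p t).2) where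
  lim_fst := (_root_.continuous_snd.tendsto _).comp h.lim_fst
  lim_snd := (_root_.continuous_snd.tendsto (0 : E × F)).comp h.lim_snd
  hasDerivAt_fst t := (h.hasDerivAt_fst t).snd
  hasDerivAt_snd t := (h.hasDerivAt_snd t).snd

theorem IsSol.prodMk {E F : Type*} [NormedAddCommGroup E] [NormedSpace ℝ E] [NormedAddCommGroup F]
    [NormedSpace ℝ F] {g : ℝ → E} {x₀ : E} {x p : ℝ → E} {h : ℝ → F} {y₀ : F} {y q : ℝ → F}
    (hx : IsSol g x₀ x p) (hy : IsSol h y₀ y q) :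
    IsSol (fun t => (g t, h t)) (x₀, y₀) (fun t => (x t, y t)) (fun t => (p t, q t)) where
  lim_fst := hx.lim_fst.prodMk_nhds hy.lim_fst
  lim_snd := hx.lim_snd.prodMk_nhds hy.lim_snd
  hasDerivAt_fst t := (hx.hasDerivAt_fst t).prodMk (hy.hasDerivAt_fst t)
  hasDerivAt_snd t := (hx.hasDerivAt_snd t).prodMk (hy.hasDerivAt_snd t)

/-- The right-hand side of the truncated system. -/
def systemG (a₁ a₂ s t : ℝ) : ℝ := -(1 + a₁) * truncF a₁ s t + a₁ * truncF a₂ t s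

/-- The logarithmic profiles `2 N₁ t + x₁` and `2 N₂ t + x₂` solve the truncated system with
initial values `c₁` and `c₂`. -/
structure ShootSol (a₁ a₂ : ℝ) (N₁ N₂ : ℕ) (c₁ c₂ : ℝ) (x₁ p₁ x₂ p₂ : ℝ → ℝ) : Prop where
  fst : IsSol (fun t => systemG a₁ a₂ (2 * N₁ * t + x₁ t) (2 * N₂ * t + x₂ t)) c₁ x₁ p₁
  snd : IsSol (fun t => systemG a₂ a₁ (2 * N₂ * t + x₂ t) (2 * N₁ * t + x₁ t)) c₂ x₂ p₂

variable {a₁ a₂ : ℝ} {N₁ N₂ : ℕ} {c₁ c₂ : ℝ} {x₁ p₁ x₂ p₂ : ℝ → ℝ}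

theorem ShootSol.symm (h : ShootSol a₁ a₂ N₁ N₂ c₁ c₂ x₁ p₁ x₂ p₂) :
    ShootSol a₂ a₁ N₂ N₁ c₂ c₁ x₂ p₂ x₁ p₁ := ⟨h.snd, h.fst⟩

theorem continuous_systemG (a₁ a₂ : ℝ) : Continuous fun q : ℝ × ℝ => systemG a₁ a₂ q.1 q.2 := by
  have h1 := continuous_truncF a₁
  have h2 := (continuous_truncF a₂).comp continuous_swap
  exact (h1.const_mul _).add (h2.const_mul _)

theorem abs_systemG_le (h₁ : 0 < a₁) (h₂ : 0 < a₂) (s t : ℝ) :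
    |systemG a₁ a₂ s t| ≤ (1 + a₁) * (1 + a₁) + a₁ * (1 + a₂) := by
  have e1 := (abs_truncF_le h₁ s t).trans
    (mul_le_mul_of_nonneg_left (cap_le_one s) (by linarith))
  have e2 := (abs_truncF_le h₂ t s).trans
    (mul_le_mul_of_nonneg_left (cap_le_one t) (by linarith))
  refine (abs_add_le _ _).trans (add_le_add ?_ ?_)
  · rw [abs_mul, abs_neg, abs_of_pos (by linarith)]
    exact mul_le_mul_of_nonneg_left (by linarith) (by linarith)
  · rw [abs_mul, abs_of_pos h₁]
    exact mul_le_mul_of_nonneg_left (by linarith) h₁.le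

theorem abs_systemG_sub_le (h₁ : 0 < a₁) (h₂ : 0 < a₂) (s t s' t' : ℝ) :
    |systemG a₁ a₂ s t - systemG a₁ a₂ s' t'| ≤
      ((1 + a₁) * (3 + 4 * a₁) + a₁ * (3 + 4 * a₂)) * (|s - s'| + |t - t'|) := by
  have e1 := abs_truncF_sub_le h₁ s t s' t'
  have e2 := abs_truncF_sub_le h₂ t s t' s'
  have key : systemG a₁ a₂ s t - systemG a₁ a₂ s' t' =
      -(1 + a₁) * (truncF a₁ s t - truncF a₁ s' t') +
        a₁ * (truncF a₂ t s - truncF a₂ t' s') := by unfold systemG; ring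
  rw [key, add_mul]
  refine (abs_add_le _ _).trans (add_le_add ?_ ?_)
  · rw [abs_mul, abs_neg, abs_of_pos (by linarith), mul_assoc]
    exact mul_le_mul_of_nonneg_left e1 (by linarith)
  · rw [abs_mul, abs_of_pos h₁, mul_assoc]
    exact mul_le_mul_of_nonneg_left (by rw [add_comm |s - s'|]; exact e2) h₁.le

theorem exists_shootSol (h₁ : 0 < a₁) (h₂ : 0 < a₂) (N₁ N₂ : ℕ) (c₁ c₂ : ℝ) :
    ∃ x₁ p₁ x₂ p₂, ShootSol a₁ a₂ N₁ N₂ c₁ c₂ x₁ p₁ x₂ p₂ := by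
  set L := 2 * ((1 + a₁) * (3 + 4 * a₁) + a₁ * (3 + 4 * a₂)) +
    2 * ((1 + a₂) * (3 + 4 * a₂) + a₂ * (3 + 4 * a₁)) with hL
  set C := (1 + a₁) * (1 + a₁) + a₁ * (1 + a₂) + ((1 + a₂) * (1 + a₂) + a₂ * (1 + a₁)) with hC
  obtain ⟨z, p, h⟩ := exists_isSol (fun (t : ℝ) (z : ℝ × ℝ) =>
    (systemG a₁ a₂ (2 * N₁ * t + z.1) (2 * N₂ * t + z.2),
      systemG a₂ a₁ (2 * N₂ * t + z.2) (2 * N₁ * t + z.1))) (c₁, c₂) (L := L) (C := C)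
    (by positivity) (by positivity) (by
      have e1 : Continuous fun q : ℝ × ℝ × ℝ => (2 * N₁ * q.1 + q.2.1, 2 * N₂ * q.1 + q.2.2) := by
        fun_prop
      exact ((continuous_systemG a₁ a₂).comp e1).prodMk
        ((continuous_systemG a₂ a₁).comp (continuous_swap.comp e1)))
    (fun t z w => by
      have e1 : |z.1 - w.1| ≤ ‖z - w‖ := norm_fst_le (z - w)
      have e2 : |z.2 - w.2| ≤ ‖z - w‖ := norm_snd_le (z - w)
      have e3 := norm_nonneg (z - w)
      have f1 := abs_systemG_sub_le h₁ h₂ (2 * N₁ * t + z.1) (2 * N₂ * t + z.2)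
        (2 * N₁ * t + w.1) (2 * N₂ * t + w.2)
      have f2 := abs_systemG_sub_le h₂ h₁ (2 * N₂ * t + z.2) (2 * N₁ * t + z.1)
        (2 * N₂ * t + w.2) (2 * N₁ * t + w.1)
      rw [add_sub_add_left_eq_sub, add_sub_add_left_eq_sub] at f1 f2
      refine norm_prod_le_iff.2 ⟨f1.trans ?_, f2.trans ?_⟩
      · calc _ ≤ ((1 + a₁) * (3 + 4 * a₁) + a₁ * (3 + 4 * a₂)) * (‖z - w‖ + ‖z - w‖) := by gcongr
          _ ≤ _ := by
            have : 0 ≤ ((1 + a₂) * (3 + 4 * a₂) + a₂ * (3 + 4 * a₁)) * ‖z - w‖ := by positivity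
            rw [hL]; linarith
      · calc _ ≤ ((1 + a₂) * (3 + 4 * a₂) + a₂ * (3 + 4 * a₁)) * (‖z - w‖ + ‖z - w‖) := by gcongr
          _ ≤ _ := by
            have : 0 ≤ ((1 + a₁) * (3 + 4 * a₁) + a₁ * (3 + 4 * a₂)) * ‖z - w‖ := by positivity
            rw [hL]; linarith)
    (fun t => by
      have p1 : 0 < (1 + a₁) * (1 + a₁) + a₁ * (1 + a₂) := by positivity
      have p2 : 0 < (1 + a₂) * (1 + a₂) + a₂ * (1 + a₁) := by positivity
      refine norm_prod_le_iff.2 ⟨(abs_systemG_le h₁ h₂ _ _).trans ?_,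
        (abs_systemG_le h₂ h₁ _ _).trans ?_⟩ <;> linarith)
  exact ⟨_, _, _, _, h.fst, h.snd⟩

namespace ShootSol

theorem continuous_G (h : ShootSol a₁ a₂ N₁ N₂ c₁ c₂ x₁ p₁ x₂ p₂) :
    Continuous fun t => systemG a₁ a₂ (2 * N₁ * t + x₁ t) (2 * N₂ * t + x₂ t) := by
  have e1 := h.fst.continuous_fst
  have e2 := h.snd.continuous_fst
  exact (continuous_systemG a₁ a₂).comp (by fun_prop :
    Continuous fun t => (2 * N₁ * t + x₁ t, 2 * N₂ * t + x₂ t))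

theorem system (h : ShootSol a₁ a₂ N₁ N₂ c₁ c₂ x₁ p₁ x₂ p₂) :
    System a₁ a₂ (fun t => 2 * N₁ * t + x₁ t + 2 * t) (fun t => 2 * N₂ * t + x₂ t + 2 * t)
      (fun t => 2 * N₁ + p₁ t + 2) (fun t => 2 * N₂ + p₂ t + 2)
      (fun t => ∫ s in (0)..t, Real.exp (2 * N₁ * s + x₁ s + 2 * s))
      (fun t => ∫ s in (0)..t, Real.exp (2 * N₂ * s + x₂ s + 2 * s)) := by
  have e1 := h.fst.continuous_fst
  have e2 := h.snd.continuous_fst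
  have hlin : ∀ (k : ℝ) {x p : ℝ → ℝ}, (∀ t, HasDerivAt x (p t) t) → ∀ t,
      HasDerivAt (fun t => 2 * k * t + x t + 2 * t) (2 * k + p t + 2) t := fun k x p hx t => by
    simpa using (((hasDerivAt_id t).const_mul (2 * k)).fun_add (hx t)).fun_add
      ((hasDerivAt_id t).const_mul 2)
  have hint : ∀ {f : ℝ → ℝ}, Continuous f → ∀ t,
      HasDerivAt (fun t => ∫ s in (0)..t, f s) (f t) t := fun hf t =>
    intervalIntegral.integral_hasDerivAt_right (hf.intervalIntegrable _ _)
      hf.stronglyMeasurable.stronglyMeasurableAtFilter hf.continuousAt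
  refine ⟨hlin N₁ h.fst.hasDerivAt_fst, hlin N₂ h.snd.hasDerivAt_fst, fun t => ?_, fun t => ?_,
    hint (by fun_prop), hint (by fun_prop)⟩
  · simp only [add_sub_cancel_right]
    exact ((h.fst.hasDerivAt_snd t).const_add _).add_const _
  · simp only [add_sub_cancel_right]
    exact ((h.snd.hasDerivAt_snd t).const_add _).add_const _

end ShootSol

/-- The first component converges to the scalar solution as the second one is blown down. -/
theorem exists_shootSol_sub_le {c : ℝ} (h₁ : 0 < a₁) (h₂ : 0 < a₂) (N₂ : ℕ) (hc : Good N₁ c)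
    (T : ℝ) : ∃ K > 0, ∀ ε > 0, ∀ x₁ p₁ x₂ p₂ : ℝ → ℝ,
      ShootSol a₁ a₂ N₁ N₂ (c - Real.log (1 + a₁)) (Real.log ε) x₁ p₁ x₂ p₂ → ∀ t ≤ T,
      |x₁ t - (shootX N₁ c t - Real.log (1 + a₁))| ≤ K * ε ∧ |p₁ t - shootP N₁ c t| ≤ K * ε ∧
      |x₂ t - (Real.log ε - a₂ / (1 + a₁) * (shootX N₁ c t - c))| ≤ K * ε ∧
      |p₂ t - -(a₂ / (1 + a₁)) * shootP N₁ c t| ≤ K * ε ∧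
      |systemG a₁ a₂ (2 * N₁ * t + x₁ t) (2 * N₂ * t + x₂ t) -
        -(cap (shootU N₁ c t) * (1 - cap (shootU N₁ c t)))| ≤ K * ε := by
  have hb : 0 < 1 + a₁ := by linarith
  have hb₂ : 0 < 1 + a₂ := by linarith
  have hs := isSol_shoot N₁ c
  -- `K₁ ε` bounds the exponential of the function with which the second component is compared, up
  -- to `T`.
  obtain ⟨K₁, hK₁0, hK₁⟩ : ∃ K₁ > 0, ∀ t ≤ T,
      Real.exp (2 * N₂ * t - a₂ / (1 + a₁) * (shootX N₁ c t - c)) ≤ K₁ := by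
    refine ⟨Real.exp (2 * N₂ * T + a₂ / (1 + a₁) * (1 / 4 * Real.exp (2 * T))), Real.exp_pos _,
      fun t ht => Real.exp_le_exp.2 ?_⟩
    have e1 := (abs_le.1 (hs.abs_le (T := T) (fun t _ => abs_shootG_le N₁ c t) ht).2).1
    have e2 : Real.exp (2 * t) ≤ Real.exp (2 * T) := Real.exp_le_exp.2 (by linarith)
    have e3 := mul_le_mul_of_nonneg_left (show -(shootX N₁ c t - c) ≤ 1 / 4 * Real.exp (2 * T) by
      linarith) (by positivity : 0 ≤ a₂ / (1 + a₁))
    have e4 := mul_le_mul_of_nonneg_left ht (by positivity : (0 : ℝ) ≤ 2 * N₂)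
    linarith
  obtain ⟨L, hL⟩ : ∃ L, L = (1 + a₁) * (3 + 4 * a₁) + (1 + a₁) * a₁ + a₁ * (1 + a₂) +
    (1 + a₂) * (1 + a₂) + a₂ * (3 + 4 * a₁) + a₂ * a₁ := ⟨_, rfl⟩
  have hL1 : 1 ≤ L := by
    have : 0 < 7 * a₁ + 4 * a₁ ^ 2 + (1 + a₁) * a₁ + a₁ * (1 + a₂) +
      (2 * a₂ + a₂ ^ 2) + a₂ * (3 + 4 * a₁) + a₂ * a₁ := by positivity
    rw [hL]; linarith
  have hL0 : 0 < L := by linarith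
  obtain ⟨M, hM⟩ : ∃ M, M = 2 * weight L T * (0 + L * K₁) := ⟨_, rfl⟩
  have hM0 : 0 < M := by rw [hM]; have := weight_pos L T; positivity
  obtain ⟨M', hM'⟩ : ∃ M', M' = 2 * L * Real.exp (2 * T) * weight L T * (0 + L * K₁) := ⟨_, rfl⟩
  have hM'0 : 0 < M' := by rw [hM']; have := weight_pos L T; positivity
  refine ⟨M + M' + L * M + L * K₁, by positivity, fun ε hε x₁ p₁ x₂ p₂ h => ?_⟩
  have hy₁ : IsSol (fun t => -(cap (shootU N₁ c t) * (1 - cap (shootU N₁ c t))))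
      (c - Real.log (1 + a₁)) (fun t => shootX N₁ c t - Real.log (1 + a₁)) (shootP N₁ c) := by
    simpa only [sub_eq_add_neg] using hs.add_const (-Real.log (1 + a₁))
  -- To leading order the second component feels only the first, with a force that is `-a₂ / (1 +
  -- a₁)` times the force on the first. Its comparison function is therefore explicit.
  have hy₂ : IsSol (fun t => -(a₂ / (1 + a₁)) *
        -(cap (shootU N₁ c t) * (1 - cap (shootU N₁ c t)))) (Real.log ε)
      (fun t => Real.log ε - a₂ / (1 + a₁) * (shootX N₁ c t - c))
      (fun t => -(a₂ / (1 + a₁)) * shootP N₁ c t) := by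
    have := (hs.const_smul (-(a₂ / (1 + a₁)))).add_const (Real.log ε + a₂ / (1 + a₁) * c)
    simp only [smul_eq_mul] at this
    convert this using 1
    · ring
    · funext t; ring
  have hgh : ∀ t ≤ T, ‖((systemG a₁ a₂ (2 * N₁ * t + x₁ t) (2 * N₂ * t + x₂ t),
        systemG a₂ a₁ (2 * N₂ * t + x₂ t) (2 * N₁ * t + x₁ t)) : ℝ × ℝ) -
      (-(cap (shootU N₁ c t) * (1 - cap (shootU N₁ c t))), -(a₂ / (1 + a₁)) *
        -(cap (shootU N₁ c t) * (1 - cap (shootU N₁ c t))))‖ ≤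
      L * ‖((x₁ t, x₂ t) : ℝ × ℝ) - (shootX N₁ c t - Real.log (1 + a₁),
        Real.log ε - a₂ / (1 + a₁) * (shootX N₁ c t - c))‖ + L * K₁ * ε := by
    intro t ht
    obtain ⟨d, hd⟩ : ∃ d, d = ‖((x₁ t, x₂ t) : ℝ × ℝ) - (shootX N₁ c t - Real.log (1 + a₁),
        Real.log ε - a₂ / (1 + a₁) * (shootX N₁ c t - c))‖ := ⟨_, rfl⟩
    have d1 : |x₁ t - (shootX N₁ c t - Real.log (1 + a₁))| ≤ d := by
      rw [hd]; exact norm_fst_le (((x₁ t, x₂ t) : ℝ × ℝ) - (_, _))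
    have d2 : |x₂ t - (Real.log ε - a₂ / (1 + a₁) * (shootX N₁ c t - c))| ≤ d := by
      rw [hd]; exact norm_snd_le (((x₁ t, x₂ t) : ℝ × ℝ) - (_, _))
    have hd0 : 0 ≤ d := (abs_nonneg _).trans d1
    rw [← hd]
    obtain ⟨s, hs'⟩ : ∃ s, s = 2 * N₁ * t + x₁ t := ⟨_, rfl⟩
    obtain ⟨r, hr'⟩ : ∃ r, r = 2 * N₂ * t + x₂ t := ⟨_, rfl⟩
    obtain ⟨s₀, hs₀⟩ : ∃ s₀, s₀ = shootU N₁ c t - Real.log (1 + a₁) := ⟨_, rfl⟩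
    have hss : |s - s₀| ≤ d := by
      rw [hs', hs₀, shootU]
      convert d1 using 2; ring
    -- All neglected terms carry `cap r`. It is of order `ε` up to the distance `d` that is being
    -- estimated, so the estimate closes without an a priori bound on the second component.
    have hcap : cap r ≤ K₁ * ε + d := by
      obtain ⟨r₀, hr₀⟩ : ∃ r₀, r₀ = 2 * N₂ * t + (Real.log ε - a₂ / (1 + a₁) *
        (shootX N₁ c t - c)) := ⟨_, rfl⟩
      have e1 : cap r₀ ≤ K₁ * ε := by
        refine (cap_le_exp r₀).trans ?_
        have : Real.exp r₀ =
            Real.exp (2 * N₂ * t - a₂ / (1 + a₁) * (shootX N₁ c t - c)) * ε := by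
          rw [hr₀, ← add_sub_assoc, add_sub_right_comm, Real.exp_add, Real.exp_log hε]
        rw [this]
        exact mul_le_mul_of_nonneg_right (hK₁ t ht) hε.le
      have e2 := (le_abs_self _).trans (abs_cap_sub_le r r₀)
      have e3 : |r - r₀| ≤ d := by
        rw [hr', hr₀, add_sub_add_left_eq_sub]; exact d2
      linarith
    have hcap0 := cap_pos r
    rw [← hs', ← hr']
    obtain ⟨H, hH⟩ : ∃ H, H = cap s₀ * (1 - (1 + a₁) * cap s₀) := ⟨_, rfl⟩
    have hHU : cap (shootU N₁ c t) * (1 - cap (shootU N₁ c t)) = (1 + a₁) * H := by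
      have hU := hc.shootU_neg t
      have hlog : 0 < Real.log (1 + a₁) := Real.log_pos (by linarith)
      rw [hH, hs₀, cap_of_nonpos hU.le, cap_of_nonpos (by linarith), Real.exp_sub,
        Real.exp_log hb]
      field_simp
    have hF : |truncF a₁ s r - H| ≤ (3 + 4 * a₁) * d + a₁ * (K₁ * ε + d) := by
      have e1 := abs_truncF_sub_le h₁ s r s₀ r
      rw [sub_self, abs_zero, add_zero] at e1
      have e2 : |truncF a₁ s₀ r - H| ≤ a₁ * cap r := by
        have : truncF a₁ s₀ r - H = cap s₀ * (a₁ * cap r) := by rw [truncF, hH]; ring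
        rw [this, abs_of_pos (mul_pos (cap_pos _) (mul_pos h₁ hcap0))]
        exact mul_le_of_le_one_left (mul_pos h₁ hcap0).le (cap_le_one _)
      have e3 := abs_sub_le (truncF a₁ s r) (truncF a₁ s₀ r) H
      have e4 := mul_le_mul_of_nonneg_left hss (by linarith : 0 ≤ 3 + 4 * a₁)
      have e5 := mul_le_mul_of_nonneg_left hcap h₁.le
      linarith
    have hF₂ : |truncF a₂ r s| ≤ (1 + a₂) * (K₁ * ε + d) :=
      (abs_truncF_le h₂ r s).trans (mul_le_mul_of_nonneg_left hcap hb₂.le)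
    have hKε : 0 < K₁ * ε := by positivity
    have p1 := mul_le_mul_of_nonneg_left hF hb.le
    have p2 := mul_le_mul_of_nonneg_left hF₂ h₁.le
    have p3 := mul_le_mul_of_nonneg_left hF h₂.le
    have p4 := mul_le_mul_of_nonneg_left hF₂ hb₂.le
    have q1 : 0 ≤ (1 + a₁) * (3 + 4 * a₁) * d := by positivity
    have q2 : 0 ≤ (1 + a₁) * a₁ * d := by positivity
    have q3 : 0 ≤ a₁ * (1 + a₂) * d := by positivity
    have q4 : 0 ≤ (1 + a₂) * (1 + a₂) * d := by positivity
    have q5 : 0 ≤ a₂ * (3 + 4 * a₁) * d := by positivity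
    have q6 : 0 ≤ a₂ * a₁ * d := by positivity
    have r1 : 0 ≤ (1 + a₁) * (3 + 4 * a₁) * (K₁ * ε) := by positivity
    have r2 : 0 ≤ (1 + a₁) * a₁ * (K₁ * ε) := by positivity
    have r3 : 0 ≤ a₁ * (1 + a₂) * (K₁ * ε) := by positivity
    have r4 : 0 ≤ (1 + a₂) * (1 + a₂) * (K₁ * ε) := by positivity
    have r5 : 0 ≤ a₂ * (3 + 4 * a₁) * (K₁ * ε) := by positivity
    have r6 : 0 ≤ a₂ * a₁ * (K₁ * ε) := by positivity
    rw [mul_assoc L K₁ ε, ← mul_add, hL]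
    refine norm_prod_le_iff.2 ⟨?_, ?_⟩
    · show |systemG a₁ a₂ s r - -(cap (shootU N₁ c t) * (1 - cap (shootU N₁ c t)))| ≤ _
      have e1 : systemG a₁ a₂ s r - -(cap (shootU N₁ c t) * (1 - cap (shootU N₁ c t))) =
          -((1 + a₁) * (truncF a₁ s r - H)) + a₁ * truncF a₂ r s := by
        rw [hHU, systemG]; ring
      rw [e1]
      refine (abs_add_le _ _).trans ?_
      rw [abs_neg, abs_mul, abs_mul, abs_of_pos hb, abs_of_pos h₁]
      linarith
    · show |systemG a₂ a₁ r s - -(a₂ / (1 + a₁)) *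
        -(cap (shootU N₁ c t) * (1 - cap (shootU N₁ c t)))| ≤ _
      have e1 : systemG a₂ a₁ r s - -(a₂ / (1 + a₁)) *
          -(cap (shootU N₁ c t) * (1 - cap (shootU N₁ c t))) =
          a₂ * (truncF a₁ s r - H) + -((1 + a₂) * truncF a₂ r s) := by
        rw [hHU, systemG]; field_simp; ring
      rw [e1]
      refine (abs_add_le _ _).trans ?_
      rw [abs_neg, abs_mul, abs_mul, abs_of_pos hb₂, abs_of_pos h₂]
      linarith
  intro t ht
  obtain ⟨e1, e2⟩ := (h.fst.prodMk h.snd).norm_sub_le (hy₁.prodMk hy₂) (d := 0)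
    (e := L * K₁ * ε) (T := T) hL1 le_rfl (by positivity) (by simp) hgh ht
  have hMε : 2 * weight L T * (0 + L * K₁ * ε) = M * ε := by rw [hM]; ring
  have hM'ε : 2 * L * Real.exp (2 * T) * weight L T * (0 + L * K₁ * ε) = M' * ε := by
    rw [hM']; ring
  rw [hMε] at e1
  rw [hM'ε] at e2
  have f1 := (norm_fst_le (((x₁ t, x₂ t) : ℝ × ℝ) - (_, _))).trans e1
  have f2 := (norm_snd_le (((x₁ t, x₂ t) : ℝ × ℝ) - (_, _))).trans e1
  have f3 := (norm_fst_le (((p₁ t, p₂ t) : ℝ × ℝ) - (_, _))).trans e2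
  have f4 := (norm_snd_le (((p₁ t, p₂ t) : ℝ × ℝ) - (_, _))).trans e2
  have f5 := (norm_fst_le (((systemG a₁ a₂ (2 * N₁ * t + x₁ t) (2 * N₂ * t + x₂ t),
    systemG a₂ a₁ (2 * N₂ * t + x₂ t) (2 * N₁ * t + x₁ t)) : ℝ × ℝ) - (_, _))).trans (hgh t ht)
  have f6 := mul_le_mul_of_nonneg_left e1 hL0.le
  simp only [Prod.fst_sub, Prod.snd_sub, Real.norm_eq_abs] at f1 f2 f3 f4 f5
  have q1 : 0 < M * ε := by positivity
  have q2 : 0 < M' * ε := by positivity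
  have q3 : 0 < L * (M * ε) := by positivity
  have q4 : 0 < L * K₁ * ε := by positivity
  have hsum : (M + M' + L * M + L * K₁) * ε = M * ε + M' * ε + L * (M * ε) + L * K₁ * ε := by ring
  rw [hsum]
  refine ⟨?_, ?_, ?_, ?_, ?_⟩
  · exact f1.trans (by linarith)
  · exact f3.trans (by linarith)
  · exact f2.trans (by linarith)
  · exact f4.trans (by linarith)
  · exact f5.trans (by linarith)

end Shooting

/-! ### The family of solutions as the shooting parameter tends to zero. -/

section Family

/-- The quantitative description of a trajectory of the Liouville system that meets the diagonal
twice, up to the error `κ`. -/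
structure Phases (a₁ a₂ σ A B κ : ℝ) (X Y x y m₁ m₂ : ℝ → ℝ) (t₁ t₃ ξ υ : ℝ) : Prop where
  inv_le : κ⁻¹ ≤ t₁
  lt : t₁ < t₃
  inv_le_sub : κ⁻¹ ≤ t₃ - t₁
  eq₁ : X t₁ = Y t₁
  eq₃ : X t₃ = Y t₃
  lim_x : Tendsto x atTop (𝓝 ξ)
  lim_y : Tendsto y atTop (𝓝 υ)
  ξ_neg : ξ < 0
  υ_neg : υ < 0
  isBigO_X : (fun t => X t - ξ * t) =O[atTop] fun _ => (1 : ℝ)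
  isBigO_Y : (fun t => Y t - υ * t) =O[atTop] fun _ => (1 : ℝ)
  abs_ξ : |ξ + A| ≤ κ
  abs_υ : |υ + B| ≤ κ
  mass₁ : |m₁ t₃ - m₁ t₁| ≤ κ
  mass₂ : |m₂ t₃ - m₂ t₁ - 2 * σ / (1 + a₂)| ≤ κ
  tail₁ : ∃ M, Tendsto m₁ atTop (𝓝 M) ∧ |M - m₁ t₃ - 2 * A / (1 + a₁)| ≤ κ
  tail₂ : ∃ M, Tendsto m₂ atTop (𝓝 M) ∧ |M - m₂ t₃| ≤ κ

theorem Phases.mono {a₁ a₂ σ A B κ κ' : ℝ} {X Y x y m₁ m₂ : ℝ → ℝ} {t₁ t₃ ξ υ : ℝ} (hκ : 0 < κ)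
    (hκκ : κ ≤ κ') (h : Phases a₁ a₂ σ A B κ X Y x y m₁ m₂ t₁ t₃ ξ υ) :
    Phases a₁ a₂ σ A B κ' X Y x y m₁ m₂ t₁ t₃ ξ υ where
  inv_le := (inv_anti₀ hκ hκκ).trans h.inv_le
  lt := h.lt
  inv_le_sub := (inv_anti₀ hκ hκκ).trans h.inv_le_sub
  eq₁ := h.eq₁
  eq₃ := h.eq₃
  lim_x := h.lim_x
  lim_y := h.lim_y
  ξ_neg := h.ξ_neg
  υ_neg := h.υ_neg
  isBigO_X := h.isBigO_X
  isBigO_Y := h.isBigO_Y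
  abs_ξ := h.abs_ξ.trans hκκ
  abs_υ := h.abs_υ.trans hκκ
  mass₁ := h.mass₁.trans hκκ
  mass₂ := h.mass₂.trans hκκ
  tail₁ := h.tail₁.imp fun _ h => ⟨h.1, h.2.trans hκκ⟩
  tail₂ := h.tail₂.imp fun _ h => ⟨h.1, h.2.trans hκκ⟩

/-- A choice of data that is good up to an error tending to zero. -/
theorem exists_diagonal {α : Type*} [Inhabited α] (Q : ℝ → ℝ → α → Prop)
    (hmono : ∀ ε κ κ' d, 0 < κ → κ ≤ κ' → Q ε κ d → Q ε κ' d)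
    (h : ∀ κ > 0, ∀ᶠ ε in 𝓝[>] (0 : ℝ), ∃ d, Q ε κ d) :
    ∃ d : ℝ → α, ∀ κ > 0, ∀ᶠ ε in 𝓝[>] (0 : ℝ), Q ε κ (d ε) := by
  classical
  set P : ℝ → ℕ → Prop := fun ε n => ∃ d, Q ε (1 / ((n : ℝ) + 1)) d with hP
  -- The best accuracy `1 / (n + 1)` attainable for `ε` among `n ≤ ε⁻¹`; the cutoff ensures that a
  -- best one exists. Monotonicity in `κ` passes it on to all coarser accuracies.
  set n : ℝ → ℕ := fun ε => Nat.findGreatest (P ε) ⌊ε⁻¹⌋₊ with hn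
  refine ⟨fun ε => if h : P ε (n ε) then h.choose else default, fun κ hκ => ?_⟩
  obtain ⟨k, hk⟩ := exists_nat_one_div_lt hκ
  have hlarge : ∀ᶠ ε in 𝓝[>] (0 : ℝ), (k : ℝ) ≤ ε⁻¹ :=
    tendsto_inv_nhdsGT_zero.eventually_ge_atTop _
  filter_upwards [h (1 / ((k : ℝ) + 1)) (by positivity), hlarge] with ε hε hkε
  have hkn : k ≤ ⌊ε⁻¹⌋₊ := Nat.le_floor hkε
  have hPn : P ε (n ε) := Nat.findGreatest_spec hkn hε
  have hle : k ≤ n ε := Nat.le_findGreatest hkn hε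
  rw [dif_pos hPn]
  refine hmono _ _ _ _ (by positivity) (le_trans ?_ hk.le) hPn.choose_spec
  exact one_div_le_one_div_of_le (by positivity) (by exact_mod_cast Nat.succ_le_succ hle)

variable {a₁ a₂ γ c ρ σ A B : ℝ} {N₁ N₂ : ℕ}

set_option maxHeartbeats 1000000 in
/-- For small shooting parameters the solutions go through all phases. -/
theorem eventually_phases (h₁ : 0 < a₁) (h₂ : 0 < a₂) (hc : Good N₁ c) (hγ : ell N₁ c = -2 * γ)
    (hρ : ρ = 2 * (γ - 1)) (hρ0 : 0 < ρ)
    (hσ : σ = 2 * (N₂ + 1 + a₂ / (1 + a₁) * (γ + N₁))) (hσ0 : 0 < σ) (hA : 0 ≤ A) (hB : 0 < B)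
    (hl : (1 + a₂) * A - a₁ * σ = -(1 + a₂) * ρ + a₁ * σ)
    (hl' : -(1 + a₁) * σ + a₂ * A = -(1 + a₁) * B - a₂ * A) {κ : ℝ} (hκ : 0 < κ) :
    ∀ᶠ ε in 𝓝[>] (0 : ℝ), ∀ x₁ p₁ x₂ p₂ : ℝ → ℝ,
      ShootSol a₁ a₂ N₁ N₂ (c - Real.log (1 + a₁)) (Real.log ε) x₁ p₁ x₂ p₂ →
      (∀ t, 2 * N₁ * t + x₁ t ≤ 0) ∧ (∀ t, 2 * N₂ * t + x₂ t ≤ -κ⁻¹) ∧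
      ∃ d : ℝ × ℝ × ℝ × ℝ, Phases a₁ a₂ σ A B κ
        (fun t => 2 * N₁ * t + x₁ t + 2 * t) (fun t => 2 * N₂ * t + x₂ t + 2 * t)
        (fun t => 2 * N₁ + p₁ t + 2) (fun t => 2 * N₂ + p₂ t + 2)
        (fun t => ∫ s in (0)..t, Real.exp (2 * N₁ * s + x₁ s + 2 * s))
        (fun t => ∫ s in (0)..t, Real.exp (2 * N₂ * s + x₂ s + 2 * s))
        d.1 d.2.1 d.2.2.1 d.2.2.2 := by
  have hb : 0 < 1 + a₁ := by linarith
  have hD : 0 < 1 + a₁ + a₂ := by linarith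
  have hlog : 0 < Real.log (1 + a₁) := Real.log_pos (by linarith)
  have hk0 : 0 < a₂ / (1 + a₁) := by positivity
  -- At time `T` the form `J` of the slopes will be within one of `J (-ρ) σ`, and both exponentials
  -- will be at most one.
  obtain ⟨E₀, hE₀⟩ : ∃ E₀, E₀ = J a₁ a₂ (-ρ) σ + 1 + (1 + a₁ + a₂) * (a₂ + a₁) := ⟨_, rfl⟩
  have hE₀0 : 0 ≤ E₀ := by
    have : 0 ≤ J a₁ a₂ (-ρ) σ := le_trans (by positivity) (sq_le_J h₂ (-ρ) σ)
    rw [hE₀]; positivity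
  obtain ⟨C, hC, hflow⟩ := exists_flow h₁ h₂ hE₀0
  -- Order of choices: `κ` dictates `μ`; then comes a time `T` at which the scalar solution is
  -- sufficiently close to its asymptotic slope and low enough; finally `ε`, small enough for the
  -- comparison up to `T`.
  obtain ⟨μ, hμ0, hphases, hμ1, hμJ⟩ := ((eventually_mem_nhdsWithin (a := (0:ℝ))
    (s := Ioi 0)).and ((exists_phases h₁ h₂ hC hρ0 hσ0 hA hB hl hl' hκ).and
    ((eventually_le_of_linear 1 one_half_pos).and
    (eventually_abs_J_sub_le a₁ a₂ (-ρ) σ one_pos)))).exists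
  rw [mem_Ioi] at hμ0
  have hshD : ∀ k : ℝ, ∀ᶠ T in atTop, k * |shootD N₁ c T - ell N₁ c| < μ / 2 := fun k => by
    have := ((hc.tendsto_shootD.sub_const (ell N₁ c)).abs).const_mul k
    rw [sub_self, abs_zero, mul_zero] at this
    exact this.eventually_lt_const (half_pos hμ0)
  obtain ⟨T, hfl, hT1, hT2, hT3, hT4, hT5⟩ := ((hflow μ hμ0 (by linarith)).and
    ((hshD 1).and ((hshD (a₂ / (1 + a₁))).and
    ((hc.tendsto_shootW.eventually_le_atBot (-μ⁻¹ - 1)).and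
    ((eventually_ge_atTop κ⁻¹).and (eventually_ge_atTop ((Real.log C + κ⁻¹) / 2))))))).exists
  obtain ⟨K, hK0, hK⟩ := exists_shootSol_sub_le h₁ h₂ N₂ hc T
  have hlogε : ∀ b : ℝ, ∀ᶠ ε in 𝓝[>] (0 : ℝ), Real.log ε ≤ b := fun b =>
    Real.tendsto_log_nhdsGT_zero.eventually_le_atBot b
  filter_upwards [self_mem_nhdsWithin, eventually_le_of_linear K (half_pos hμ0),
    eventually_le_of_linear K one_pos, eventually_le_of_linear K hlog,
    hlogε (-κ⁻¹ - (2 * N₂ * T + a₂ / (1 + a₁) * (1 / 4 * Real.exp (2 * T)) + 1)),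
    hlogε (shootU N₁ c T - Real.log (1 + a₁) - 2 -
      (2 * N₂ * T - a₂ / (1 + a₁) * (shootX N₁ c T - c)))] with
    ε hε hε1 hε2 hε3 hε4 hε5 x₁ p₁ x₂ p₂ h
  rw [mem_Ioi] at hε
  have hcomp := hK ε hε x₁ p₁ x₂ p₂ h
  obtain ⟨c1, c2, c3, c4, -⟩ := hcomp T le_rfl
  have c1' := abs_le.1 c1
  have c2' := abs_le.1 c2
  have c3' := abs_le.1 c3
  have c4' := abs_le.1 c4
  have hUT : shootU N₁ c T = 2 * N₁ * T + shootX N₁ c T := rfl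
  have hDT : shootD N₁ c T = 2 * N₁ + shootP N₁ c T := rfl
  rw [one_mul] at hT1
  have hxT : |2 * N₁ + p₁ T + 2 - -ρ| ≤ μ := by
    have e : 2 * N₁ + p₁ T + 2 - -ρ =
        (shootD N₁ c T - ell N₁ c) + (p₁ T - shootP N₁ c T) := by rw [hγ, hDT, hρ]; ring
    rw [e]
    refine (abs_add_le _ _).trans ?_
    linarith
  have hyT : |2 * N₂ + p₂ T + 2 - σ| ≤ μ := by
    have e : 2 * N₂ + p₂ T + 2 - σ = -(a₂ / (1 + a₁) * (shootD N₁ c T - ell N₁ c)) +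
        (p₂ T - -(a₂ / (1 + a₁)) * shootP N₁ c T) := by rw [hγ, hDT, hσ]; ring
    rw [e]
    refine (abs_add_le _ _).trans ?_
    rw [abs_neg, abs_mul, abs_of_pos hk0]
    linarith
  have hXT : 2 * N₁ * T + x₁ T + 2 * T ≤ -μ⁻¹ := by linarith [c1'.2]
  have hYX : 2 * N₂ * T + x₂ T + 2 * T ≤ 2 * N₁ * T + x₁ T + 2 * T := by
    linarith [c1'.1, c3'.2]
  have hX0 : Real.exp (2 * N₁ * T + x₁ T + 2 * T) ≤ 1 :=
    Real.exp_le_one_iff.2 (hXT.trans (neg_nonpos.2 (inv_pos.2 hμ0).le))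
  have hE : energy a₁ a₂ (2 * N₁ * T + x₁ T + 2 * T) (2 * N₂ * T + x₂ T + 2 * T)
      (2 * N₁ + p₁ T + 2) (2 * N₂ + p₂ T + 2) ≤ E₀ := by
    have e1 := (abs_le.1 (hμJ _ _ hxT hyT)).2
    have e2 := (Real.exp_le_exp.2 hYX).trans hX0
    have e3 := mul_le_mul_of_nonneg_left hX0 h₂.le
    have e4 := mul_le_mul_of_nonneg_left e2 h₁.le
    have e5 := mul_le_mul_of_nonneg_left (add_le_add e3 e4) hD.le
    rw [hE₀, energy]
    linarith
  obtain ⟨hF, hneg⟩ := hfl _ _ _ _ _ _ h.system hE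
  obtain ⟨t₁, t₃, M₁, M₂, ξ, υ, hTt, ht, htt, hXY₁, hXY₃, hM₁, hM₂, hξ, hυ, hξ0, hυ0, hXO, hYO,
    g1, g2, g3, g4, g5, g6⟩ := hphases T _ _ _ _ _ _ _ _ hF hxT hyT hXT hYX
  refine ⟨fun t => ?_, fun t => ?_, (t₁, t₃, ξ, υ), hT4.trans hTt, ht, htt, hXY₁, hXY₃, hξ, hυ,
    hξ0, hυ0, hXO, hYO, g1, g2, g3, g4, ⟨M₁, hM₁, g6⟩, ⟨M₂, hM₂, g5⟩⟩
  -- Up to `T` the sign comes from the negative scalar solution with the margin `log (1 + a₁)`,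
  -- after `T` from the flow.
  · rcases le_total t T with htT | htT
    · have e1 := (abs_le.1 (hcomp t htT).1).2
      have e2 := hc.shootU_neg t
      rw [shootU] at e2
      linarith
    · simpa using (hneg t htT).1
  · rcases le_total t T with htT | htT
    · have e1 := (abs_le.1 (hcomp t htT).2.2.1).2
      have e2 := (abs_le.1 ((isSol_shoot N₁ c).abs_le (T := T)
        (fun t _ => abs_shootG_le N₁ c t) htT).2).1
      have e3 : Real.exp (2 * t) ≤ Real.exp (2 * T) := Real.exp_le_exp.2 (by linarith)
      have e4 := mul_le_mul_of_nonneg_left (show -(shootX N₁ c t - c) ≤ 1 / 4 * Real.exp (2 * T) by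
        linarith) hk0.le
      have e5 := mul_le_mul_of_nonneg_left htT (by positivity : (0 : ℝ) ≤ 2 * N₂)
      linarith
    · have e1 := (Real.le_log_iff_exp_le hC).2 (hF.exp_Y_le t htT)
      linarith

/-- The argument converges for `N = 0` and tends to `-∞` otherwise. The limit makes the right-hand
side continuous at the origin, as `C²` regularity there requires. -/
theorem exists_tendsto_cap {x : ℝ → ℝ} {x₀ : ℝ} (hx : Tendsto x atBot (𝓝 x₀)) (N : ℕ) :
    ∃ l, Tendsto (fun t => cap (2 * N * t + x t)) atBot (𝓝 l) := by
  rcases Nat.eq_zero_or_pos N with rfl | hN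
  · refine ⟨cap x₀, (continuous_cap.tendsto x₀).comp ?_⟩
    simpa using hx
  · refine ⟨0, squeeze_zero (fun t => (cap_pos _).le) (fun t => cap_le_exp _)
      (Real.tendsto_exp_atBot.comp ?_)⟩
    exact (tendsto_id.const_mul_atBot (by positivity : (0 : ℝ) < 2 * N)).atBot_add hx

theorem exists_tendsto_shootG (N : ℕ) (c : ℝ) :
    ∃ l, Tendsto (fun t => -(cap (shootU N c t) * (1 - cap (shootU N c t)))) atBot (𝓝 l) := by
  obtain ⟨l, hl⟩ := exists_tendsto_cap (isSol_shoot N c).lim_fst N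
  exact ⟨_, (hl.mul (hl.const_sub 1)).neg⟩

theorem ShootSol.exists_tendsto_G {c₁ c₂ : ℝ} {x₁ p₁ x₂ p₂ : ℝ → ℝ}
    (h : ShootSol a₁ a₂ N₁ N₂ c₁ c₂ x₁ p₁ x₂ p₂) : ∃ l, Tendsto
      (fun t => systemG a₁ a₂ (2 * N₁ * t + x₁ t) (2 * N₂ * t + x₂ t)) atBot (𝓝 l) := by
  obtain ⟨l₁, hl₁⟩ := exists_tendsto_cap h.fst.lim_fst N₁
  obtain ⟨l₂, hl₂⟩ := exists_tendsto_cap h.snd.lim_fst N₂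
  exact ⟨_, ((hl₁.mul (((hl₁.const_mul (1 + a₁)).const_sub 1).add (hl₂.const_mul a₁))).const_mul
    (-(1 + a₁))).add ((hl₂.mul (((hl₂.const_mul (1 + a₂)).const_sub 1).add
      (hl₁.const_mul a₂))).const_mul a₁)⟩

/-- The difference between the first component and the scalar solution solves a singular initial
value problem whose right-hand side converges at the origin. -/
theorem ShootSol.isSol_sub {c₂ : ℝ} {x₁ p₁ x₂ p₂ : ℝ → ℝ}
    (h : ShootSol a₁ a₂ N₁ N₂ (c - Real.log (1 + a₁)) c₂ x₁ p₁ x₂ p₂) :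
    IsSol (fun t => systemG a₁ a₂ (2 * N₁ * t + x₁ t) (2 * N₂ * t + x₂ t) -
        -(cap (shootU N₁ c t) * (1 - cap (shootU N₁ c t)))) 0
      (fun t => x₁ t - (shootX N₁ c t - Real.log (1 + a₁))) (fun t => p₁ t - shootP N₁ c t) := by
  have hs := h.fst.sub ((isSol_shoot N₁ c).add_const (-Real.log (1 + a₁)))
  simpa only [← sub_eq_add_neg, sub_self] using hs

theorem ShootSol.contDiff_sub {c₂ : ℝ} {x₁ p₁ x₂ p₂ : ℝ → ℝ}
    (h : ShootSol a₁ a₂ N₁ N₂ (c - Real.log (1 + a₁)) c₂ x₁ p₁ x₂ p₂) :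
    ContDiff ℝ 2 (radialExt 0 fun t => x₁ t - (shootX N₁ c t - Real.log (1 + a₁)) :
      Plane → ℝ) := by
  obtain ⟨l₁, hl₁⟩ := h.exists_tendsto_G
  obtain ⟨l₂, hl₂⟩ := exists_tendsto_shootG N₁ c
  exact h.isSol_sub.contDiff_radialExt (h.continuous_G.sub (continuous_shootG N₁ c))
    (hl₁.sub hl₂)

/-- The difference from the scalar solution solves a Poisson equation with right-hand side `O(ε)`
and value zero at the origin. -/
theorem eventually_iteratedFDeriv_le (h₁ : 0 < a₁) (h₂ : 0 < a₂) (N₂ : ℕ) (hc : Good N₁ c) {R : ℝ}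
    (hR : 1 ≤ R) {k : ℕ} (hk : k ≤ 2) {κ : ℝ} (hκ : 0 < κ) :
    ∀ᶠ ε in 𝓝[>] (0 : ℝ), ∀ x₁ p₁ x₂ p₂ : ℝ → ℝ,
      ShootSol a₁ a₂ N₁ N₂ (c - Real.log (1 + a₁)) (Real.log ε) x₁ p₁ x₂ p₂ →
      ∀ y : Plane, ‖y‖ ≤ R → ‖iteratedFDeriv ℝ k
        (radialExt 0 fun t => x₁ t - (shootX N₁ c t - Real.log (1 + a₁)) : Plane → ℝ) y‖ < κ := by
  obtain ⟨K, hK0, hK⟩ := exists_shootSol_sub_le h₁ h₂ N₂ hc (Real.log R)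
  filter_upwards [self_mem_nhdsWithin, eventually_le_of_linear (3 * K * R ^ 2) hκ] with
    ε hε hε1 x₁ p₁ x₂ p₂ h y hy
  obtain ⟨l₁, hl₁⟩ := h.exists_tendsto_G
  obtain ⟨l₂, hl₂⟩ := exists_tendsto_shootG N₁ c
  have := h.isSol_sub.norm_iteratedFDeriv_le (V := Plane) (k := k) (K := K * ε) (hl₁.sub hl₂) hR
    (fun t ht => (hK ε hε x₁ p₁ x₂ p₂ h t ht).2.2.2.2) hy hk
  linarith

end Family

/-! ### Return to the radial variable, and the algebra of the decay rates. -/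

section RadialSolutions

theorem tendsto_of_forall_abs_le {f : ℝ → ℝ} {l : ℝ} {F : Filter ℝ}
    (h : ∀ κ > 0, ∀ᶠ ε in F, |f ε - l| ≤ κ) : Tendsto f F (𝓝 l) := by
  refine Metric.tendsto_nhds.2 fun κ hκ => ?_
  filter_upwards [h (κ / 2) (half_pos hκ)] with ε hε
  rw [Real.dist_eq]
  linarith

theorem tendsto_atTop_of_forall_inv_le {f : ℝ → ℝ} {F : Filter ℝ}
    (h : ∀ κ > 0, ∀ᶠ ε in F, κ⁻¹ ≤ f ε) : Tendsto f F atTop := by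
  refine tendsto_atTop.2 fun b => ?_
  filter_upwards [h (|b| + 1)⁻¹ (by positivity)] with ε hε
  rw [inv_inv] at hε
  linarith [le_abs_self b]

/-! ### Masses in the radial variable. -/

section Mass

variable {N : ℕ} {x m : ℝ → ℝ}

theorem hasDerivAt_mass_log (hm : ∀ t, HasDerivAt m (Real.exp (2 * N * t + x t + 2 * t)) t)
    {r : ℝ} (hr : 0 < r) : HasDerivAt (fun r => m (Real.log r))
      (r * Real.exp (2 * N * Real.log r + x (Real.log r))) r := by
  refine ((hm _).comp r (Real.hasDerivAt_log hr.ne')).congr_deriv ?_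
  rw [Real.exp_add _ (2 * Real.log r), two_mul (Real.log r), Real.exp_add (Real.log r),
    Real.exp_log hr]
  field_simp

theorem continuousOn_mass_density (hx : Continuous x) :
    ContinuousOn (fun r => r * Real.exp (2 * N * Real.log r + x (Real.log r))) (Ioi 0) := by
  have hlog : ContinuousOn Real.log (Ioi 0) := Real.continuousOn_log.mono fun _ hr => ne_of_gt hr
  exact continuousOn_id.mul (Real.continuous_exp.comp_continuousOn
    ((hlog.const_mul (2 * N : ℝ)).add (hx.comp_continuousOn hlog)))

theorem intervalIntegral_mass (hx : Continuous x)
    (hm : ∀ t, HasDerivAt m (Real.exp (2 * N * t + x t + 2 * t)) t) (s t : ℝ) :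
    ∫ r in (Real.exp s)..(Real.exp t), r * Real.exp (2 * N * Real.log r + x (Real.log r)) =
      m t - m s := by
  have hsub : uIcc (Real.exp s) (Real.exp t) ⊆ Ioi 0 := fun r hr =>
    (lt_min (Real.exp_pos s) (Real.exp_pos t)).trans_le hr.1
  rw [intervalIntegral.integral_eq_sub_of_hasDerivAt
    (fun r hr => hasDerivAt_mass_log hm (hsub hr))
    ((continuousOn_mass_density hx).mono hsub).intervalIntegrable, Real.log_exp, Real.log_exp]

theorem integral_Ioi_mass (hm : ∀ t, HasDerivAt m (Real.exp (2 * N * t + x t + 2 * t)) t) {M : ℝ}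
    (hM : Tendsto m atTop (𝓝 M)) (t : ℝ) :
    IntegrableOn (fun r => r * Real.exp (2 * N * Real.log r + x (Real.log r)))
      (Ioi (Real.exp t)) ∧
    ∫ r in Ioi (Real.exp t), r * Real.exp (2 * N * Real.log r + x (Real.log r)) = M - m t := by
  have h1 : ∀ r ∈ Ici (Real.exp t), HasDerivAt (fun r => m (Real.log r))
      (r * Real.exp (2 * N * Real.log r + x (Real.log r))) r := fun r hr =>
    hasDerivAt_mass_log hm ((Real.exp_pos t).trans_le hr)
  have h2 : ∀ r ∈ Ioi (Real.exp t),
      0 ≤ r * Real.exp (2 * N * Real.log r + x (Real.log r)) := fun r hr =>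
    mul_nonneg ((Real.exp_pos t).trans hr).le (Real.exp_pos _).le
  have h3 := hM.comp Real.tendsto_log_atTop
  refine ⟨integrableOn_Ioi_deriv_of_nonneg' h1 h2 h3, ?_⟩
  rw [integral_Ioi_of_hasDerivAt_of_nonneg' h1 h2 h3, Real.log_exp]

theorem integrableOn_mass (hx : Continuous x)
    (hm : ∀ t, HasDerivAt m (Real.exp (2 * N * t + x t + 2 * t)) t) {M : ℝ}
    (hM : Tendsto m atTop (𝓝 M)) (hneg : ∀ t, 2 * N * t + x t ≤ 0) :
    IntegrableOn (fun r => r * Real.exp (2 * N * Real.log r + x (Real.log r))) (Ioi 0) := by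
  have h1 := (integral_Ioi_mass hm hM 0).1
  rw [Real.exp_zero] at h1
  rw [← Ioc_union_Ioi_eq_Ioi zero_le_one]
  refine IntegrableOn.union ?_ h1
  refine IntegrableOn.of_bound (C := 1) (by simp)
    (((continuousOn_mass_density hx).mono fun r hr => hr.1).aestronglyMeasurable
      measurableSet_Ioc) ?_
  filter_upwards [ae_restrict_mem measurableSet_Ioc] with r hr
  rw [Real.norm_of_nonneg (mul_nonneg hr.1.le (Real.exp_pos _).le)]
  exact mul_le_one₀ hr.2 (Real.exp_pos _).le (Real.exp_le_one_iff.2 (hneg _))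

end Mass

/-- `ξ` is the slope of `u + 2 t`, so `u` has slope `ξ - 2 = -2 (1 - ξ / 2)`. -/
theorem hasDecayRate_of_isBigO {N : ℕ} {x : ℝ → ℝ} {ξ : ℝ}
    (h : (fun t => 2 * N * t + x t + 2 * t - ξ * t) =O[atTop] fun _ => (1 : ℝ)) :
    HasDecayRate (fun r => 2 * N * Real.log r + x (Real.log r)) (1 - ξ / 2) := by
  refine (h.comp_tendsto Real.tendsto_log_atTop).congr_left fun r => ?_
  simp only [Function.comp]
  ring

theorem tendsto_cocompact_of_isBigO {N : ℕ} {x : ℝ → ℝ} {ξ : ℝ} (hξ : ξ < 0)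
    (h : (fun t => 2 * N * t + x t + 2 * t - ξ * t) =O[atTop] fun _ => (1 : ℝ)) :
    Tendsto (radial fun r => 2 * N * Real.log r + x (Real.log r)) (cocompact Plane) atBot := by
  have h1 : Tendsto (fun t => 2 * N * t + x t) atTop atBot := by
    obtain ⟨K, hK⟩ := h.bound
    have h2 : Tendsto (fun t : ℝ => (ξ - 2) * t + K) atTop atBot :=
      tendsto_atBot_add_const_right _ _ (tendsto_id.const_mul_atTop_of_neg (by linarith))
    refine tendsto_atBot_mono' _ ?_ h2
    filter_upwards [hK] with t ht
    rw [norm_one, mul_one] at ht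
    linarith [le_of_abs_le ht]
  exact h1.comp (Real.tendsto_log_atTop.comp tendsto_norm_cocompact_atTop)

variable {a₁ a₂ c₁ c₂ : ℝ} {N₁ N₂ : ℕ} {x₁ p₁ x₂ p₂ : ℝ → ℝ}

namespace ShootSol

theorem ode (h : ShootSol a₁ a₂ N₁ N₂ c₁ c₂ x₁ p₁ x₂ p₂)
    (hneg₁ : ∀ t, 2 * N₁ * t + x₁ t ≤ 0) (hneg₂ : ∀ t, 2 * N₂ * t + x₂ t ≤ 0) {r : ℝ}
    (hr : 0 < r) :
    deriv (deriv fun r => 2 * N₁ * Real.log r + x₁ (Real.log r)) r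
      + 1 / r * deriv (fun r => 2 * N₁ * Real.log r + x₁ (Real.log r)) r =
    (1 + a₁) * F a₁ (2 * N₁ * Real.log r + x₁ (Real.log r)) (2 * N₂ * Real.log r + x₂ (Real.log r))
      - a₁ * F a₂ (2 * N₂ * Real.log r + x₂ (Real.log r))
        (2 * N₁ * Real.log r + x₁ (Real.log r)) := by
  have h1 : deriv (fun r => 2 * N₁ * Real.log r + x₁ (Real.log r)) =ᶠ[𝓝 r]
      fun r => (2 * N₁ + p₁ (Real.log r)) / r := by
    filter_upwards [Ioi_mem_nhds hr] with s hs
    exact (h.fst.hasDerivAt_radial N₁ hs).deriv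
  have h2 := ((h.fst.hasDerivAt_snd_log hr).const_add (2 * (N₁ : ℝ))).fun_div (hasDerivAt_id r)
    hr.ne'
  simp only [id] at h2
  rw [h1.deriv_eq, h2.deriv, h1.eq_of_nhds, systemG, truncF_eq_neg_F (hneg₁ _) (hneg₂ _),
    truncF_eq_neg_F (hneg₂ _) (hneg₁ _)]
  field_simp
  ring

theorem isEntireShootingSolution (h : ShootSol a₁ a₂ N₁ N₂ c₁ c₂ x₁ p₁ x₂ p₂)
    (hneg₁ : ∀ t, 2 * N₁ * t + x₁ t ≤ 0) (hneg₂ : ∀ t, 2 * N₂ * t + x₂ t ≤ 0) :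
    IsEntireShootingSolution a₁ a₂ N₁ N₂ c₁ c₂
      (fun r => 2 * N₁ * Real.log r + x₁ (Real.log r))
      (fun r => 2 * N₂ * Real.log r + x₂ (Real.log r)) where
  contDiffOn_fst := h.fst.contDiffOn_radial h.continuous_G N₁
  contDiffOn_snd := h.snd.contDiffOn_radial h.symm.continuous_G N₂
  ode_fst r hr := h.ode hneg₁ hneg₂ hr
  ode_snd r hr := h.symm.ode hneg₂ hneg₁ hr
  init_fst := by
    simp only [add_sub_cancel_left]
    exact h.fst.lim_fst.comp tendsto_log_nhdsGT
  init_snd := by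
    simp only [add_sub_cancel_left]
    exact h.snd.lim_fst.comp tendsto_log_nhdsGT

theorem solvesWithDirac (h : ShootSol a₁ a₂ N₁ N₂ c₁ c₂ x₁ p₁ x₂ p₂) (h₁ : 0 < a₁) (h₂ : 0 < a₂)
    (hneg₁ : ∀ t, 2 * N₁ * t + x₁ t ≤ 0) (hneg₂ : ∀ t, 2 * N₂ * t + x₂ t ≤ 0) {f : Plane → ℝ}
    {u₁ u₂ : Plane → ℝ} (hu₁ : u₁ = radial fun r => 2 * N₁ * Real.log r + x₁ (Real.log r))
    (hu₂ : u₂ = radial fun r => 2 * N₂ * Real.log r + x₂ (Real.log r))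
    (hf : ∀ y, f y = (1 + a₁) * (Real.exp (u₁ y) - (1 + a₁) * Real.exp (2 * u₁ y)
        + a₁ * Real.exp (u₁ y + u₂ y))
      - a₁ * (Real.exp (u₂ y) - (1 + a₂) * Real.exp (2 * u₂ y)
        + a₂ * Real.exp (u₁ y + u₂ y))) :
    SolvesWithDirac u₁ f (4 * Real.pi * N₁) := by
  have := h.fst.solvesWithDirac h.continuous_G
    (fun _ => ⟨_, fun t _ => abs_systemG_le h₁ h₂ _ _⟩) N₁
  rw [← hu₁] at this
  convert this using 1
  funext y
  rw [hf, hu₁, hu₂]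
  simp only [radial, systemG]
  rw [truncF_eq_neg_F (hneg₁ _) (hneg₂ _), truncF_eq_neg_F (hneg₂ _) (hneg₁ _), F, F,
    add_comm (2 * (N₂ : ℝ) * Real.log ‖y‖ + x₂ (Real.log ‖y‖))]
  ring

theorem solvesSystem (h : ShootSol a₁ a₂ N₁ N₂ c₁ c₂ x₁ p₁ x₂ p₂) (h₁ : 0 < a₁) (h₂ : 0 < a₂)
    (hneg₁ : ∀ t, 2 * N₁ * t + x₁ t ≤ 0) (hneg₂ : ∀ t, 2 * N₂ * t + x₂ t ≤ 0) :
    SolvesSystem a₁ a₂ N₁ N₂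
      (radial fun r => 2 * N₁ * Real.log r + x₁ (Real.log r))
      (radial fun r => 2 * N₂ * Real.log r + x₂ (Real.log r)) where
  fst := h.solvesWithDirac h₁ h₂ hneg₁ hneg₂ rfl rfl fun _ => rfl
  snd := h.symm.solvesWithDirac h₂ h₁ hneg₂ hneg₁ rfl rfl fun y => by
    rw [add_comm (radial (fun r => 2 * N₁ * Real.log r + x₁ (Real.log r)) y)]

end ShootSol

/-- The line `g = 0` is the law of the second reflection, `σ = B + 2 a₂ A / (1 + a₁)` with `A = 2
(α₁ - 1)` and `B = 2 (α₂ - 1)`: the two sides differ by a multiple of `g`. -/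
theorem slope_eq {a₁ a₂ α₁ α₂ σ : ℝ} {N₁ N₂ : ℕ} (h₁ : 0 < a₁) (h₂ : 0 < a₂)
    (hg : g a₁ a₂ N₁ N₂ α₁ α₂ = 0)
    (hσ : σ = 2 * (N₂ + 1 + a₂ / (1 + a₁) * (gam a₁ a₂ α₁ α₂ + N₁))) :
    σ = 2 * (α₂ - 1) + 2 * a₂ / (1 + a₁) * (2 * (α₁ - 1)) := by
  have e : σ - (2 * (α₂ - 1) + 2 * a₂ / (1 + a₁) * (2 * (α₁ - 1))) =
      -(2 * a₂ / ((1 + a₁) ^ 2 * (1 + a₂))) * g a₁ a₂ N₁ N₂ α₁ α₂ := by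
    rw [hσ, gam, g, cA, cB]
    field_simp
    ring
  rw [hg, mul_zero] at e
  linarith

/-- `J` is invariant under both reflections, which lead from `(α₁ - 1, α₂ - 1)` back to `(α₁ - 1, -σ
/ 2)` and then to `(-(γ - 1), σ / 2)`. There the formula for `σ` makes the excess over the
right-hand point a positive multiple of `(γ - 1)² - (N₁ + 1)²`. -/
theorem J_lt {a₁ a₂ α₁ α₂ γ σ : ℝ} {N₁ N₂ : ℕ} (h₁ : 0 < a₁) (h₂ : 0 < a₂)
    (hγ : (N₁ : ℝ) + 2 < γ) (hσ : σ = 2 * (N₂ + 1 + a₂ / (1 + a₁) * (γ + N₁)))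
    (hσα : σ = 2 * (α₂ - 1) + 2 * a₂ / (1 + a₁) * (2 * (α₁ - 1)))
    (hl : (1 + a₂) * (2 * (α₁ - 1)) - a₁ * σ = -(1 + a₂) * (2 * (γ - 1)) + a₁ * σ) :
    J a₁ a₂ (N₁ + 1) (N₂ + 1) < J a₁ a₂ (α₁ - 1) (α₂ - 1) := by
  have hN : (0 : ℝ) ≤ N₁ := Nat.cast_nonneg N₁
  have e1 : J a₁ a₂ (α₁ - 1) (α₂ - 1) = J a₁ a₂ (α₁ - 1) (-(σ / 2)) := by
    rw [show α₂ - 1 = σ / 2 - 2 * a₂ / (1 + a₁) * (α₁ - 1) by rw [hσα]; ring]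
    unfold J
    field_simp
    ring
  have e2 : J a₁ a₂ (α₁ - 1) (-(σ / 2)) = J a₁ a₂ (-(γ - 1)) (σ / 2) := by
    rw [show α₁ - 1 = a₁ * σ / (1 + a₂) - (γ - 1) by field_simp; linarith]
    unfold J
    field_simp
    ring
  have e3 : J a₁ a₂ (-(γ - 1)) (σ / 2) - J a₁ a₂ (N₁ + 1) (N₂ + 1) =
      a₂ * (1 + a₁ + a₂) / (2 * (1 + a₁)) * ((γ - 1) ^ 2 - (N₁ + 1) ^ 2) := by
    rw [hσ]
    unfold J
    field_simp
    ring
  have e4 : 0 < (γ - 1) ^ 2 - ((N₁ : ℝ) + 1) ^ 2 := by nlinarith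
  have e5 : 0 < a₂ * (1 + a₁ + a₂) / (2 * (1 + a₁)) * ((γ - 1) ^ 2 - ((N₁ : ℝ) + 1) ^ 2) := by
    positivity
  linarith

end RadialSolutions

end ChernSimons

end

/-! ### The main theorem. -/

theorem theorem1p1 (a₁ a₂ : ℝ) (ha₁ : 0 < a₁) (ha₂ : 0 < a₂)
    (ha : 0 < 3 * (1 + a₁) * (1 + a₂) - 4 * a₁ * a₂)
    (N₁ N₂ : ℕ)
    (hN : 0 < ChernSimons.cA a₁ a₂ - 4 * ChernSimons.cB a₁ a₂ →
      (ChernSimons.cA a₁ a₂ - 4 * ChernSimons.cB a₁ a₂) * (N₁ + 1)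
        < 2 * a₁ * (1 + a₁) * (N₂ + 1))
    (α₁ α₂ : ℝ) (hα₁ : 1 ≤ α₁) (hα₂ : 1 < α₂)
    (hg : ChernSimons.g a₁ a₂ N₁ N₂ α₁ α₂ = 0)
    (hh : 0 < ChernSimons.h a₁ a₂ N₁ α₁ α₂) :
    -- the limit profile `U`: existence, uniqueness, and the value `V₀ = V(0)`
    ∃ (U : ℝ → ℝ) (V₀ : ℝ),
      ChernSimons.IsRadialCSH a₁ N₁ (ChernSimons.gam a₁ a₂ α₁ α₂) U ∧
      (∀ W : ℝ → ℝ, ChernSimons.IsRadialCSH a₁ N₁ (ChernSimons.gam a₁ a₂ α₁ α₂) W →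
        EqOn W U (Ioi 0)) ∧
      Tendsto (fun r => U r - 2 * N₁ * Real.log r) (𝓝[>] 0) (𝓝 V₀) ∧
    -- the family of solutions, its intersection radii and its decay rates
    ∃ (ε₀ : ℝ) (u₁ u₂ : ℝ → ℝ → ℝ) (R₁ R₃ β₁ β₂ : ℝ → ℝ),
      0 < ε₀ ∧
      (∀ ε ∈ Ioo 0 ε₀,
        ChernSimons.IsEntireShootingSolution a₁ a₂ N₁ N₂ V₀ (Real.log ε) (u₁ ε) (u₂ ε) ∧
        ChernSimons.SolvesSystem a₁ a₂ N₁ N₂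
          (ChernSimons.radial (u₁ ε)) (ChernSimons.radial (u₂ ε)) ∧
        ChernSimons.IsNonTopological
          (ChernSimons.radial (u₁ ε)) (ChernSimons.radial (u₂ ε)) ∧
        0 < R₁ ε ∧ R₁ ε < R₃ ε ∧
        u₁ ε (R₁ ε) = u₂ ε (R₁ ε) ∧ u₁ ε (R₃ ε) = u₂ ε (R₃ ε) ∧
        IntegrableOn (fun r => r * Real.exp (u₁ ε r)) (Ioi 0) ∧
        IntegrableOn (fun r => r * Real.exp (u₂ ε r)) (Ioi 0) ∧
        (β₁ ε, β₂ ε) ∈ ChernSimons.Omega a₁ a₂ N₁ N₂ ∧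
        ChernSimons.HasDecayRate (u₁ ε) (β₁ ε) ∧
        ChernSimons.HasDecayRate (u₂ ε) (β₂ ε)) ∧
      -- `R₃ ≫ R₁ ≫ 1`
      Tendsto R₁ (𝓝[>] 0) atTop ∧
      Tendsto (fun ε => R₃ ε / R₁ ε) (𝓝[>] 0) atTop ∧
      -- convergence of the first component, blow-down of the second one
      ChernSimons.TendstoC2Loc (fun ε => ChernSimons.radial (u₁ ε)) (ChernSimons.radial U) ∧
      Tendsto (fun ε => ⨆ r ∈ Ioi (0 : ℝ), ((u₂ ε r : ℝ) : EReal)) (𝓝[>] 0) (𝓝 ⊥) ∧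
      -- masses
      Tendsto (fun ε => ∫ r in (R₁ ε)..(R₃ ε), r * Real.exp (u₁ ε r)) (𝓝[>] 0) (𝓝 0) ∧
      Tendsto (fun ε => ∫ r in Ioi (R₃ ε), r * Real.exp (u₂ ε r)) (𝓝[>] 0) (𝓝 0) ∧
      Tendsto (fun ε => ∫ r in (R₁ ε)..(R₃ ε), r * Real.exp (u₂ ε r)) (𝓝[>] 0)
        (𝓝 (4 / (1 + a₂) *
          (a₂ / (1 + a₁) * (ChernSimons.gam a₁ a₂ α₁ α₂ + N₁) + N₂ + 1))) ∧
      Tendsto (fun ε => ∫ r in Ioi (R₃ ε), r * Real.exp (u₁ ε r)) (𝓝[>] 0)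
        (𝓝 (4 / (1 + a₁) * (α₁ - 1))) ∧
      -- decay rates
      Tendsto (fun ε => (β₁ ε, β₂ ε)) (𝓝[>] 0) (𝓝 (α₁, α₂)) := by
  have hb₁ : 0 < 1 + a₁ := by linarith
  have hb₂ : 0 < 1 + a₂ := by linarith
  obtain ⟨γ, hγ⟩ : ∃ γ, γ = ChernSimons.gam a₁ a₂ α₁ α₂ := ⟨_, rfl⟩
  rw [← hγ]
  -- The value of `h` is `γ - (N₁ + 2)`.
  have hγN : (N₁ : ℝ) + 2 < γ := by
    rw [ChernSimons.h] at hh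
    rw [hγ, ChernSimons.gam]
    linarith
  have hN₁ : (0 : ℝ) ≤ N₁ := Nat.cast_nonneg N₁
  have hN₂ : (0 : ℝ) ≤ N₂ := Nat.cast_nonneg N₂
  obtain ⟨c, hc, hell, hCSH, huniq⟩ := ChernSimons.exists_unique_radialCSH ha₁ hγN
  obtain ⟨σ, hσ⟩ : ∃ σ, σ = 2 * (N₂ + 1 + a₂ / (1 + a₁) * (γ + N₁)) := ⟨_, rfl⟩
  have hσ0 : 0 < σ := by
    have : 0 < γ + N₁ := by linarith
    rw [hσ]; positivity
  have hσB : σ = 2 * (α₂ - 1) + 2 * a₂ / (1 + a₁) * (2 * (α₁ - 1)) :=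
    ChernSimons.slope_eq ha₁ ha₂ hg (hγ ▸ hσ)
  -- The law of the first reflection. Given `σ`, it is the definition of `γ`.
  have hl : (1 + a₂) * (2 * (α₁ - 1)) - a₁ * σ = -(1 + a₂) * (2 * (γ - 1)) + a₁ * σ := by
    rw [hσB, hγ, ChernSimons.gam, ChernSimons.cA, ChernSimons.cB]; field_simp; ring
  have hl' : -(1 + a₁) * σ + a₂ * (2 * (α₁ - 1)) =
      -(1 + a₁) * (2 * (α₂ - 1)) - a₂ * (2 * (α₁ - 1)) := by
    rw [hσB]; field_simp; ring
  refine ⟨ChernSimons.profile a₁ N₁ c, c - Real.log (1 + a₁), hCSH, huniq,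
    ChernSimons.tendsto_profile a₁ N₁ c, ?_⟩
  -- The truncated system has solutions for every real `ε`; nothing is claimed about them unless `ε`
  -- is small and positive.
  choose x₁ p₁ x₂ p₂ hsol using fun ε : ℝ =>
    ChernSimons.exists_shootSol ha₁ ha₂ N₁ N₂ (c - Real.log (1 + a₁)) (Real.log ε)
  have hev := fun (κ : ℝ) (hκ : 0 < κ) =>
    (ChernSimons.eventually_phases ha₁ ha₂ hc hell rfl (by linarith) hσ hσ0 (by linarith)
      (by linarith) hl hl' hκ (A := 2 * (α₁ - 1)) (B := 2 * (α₂ - 1)) (N₂ := N₂)).mono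
      fun ε h => h _ _ _ _ (hsol ε)
  -- The meeting times and final slopes found so far depend on the accuracy `κ`. A diagonal choice
  -- yields a single family that is eventually good to every accuracy.
  obtain ⟨d, hd⟩ := ChernSimons.exists_diagonal
    (fun ε κ (d : ℝ × ℝ × ℝ × ℝ) =>
      ChernSimons.Phases a₁ a₂ σ (2 * (α₁ - 1)) (2 * (α₂ - 1)) κ
        (fun t => 2 * N₁ * t + x₁ ε t + 2 * t) (fun t => 2 * N₂ * t + x₂ ε t + 2 * t)
        (fun t => 2 * N₁ + p₁ ε t + 2) (fun t => 2 * N₂ + p₂ ε t + 2)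
        (fun t => ∫ s in (0)..t, Real.exp (2 * N₁ * s + x₁ ε s + 2 * s))
        (fun t => ∫ s in (0)..t, Real.exp (2 * N₂ * s + x₂ ε s + 2 * s))
        d.1 d.2.1 d.2.2.1 d.2.2.2)
    (fun ε κ κ' d hκ hκκ h => h.mono hκ hκκ)
    fun κ hκ => (hev κ hκ).mono fun ε h => h.2.2
  have hx₁c := fun ε => (hsol ε).fst.continuous_fst
  have hx₂c := fun ε => (hsol ε).snd.continuous_fst
  have hm₁' := fun ε => (hsol ε).system.hm₁
  have hm₂' := fun ε => (hsol ε).system.hm₂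
  have hβ₁ : Tendsto (fun ε => 1 - (d ε).2.2.1 / 2) (𝓝[>] 0) (𝓝 α₁) :=
    ChernSimons.tendsto_of_forall_abs_le fun κ hκ => by
      filter_upwards [hd κ hκ] with ε h
      have := abs_le.1 h.abs_ξ
      rw [abs_le]
      constructor <;> linarith
  have hβ₂ : Tendsto (fun ε => 1 - (d ε).2.2.2 / 2) (𝓝[>] 0) (𝓝 α₂) :=
    ChernSimons.tendsto_of_forall_abs_le fun κ hκ => by
      filter_upwards [hd κ hκ] with ε h
      have := abs_le.1 h.abs_υ
      rw [abs_le]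
      constructor <;> linarith
  have hJ : ∀ᶠ ε in 𝓝[>] (0 : ℝ), ChernSimons.J a₁ a₂ (N₁ + 1) (N₂ + 1) <
      ChernSimons.J a₁ a₂ (1 - (d ε).2.2.1 / 2 - 1) (1 - (d ε).2.2.2 / 2 - 1) := by
    have hcont : Continuous fun q : ℝ × ℝ => ChernSimons.J a₁ a₂ (q.1 - 1) (q.2 - 1) := by
      unfold ChernSimons.J; fun_prop
    exact ((hcont.tendsto (α₁, α₂)).comp (hβ₁.prodMk_nhds hβ₂)).eventually_const_lt
      (ChernSimons.J_lt ha₁ ha₂ hγN hσ hσB hl)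
  -- Accuracy one already gives every property required of an individual solution, except the
  -- inequality for `J`, which comes from convergence of the decay rates.
  obtain ⟨ε₀, hε₀, hε₀'⟩ := mem_nhdsGT_iff_exists_Ioo_subset.1
    ((hev 1 one_pos).and ((hd 1 one_pos).and hJ))
  refine ⟨ε₀, fun ε r => 2 * N₁ * Real.log r + x₁ ε (Real.log r),
    fun ε r => 2 * N₂ * Real.log r + x₂ ε (Real.log r), fun ε => Real.exp (d ε).1,
    fun ε => Real.exp (d ε).2.1, fun ε => 1 - (d ε).2.2.1 / 2, fun ε => 1 - (d ε).2.2.2 / 2,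
    hε₀, ?_, ?_, ?_, ?_, ?_, ?_, ?_, ?_, ?_, hβ₁.prodMk_nhds hβ₂⟩
  · intro ε hε
    obtain ⟨⟨hn₁, hn₂, -⟩, hp, hJε⟩ := hε₀' hε
    have hn₂' : ∀ t, 2 * N₂ * t + x₂ ε t ≤ 0 := fun t => (hn₂ t).trans (by norm_num)
    obtain ⟨M₁, hM₁, -⟩ := hp.tail₁
    obtain ⟨M₂, hM₂, -⟩ := hp.tail₂
    refine ⟨(hsol ε).isEntireShootingSolution hn₁ hn₂', (hsol ε).solvesSystem ha₁ ha₂ hn₁ hn₂',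
      ⟨ChernSimons.tendsto_cocompact_of_isBigO hp.ξ_neg hp.isBigO_X,
        ChernSimons.tendsto_cocompact_of_isBigO hp.υ_neg hp.isBigO_Y⟩,
      Real.exp_pos _, Real.exp_lt_exp.2 hp.lt, ?_, ?_,
      ChernSimons.integrableOn_mass (hx₁c ε) (hm₁' ε) hM₁ hn₁,
      ChernSimons.integrableOn_mass (hx₂c ε) (hm₂' ε) hM₂ hn₂', ⟨?_, ?_, hJε⟩,
      ChernSimons.hasDecayRate_of_isBigO hp.isBigO_X,
      ChernSimons.hasDecayRate_of_isBigO hp.isBigO_Y⟩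
    · simpa using hp.eq₁
    · simpa using hp.eq₃
    · have := hp.ξ_neg
      show 1 < 1 - (d ε).2.2.1 / 2
      linarith
    · have := hp.υ_neg
      show 1 < 1 - (d ε).2.2.2 / 2
      linarith
  · exact Real.tendsto_exp_atTop.comp (ChernSimons.tendsto_atTop_of_forall_inv_le fun κ hκ =>
      (hd κ hκ).mono fun ε h => h.inv_le)
  · simp only [← Real.exp_sub]
    exact Real.tendsto_exp_atTop.comp (ChernSimons.tendsto_atTop_of_forall_inv_le fun κ hκ =>
      (hd κ hκ).mono fun ε h => h.inv_le_sub)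
  · refine ⟨fun ε => ChernSimons.radialExt 0 fun t =>
      x₁ ε t - (ChernSimons.shootX N₁ c t - Real.log (1 + a₁)), Eventually.of_forall fun ε =>
      ⟨(hsol ε).contDiff_sub, fun y hy => ?_⟩, fun k hk K hK => ?_⟩
    · beta_reduce
      rw [ChernSimons.radialExt_of_ne hy]
      simp only [ChernSimons.radial, ChernSimons.profile, ChernSimons.shootU]
      ring
    · obtain ⟨R, hR⟩ := hK.isBounded.exists_norm_le
      refine Metric.tendstoUniformlyOn_iff.2 fun κ hκ => ?_
      filter_upwards [ChernSimons.eventually_iteratedFDeriv_le ha₁ ha₂ N₂ hc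
        (le_max_right R 1) hk hκ] with ε h y hy
      rw [dist_comm, dist_eq_norm]
      simpa using h _ _ _ _ (hsol ε) y ((hR y hy).trans (le_max_left _ _))
  · refine EReal.tendsto_nhds_bot_iff_real.2 fun b => ?_
    -- For this accuracy the upper bound on the second component is `-(|b| + 1) < b`.
    filter_upwards [hev (|b| + 1)⁻¹ (by positivity)] with ε h
    have hle : ⨆ r ∈ Ioi (0 : ℝ),
        ((2 * N₂ * Real.log r + x₂ ε (Real.log r) : ℝ) : EReal) ≤ ((-(|b| + 1) : ℝ) : EReal) := by
      refine iSup₂_le fun r _ => EReal.coe_le_coe_iff.2 ?_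
      simpa using h.2.1 (Real.log r)
    refine hle.trans_lt (EReal.coe_lt_coe_iff.2 ?_)
    linarith [neg_abs_le b]
  · refine ChernSimons.tendsto_of_forall_abs_le fun κ hκ => (hd κ hκ).mono fun ε h => ?_
    rw [ChernSimons.intervalIntegral_mass (hx₁c ε) (hm₁' ε), sub_zero]
    exact h.mass₁
  · refine ChernSimons.tendsto_of_forall_abs_le fun κ hκ => (hd κ hκ).mono fun ε h => ?_
    obtain ⟨M, hM, hMκ⟩ := h.tail₂
    rw [(ChernSimons.integral_Ioi_mass (hm₂' ε) hM _).2, sub_zero]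
    exact hMκ
  · refine ChernSimons.tendsto_of_forall_abs_le fun κ hκ => (hd κ hκ).mono fun ε h => ?_
    rw [ChernSimons.intervalIntegral_mass (hx₂c ε) (hm₂' ε)]
    convert h.mass₂ using 3
    rw [hσ]; ring
  · refine ChernSimons.tendsto_of_forall_abs_le fun κ hκ => (hd κ hκ).mono fun ε h => ?_
    obtain ⟨M, hM, hMκ⟩ := h.tail₁
    rw [(ChernSimons.integral_Ioi_mass (hm₁' ε) hM _).2]
    convert hMκ using 3
    ring
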